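/- **Setting.** Fix $\alpha\in[0,1)$, $\gamma\in(0,1)$, $z_s,q>0$ with $\alpha\ge 1-3\gamma$, $x\in(0,\tfrac12)$ and $T>0$. Put $a_l=l^\alpha$, $b_l=l^\alpha(z_s+ql^{-\gamma})$, $\omega_l=z_s^l\prod_{j=1}^{l-1}\frac{a_j}{b_{j+1}}$, $k^l=a_l\omega_1\omega_l=b_{l+1}\omega_{l+1}$, $\varrho_s=\sum_{l\ge1}l\,\omega_l$, and fix $\varrho_0>\varrho_s$. *States* are sequences $n=(n_l)_{l\ge1}$ with $n_l\ge0$ and $\sum_l l\,n_l=\varrho_0$. *Microscopic objects.* Let $\psi(s)=s\log s-s+1$ (with $\psi(0)=1$), $\Lambda(a,b)=\int_0^1a^sb^{1-s}\,ds$ and $\hat n_l=\Lambda\big(\tfrac{n_1n_l}{\omega_1\omega_l},\tfrac{n_{l+1}}{\omega_{l+1}}\big)$. For $\varepsilon>0$, a state $n$ and a function $w$ on $\{\varepsilon l: l\ge 1\}$ let $$\mathcal F^\varepsilon(n)=\frac{z_s}{\varepsilon^{\gamma}}\sum_{l\ge1}\omega_l\,\psi\!\Big(\frac{n_l}{\omega_l}\Big),\qquad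 \mathcal A^\varepsilon(n,w)=\frac{z_s}{\varepsilon^{1-\alpha+2\gamma}}\sum_{l\ge1}k^l\hat n_l\,\big|z_s^{-1}\varepsilon^\gamma w(\varepsilon l)\big|^2,$$ $$\mathcal D^\varepsilon(n)=\frac{z_s}{\varepsilon^{1-\alpha+2\gamma}}\sum_{l\ge1}(a_ln_1n_l-b_{l+1}n_{l+1})\big(\log(a_ln_1n_l)-\log(b_{l+1}n_{l+1})\big),$$ where a summand of $\mathcal D^\varepsilon$ is $+\infty$ if exactly one of $a_ln_1n_l$, $b_{l+1}n_{l+1}$ vanishes and $0$ if both do, and $$\mathcal K^\varepsilon(n)w=-\frac1{\varepsilon^{1-\alpha+\gamma}}\sum_{l\ge1}k^l\hat n_l\,z_s^{-1}\varepsilon^\gamma w(\varepsilon l)\,(e^1+e^l-e^{l+1}),$$ with $e^l$ the unit sequences. A *rescaled curve of finite action* is a pair $(n,w)$ of a curve of states $t\mapsto n(t)$, $t\in[0,T]$, with absolutely continuous components, and of functions $w_t$ on $\{\varepsilon l\}$ depending measurably on $t$, such that $\int_0^T(\dot\eta\,n_l+\eta\,(\mathcal K^\varepsilon(n)w)_l)\,dt=0$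 for all $\eta\in C^1_c((0,T))$ and $l\ge1$ (that is, $\dot n=\mathcal K^\varepsilon(n)w$), $\sup_{[0,T]}\mathcal F^\varepsilon(n(t))<\infty$, $\int_0^T\mathcal A^\varepsilon(n,w)\,dt<\infty$ and $\int_0^T\mathcal D^\varepsilon(n)\,dt<\infty$. For such a curve $$\mathcal J^\varepsilon(n)=\mathcal F^\varepsilon(n(T))-\mathcal F^\varepsilon(n(0))+\tfrac12\int_0^T\mathcal D^\varepsilon(n)\,dt+\tfrac12\int_0^T\mathcal A^\varepsilon(n,w)\,dt .$$ The empirical measure of the large clusters is $\Pi^\varepsilon_{\rm mac}n=\varepsilon^{-1}\sum_{l\ge l_0}n_l\,\delta_{\varepsilon l}$ with $l_0=\lfloor\varepsilon^{-x}\rfloor$ (and $l\ge1$). *Macroscopic objects.* Let $M$ be the set of nonnegative Borel measures $\nu$ on $(0,\infty)$ with $\int\lambda\,d\nu=\varrho_0-\varrho_s$. For a measure $\nu$ on $(0,\infty)$ and measurable $w$ let $$E(\nu)=\frac q{1-\gamma}\int\lambda^{1-\gamma}d\nu,\quad A(\nu,w)=\int\lambda^\alpha|w|^2d\nu,\quad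 u(\nu)=\frac{q\int\lambda^{\alpha-\gamma}d\nu}{\int\lambda^\alpha d\nu},\quad D(\nu)=\int\lambda^\alpha|u(\nu)-q\lambda^{-\gamma}|^2d\nu .$$ Write $(\nu,w)\in{\rm CE}_T$ if $[0,T]\ni t\mapsto\nu_t\in M$ is weakly-* continuous in $C_c^0((0,\infty))^*$, $w$ is measurable on $[0,T]\times(0,\infty)$, for a.e. $t$ the function $\lambda^\alpha w_t$ is $\nu_t$-integrable with $\int\lambda^\alpha w_t\,d\nu_t=0$, $\int_0^TA(\nu_t,w_t)\,dt<\infty$, and $\partial_t\nu_t+\partial_\lambda(\lambda^\alpha w_t\nu_t)=0$, i.e. $$\int\zeta(T,\cdot)\,d\nu_T-\int\zeta(0,\cdot)\,d\nu_0=\int_0^T\!\!\int\big(\partial_t\zeta+\lambda^\alpha w_t\,\partial_\lambda\zeta\big)\,d\nu_t\,dt\qquad\text{for all }\zeta\in C_c^\infty(\mathbb R\times(0,\infty)).$$ Put $J(\nu)=E(\nu_T)-E(\nu_0)+\frac12\int_0^TD(\nu_t)\,dt+\frac12\int_0^TA(\nu_t,w_t)\,dt$. The curve $\nu$ is a *weak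 solution of the LSW equation* $\partial_t\nu_t+\partial_\lambda(\lambda^\alpha(u(\nu_t)-q\lambda^{-\gamma})\nu_t)=0$ if $(\nu,w)\in{\rm CE}_T$ for $w_t(\lambda)=u(\nu_t)-q\lambda^{-\gamma}$. **Corollary 2.3 (Convergence of curves of maximal slope).** Let $\varepsilon_k>0$, $\varepsilon_k\to0$, and for each $k$ let $(n^k,w^k)$ be a rescaled curve of finite action for $\varepsilon=\varepsilon_k$, such that $\sup_k\mathcal J^{\varepsilon_k}(n^k)<\infty$. Write $\nu^k_t=\Pi^{\varepsilon_k}_{\rm mac}n^k(t)$. Assume the tightness condition $$\int_{[R,\infty)}\lambda\,d\nu_0^k\to0\quad\text{as }R\to\infty,\text{ uniformly in }k,$$ and that the initial data are well-prepared: there is a measure $\bar\nu$ on $(0,\infty)$ with $E(\bar\nu)<\infty$, $\nu^k_0\overset{*}{\rightharpoonup}\bar\nu$ in $C_c^0((0,\infty))^*$ and $\lim_{k\to\infty}\mathcal F^{\varepsilon_k}(n^k(0))=E(\bar\nu)$. Then there are $(\nu,w)\in{\rm CE}_T$ with $\nu_0=\bar\nu$ and a strictly increasing sequence of indices $k_j$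 such that, as $j\to\infty$, $$\nu_t^{k_j}\overset{*}{\rightharpoonup}\nu_t\ \text{ in }C_c^0((0,\infty))^*\text{ for all }t\in[0,T],\qquad w_t^{k_j}\nu_t^{k_j}\,dt\overset{*}{\rightharpoonup}w_t\nu_t\,dt\ \text{ in }C_c^0([0,T]\times(0,\infty))^*,$$ and $$\liminf_{k\to\infty}\mathcal J^{\varepsilon_k}(n^k)\ \ge\ J(\nu)\ \ge\ 0$$ (the $\liminf$ being taken along the whole sequence). If moreover $\mathcal J^{\varepsilon_k}(n^k)=0$ for all $k$, then $J(\nu)=0$, $\nu$ is a weak solution of the LSW equation, and, as $j\to\infty$, $$\mathcal F^{\varepsilon_{k_j}}(n^{k_j}(t))\to E(\nu_t)\ \text{ for all }t\in[0,T],$$ $$\mathcal A^{\varepsilon_{k_j}}(n^{k_j}(t),w^{k_j}_t)\to A(\nu_t,w_t)\quad\text{and}\quad\mathcal D^{\varepsilon_{k_j}}(n^{k_j}(t))\to D(\nu_t)\quad\text{for a.e. }t\in[0,T].$$ -/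

import Mathlib

open Filter Topology MeasureTheory Set
open scoped ENNReal NNReal ContDiff

namespace BeckerDoring

noncomputable section

/-! ### The Becker-Doering model and its gradient structure

A state is a function `n : ℕ → ℝ`, where `n l` is the density of clusters of size `l ≥ 1`; the value
`n 0` is never used. Sums over all cluster sizes are written as sums over `i : ℕ` with `l = i + 1`. -/

/-- The parameters of the rates, with their standing assumptions. -/
structure Rates where
  α : ℝ
  γ : ℝ
  zs : ℝ
  q : ℝ
  α_nonneg : 0 ≤ α
  α_lt_one : α < 1
  γ_pos : 0 < γ
  γ_lt_one : γ < 1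
  zs_pos : 0 < zs
  q_pos : 0 < q

/-- Coagulation rate `a_l = l ^ α`. -/
def Rates.a (p : Rates) (l : ℕ) : ℝ := (l : ℝ) ^ p.α

/-- Fragmentation rate `b_l = l ^ α (z_s + q l ^ (-γ))`. -/
def Rates.b (p : Rates) (l : ℕ) : ℝ := (l : ℝ) ^ p.α * (p.zs + p.q * (l : ℝ) ^ (-p.γ))

/-- `Q_l = ∏_{j=1}^{l-1} a_j / b_{j+1}`. -/
def Rates.Q (p : Rates) (l : ℕ) : ℝ := ∏ j ∈ Finset.Ico 1 l, p.a j / p.b (j + 1)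

/-- The equilibrium state `ω_l = z_s ^ l Q_l`. -/
def Rates.ω (p : Rates) (l : ℕ) : ℝ := p.zs ^ l * p.Q l

/-- The critical mass `ϱ_s = ∑_{l ≥ 1} l ω_l`. -/
def Rates.ρs (p : Rates) : ℝ := ∑' i : ℕ, ((i + 1 : ℕ) : ℝ) * p.ω (i + 1)

/-- The equilibrium flux `k^l = a_l ω_1 ω_l` (which is also `b_{l+1} ω_{l+1}`). -/
def Rates.k (p : Rates) (l : ℕ) : ℝ := p.a l * p.ω 1 * p.ω l

/-- `ψ(s) = s log s - s + 1`, with `ψ(0) = 1`. -/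
def ψ (s : ℝ) : ℝ := s * Real.log s - s + 1

/-- The free energy `F(n) = ∑_l ω_l ψ(n_l / ω_l)`, with values in `[0, ∞]`. -/
def freeEnergy (p : Rates) (n : ℕ → ℝ) : ℝ≥0∞ :=
  ∑' i : ℕ, ENNReal.ofReal (p.ω (i + 1) * ψ (n (i + 1) / p.ω (i + 1)))

/-- The logarithmic mean of nonnegative numbers, `∫_0^1 a^s b^(1-s) ds`; it vanishes if one of the
arguments does. -/
def logMean (a b : ℝ) : ℝ :=
  if a ≤ 0 ∨ b ≤ 0 then 0 else if a = b then a else (a - b) / (Real.log a - Real.log b)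

/-- `Λ(n_1 n_l / (ω_1 ω_l), n_{l+1} / ω_{l+1})`. -/
def nHat (p : Rates) (n : ℕ → ℝ) (l : ℕ) : ℝ :=
  logMean (n 1 * n l / (p.ω 1 * p.ω l)) (n (l + 1) / p.ω (l + 1))

/-- The `l`-th component of the reaction vector `e^1 + e^j - e^{j+1}`. -/
def reaction (j l : ℕ) : ℝ :=
  (if l = 1 then 1 else 0) + (if l = j then 1 else 0) - (if l = j + 1 then 1 else 0)

/-- The discrete gradient `∇_l φ = φ_{l+1} - φ_l - φ_1` of a covector. -/
def discreteGrad (φ : ℕ → ℝ) (l : ℕ) : ℝ := φ (l + 1) - φ l - φ 1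

/-- Every sequence is the discrete gradient of a covector. Since the Onsager operator and the action
depend on a covector only through its discrete gradient, they are defined below as functions of the
latter. -/
theorem exists_discreteGrad (g : ℕ → ℝ) : ∃ φ : ℕ → ℝ, ∀ l, 1 ≤ l → discreteGrad φ l = g l := by
  refine ⟨fun l => ∑ j ∈ Finset.Ico 1 l, g j, fun l hl => ?_⟩
  simp [discreteGrad, Finset.sum_Ico_succ_top hl]

/-- The `l`-th component of
`K(n)φ = ∑_j k^j n̂_j ((e^1 + e^j - e^{j+1}) · φ) (e^1 + e^j - e^{j+1})`, where `g = ∇φ`, so that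
`(e^1 + e^j - e^{j+1}) · φ = - g_j`. -/
def onsager (p : Rates) (n g : ℕ → ℝ) (l : ℕ) : ℝ :=
  ∑' i : ℕ, p.k (i + 1) * nHat p n (i + 1) * (-g (i + 1)) * reaction (i + 1) l

/-- The action `∑_l k^l n̂_l |∇_l φ|²`, where `g = ∇φ`. -/
def action (p : Rates) (n g : ℕ → ℝ) : ℝ≥0∞ :=
  ∑' i : ℕ, ENNReal.ofReal (p.k (i + 1) * nHat p n (i + 1) * g (i + 1) ^ 2)

/-- `(a - b)(log a - log b)` for `a, b ≥ 0`, with the value `∞` if exactly one of them vanishes and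
`0` if both do. -/
def entropyProduction (a b : ℝ) : ℝ≥0∞ :=
  if 0 < a ∧ 0 < b then ENNReal.ofReal ((a - b) * (Real.log a - Real.log b))
  else if a = b then 0 else ⊤

/-- The dissipation
`∑_l (a_l n_1 n_l - b_{l+1} n_{l+1}) (log (a_l n_1 n_l) - log (b_{l+1} n_{l+1}))`. -/
def dissipation (p : Rates) (n : ℕ → ℝ) : ℝ≥0∞ :=
  ∑' i : ℕ, entropyProduction (p.a (i + 1) * n 1 * n (i + 1)) (p.b (i + 2) * n (i + 2))

/-- States: nonnegative densities of total mass `ρ₀`. -/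
def IsState (ρ₀ : ℝ) (n : ℕ → ℝ) : Prop :=
  (∀ l, 1 ≤ l → 0 ≤ n l) ∧ HasSum (fun i : ℕ => ((i + 1 : ℕ) : ℝ) * n (i + 1)) ρ₀

/-! ### Rescaling -/

/-- The cut-off `l₀ = ⌊ε ^ (-x)⌋`. -/
def cutoff (x ε : ℝ) : ℕ := ⌊ε ^ (-x)⌋₊

/-- The macroscopic empirical measure `ε⁻¹ ∑_{l ≥ l₀} n_l δ_{ε l}`. -/
def macroMeasure (x ε : ℝ) (n : ℕ → ℝ) : Measure ℝ :=
  Measure.sum fun i : ℕ =>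
    if cutoff x ε ≤ i + 1 then
      ENNReal.ofReal (n (i + 1) / ε) • Measure.dirac (ε * ((i + 1 : ℕ) : ℝ))
    else 0

/-- The discrete gradient `∇_l φ = z_s⁻¹ ε^γ w(ε l)` belonging to the rescaled covector `w`. -/
def unscale (p : Rates) (ε : ℝ) (w : ℝ → ℝ) (l : ℕ) : ℝ := p.zs⁻¹ * ε ^ p.γ * w (ε * (l : ℝ))

def freeEnergyε (p : Rates) (ε : ℝ) (n : ℕ → ℝ) : ℝ≥0∞ :=
  ENNReal.ofReal (p.zs / ε ^ p.γ) * freeEnergy p n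

def actionε (p : Rates) (ε : ℝ) (n : ℕ → ℝ) (w : ℝ → ℝ) : ℝ≥0∞ :=
  ENNReal.ofReal (p.zs / ε ^ (1 - p.α + 2 * p.γ)) * action p n (unscale p ε w)

def dissipationε (p : Rates) (ε : ℝ) (n : ℕ → ℝ) : ℝ≥0∞ :=
  ENNReal.ofReal (p.zs / ε ^ (1 - p.α + 2 * p.γ)) * dissipation p n

def onsagerε (p : Rates) (ε : ℝ) (n : ℕ → ℝ) (w : ℝ → ℝ) (l : ℕ) : ℝ :=
  (1 / ε ^ (1 - p.α + p.γ)) * onsager p n (unscale p ε w) l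

/-- Rescaled curves of finite action on `[0, T]`: absolutely continuous curves of states that solve
`∂ₜ n = K^ε(n) w` weakly, with bounded free energy, finite action and finite dissipation. The function
`w t` matters only at the points `ε l`, `l ≥ 1`. -/
structure IsRescaledCurve (p : Rates) (ρ₀ T ε : ℝ) (n : ℝ → ℕ → ℝ) (w : ℝ → ℝ → ℝ) : Prop where
  isState : ∀ t ∈ Icc 0 T, IsState ρ₀ (n t)
  absolutelyContinuous : ∀ l, 1 ≤ l → AbsolutelyContinuousOnInterval (fun t => n t l) 0 T
  measurable : ∀ l : ℕ, 1 ≤ l →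
    AEMeasurable (fun t => w t (ε * (l : ℝ))) (volume.restrict (Icc 0 T))
  continuityEq : ∀ η : ℝ → ℝ, ContDiff ℝ 1 η → HasCompactSupport η → tsupport η ⊆ Ioo 0 T →
    ∀ l, 1 ≤ l → ∫ t in (0 : ℝ)..T, (deriv η t * n t l + η t * onsagerε p ε (n t) (w t) l) = 0
  energy_bounded : (⨆ t ∈ Icc 0 T, freeEnergyε p ε (n t)) < ⊤
  action_finite : ∫⁻ t in Icc 0 T, actionε p ε (n t) (w t) < ⊤
  dissipation_finite : ∫⁻ t in Icc 0 T, dissipationε p ε (n t) < ⊤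

/-- `F^ε(n(T)) - F^ε(n(0)) + ½ ∫ D^ε(n) dt + ½ ∫ A^ε(n, w) dt`. -/
def Jε (p : Rates) (T ε : ℝ) (n : ℝ → ℕ → ℝ) (w : ℝ → ℝ → ℝ) : EReal :=
  (freeEnergyε p ε (n T) : EReal) - (freeEnergyε p ε (n 0) : EReal)
    + (((∫⁻ t in Icc 0 T, dissipationε p ε (n t)) / 2 : ℝ≥0∞) : EReal)
    + (((∫⁻ t in Icc 0 T, actionε p ε (n t) (w t)) / 2 : ℝ≥0∞) : EReal)

/-! ### The LSW equation

Radon measures on `(0, ∞)` are represented by measures on `ℝ` that do not charge `(-∞, 0]`. They may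
have infinite mass near `0`. -/

/-- Weak-* convergence in the dual of the continuous functions with compact support in `(0, ∞)`. -/
def VagueTendsto {ι : Type*} (F : Filter ι) (μ : ι → Measure ℝ) (ν : Measure ℝ) : Prop :=
  ∀ ζ : ℝ → ℝ, Continuous ζ → HasCompactSupport ζ → tsupport ζ ⊆ Ioi 0 →
    Tendsto (fun i => ∫ r, ζ r ∂(μ i)) F (𝓝 (∫ r, ζ r ∂ν))

/-- The state manifold: measures on `(0, ∞)` with first moment `ρ`. -/
def IsLSWState (ρ : ℝ) (ν : Measure ℝ) : Prop :=
  ν (Iic 0) = 0 ∧ ∫⁻ r, ENNReal.ofReal r ∂ν = ENNReal.ofReal ρ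

/-- The energy `E(ν) = q / (1 - γ) ∫ r^(1-γ) dν`. -/
def energyLSW (p : Rates) (ν : Measure ℝ) : ℝ≥0∞ :=
  ENNReal.ofReal (p.q / (1 - p.γ)) * ∫⁻ r, ENNReal.ofReal (r ^ (1 - p.γ)) ∂ν

/-- The action `A(ν, w) = ∫ r^α |w|² dν`. -/
def actionLSW (p : Rates) (ν : Measure ℝ) (w : ℝ → ℝ) : ℝ≥0∞ :=
  ∫⁻ r, ENNReal.ofReal (r ^ p.α * w r ^ 2) ∂ν

/-- `u(ν) = q ∫ r^(α-γ) dν / ∫ r^α dν`. -/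
def meanField (p : Rates) (ν : Measure ℝ) : ℝ :=
  p.q * (∫ r, r ^ (p.α - p.γ) ∂ν) / ∫ r, r ^ p.α ∂ν

/-- The LSW velocity `u(ν) - q r^(-γ)`. -/
def velocityLSW (p : Rates) (ν : Measure ℝ) (r : ℝ) : ℝ := meanField p ν - p.q * r ^ (-p.γ)

/-- The dissipation `D(ν) = ∫ r^α |u(ν) - q r^(-γ)|² dν`. On the state manifold the integral is
infinite, whatever the value of `u`, if one of the two moments in `u(ν)` is infinite. -/
def dissipationLSW (p : Rates) (ν : Measure ℝ) : ℝ≥0∞ := actionLSW p ν (velocityLSW p ν)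

/-- Covectors at `ν`: those `w` whose tangent vector `-∂_r (r^α w ν)` preserves the first moment. -/
def IsCovectorLSW (p : Rates) (ν : Measure ℝ) (w : ℝ → ℝ) : Prop :=
  Integrable (fun r => r ^ p.α * w r) ν ∧ ∫ r, r ^ p.α * w r ∂ν = 0

/-- Curves of finite action on `[0, T]`: weakly-* continuous curves in the state manifold with a
measurable field of covectors of finite action that solve `∂ₜ ν + ∂_r (r^α w ν) = 0` weakly. -/
structure IsLSWCurve (p : Rates) (ρ T : ℝ) (ν : ℝ → Measure ℝ) (w : ℝ → ℝ → ℝ) : Prop where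
  isState : ∀ t ∈ Icc 0 T, IsLSWState ρ (ν t)
  continuous : ∀ ζ : ℝ → ℝ, Continuous ζ → HasCompactSupport ζ → tsupport ζ ⊆ Ioi 0 →
    ContinuousOn (fun t => ∫ r, ζ r ∂(ν t)) (Icc 0 T)
  measurable : Measurable ((Icc 0 T ×ˢ Ioi (0 : ℝ)).indicator (Function.uncurry w))
  isCovector : ∀ᵐ t ∂(volume.restrict (Icc 0 T)), IsCovectorLSW p (ν t) (w t)
  action_finite : ∫⁻ t in Icc 0 T, actionLSW p (ν t) (w t) < ⊤
  continuityEq : ∀ ζ : ℝ × ℝ → ℝ, ContDiff ℝ ∞ ζ → HasCompactSupport ζ →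
    tsupport ζ ⊆ univ ×ˢ Ioi 0 →
    (∫ r, ζ (T, r) ∂(ν T)) - (∫ r, ζ (0, r) ∂(ν 0))
      = ∫ t in (0 : ℝ)..T, ∫ r, (deriv (fun s => ζ (s, r)) t
          + r ^ p.α * w t r * deriv (fun s => ζ (t, s)) r) ∂(ν t)

/-- Weak solutions of the LSW equation `∂ₜ ν + ∂_r (r^α (u(ν) - q r^(-γ)) ν) = 0`. -/
def IsLSWSolution (p : Rates) (ρ T : ℝ) (ν : ℝ → Measure ℝ) : Prop :=
  IsLSWCurve p ρ T ν fun t => velocityLSW p (ν t)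

/-- `E(ν_T) - E(ν_0) + ½ ∫ D(ν_t) dt + ½ ∫ A(ν_t, w_t) dt`. -/
def JLSW (p : Rates) (T : ℝ) (ν : ℝ → Measure ℝ) (w : ℝ → ℝ → ℝ) : EReal :=
  (energyLSW p (ν T) : EReal) - (energyLSW p (ν 0) : EReal)
    + (((∫⁻ t in Icc 0 T, dissipationLSW p (ν t)) / 2 : ℝ≥0∞) : EReal)
    + (((∫⁻ t in Icc 0 T, actionLSW p (ν t) (w t)) / 2 : ℝ≥0∞) : EReal)

end

end BeckerDoring

open BeckerDoring

/-!
The functional `Jε` compares the two sides of an energy-dissipation inequality, and the theorem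
passes to the limit in each of its terms separately.

*Discrete side.* Along a rescaled curve the derivative of the free energy is `∑ -(k n̂) g Δ` with
`Δ` the thermodynamic force (`force`) and `g` the rescaled velocity (`grad`), and Young's inequality
bounds it by half the sum of action and dissipation. The logarithms are singular at empty sizes and
the series is infinite, so this is proved for sums truncated at a size `N`; the boundary terms are
dominated by action, dissipation and mass and vanish along a sequence of `N`. The result,
`freeEnergy_sub_le`, gives `0 ≤ Jε`, applied on subintervals it bounds the energy at every
time, and it is an equality of action and dissipation almost everywhere when `Jε = 0`. Together with
the tightness of the data this is condensed in `BoundedSeq`, the hypothesis of all limit passages.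

*Compactness.* Entropy duality (`ns ≤ ω ψ(n / ω) + ω (exp s - 1)`) shows that the small clusters
carry the mass `ρs` in the limit and that the macroscopic energy is bounded by the free energy. On
compact subsets of `(0, ∞)` the curve satisfies a discrete continuity equation whose flux is bounded
in `L²`, so integrals of test functions are equicontinuous in time, and a diagonal argument gives
vague convergence at every time (`exists_subseq_vagueTendsto`). Mass neither concentrates at zero,
by the energy bound, nor escapes to infinity, as the tightness at time `0` propagates; so
the limits have mass `ρ₀ - ρs`. The fluxes form a bounded family of functionals, their limit is
continuous for the `L²` norm of the limit measure, and its Riesz representative is the velocity `v`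
(`exists_velocity`). The same duality gives lower semicontinuity of the action.
For the dissipation, Young's inequality with a test function `φ` and a summation by parts bound it
from below by `2 ∫ r ^ α φ (u - q r ^ (-γ)) - ∫ r ^ α φ ^ 2` with `u = (n₁ - zₛ) / ε ^ γ`
(`IsState.le_dissipationε`), and `u` is bounded along subsequences of bounded dissipation.

*Limit side.* By `α ≥ 1 - 3 γ` the moment `∫ r ^ α` is controlled by the dissipation and the mass,
so that the continuity equation holds for test functions of linear growth. The test function `r`
yields `∫ r ^ α v = 0`, and the primitives of truncations of `q r ^ (-γ)` yield the identity
`E(ν_t) - E(ν_s) = -∫∫ r ^ α v (u - q r ^ (-γ))`, whence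
`J(ν) = ½ ∫∫ r ^ α (v - (u - q r ^ (-γ)))² ≥ 0`.
If all `Jε` vanish then so does `J(ν)`, which makes `v` the LSW velocity; no lower
semicontinuity inequality can then be strict, which turns them into limits.
-/

namespace BeckerDoring

open Real (dist_eq div_rpow exp exp_add exp_pos log log_div log_le_log log_lt_log log_mul log_nonneg
  measurable_log mul_rpow norm_eq_abs rpow_add rpow_le_rpow rpow_le_rpow_of_nonpos rpow_mul
  rpow_natCast rpow_neg rpow_nonneg rpow_one rpow_pos_of_pos rpow_sub rpow_sub_one smoothTransition
  sq_sqrt sqrt sqrt_nonneg sqrt_pos zero_rpow)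
open ENNReal (add_lt_top div_le_iff div_ne_top le_tsum measurable_ofReal mul_lt_top mul_ne_top
  mul_top ofNat_ne_top ofReal ofReal_add ofReal_coe_nnreal ofReal_eq_zero ofReal_le_iff_le_toReal
  ofReal_le_ofReal ofReal_lt_top ofReal_mul ofReal_ne_top ofReal_one ofReal_pos ofReal_sum_of_nonneg
  ofReal_toReal ofReal_tsum_of_nonneg ofReal_zero sum_le_tsum tendsto_ofReal tendsto_toReal
  toReal_add toReal_div toReal_le_of_le_ofReal toReal_mono toReal_mul toReal_nonneg toReal_ofNat
  toReal_ofReal tsum_add tsum_le_tsum zero_lt_top)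
open Finset (abs_sum_le_sum_abs mem_filter mul_sum sum_add_distrib sum_congr sum_filter sum_le_sum
  sum_mul sum_nonneg sum_range_succ sum_sub_distrib)

/-- Lebesgue measure on the time interval `[0, T]`. -/
notation "vol[" T "]" => volume.restrict (Icc (0 : ℝ) T)

/-! ### The logarithmic mean -/

theorem logMean_nonneg (a b : ℝ) : 0 ≤ logMean a b := by
  unfold logMean
  split_ifs with h1 h2
  · exact le_rfl
  · grind
  · push Not at h1
    rcases lt_or_gt_of_ne h2 with h | h
    · exact div_nonneg_of_nonpos (by linarith) (by linarith [log_lt_log h1.1 h])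
    · exact div_nonneg (by linarith) (by linarith [log_lt_log h1.2 h])

theorem logMean_of_pos {a b : ℝ} (ha : 0 < a) (hb : 0 < b) :
    logMean a b = if a = b then a else (a - b) / (log a - log b) := by
  simp [logMean, not_le.2 ha, not_le.2 hb]

theorem logMean_comm (a b : ℝ) : logMean a b = logMean b a := by
  by_cases h : a ≤ 0 ∨ b ≤ 0
  · simp [logMean, h, h.symm]
  · have h' : 0 < a ∧ 0 < b := by grind
    rw [logMean_of_pos h'.1 h'.2, logMean_of_pos h'.2 h'.1]
    grind

theorem log_sub_log_ne_zero {a b : ℝ} (ha : 0 < a) (hb : 0 < b) (hab : a ≠ b) : log a - log b ≠ 0 :=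
  fun h => hab (Real.log_injOn_pos ha hb (by linarith))

theorem logMean_mul_log_sub {a b : ℝ} (ha : 0 < a) (hb : 0 < b) :
    logMean a b * (log a - log b) = a - b := by
  rw [logMean_of_pos ha hb]
  split_ifs with h
  · simp [h]
  · exact div_mul_cancel₀ _ (log_sub_log_ne_zero ha hb h)

theorem logMean_pos {a b : ℝ} (ha : 0 < a) (hb : 0 < b) : 0 < logMean a b := by
  refine (logMean_nonneg a b).lt_of_ne' fun h => ?_
  have := logMean_mul_log_sub ha hb
  rw [h, zero_mul] at this
  have hab : a = b := by linarith
  rw [logMean_of_pos ha hb, if_pos hab] at h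
  exact ha.ne' h

/-- The logarithmic mean lies above the smaller of its arguments and below the larger one. -/
theorem logMean_mem_Icc {a b : ℝ} (ha : 0 < a) (hab : a ≤ b) : logMean a b ∈ Icc a b := by
  have hb : 0 < b := ha.trans_le hab
  rcases hab.eq_or_lt with rfl | h
  · rw [logMean_of_pos ha ha, if_pos rfl]; simp
  have hlog : 0 < log b - log a := by linarith [log_lt_log ha h]
  have hm : logMean a b = (b - a) / (log b - log a) := by
    rw [logMean_comm, logMean_of_pos hb ha, if_neg h.ne']
  have h1 : log (b / a) ≤ b / a - 1 := Real.log_le_sub_one_of_pos (div_pos hb ha)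
  have h2 : log (a / b) ≤ a / b - 1 := Real.log_le_sub_one_of_pos (div_pos ha hb)
  rw [log_div hb.ne' ha.ne'] at h1
  rw [log_div ha.ne' hb.ne'] at h2
  rw [hm]
  constructor
  · rw [le_div_iff₀ hlog]
    calc a * (log b - log a) ≤ a * (b / a - 1) := by gcongr
      _ = b - a := by field_simp
  · rw [div_le_iff₀ hlog]
    calc b - a = b * (1 - a / b) := by field_simp
      _ ≤ b * (log b - log a) := mul_le_mul_of_nonneg_left (by linarith) hb.le

theorem logMean_le_max {a b : ℝ} (ha : 0 ≤ a) (_hb : 0 ≤ b) : logMean a b ≤ max a b := by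
  by_cases h : a ≤ 0 ∨ b ≤ 0
  · simp only [logMean, h, if_true]; positivity
  · push Not at h
    rcases le_total a b with hab | hab
    · exact (logMean_mem_Icc h.1 hab).2.trans (le_max_right _ _)
    · rw [logMean_comm]; exact (logMean_mem_Icc h.2 hab).2.trans (le_max_left _ _)

theorem abs_sub_logMean_le {a b : ℝ} (ha : 0 < a) (hb : 0 < b) : |a - logMean a b| ≤ |a - b| := by
  rcases le_total a b with hab | hab
  · have := logMean_mem_Icc ha hab
    grind
  · have := logMean_mem_Icc hb hab
    rw [logMean_comm] at this
    grind

theorem two_mul_sub_one_div_le_log {t : ℝ} (ht : 1 ≤ t) : 2 * (t - 1) / (t + 1) ≤ log t := by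
  have key : MonotoneOn (fun s : ℝ => log s - 2 * (s - 1) / (s + 1)) (Ici 1) := by
    refine monotoneOn_of_deriv_nonneg (convex_Ici 1) ?_ ?_ ?_
    · refine ContinuousOn.sub ?_ ?_
      · exact Real.continuousOn_log.mono fun s hs => (lt_of_lt_of_le one_pos hs).ne'
      · exact ContinuousOn.div (by fun_prop) (by fun_prop) fun s (hs : 1 ≤ s) => by positivity
    · intro s hs
      rw [interior_Ici] at hs
      have h0 : s ≠ 0 := by grind
      have h1 : s + 1 ≠ 0 := by grind
      exact ((Real.differentiableAt_log h0).sub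
        (DifferentiableAt.div (by fun_prop) (by fun_prop) h1)).differentiableWithinAt
    · intro s hs
      rw [interior_Ici] at hs
      have hs' : (1 : ℝ) < s := hs
      have h0 : s ≠ 0 := by positivity
      have h1 : s + 1 ≠ 0 := by positivity
      have hd : HasDerivAt (fun s : ℝ => log s - 2 * (s - 1) / (s + 1)) (s⁻¹
          - (2 * 1 * (s + 1) - 2 * (s - 1) * 1) / (s + 1) ^ 2) s := (Real.hasDerivAt_log h0).sub
          ((((hasDerivAt_id s).sub_const 1).const_mul 2).div ((hasDerivAt_id s).add_const 1) h1)
      rw [hd.deriv]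
      have : s⁻¹ - (2 * 1 * (s + 1) - 2 * (s - 1) * 1) / (s + 1) ^ 2
          = (s - 1) ^ 2 / (s * (s + 1) ^ 2) := by field_simp; ring
      rw [this]; positivity
  have := key (mem_Ici.2 le_rfl) (mem_Ici.2 ht) ht
  simp only [Real.log_one, sub_self, mul_zero, zero_div] at this
  linarith

/-- The logarithmic mean is at most the arithmetic mean. -/
theorem logMean_le_half_add {a b : ℝ} (ha : 0 ≤ a) (hb : 0 ≤ b) : logMean a b ≤ (a + b) / 2 := by
  wlog hab : b ≤ a generalizing a b
  · rw [logMean_comm, add_comm]; grind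
  by_cases h : a ≤ 0 ∨ b ≤ 0
  · simp only [logMean, h, if_true]; positivity
  push Not at h
  rcases hab.eq_or_lt with rfl | hlt
  · rw [logMean_of_pos h.1 h.1, if_pos rfl]; linarith
  have hlog : 0 < log a - log b := by linarith [log_lt_log h.2 hlt]
  rw [logMean_of_pos h.1 h.2, if_neg hlt.ne', div_le_iff₀ hlog]
  have := two_mul_sub_one_div_le_log (t := a / b) (by rw [le_div_iff₀ h.2]; linarith)
  rw [log_div h.1.ne' h.2.ne'] at this
  have e : 2 * (a / b - 1) / (a / b + 1) = 2 * (a - b) / (a + b) := by grind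
  rw [e, div_le_iff₀ (by linarith)] at this
  linarith

theorem measurable_logMean : Measurable fun z : ℝ × ℝ => logMean z.1 z.2 := by
  unfold logMean
  refine Measurable.ite ?_ measurable_const (Measurable.ite ?_ measurable_fst ?_)
  · exact (measurableSet_le measurable_fst measurable_const).union
      (measurableSet_le measurable_snd measurable_const)
  · exact measurableSet_eq_fun measurable_fst measurable_snd
  fun_prop

/-! ### The entropy function -/

/-- Young's inequality for `ψ`, whose Legendre transform is `s ↦ e^s - 1`. -/
theorem mul_sub_exp_le_ψ {x : ℝ} (hx : 0 ≤ x) (s : ℝ) : x * s - (exp s - 1) ≤ ψ x := by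
  unfold ψ
  rcases hx.eq_or_lt with rfl | hx
  · simp; positivity
  · have h := Real.add_one_le_exp (s - log x)
    rw [Real.exp_sub, Real.exp_log hx, le_div_iff₀ hx] at h
    nlinarith

theorem ψ_nonneg {x : ℝ} (hx : 0 ≤ x) : 0 ≤ ψ x := by
  simpa using mul_sub_exp_le_ψ hx 0

/-- Young's inequality for one summand of the free energy. -/
theorem mul_sub_mul_exp_le {n o : ℝ} (hn : 0 ≤ n) (ho : 0 < o) (s : ℝ) :
    n * s - o * (exp s - 1) ≤ o * ψ (n / o) := by
  have h := mul_le_mul_of_nonneg_left (mul_sub_exp_le_ψ (x := n / o) (by positivity) s) ho.le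
  have e : o * (n / o * s - (exp s - 1)) = n * s - o * (exp s - 1) := by
    field_simp
  linarith

/-! ### The rates and the equilibrium state -/

variable (p : Rates)

theorem Rates.a_pos {l : ℕ} (hl : 1 ≤ l) : 0 < p.a l := rpow_pos_of_pos (by exact_mod_cast hl) _

theorem Rates.fac_pos (l : ℕ) : 0 < p.zs + p.q * (l : ℝ) ^ (-p.γ) :=
  add_pos_of_pos_of_nonneg p.zs_pos (mul_nonneg p.q_pos.le (by positivity))

theorem Rates.b_pos {l : ℕ} (hl : 1 ≤ l) : 0 < p.b l :=
  mul_pos (rpow_pos_of_pos (by exact_mod_cast hl) _) (p.fac_pos l)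

theorem Rates.ω_one : p.ω 1 = p.zs := by simp [Rates.ω, Rates.Q]

theorem Rates.ω_succ {l : ℕ} (hl : 1 ≤ l) : p.ω (l + 1) = p.ω l * (p.zs * p.a l / p.b (l + 1)) := by
  unfold Rates.ω Rates.Q
  rw [Finset.prod_Ico_succ_top hl, pow_succ]; ring

theorem Rates.ω_pos (l : ℕ) : 0 < p.ω l := by
  refine mul_pos (pow_pos p.zs_pos _) (Finset.prod_pos fun j hj => ?_)
  exact div_pos (p.a_pos (Finset.mem_Ico.1 hj).1) (p.b_pos (by omega))

theorem Rates.k_pos {l : ℕ} (hl : 1 ≤ l) : 0 < p.k l :=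
  mul_pos (mul_pos (p.a_pos hl) (p.ω_pos 1)) (p.ω_pos l)

/-- Detailed balance. -/
theorem Rates.k_eq {l : ℕ} (hl : 1 ≤ l) : p.k l = p.b (l + 1) * p.ω (l + 1) := by
  have := (p.b_pos (l := l + 1) (by omega)).ne'
  rw [p.ω_succ hl, Rates.k, p.ω_one]; field_simp

theorem Rates.a_le {l : ℕ} (hl : 1 ≤ l) : p.a l ≤ l := by
  calc p.a l = (l : ℝ) ^ p.α := rfl
    _ ≤ (l : ℝ) ^ (1 : ℝ) := Real.rpow_le_rpow_of_exponent_le (by exact_mod_cast hl) p.α_lt_one.le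
    _ = l := rpow_one _

theorem Rates.fac_le {l : ℕ} (hl : 1 ≤ l) : p.zs + p.q * (l : ℝ) ^ (-p.γ) ≤ p.zs + p.q := by
  have : (l : ℝ) ^ (-p.γ) ≤ 1 :=
    Real.rpow_le_one_of_one_le_of_nonpos (by exact_mod_cast hl) (by linarith [p.γ_pos])
  nlinarith [p.q_pos]

theorem Rates.b_le {l : ℕ} (hl : 1 ≤ l) : p.b l ≤ (p.zs + p.q) * l := by
  calc p.b l = p.a l * (p.zs + p.q * (l : ℝ) ^ (-p.γ)) := rfl
    _ ≤ l * (p.zs + p.q) := mul_le_mul (p.a_le hl) (p.fac_le hl) (p.fac_pos l).le (by positivity)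
    _ = _ := by ring

theorem Rates.k_eq_a {l : ℕ} : p.k l = p.zs * p.a l * p.ω l := by
  rw [Rates.k, p.ω_one]; ring

/-- `ω_l ω_{l+1}⁻¹`, up to the factor `z_s`. -/
theorem Rates.ω_div_ω_succ {l : ℕ} (hl : 1 ≤ l) :
    p.ω l / p.ω (l + 1) = p.b (l + 1) / (p.zs * p.a l) := by
  have h1 := (p.ω_pos l).ne'
  have h2 := (p.b_pos (l := l + 1) (by omega)).ne'
  have h3 := (p.a_pos hl).ne'
  have h4 := p.zs_pos.ne'
  rw [p.ω_succ hl]; field_simp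

theorem Rates.a_mono {l m : ℕ} (h : l ≤ m) : p.a l ≤ p.a m :=
  rpow_le_rpow (by positivity) (by exact_mod_cast h) p.α_nonneg

theorem Rates.a_succ_le {l : ℕ} (hl : 1 ≤ l) : p.a (l + 1) ≤ 2 * p.a l := by
  have h1 : ((l + 1 : ℕ) : ℝ) ≤ 2 * l := by
    have : (1 : ℝ) ≤ l := by exact_mod_cast hl
    grind
  calc p.a (l + 1) ≤ (2 * (l : ℝ)) ^ p.α := rpow_le_rpow (by positivity) h1 p.α_nonneg
    _ = 2 ^ p.α * p.a l := mul_rpow (by norm_num) (by positivity)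
    _ ≤ 2 ^ (1 : ℝ) * p.a l := mul_le_mul_of_nonneg_right
        (Real.rpow_le_rpow_of_exponent_le (by norm_num) p.α_lt_one.le) (p.a_pos hl).le
    _ = 2 * p.a l := by rw [rpow_one]

theorem Rates.b_succ_le {l : ℕ} (hl : 1 ≤ l) : p.b (l + 1) ≤ 2 * (p.zs + p.q) * p.a l := by
  calc p.b (l + 1) = p.a (l + 1) * (p.zs + p.q * ((l + 1 : ℕ) : ℝ) ^ (-p.γ)) := rfl
    _ ≤ 2 * p.a l * (p.zs + p.q) := mul_le_mul (p.a_succ_le hl) (p.fac_le (by omega)) (p.fac_pos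
      _).le (by have := p.a_pos hl; positivity)
    _ = _ := by ring

/-- An upper bound for the ratios `ω_l / ω_{l+1}`. -/
noncomputable def Rates.ratio : ℝ := 2 * (p.zs + p.q) / p.zs

theorem Rates.one_le_ratio : 1 ≤ p.ratio := by
  rw [Rates.ratio, le_div_iff₀ p.zs_pos]; linarith [p.zs_pos, p.q_pos]

theorem Rates.ω_div_ω_succ_le {l : ℕ} (hl : 1 ≤ l) : p.ω l / p.ω (l + 1) ≤ p.ratio := by
  have h3 := p.a_pos hl
  have h4 := p.zs_pos
  rw [p.ω_div_ω_succ hl, Rates.ratio, div_le_div_iff₀ (by positivity) h4]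
  nlinarith [p.b_succ_le hl]

theorem Rates.ω_le_ratio_mul {l : ℕ} (hl : 1 ≤ l) : p.ω l ≤ p.ratio * p.ω (l + 1) :=
  (div_le_iff₀ (p.ω_pos _)).1 (p.ω_div_ω_succ_le hl)

theorem Rates.neg_log_ω_le : ∃ C : ℝ, 0 < C ∧ ∀ l : ℕ, 1 ≤ l → -log (p.ω l) ≤ C * l := by
  have hr := p.one_le_ratio
  have hr0 : 0 ≤ log p.ratio := log_nonneg hr
  refine ⟨|log p.zs| + log p.ratio + 1, by positivity, fun l hl => ?_⟩
  have key : -log (p.ω l) ≤ |log p.zs| + log p.ratio * l := by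
    induction l, hl using Nat.le_induction with
    | base => rw [p.ω_one]; grind
    | succ l hl ih =>
      have h := log_le_log (p.ω_pos l) (p.ω_le_ratio_mul hl)
      rw [log_mul (by linarith) (p.ω_pos _).ne'] at h
      grind
  have : (1 : ℝ) ≤ l := by exact_mod_cast hl
  nlinarith [abs_nonneg (log p.zs)]

/-- The constant `q / (z_s (1 - γ))` in the exponent of the equilibrium state
`ω_l = exp (-(c + o(1)) l ^ (1 - γ))`. -/
noncomputable def Rates.c : ℝ := p.q / (p.zs * (1 - p.γ))

theorem Rates.one_sub_γ_pos : 0 < 1 - p.γ := by linarith [p.γ_lt_one]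

theorem Rates.c_pos : 0 < p.c := div_pos p.q_pos (mul_pos p.zs_pos p.one_sub_γ_pos)

theorem rpow_succ_sub_le {s : ℝ} (hs0 : 0 < s) (hs1 : s < 1) {l : ℕ} (hl : 1 ≤ l) :
    ((l + 1 : ℕ) : ℝ) ^ s - (l : ℝ) ^ s ≤ s * (l : ℝ) ^ (s - 1) := by
  have hl0 : (0 : ℝ) < l := by exact_mod_cast hl
  have h := rpow_one_add_le_one_add_mul_self (s := 1 / (l : ℝ)) (p := s)
    (by have : (0:ℝ) ≤ 1 / l := by positivity
        linarith) hs0.le hs1.le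
  have e : ((l + 1 : ℕ) : ℝ) = l * (1 + 1 / l) := by grind
  rw [e, mul_rpow hl0.le (by positivity), rpow_sub_one hl0.ne']
  have := mul_le_mul_of_nonneg_left h (rpow_nonneg hl0.le s)
  grind

theorem tendsto_natCast_rpow_neg {s : ℝ} (hs : 0 < s) :
    Tendsto (fun l : ℕ => (l : ℝ) ^ (-s)) atTop (𝓝 0) :=
  (tendsto_rpow_neg_atTop hs).comp tendsto_natCast_atTop_atTop

/-- The ratio of successive powers tends to one. -/
theorem tendsto_succ_div_rpow (s : ℝ) :
    Tendsto (fun l : ℕ => (((l + 1 : ℕ) : ℝ) / l) ^ s) atTop (𝓝 1) := by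
  have h1 : Tendsto (fun l : ℕ => (((l + 1 : ℕ) : ℝ) / l)) atTop (𝓝 1) := by
    have : Tendsto (fun l : ℕ => 1 + 1 / (l : ℝ)) atTop (𝓝 (1 + 0)) :=
      tendsto_const_nhds.add tendsto_one_div_atTop_nhds_zero_nat
    rw [add_zero] at this
    refine this.congr' ?_
    filter_upwards [eventually_ge_atTop 1] with l hl
    have : (l : ℝ) ≠ 0 := by positivity
    grind
  simpa using h1.rpow_const (p := s) (Or.inl one_ne_zero)

theorem Rates.tendsto_ω_div_ω_succ : Tendsto (fun l : ℕ => p.ω l / p.ω (l + 1)) atTop (𝓝 1) := by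
  have h1 := tendsto_succ_div_rpow p.α
  have h2 : Tendsto (fun l : ℕ => 1 + p.q / p.zs * ((l + 1 : ℕ) : ℝ) ^ (-p.γ)) atTop (𝓝 1) := by
    have := ((tendsto_natCast_rpow_neg p.γ_pos).comp (tendsto_add_atTop_nat 1)).const_mul
      (p.q / p.zs) |>.const_add 1
    simpa using this
  have h3 := h1.mul h2
  rw [mul_one] at h3
  refine h3.congr' ?_
  filter_upwards [eventually_ge_atTop 1] with l hl
  rw [p.ω_div_ω_succ hl, Rates.b, Rates.a, div_rpow (by positivity) (by positivity)]
  have h4 := p.zs_pos.ne'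
  grind

/-- The equilibrium state decays like a stretched exponential with constant almost `c`. -/
theorem Rates.ω_le {θ : ℝ} (hθ0 : 0 < θ) (hθ : θ < 1) :
    ∃ C : ℝ, 0 < C ∧ ∀ l : ℕ, 1 ≤ l → p.ω l ≤ C * exp (-(θ * p.c * (l : ℝ) ^ (1 - p.γ))) := by
  -- the quotient of the two sides is eventually nonincreasing
  set u : ℕ → ℝ := fun l => p.ω l * exp (θ * p.c * (l : ℝ) ^ (1 - p.γ)) with hu
  have hu0 : ∀ l, 0 < u l := fun l => mul_pos (p.ω_pos l) (exp_pos _)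
  have hev : ∀ᶠ l : ℕ in atTop, u (l + 1) ≤ u l := by
    have e1 : ∀ᶠ l : ℕ in atTop, (1 + θ) / 2 < (((l + 1 : ℕ) : ℝ) / l) ^ (-p.γ) :=
      (tendsto_succ_div_rpow (-p.γ)).eventually (lt_mem_nhds (by linarith))
    have e2 := (tendsto_natCast_rpow_neg p.γ_pos).const_mul (p.q / p.zs)
    rw [mul_zero] at e2
    filter_upwards [e1, e2.eventually (gt_mem_nhds (show 0 < (1 - θ) / 2 by linarith)),
      eventually_ge_atTop 1] with l h1 h2 hl
    have hl0 : (0 : ℝ) < l := by exact_mod_cast hl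
    set y := p.q / p.zs * (l : ℝ) ^ (-p.γ) with hy
    have hy0 : 0 < y := mul_pos (div_pos p.q_pos p.zs_pos) (rpow_pos_of_pos hl0 _)
    set y' := p.q / p.zs * ((l + 1 : ℕ) : ℝ) ^ (-p.γ) with hy'
    have hyy : (1 + θ) / 2 * y ≤ y' := by
      rw [div_rpow (by positivity) hl0.le, lt_div_iff₀ (rpow_pos_of_pos hl0 _)] at h1
      have := mul_le_mul_of_nonneg_left h1.le (div_pos p.q_pos p.zs_pos).le
      linarith
    have hexp : exp (θ * y) ≤ 1 + y' := by
      have := (abs_le.1 (Real.abs_exp_sub_one_sub_id_le (x := θ * y)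
        (by rw [abs_of_nonneg (by positivity)]; nlinarith))).2
      have : (θ * y) ^ 2 ≤ 1 ^ 2 * (y * y) := by
        rw [mul_pow, ← sq y]; gcongr
      nlinarith
    have hratio : p.ω (l + 1) * (1 + y') ≤ p.ω l := by
      have hz := p.zs_pos
      have hy'0 : 0 ≤ y' := mul_nonneg (div_pos p.q_pos hz).le (by positivity)
      rw [← le_div_iff₀' (p.ω_pos _), p.ω_div_ω_succ hl, le_div_iff₀ (mul_pos hz (p.a_pos hl))]
      calc _ ≤ (1 + y') * (p.zs * p.a (l + 1)) := by gcongr; exact p.a_mono (Nat.le_succ l)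
        _ = _ := by rw [hy', Rates.b, Rates.a]; field_simp
    have hpow : θ * p.c * ((l + 1 : ℕ) : ℝ) ^ (1 - p.γ) ≤ θ * p.c * (l : ℝ) ^ (1 - p.γ) + θ * y := by
      have h5 := rpow_succ_sub_le p.one_sub_γ_pos (by linarith [p.γ_pos]) hl
      have h6 : θ * y = θ * p.c * ((1 - p.γ) * (l : ℝ) ^ (1 - p.γ - 1)) := by
        have := p.one_sub_γ_pos.ne'
        have := p.zs_pos.ne'
        rw [hy, Rates.c, show 1 - p.γ - 1 = -p.γ by ring]; field_simp
      rw [h6, ← mul_add]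
      exact mul_le_mul_of_nonneg_left (by linarith) (mul_pos hθ0 p.c_pos).le
    calc u (l + 1) ≤ p.ω (l + 1) * exp (θ * p.c * (l : ℝ) ^ (1 - p.γ) + θ * y) := by
          rw [hu]; exact mul_le_mul_of_nonneg_left (Real.exp_le_exp.2 hpow) (p.ω_pos _).le
      _ = p.ω (l + 1) * exp (θ * y) * exp (θ * p.c * (l : ℝ) ^ (1 - p.γ)) := by
          rw [exp_add]; ring
      _ ≤ u l := by
          refine mul_le_mul_of_nonneg_right (le_trans ?_ hratio) (exp_pos _).le
          exact mul_le_mul_of_nonneg_left hexp (p.ω_pos _).le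
  obtain ⟨L, hL⟩ := eventually_atTop.1 hev
  have hbd : ∀ l, u l ≤ ∑ j ∈ Finset.range (L + 1), u j := by
    intro l
    rcases le_or_gt l L with h | h
    · exact Finset.single_le_sum (fun j _ => (hu0 j).le) (Finset.mem_range.2 (by omega))
    · obtain ⟨k, rfl⟩ := Nat.exists_eq_add_of_lt h
      exact (antitone_nat_of_succ_le (f := fun k => u (L + k))
        (fun k => hL _ (Nat.le_add_right _ _)) (Nat.zero_le (k + 1))).trans
        (Finset.single_le_sum (f := u) (fun j _ => (hu0 j).le) (Finset.mem_range.2 (by omega)))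
  refine ⟨_, (hu0 0).trans_le (hbd 0), fun l _ => ?_⟩
  rw [Real.exp_neg, ← div_eq_mul_inv, le_div_iff₀ (exp_pos _)]
  exact hbd l

theorem summable_rpow_mul_exp_neg {c s : ℝ} (hc : 0 < c) (hs : 0 < s) (m : ℝ) :
    Summable fun i : ℕ => ((i + 1 : ℕ) : ℝ) ^ m * exp (-(c * ((i + 1 : ℕ) : ℝ) ^ s)) := by
  have h1 : (fun x : ℝ => exp (-c * x)) =o[atTop] fun x : ℝ => x ^ (-((m + 2) / s)) :=
    isLittleO_exp_neg_mul_rpow_atTop hc _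
  have h2 : Tendsto (fun i : ℕ => ((i + 1 : ℕ) : ℝ) ^ s) atTop atTop :=
    (tendsto_rpow_atTop hs).comp (tendsto_natCast_atTop_atTop.comp (tendsto_add_atTop_nat 1))
  have h3 := (h1.comp_tendsto h2).isBigO
  have h4 : (fun i : ℕ => ((i + 1 : ℕ) : ℝ) ^ m * exp (-(c * ((i + 1 : ℕ) : ℝ) ^ s))) =O[atTop]
      fun i : ℕ => ((i + 1 : ℕ) : ℝ) ^ (-(2 : ℝ)) := by
    have := (Asymptotics.isBigO_refl (fun i : ℕ => ((i + 1 : ℕ) : ℝ) ^ m) atTop).mul h3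
    refine (this.congr_left fun i => ?_).congr_right fun i => ?_
    · simp
    · have hi : (0 : ℝ) < ((i + 1 : ℕ) : ℝ) := by positivity
      simp only [Function.comp]
      rw [← rpow_mul hi.le, ← rpow_add hi]
      grind
  refine summable_of_isBigO_nat ?_ h4
  exact ((Real.summable_nat_rpow (p := -2)).2 (by norm_num)).comp_injective (add_left_injective 1)

theorem Rates.summable_pow_mul_ω (m : ℝ) :
    Summable fun i : ℕ => ((i + 1 : ℕ) : ℝ) ^ m * p.ω (i + 1) := by
  obtain ⟨C, hC, h⟩ := p.ω_le (θ := 1 / 2) (by norm_num) (by norm_num)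
  refine Summable.of_nonneg_of_le (fun i => mul_nonneg (by positivity) (p.ω_pos _).le) (fun i => ?_)
    ((summable_rpow_mul_exp_neg (mul_pos (by norm_num : (0:ℝ) < 1 / 2) p.c_pos) p.one_sub_γ_pos
    m).mul_left C)
  calc _ ≤ ((i + 1 : ℕ) : ℝ) ^ m * (C * _) :=
        mul_le_mul_of_nonneg_left (h (i + 1) (by omega)) (by positivity)
    _ = _ := by ring

theorem Rates.ρs_nonneg : 0 ≤ p.ρs := tsum_nonneg fun i => mul_nonneg (by positivity) (p.ω_pos _).le

theorem Rates.hasSum_ρs : HasSum (fun i : ℕ => ((i + 1 : ℕ) : ℝ) * p.ω (i + 1)) p.ρs := by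
  have := p.summable_pow_mul_ω 1
  simp only [rpow_one] at this
  exact this.hasSum

/-! ### Densities, mobilities and forces of a single state -/

/-- The density of `n` with respect to the equilibrium state. -/
noncomputable def dens (p : Rates) (n : ℕ → ℝ) (l : ℕ) : ℝ := n l / p.ω l

/-- The mobility `k^l n̂_l` of the reaction `l`. -/
noncomputable def mob (p : Rates) (n : ℕ → ℝ) (l : ℕ) : ℝ := p.k l * nHat p n l

/-- The force `log (n_1 n_l / (ω_1 ω_l)) - log (n_{l+1} / ω_{l+1})` that drives the reaction `l`. -/
noncomputable def force (p : Rates) (n : ℕ → ℝ) (l : ℕ) : ℝ :=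
  log (dens p n 1) + log (dens p n l) - log (dens p n (l + 1))

variable {p : Rates} {ρ₀ : ℝ} {n : ℕ → ℝ}

theorem nHat_eq (p : Rates) (n : ℕ → ℝ) (l : ℕ) :
    nHat p n l = logMean (dens p n 1 * dens p n l) (dens p n (l + 1)) := by
  rw [nHat, dens, dens, dens, div_mul_div_comm]

theorem nHat_nonneg (p : Rates) (n : ℕ → ℝ) (l : ℕ) : 0 ≤ nHat p n l := logMean_nonneg _ _

theorem mob_nonneg {l : ℕ} (hl : 1 ≤ l) : 0 ≤ mob p n l :=
  mul_nonneg (p.k_pos hl).le (nHat_nonneg _ _ _)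

theorem k_mul_dens (l : ℕ) : p.k l * (dens p n 1 * dens p n l) = p.a l * n 1 * n l := by
  have := (p.ω_pos l).ne'
  have := (p.ω_pos 1).ne'
  rw [dens, dens, Rates.k]; field_simp

theorem k_mul_dens_succ {l : ℕ} (hl : 1 ≤ l) :
    p.k l * dens p n (l + 1) = p.b (l + 1) * n (l + 1) := by
  have := (p.ω_pos (l + 1)).ne'
  rw [dens, p.k_eq hl]; field_simp

namespace IsState

section

variable (h : IsState ρ₀ n)
include h

theorem natCast_mul_le {l : ℕ} (hl : 1 ≤ l) : l * n l ≤ ρ₀ := by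
  obtain ⟨i, rfl⟩ : ∃ i, l = i + 1 := ⟨l - 1, by omega⟩
  refine le_hasSum h.2 i fun j _ => mul_nonneg (by positivity) (h.1 _ (by omega))

theorem le {l : ℕ} (hl : 1 ≤ l) : n l ≤ ρ₀ := by
  have h1 := h.natCast_mul_le hl
  have h2 : (1 : ℝ) ≤ l := by exact_mod_cast hl
  nlinarith [h.1 l hl]

theorem dens_nonneg {l : ℕ} (hl : 1 ≤ l) : 0 ≤ dens p n l :=
  div_nonneg (h.1 l hl) (p.ω_pos l).le

theorem summable_succ : Summable fun i : ℕ => (i + 2 : ℕ) * n (i + 2) :=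
  (summable_nat_add_iff 1).2 h.2.summable

theorem tsum_succ_le : ∑' i : ℕ, (i + 2 : ℕ) * n (i + 2) ≤ ρ₀ := by
  have h1 := h.2.summable.tsum_eq_zero_add
  rw [h.2.tsum_eq] at h1
  have : 0 ≤ n 1 := h.1 1 le_rfl
  grind

/-- The mobility is at most the arithmetic mean of the two one-way fluxes. -/
theorem mob_le_half {l : ℕ} (hl : 1 ≤ l) :
    mob p n l ≤ (p.a l * n 1 * n l + p.b (l + 1) * n (l + 1)) / 2 := by
  rw [← k_mul_dens l, ← k_mul_dens_succ hl, ← mul_add, mul_div_assoc, mob, nHat_eq]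
  exact mul_le_mul_of_nonneg_left (logMean_le_half_add (mul_nonneg (h.dens_nonneg le_rfl)
    (h.dens_nonneg hl)) (h.dens_nonneg (by omega))) (p.k_pos hl).le

theorem mob_le {l : ℕ} (hl : 1 ≤ l) :
    mob p n l ≤ (ρ₀ + p.zs + p.q) * (l * n l + (l + 1 : ℕ) * n (l + 1)) := by
  have h1 := h.mob_le_half (p := p) hl
  have hn1 := h.1 1 le_rfl
  have hnl := h.1 l hl
  have hnl' := h.1 (l + 1) (by omega)
  have e1 : p.a l * n 1 * n l ≤ ρ₀ * (l * n l) := by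
    calc p.a l * n 1 * n l ≤ l * ρ₀ * n l := by
          refine mul_le_mul_of_nonneg_right ?_ hnl
          exact mul_le_mul (p.a_le hl) (h.le le_rfl) hn1 (by positivity)
      _ = _ := by ring
  have e2 : p.b (l + 1) * n (l + 1) ≤ (p.zs + p.q) * ((l + 1 : ℕ) * n (l + 1)) := by
    rw [← mul_assoc]; exact mul_le_mul_of_nonneg_right (p.b_le (by omega)) hnl'
  have e3 : 0 ≤ (l : ℝ) * n l := by positivity
  have e4 : 0 ≤ (l + 1 : ℕ) * n (l + 1) := by positivity
  have e5 : 0 ≤ ρ₀ := hn1.trans (h.le le_rfl)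
  nlinarith [p.zs_pos, p.q_pos, mul_nonneg e5 e4, mul_nonneg p.zs_pos.le e3,
    mul_nonneg p.q_pos.le e3, mul_nonneg e5 e3, mul_nonneg p.zs_pos.le e4, mul_nonneg p.q_pos.le e4]

theorem summable_mob : Summable fun i : ℕ => mob p n (i + 1) :=
  Summable.of_nonneg_of_le (fun i => mob_nonneg (by omega)) (fun i => h.mob_le (by omega))
    ((h.2.summable.add h.summable_succ).mul_left _)

end

end IsState

/-! ### States with positive components -/

theorem dens_pos (hn : ∀ l, 1 ≤ l → 0 < n l) {l : ℕ} (hl : 1 ≤ l) : 0 < dens p n l :=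
  div_pos (hn l hl) (p.ω_pos l)

theorem mob_pos (hn : ∀ l, 1 ≤ l → 0 < n l) {l : ℕ} (hl : 1 ≤ l) : 0 < mob p n l := by
  rw [mob, nHat_eq]
  exact mul_pos (p.k_pos hl)
    (logMean_pos (mul_pos (dens_pos hn le_rfl) (dens_pos hn hl)) (dens_pos hn (by omega)))

theorem mob_mul_force (hn : ∀ l, 1 ≤ l → 0 < n l) {l : ℕ} (hl : 1 ≤ l) :
    mob p n l * force p n l = p.a l * n 1 * n l - p.b (l + 1) * n (l + 1) := by
  have h1 := dens_pos (p := p) hn le_rfl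
  have h2 := dens_pos (p := p) hn hl
  have h3 := dens_pos (p := p) hn (l := l + 1) (by omega)
  rw [← k_mul_dens l, ← k_mul_dens_succ hl, mob, nHat_eq, force, ← log_mul h1.ne' h2.ne', mul_assoc,
    logMean_mul_log_sub (mul_pos h1 h2) h3, mul_sub]

theorem entropyProduction_eq (hn : ∀ l, 1 ≤ l → 0 < n l) {l : ℕ} (hl : 1 ≤ l) :
    entropyProduction (p.a l * n 1 * n l) (p.b (l + 1) * n (l + 1))
    = ofReal (mob p n l * force p n l ^ 2) := by
  have h1 := dens_pos (p := p) hn le_rfl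
  have h2 := dens_pos (p := p) hn hl
  have h3 := dens_pos (p := p) hn (l := l + 1) (by omega)
  have h4 : 0 < p.a l * n 1 * n l := mul_pos (mul_pos (p.a_pos hl) (hn 1 le_rfl)) (hn l hl)
  have h5 : 0 < p.b (l + 1) * n (l + 1) := mul_pos (p.b_pos (by omega)) (hn _ (by omega))
  rw [entropyProduction, if_pos ⟨h4, h5⟩, sq, ← mul_assoc, mob_mul_force hn hl]
  congr 2
  rw [force, ← log_mul h1.ne' h2.ne', ← k_mul_dens l, ← k_mul_dens_succ hl,
    log_mul (p.k_pos hl).ne' (mul_pos h1 h2).ne', log_mul (p.k_pos hl).ne' h3.ne']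
  ring

theorem dissipation_eq (hn : ∀ l, 1 ≤ l → 0 < n l) :
    dissipation p n = ∑' i : ℕ, ofReal (mob p n (i + 1) * force p n (i + 1) ^ 2) :=
  tsum_congr fun _ => entropyProduction_eq hn (by omega)

/-- Finite dissipation forces all components of a state to be positive, as either both or none of
`n_1 n_l` and `n_{l+1}` vanish. -/
theorem IsState.pos_of_dissipation_lt_top (h : IsState ρ₀ n) (hρ₀ : 0 < ρ₀)
    (hD : dissipation p n < ⊤) : ∀ l, 1 ≤ l → 0 < n l := by
  have key : ∀ l, 1 ≤ l → (0 < n 1 * n l ↔ 0 < n (l + 1)) := by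
    intro l hl
    obtain ⟨i, rfl⟩ : ∃ i, l = i + 1 := ⟨l - 1, by omega⟩
    have h1 : entropyProduction (p.a (i + 1) * n 1 * n (i + 1)) (p.b (i + 2) * n (i + 2)) < ⊤ :=
      (le_tsum i).trans_lt hD
    have ha := p.a_pos (l := i + 1) (by omega)
    have hb := p.b_pos (l := i + 2) (by omega)
    have hn1 := h.1 1 le_rfl
    have hni := h.1 (i + 1) (by omega)
    have hni' := h.1 (i + 2) (by omega)
    unfold entropyProduction at h1
    split_ifs at h1 with h2 h3
    · rw [mul_assoc] at h2
      exact ⟨fun _ => pos_of_mul_pos_right h2.2 hb.le, fun _ => pos_of_mul_pos_right h2.1 ha.le⟩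
    · rw [mul_assoc] at h2 h3
      constructor
      · intro h4
        have h5 := mul_pos ha h4
        grind
      · intro h4
        have h5 : 0 < p.b (i + 2) * n (i + 2) := mul_pos hb h4
        grind
    · simp at h1
  have h1 : 0 < n 1 := by
    refine (h.1 1 le_rfl).lt_of_ne fun h0 => ?_
    have hz : ∀ i : ℕ, n (i + 1) = 0 := by
      intro i
      rcases Nat.eq_zero_or_pos i with rfl | hi
      · exact h0.symm
      · have h2 := (key i hi).not.1 (by rw [← h0]; simp)
        exact le_antisymm (not_lt.1 h2) (h.1 _ (by omega))
    have h3 : HasSum (fun i : ℕ => (i + 1 : ℕ) * n (i + 1)) 0 := by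
      simp only [hz, mul_zero]; exact hasSum_zero
    exact hρ₀.ne (h3.unique h.2)
  intro l hl
  induction l, hl using Nat.le_induction with
  | base => exact h1
  | succ l hl ih => exact (key l hl).1 (mul_pos h1 ih)

/-! ### Logarithms of single densities

The chain rule for the free energy involves the products of the fluxes with the logarithms of single
densities, whereas action and dissipation only control their combination in `force`. If a density is
small, then either the mobility is small as well or the force is comparable to the logarithm. -/

theorem sqrt_mul_log_sq_le {y : ℝ} (hy : 0 < y) (hy1 : y ≤ 1) : sqrt y * log y ^ 2 ≤ 16 := by
  have h := Real.abs_log_mul_self_rpow_lt y (1 / 4) hy hy1 (by norm_num)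
  have e : sqrt y * log y ^ 2 = (|log y * y ^ (1 / 4 : ℝ)|) ^ 2 := by
    rw [sq_abs, mul_pow, ← rpow_natCast (y ^ (1 / 4 : ℝ)), ← rpow_mul hy.le, Real.sqrt_eq_rpow]
    norm_num; ring
  rw [e]
  rw [show (1 : ℝ) / (1 / 4) = 4 by norm_num] at h
  nlinarith [abs_nonneg (log y * y ^ (1 / 4 : ℝ))]

theorem logMean_mul_log_snd_sq_le {x y z M : ℝ} (hx : 0 < x) (hy : 0 < y) (hz : 0 < z) (hM : 1 ≤ M)
    (hxM : x ≤ M) (hy1 : y ≤ 1) :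
    logMean (x * y) z * log y ^ 2 ≤ 8 * (logMean (x * y) z * (log x + log y - log z) ^ 2)
    + 8 * log M ^ 2 * logMean (x * y) z + 16 * M := by
  set Λ := logMean (x * y) z
  have hΛ : 0 ≤ Λ := logMean_nonneg _ _
  have hs : y ≤ sqrt y := by
    rw [Real.le_sqrt hy.le hy.le]; nlinarith
  rcases le_or_gt z (sqrt y) with h | h
  · have h1 : Λ ≤ M * sqrt y := by
      refine (logMean_le_max (mul_pos hx hy).le hz.le).trans (max_le ?_ ?_)
      · gcongr
      · exact h.trans (le_mul_of_one_le_left (sqrt_nonneg _) hM)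
    have h2 : Λ * log y ^ 2 ≤ 16 * M := by
      calc Λ * log y ^ 2 ≤ M * sqrt y * log y ^ 2 := by gcongr
        _ = M * (sqrt y * log y ^ 2) := by ring
        _ ≤ M * 16 := mul_le_mul_of_nonneg_left (sqrt_mul_log_sq_le hy hy1) (by linarith)
        _ = _ := by ring
    have h3 : 0 ≤ 8 * (Λ * (log x + log y - log z) ^ 2) + 8 * log M ^ 2 * Λ := by positivity
    linarith
  · have h1 : log y / 2 < log z := by
      rw [← Real.log_sqrt hy.le]; gcongr
    have h2 : log x ≤ log M := log_le_log hx hxM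
    have h3 : log y ≤ 0 := Real.log_nonpos hy.le hy1
    have h4 : 0 ≤ log M := log_nonneg hM
    set D := log x + log y - log z
    have h5 : -log y ≤ 2 * (log M - D) := by linarith
    have h6 : log y ^ 2 ≤ 8 * D ^ 2 + 8 * log M ^ 2 := by
      nlinarith [sq_nonneg (log M + D)]
    have h7 := mul_le_mul_of_nonneg_left h6 hΛ
    nlinarith

theorem logMean_mul_log_fst_sq_le {x y z : ℝ} (hx : 0 < x) (hy : 0 < y) (hz : 0 < z) (hx1 : x ≤ 1) :
    logMean (x * y) z * log x ^ 2
    ≤ 4 * (logMean (x * y) z * (log x + log y - log z) ^ 2) + 16 * y := by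
  set Λ := logMean (x * y) z
  have hΛ : 0 ≤ Λ := logMean_nonneg _ _
  have hs : x ≤ sqrt x := by
    rw [Real.le_sqrt hx.le hx.le]; nlinarith
  rcases le_or_gt z (sqrt x * y) with h | h
  · have h1 : Λ ≤ sqrt x * y := by
      refine (logMean_le_max (mul_pos hx hy).le hz.le).trans (max_le ?_ h)
      gcongr
    have h2 : Λ * log x ^ 2 ≤ 16 * y := by
      calc Λ * log x ^ 2 ≤ sqrt x * y * log x ^ 2 := by gcongr
        _ = y * (sqrt x * log x ^ 2) := by ring
        _ ≤ y * 16 := mul_le_mul_of_nonneg_left (sqrt_mul_log_sq_le hx hx1) hy.le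
        _ = _ := by ring
    have h3 : 0 ≤ 4 * (Λ * (log x + log y - log z) ^ 2) := by positivity
    linarith
  · have h1 : log x / 2 + log y < log z := by
      rw [← Real.log_sqrt hx.le, ← log_mul (sqrt_pos.2 hx).ne' hy.ne']
      gcongr
    have h3 : log x ≤ 0 := Real.log_nonpos hx.le hx1
    set D := log x + log y - log z
    have h5 : -log x ≤ 2 * (-D) := by linarith
    have h6 : log x ^ 2 ≤ 4 * D ^ 2 := by nlinarith
    have h7 := mul_le_mul_of_nonneg_left h6 hΛ
    nlinarith

/-- The summable quantity that dominates the fluxes times logarithms of densities. -/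
noncomputable def dominator (p : Rates) (n g : ℕ → ℝ) (l : ℕ) : ℝ :=
  mob p n l * g l ^ 2 + mob p n l * force p n l ^ 2 + mob p n l + p.k l + l * n l

theorem dominator_nonneg (h : IsState ρ₀ n) (g : ℕ → ℝ) {l : ℕ} (hl : 1 ≤ l) :
    0 ≤ dominator p n g l := by
  have h1 := mob_nonneg (p := p) (n := n) hl
  have h2 := (p.k_pos hl).le
  have h3 := h.1 l hl
  unfold dominator; positivity

theorem IsState.dens_one_le (h : IsState ρ₀ n) (p : Rates) : dens p n 1 ≤ ρ₀ / p.zs := by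
  rw [dens, p.ω_one]
  exact div_le_div_of_nonneg_right (h.le le_rfl) p.zs_pos.le

theorem abs_flux_mul_le (g : ℕ → ℝ) {l : ℕ} (hl : 1 ≤ l) (c : ℝ) :
    |mob p n l * g l| * |c| ≤ mob p n l * g l ^ 2 + mob p n l * c ^ 2 := by
  have h1 := mob_nonneg (p := p) (n := n) hl
  rw [abs_mul, abs_of_nonneg h1]
  have : |g l| * |c| ≤ g l ^ 2 + c ^ 2 := by
    rw [← sq_abs (g l), ← sq_abs c]; nlinarith [sq_nonneg (|g l| - |c|), sq_nonneg (|g l|),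
      sq_nonneg (|c|)]
  nlinarith [mul_le_mul_of_nonneg_left this h1]

theorem abs_flux_le_dominator (h : IsState ρ₀ n) (g : ℕ → ℝ) {l : ℕ} (hl : 1 ≤ l) :
    |mob p n l * g l| ≤ dominator p n g l := by
  have h0 := abs_flux_mul_le (p := p) (n := n) g hl 1
  have h1 := mob_nonneg (p := p) (n := n) hl
  have h2 := (p.k_pos hl).le
  have h3 := h.1 l hl
  have h4 : 0 ≤ mob p n l * force p n l ^ 2 := by positivity
  have h5 : 0 ≤ (l : ℝ) * n l := by positivity
  simp only [abs_one, mul_one, one_pow] at h0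
  unfold dominator; linarith

theorem abs_flux_mul_force_le_dominator (h : IsState ρ₀ n) (g : ℕ → ℝ) {l : ℕ} (hl : 1 ≤ l) :
    |mob p n l * g l| * |force p n l| ≤ dominator p n g l := by
  have h0 := abs_flux_mul_le (p := p) (n := n) g hl (force p n l)
  have h1 := mob_nonneg (p := p) (n := n) hl
  have h2 := (p.k_pos hl).le
  have h3 := h.1 l hl
  have h5 : 0 ≤ (l : ℝ) * n l := by positivity
  unfold dominator; linarith

theorem exists_abs_flux_mul_log_one_le (p : Rates) (ρ₀ : ℝ) :
    ∃ C : ℝ, 0 < C ∧ ∀ (n g : ℕ → ℝ), IsState ρ₀ n → (∀ l, 1 ≤ l → 0 < n l) → ∀ l, 1 ≤ l →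
    |mob p n l * g l| * |log (dens p n 1)| ≤ C * dominator p n g l := by
  set M := max 1 (ρ₀ / p.zs)
  have hz := p.zs_pos
  refine ⟨5 + log M ^ 2 + 16 * p.zs, by positivity, fun n g h hn l hl => ?_⟩
  have h0 := abs_flux_mul_le (p := p) (n := n) g hl (log (dens p n 1))
  have h1 := mob_nonneg (p := p) (n := n) hl
  have h2 := (p.k_pos hl).le
  have h3 := h.1 l hl
  have hd := dens_pos (p := p) hn le_rfl
  have key : mob p n l * log (dens p n 1) ^ 2
      ≤ 4 * (mob p n l * force p n l ^ 2) + log M ^ 2 * mob p n l + 16 * p.zs * (l * n l) := by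
    rcases le_or_gt (dens p n 1) 1 with hle | hgt
    · have h7 := mul_le_mul_of_nonneg_left (logMean_mul_log_fst_sq_le hd (dens_pos (p := p) hn hl)
        (dens_pos (p := p) hn (l := l + 1) (by omega)) hle) h2
      have e1 : p.k l * dens p n l ≤ p.zs * (l * n l) := by
        have := (p.ω_pos l).ne'
        rw [p.k_eq_a, dens]
        calc _ = p.zs * (p.a l * n l) := by field_simp
          _ ≤ _ := by gcongr; exact p.a_le hl
      rw [← nHat_eq, ← force] at h7
      have : 0 ≤ log M ^ 2 * mob p n l := by positivity
      rw [mob] at *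
      linarith
    · have e1 : log (dens p n 1) ≤ log M := log_le_log hd (le_max_of_le_right (h.dens_one_le p))
      have e3 : 0 ≤ log (dens p n 1) := log_nonneg hgt.le
      have e4 : log (dens p n 1) ^ 2 ≤ log M ^ 2 := by gcongr
      have := mul_le_mul_of_nonneg_left e4 h1
      have : 0 ≤ 4 * (mob p n l * force p n l ^ 2) + 16 * p.zs * (l * n l) := by positivity
      linarith
  have : 0 ≤ (4 + log M ^ 2 + 16 * p.zs) * (mob p n l * g l ^ 2)
    + (1 + log M ^ 2 + 16 * p.zs) * (mob p n l * force p n l ^ 2) + (5 + 16 * p.zs) * mob p n l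
    + (5 + log M ^ 2 + 16 * p.zs) * p.k l + (5 + log M ^ 2) * (l * n l) := by positivity
  unfold dominator
  linarith

theorem exists_abs_flux_mul_log_le (p : Rates) (ρ₀ : ℝ) :
    ∃ C : ℝ, 0 < C ∧ ∀ (n g : ℕ → ℝ), IsState ρ₀ n → (∀ l, 1 ≤ l → 0 < n l) → ∀ l, 1 ≤ l →
    |mob p n l * g l| * |log (dens p n l)| ≤ C * (l * dominator p n g l) := by
  obtain ⟨C₁, hC₁, hC⟩ := p.neg_log_ω_le
  set M := max 1 (ρ₀ / p.zs)
  have hM : 1 ≤ M := le_max_left _ _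
  refine ⟨9 + 8 * log M ^ 2 + 16 * M + (C₁ + |ρ₀|), by positivity, fun n g h hn l hl => ?_⟩
  have h1 := mob_nonneg (p := p) (n := n) hl
  have h2 := (p.k_pos hl).le
  have h3 := h.1 l hl
  have hd := dens_pos (p := p) hn hl
  have hl1 : (1 : ℝ) ≤ l := by exact_mod_cast hl
  have hdom := dominator_nonneg (p := p) h g hl
  rcases le_or_gt (dens p n l) 1 with hle | hgt
  · have h7 := mul_le_mul_of_nonneg_left
      (logMean_mul_log_snd_sq_le (dens_pos (p := p) hn le_rfl) hd (dens_pos (p := p) hn (l := l + 1)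
      (by omega)) hM (le_max_of_le_right (h.dens_one_le p)) hle) h2
    rw [← nHat_eq, ← force] at h7
    calc _ ≤ mob p n l * g l ^ 2 + mob p n l * log (dens p n l) ^ 2 := abs_flux_mul_le g hl _
      _ ≤ (9 + 8 * log M ^ 2 + 16 * M) * dominator p n g l := by
        have : 0 ≤ (8 + 8 * log M ^ 2 + 16 * M) * (mob p n l * g l ^ 2)
          + (1 + 8 * log M ^ 2 + 16 * M) * (mob p n l * force p n l ^ 2) + (9 + 16 * M) * mob p n l
          + (9 + 8 * log M ^ 2) * p.k l + (9 + 8 * log M ^ 2 + 16 * M) * (l * n l) := by positivity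
        rw [dominator]
        rw [mob] at *
        linarith
      _ ≤ _ := by
        gcongr ?_ * ?_
        · grind
        · exact le_mul_of_one_le_left hdom hl1
  · have e1 : log (dens p n l) ≤ (C₁ + |ρ₀|) * l := by
      rw [dens, log_div (hn l hl).ne' (p.ω_pos l).ne']
      have q1 := hC l hl
      have q2 : log (n l) ≤ n l - 1 := Real.log_le_sub_one_of_pos (hn l hl)
      have q3 : n l ≤ |ρ₀| := (h.le hl).trans (le_abs_self _)
      nlinarith [abs_nonneg ρ₀]
    have h0 := log_nonneg hgt.le
    rw [abs_of_nonneg h0]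
    calc _ ≤ dominator p n g l * ((C₁ + |ρ₀|) * l) :=
          mul_le_mul (abs_flux_le_dominator h g hl) e1 h0 hdom
      _ = (C₁ + |ρ₀|) * (l * dominator p n g l) := by ring
      _ ≤ _ := by gcongr ?_ * _; exact le_add_of_nonneg_left (by positivity)

/-! ### Absolutely continuous functions -/

theorem ae_mem_Icc {a b : ℝ} : ∀ᵐ t ∂volume.restrict (Icc a b), t ∈ Icc a b :=
  ae_restrict_mem measurableSet_Icc

theorem absolutelyContinuousOnInterval_comp {y φ : ℝ → ℝ} {a b : ℝ} {K : ℝ≥0} {s : Set ℝ}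
    (hφ : LipschitzOnWith K φ s) (hy : AbsolutelyContinuousOnInterval y a b)
    (hs : MapsTo y (uIcc a b) s) : AbsolutelyContinuousOnInterval (fun t => φ (y t)) a b := by
  rw [absolutelyContinuousOnInterval_iff] at hy ⊢
  intro e he
  obtain ⟨δ, hδ, h⟩ := hy (e / (K + 1)) (by positivity)
  refine ⟨δ, hδ, fun E hE hlen => ?_⟩
  have h1 := h E hE hlen
  have h2 : ∑ i ∈ Finset.range E.1, dist (φ (y (E.2 i).1)) (φ (y (E.2 i).2))
      ≤ K * ∑ i ∈ Finset.range E.1, dist (y (E.2 i).1) (y (E.2 i).2) := by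
    rw [mul_sum]
    refine sum_le_sum fun i hi => ?_
    have := hE.1 i hi
    exact hφ.dist_le_mul _ (hs this.1) _ (hs this.2)
  have h3 : 0 ≤ ∑ i ∈ Finset.range E.1, dist (y (E.2 i).1) (y (E.2 i).2) :=
    sum_nonneg fun _ _ => dist_nonneg
  rw [lt_div_iff₀ (by positivity)] at h1
  nlinarith

theorem hasDerivAt_mul_log_sub {y δ : ℝ} (hy : 0 ≤ y) (hδ : 0 < δ) :
    HasDerivAt (fun y => (y + δ) * log (y + δ) - (y + δ)) (log (y + δ)) y := by
  have h0 : y + δ ≠ 0 := by positivity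
  have h1 : HasDerivAt (fun y => y + δ) 1 y := (hasDerivAt_id y).add_const δ
  have h2 := (h1.mul (h1.log h0)).sub h1
  convert! h2 using 1
  field_simp; ring

/-- The chain rule for `ψ` along an absolutely continuous function that may touch the singularity of
`ψ' = log` at zero, provided that the resulting derivative is integrable. -/
theorem integral_deriv_mul_log {y : ℝ → ℝ} {a b : ℝ} (hab : a ≤ b)
    (hy : AbsolutelyContinuousOnInterval y a b) (h0 : ∀ t ∈ Icc a b, 0 ≤ y t)
    (hpos : ∀ᵐ t ∂volume.restrict (Icc a b), 0 < y t)
    (hint : IntervalIntegrable (fun t => deriv y t * log (y t)) volume a b) :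
    ∫ t in a..b, deriv y t * log (y t) = ψ (y b) - ψ (y a) := by
  have huIcc : uIcc a b = Icc a b := uIcc_of_le hab
  obtain ⟨M, hM⟩ := hy.exists_bound
  rw [huIcc] at hM
  have hmap : MapsTo y (uIcc a b) (Icc 0 M) := by
    rw [huIcc]; exact fun t ht => ⟨h0 t ht, (le_abs_self _).trans (hM t ht)⟩
  -- the regularised entropies have bounded derivatives on the range of `y`
  have hreg : ∀ δ : ℝ, 0 < δ → ∫ t in a..b, deriv y t * log (y t + δ)
      = ((y b + δ) * log (y b + δ) - (y b + δ)) - ((y a + δ) * log (y a + δ) - (y a + δ)) := by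
    intro δ hδ
    obtain ⟨K, hK⟩ :
        ∃ K : ℝ≥0, LipschitzOnWith K (fun y => (y + δ) * log (y + δ) - (y + δ)) (Icc 0 M) := by
      have h1 : ContDiffOn ℝ 1 (fun y => y + δ) (Icc 0 M) := by fun_prop
      exact ((h1.mul (h1.log fun z hz => by linarith [hz.1])).sub h1).exists_lipschitzOnWith
        one_ne_zero (convex_Icc 0 M) isCompact_Icc
    rw [← (absolutelyContinuousOnInterval_comp hK hy hmap).integral_deriv_eq_sub]
    refine intervalIntegral.integral_congr_ae ?_
    filter_upwards [hy.ae_differentiableAt] with t ht hmem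
    have hmem' : t ∈ uIcc a b := uIoc_subset_uIcc hmem
    have := (hasDerivAt_mul_log_sub (hmap hmem').1 hδ).comp t (ht hmem').hasDerivAt
    rw [show (fun t => (y t + δ) * log (y t + δ) - (y t + δ))
      = (fun y => (y + δ) * log (y + δ) - (y + δ)) ∘ y from rfl, this.deriv, mul_comm]
  have hδ : Tendsto (fun k : ℕ => 1 / ((k : ℝ) + 1)) atTop (𝓝 0) := tendsto_one_div_add_atTop_nhds_zero_nat
  have hδpos : ∀ k : ℕ, 0 < 1 / ((k : ℝ) + 1) := fun k => by positivity
  have hδle : ∀ k : ℕ, 1 / ((k : ℝ) + 1) ≤ 1 := fun k => by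
    rw [div_le_one (by positivity)]; linarith
  have hrestr : volume.restrict (uIoc a b) ≤ volume.restrict (Icc a b) := by
    rw [uIoc_of_le hab]; exact Measure.restrict_mono Ioc_subset_Icc_self le_rfl
  have hmeas : AEStronglyMeasurable y (volume.restrict (uIoc a b)) :=
    (hy.continuousOn.mono uIoc_subset_uIcc).aestronglyMeasurable measurableSet_uIoc
  have hderiv : AEStronglyMeasurable (deriv y) (volume.restrict (uIoc a b)) :=
    (measurable_deriv y).aestronglyMeasurable
  have h1 : Tendsto (fun k : ℕ => ∫ t in a..b, deriv y t * log (y t + 1 / ((k : ℝ) + 1))) atTop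
      (𝓝 (∫ t in a..b, deriv y t * log (y t))) := by
    refine intervalIntegral.tendsto_integral_filter_of_dominated_convergence
      (fun t => |deriv y t * log (y t)| + |log (M + 1)| * |deriv y t|) ?_ ?_ ?_ ?_
    · refine Eventually.of_forall fun k => hderiv.mul ?_
      exact (measurable_log.comp_aemeasurable (hmeas.aemeasurable.add_const _)).aestronglyMeasurable
    · refine Eventually.of_forall fun k => ?_
      rw [← ae_restrict_iff' measurableSet_uIoc]
      filter_upwards [ae_mono hrestr hpos, ae_restrict_mem measurableSet_uIoc] with t ht hmem
      have hyM := (hmap (uIoc_subset_uIcc hmem)).2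
      have e4 : |log (y t + 1 / ((k : ℝ) + 1))| ≤ |log (y t)| + |log (M + 1)| :=
        (abs_le_max_abs_abs (log_le_log ht (by grind)) (log_le_log (by positivity)
        (by grind))).trans (max_le_add_of_nonneg (abs_nonneg _) (abs_nonneg _))
      rw [norm_eq_abs, abs_mul, abs_mul]
      nlinarith [abs_nonneg (deriv y t)]
    · exact hint.abs.add (hy.intervalIntegrable_deriv.abs.const_mul _)
    · rw [← ae_restrict_iff' measurableSet_uIoc]
      filter_upwards [ae_mono hrestr hpos] with t ht
      refine Tendsto.const_mul _ ((Real.continuousAt_log ht.ne').tendsto.comp ?_)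
      simpa using hδ.const_add (y t)
  have h2 : ∀ z : ℝ, Tendsto (fun k : ℕ => (z + 1 / ((k : ℝ) + 1)) * log (z + 1 / ((k : ℝ) + 1))
      - (z + 1 / ((k : ℝ) + 1))) atTop (𝓝 (z * log z - z)) := by
    intro z
    have h3 : Tendsto (fun k : ℕ => z + 1 / ((k : ℝ) + 1)) atTop (𝓝 z) := by
      simpa using hδ.const_add z
    exact ((Real.continuous_mul_log.tendsto z).comp h3).sub h3
  have h3 := (h2 (y b)).sub (h2 (y a))
  have h4 := tendsto_nhds_unique (h1.congr fun k => hreg _ (hδpos k)) h3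
  rw [h4]; unfold ψ; ring

/-- An absolutely continuous function with weak derivative `h` has derivative `h` almost
everywhere. -/
theorem deriv_ae_eq_of_weak {y h : ℝ → ℝ} {T : ℝ} (hT : 0 < T)
    (hy : AbsolutelyContinuousOnInterval y 0 T) (hh : IntervalIntegrable h volume 0 T)
    (hw : ∀ η : ℝ → ℝ, ContDiff ℝ 1 η → HasCompactSupport η → tsupport η ⊆ Ioo 0 T →
    ∫ t in (0 : ℝ)..T, (deriv η t * y t + η t * h t) = 0) : ∀ᵐ t ∂vol[T], deriv y t = h t := by
  have hd := hy.intervalIntegrable_deriv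
  have hloc : LocallyIntegrableOn (fun t => h t - deriv y t) (Ioo 0 T) volume := by
    refine IntegrableOn.locallyIntegrableOn ?_
    exact (intervalIntegrable_iff_integrableOn_Ioo_of_le hT.le).1 (hh.sub hd)
  have key := isOpen_Ioo.ae_eq_zero_of_integral_contDiff_smul_eq_zero hloc fun η hη hcs hsupp => by
    have hη1 : ContDiff ℝ 1 η := hη.of_le (by simp)
    have hηac : AbsolutelyContinuousOnInterval η 0 T := hη1.contDiffOn.absolutelyContinuousOnInterval
    have h0 : η 0 = 0 := image_eq_zero_of_notMem_tsupport fun h => (hsupp h).1.false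
    have hT0 : η T = 0 := image_eq_zero_of_notMem_tsupport fun h => (hsupp h).2.false
    have e1 := hηac.integral_deriv_mul_eq_sub hy
    rw [h0, hT0] at e1
    have e2 := hw η hη1 hcs hsupp
    have i1 : IntervalIntegrable (fun t => deriv η t * y t) volume 0 T :=
      hηac.intervalIntegrable_deriv.mul_continuousOn hy.continuousOn
    have i2 : IntervalIntegrable (fun t => η t * deriv y t) volume 0 T :=
      hd.continuousOn_mul hη1.continuous.continuousOn
    have i3 : IntervalIntegrable (fun t => η t * h t) volume 0 T :=
      hh.continuousOn_mul hη1.continuous.continuousOn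
    rw [intervalIntegral.integral_add i1 i2] at e1
    rw [intervalIntegral.integral_add i1 i3] at e2
    have e3 : ∫ t in (0 : ℝ)..T, η t * (h t - deriv y t) = 0 := by
      simp only [mul_sub]
      rw [intervalIntegral.integral_sub i3 i2]; linarith
    rw [intervalIntegral.integral_of_le hT.le, integral_Ioc_eq_integral_Ioo] at e3
    rw [← e3, ← integral_indicator measurableSet_Ioo]
    refine integral_congr_ae (Eventually.of_forall fun t => ?_)
    by_cases ht : t ∈ Ioo 0 T
    · simp [indicator_of_mem ht]
    · have : η t = 0 := image_eq_zero_of_notMem_tsupport fun h => ht (hsupp h)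
      simp [indicator_of_notMem ht, this]
  rw [restrict_Ioo_eq_restrict_Icc.symm, ae_restrict_iff' measurableSet_Ioo]
  grind

/-! ### The chain rule for the microscopic free energy -/

section Curve

variable {p : Rates} {ρ₀ T ε : ℝ} {n : ℝ → ℕ → ℝ} {w : ℝ → ℝ → ℝ}

/-- The discrete gradient along a rescaled curve. -/
noncomputable def grad (p : Rates) (ε : ℝ) (w : ℝ → ℝ → ℝ) (t : ℝ) : ℕ → ℝ := unscale p ε (w t)

namespace IsRescaledCurve

section

variable (hc : IsRescaledCurve p ρ₀ T ε n w) (hT : 0 < T)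
include hc hT

theorem aemeasurable_comp {l : ℕ} (hl : 1 ≤ l) : AEMeasurable (fun t => n t l) vol[T] := by
  have := (hc.absolutelyContinuous l hl).continuousOn
  rw [uIcc_of_le hT.le] at this
  exact this.aemeasurable measurableSet_Icc

theorem aemeasurable_dens {l : ℕ} (hl : 1 ≤ l) : AEMeasurable (fun t => dens p (n t) l) vol[T] :=
  (hc.aemeasurable_comp hT hl).div_const _

theorem aemeasurable_nHat {l : ℕ} (hl : 1 ≤ l) : AEMeasurable (fun t => nHat p (n t) l) vol[T] := by
  simp only [nHat_eq]
  exact measurable_logMean.comp_aemeasurable (((hc.aemeasurable_dens hT le_rfl).mul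
    (hc.aemeasurable_dens hT hl)).prodMk (hc.aemeasurable_dens hT (by omega)))

theorem aemeasurable_mob {l : ℕ} (hl : 1 ≤ l) : AEMeasurable (fun t => mob p (n t) l) vol[T] :=
  (hc.aemeasurable_nHat hT hl).const_mul _

theorem aemeasurable_log {l : ℕ} (hl : 1 ≤ l) :
    AEMeasurable (fun t => log (dens p (n t) l)) vol[T] :=
  measurable_log.comp_aemeasurable (hc.aemeasurable_dens hT hl)

theorem aemeasurable_force {l : ℕ} (hl : 1 ≤ l) : AEMeasurable (fun t => force p (n t) l) vol[T] :=
  ((hc.aemeasurable_log hT le_rfl).add (hc.aemeasurable_log hT hl)).sub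
    (hc.aemeasurable_log hT (by omega))

omit hT in
theorem aemeasurable_grad {l : ℕ} (hl : 1 ≤ l) : AEMeasurable (fun t => grad p ε w t l) vol[T] :=
  (hc.measurable l hl).const_mul _

theorem aemeasurable_flux {l : ℕ} (hl : 1 ≤ l) :
    AEMeasurable (fun t => mob p (n t) l * grad p ε w t l) vol[T] :=
  (hc.aemeasurable_mob hT hl).mul (hc.aemeasurable_grad hl)

theorem aemeasurable_dominator {l : ℕ} (hl : 1 ≤ l) :
    AEMeasurable (fun t => dominator p (n t) (grad p ε w t) l) vol[T] := by
  have h1 := hc.aemeasurable_mob hT hl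
  have h2 := hc.aemeasurable_grad hl
  have h3 := hc.aemeasurable_force hT hl
  have h4 := hc.aemeasurable_comp hT hl
  exact ((((h1.mul (h2.pow_const 2)).add (h1.mul (h3.pow_const 2))).add h1).add_const _).add
    (h4.const_mul _)

theorem aemeasurable_action : AEMeasurable (fun t => action p (n t) (grad p ε w t)) vol[T] := by
  refine AEMeasurable.tsum fun i => measurable_ofReal.comp_aemeasurable ?_
  exact (hc.aemeasurable_mob hT (by omega)).mul ((hc.aemeasurable_grad (by omega)).pow_const 2)

theorem aemeasurable_dissipation : AEMeasurable (fun t => dissipation p (n t)) vol[T] := by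
  have hm : Measurable fun z : ℝ × ℝ => entropyProduction z.1 z.2 := by
    unfold entropyProduction
    refine Measurable.ite ?_ ?_ (Measurable.ite ?_ measurable_const measurable_const)
    · exact (measurableSet_lt measurable_const measurable_fst).inter
        (measurableSet_lt measurable_const measurable_snd)
    · fun_prop
    · exact measurableSet_eq_fun measurable_fst measurable_snd
  refine AEMeasurable.tsum fun i => hm.comp_aemeasurable (AEMeasurable.prodMk ?_ ?_)
  · exact ((hc.aemeasurable_comp hT le_rfl).const_mul _).mul (hc.aemeasurable_comp hT (by omega))
  · exact (hc.aemeasurable_comp hT (by omega)).const_mul _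

omit hc hT in
theorem scale_ne_zero (p : Rates) (hε : 0 < ε) : ofReal (p.zs / ε ^ (1 - p.α + 2 * p.γ)) ≠ 0 := by
  have := p.zs_pos
  positivity

omit hT in
theorem lintegral_action_lt_top (hε : 0 < ε) :
    ∫⁻ t in Icc 0 T, action p (n t) (grad p ε w t) < ⊤ := by
  have h := hc.action_finite
  unfold actionε at h
  rw [lintegral_const_mul' _ _ ofReal_ne_top] at h
  exact (ENNReal.mul_lt_top_iff.1 h).elim (fun h => h.2)
    (fun h => h.elim (fun h => absurd h (scale_ne_zero p hε)) fun h => by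
      unfold grad; grind)

omit hT in
theorem lintegral_dissipation_lt_top (hε : 0 < ε) : ∫⁻ t in Icc 0 T, dissipation p (n t) < ⊤ := by
  have h := hc.dissipation_finite
  unfold dissipationε at h
  rw [lintegral_const_mul' _ _ ofReal_ne_top] at h
  exact (ENNReal.mul_lt_top_iff.1 h).elim (fun h => h.2)
    (fun h => h.elim (fun h => absurd h (scale_ne_zero p hε)) fun h => by grind)

/-- Almost everywhere in time, all components are positive. -/
theorem ae_pos (hε : 0 < ε) (hρ₀ : 0 < ρ₀) : ∀ᵐ t ∂vol[T], ∀ l, 1 ≤ l → 0 < n t l := by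
  filter_upwards [ae_lt_top' (hc.aemeasurable_dissipation hT)
    (hc.lintegral_dissipation_lt_top hε).ne, ae_mem_Icc] with t ht hmem
  exact (hc.isState t hmem).pos_of_dissipation_lt_top hρ₀ ht

end

theorem tsum_dominator_le {n g : ℕ → ℝ} (h : IsState ρ₀ n) (hn : ∀ l, 1 ≤ l → 0 < n l) :
    ∑' i : ℕ, ofReal (dominator p n g (i + 1)) ≤ action p n g + dissipation p n
    + ((∑' i : ℕ, ofReal (p.k (i + 1))) + ofReal (2 * (ρ₀ + p.zs + p.q) * ρ₀ + ρ₀)) := by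
  have hρ : 0 ≤ ρ₀ := (h.1 1 le_rfl).trans (h.le le_rfl)
  have hz := p.zs_pos
  have hq := p.q_pos
  have e1 : ∀ i : ℕ, ofReal (dominator p n g (i + 1)) = ofReal (p.k (i + 1) * nHat p n (i + 1)
      * g (i + 1) ^ 2) + ofReal (mob p n (i + 1) * force p n (i + 1) ^ 2)
      + (ofReal (p.k (i + 1)) + ofReal (mob p n (i + 1) + (i + 1 : ℕ) * n (i + 1))) := by
    intro i
    have h1 := mob_nonneg (p := p) (n := n) (l := i + 1) (by omega)
    have h2 := (p.k_pos (l := i + 1) (by omega)).le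
    have h3 := h.1 (i + 1) (by omega)
    rw [← ofReal_add (by positivity) (by positivity), ← ofReal_add (by positivity) (by positivity),
      ← ofReal_add (by positivity) (by positivity)]
    congr 1
    unfold dominator mob; ring
  simp only [e1]
  rw [tsum_add, tsum_add, tsum_add, dissipation_eq hn, action]
  gcongr
  have hs : Summable fun i : ℕ => mob p n (i + 1) + (i + 1 : ℕ) * n (i + 1) :=
    h.summable_mob.add h.2.summable
  rw [← ofReal_tsum_of_nonneg (fun i => ?_) hs]
  · refine ofReal_le_ofReal ?_
    rw [h.summable_mob.tsum_add h.2.summable, h.2.tsum_eq]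
    gcongr
    have h5 := (h.2.summable.add h.summable_succ).mul_left (ρ₀ + p.zs + p.q)
    refine (h.summable_mob.tsum_le_tsum (fun i => h.mob_le (p := p) (l := i + 1) (by omega)) h5).trans ?_
    rw [tsum_mul_left, mul_comm 2, mul_assoc]
    refine mul_le_mul_of_nonneg_left ?_ (by positivity)
    have h6 := h.2.summable.tsum_add h.summable_succ
    have h7 := h.tsum_succ_le
    rw [h.2.tsum_eq] at h6
    linarith
  · have h1 := mob_nonneg (p := p) (n := n) (l := i + 1) (by omega)
    have h3 := h.1 (i + 1) (by omega)
    positivity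

theorem tsum_k_lt_top (p : Rates) : ∑' i : ℕ, ofReal (p.k (i + 1)) < ⊤ := by
  have h1 : Summable fun i : ℕ => p.k (i + 1) := by
    refine Summable.of_nonneg_of_le (fun i => (p.k_pos (by omega)).le) (fun i => ?_)
      (p.hasSum_ρs.summable.mul_left p.zs)
    rw [p.k_eq_a, mul_assoc]
    exact mul_le_mul_of_nonneg_left
      (mul_le_mul_of_nonneg_right (p.a_le (by omega)) (p.ω_pos _).le) p.zs_pos.le
  exact h1.tsum_ofReal_lt_top

section

variable (hc : IsRescaledCurve p ρ₀ T ε n w) (hT : 0 < T) (hε : 0 < ε) (hρ₀ : 0 < ρ₀)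
include hc hT hε hρ₀

theorem tsum_lintegral_dominator_lt_top :
    ∑' i : ℕ, ∫⁻ t in Icc 0 T, ofReal (dominator p (n t) (grad p ε w t) (i + 1)) < ⊤ := by
  rw [← lintegral_tsum fun i => (hc.aemeasurable_dominator hT (by omega)).ennreal_ofReal]
  have h : ∀ᵐ t ∂vol[T], ∑' i : ℕ, ofReal (dominator p (n t) (grad p ε w t) (i + 1))
      ≤ action p (n t) (grad p ε w t) + dissipation p (n t)
      + ((∑' i : ℕ, ofReal (p.k (i + 1))) + ofReal (2 * (ρ₀ + p.zs + p.q) * ρ₀ + ρ₀)) := by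
    filter_upwards [hc.ae_pos hT hε hρ₀, ae_mem_Icc] with t ht hmem
    exact tsum_dominator_le (hc.isState t hmem) ht
  refine (lintegral_mono_ae h).trans_lt ?_
  rw [lintegral_add_right _ measurable_const, lintegral_add_left' (hc.aemeasurable_action hT),
    lintegral_const]
  simp only [Measure.restrict_apply MeasurableSet.univ, univ_inter, Real.volume_Icc]
  exact add_lt_top.2 ⟨add_lt_top.2 ⟨hc.lintegral_action_lt_top hε, hc.lintegral_dissipation_lt_top
    hε⟩, mul_lt_top (add_lt_top.2 ⟨tsum_k_lt_top p, ofReal_lt_top⟩) ofReal_lt_top⟩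

theorem ae_summable_dominator :
    ∀ᵐ t ∂vol[T], Summable fun i : ℕ => dominator p (n t) (grad p ε w t) (i + 1) := by
  have h := hc.tsum_lintegral_dominator_lt_top hT hε hρ₀
  rw [← lintegral_tsum fun i => (hc.aemeasurable_dominator hT (by omega)).ennreal_ofReal] at h
  filter_upwards [ae_lt_top' (AEMeasurable.tsum fun i =>
    (hc.aemeasurable_dominator hT (by omega)).ennreal_ofReal) h.ne,
    ae_mem_Icc] with t ht hmem
  have := ENNReal.summable_toReal ht.ne
  refine this.congr fun i => ?_
  rw [toReal_ofReal (dominator_nonneg (hc.isState t hmem) _ (by omega))]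

/-- The flux through the reaction `l`, in rescaled time. -/
noncomputable def rflux (p : Rates) (ε : ℝ) (n : ℝ → ℕ → ℝ) (w : ℝ → ℝ → ℝ) (l : ℕ) (t : ℝ) : ℝ :=
  1 / ε ^ (1 - p.α + p.γ) * (mob p (n t) l * grad p ε w t l)

omit hc hT hε hρ₀ in
theorem onsagerε_succ_succ (p : Rates) (ε : ℝ) (n : ℝ → ℕ → ℝ) (w : ℝ → ℝ → ℝ) (l : ℕ) (t : ℝ) :
    onsagerε p ε (n t) (w t) (l + 2) = rflux p ε n w (l + 1) t - rflux p ε n w (l + 2) t := by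
  unfold onsagerε onsager rflux
  rw [tsum_eq_sum (s := {l, l + 1}) ?_, Finset.sum_pair (by omega)]
  · simp only [reaction, mob, grad]
    simp
    ring
  · intro i hi
    simp only [Finset.mem_insert, Finset.mem_singleton, not_or] at hi
    have h1 : ¬ (l + 2 = i + 1) := by omega
    have h2 : ¬ (l + 2 = i + 1 + 1) := by omega
    simp only [reaction, h1, h2, if_false]
    simp

omit hc hT hε hρ₀ in
theorem onsagerε_one (p : Rates) (ε : ℝ) {n : ℝ → ℕ → ℝ} {w : ℝ → ℝ → ℝ} {t : ℝ}
    (hs : Summable fun i : ℕ => rflux p ε n w (i + 1) t) (hε : 0 < ε) :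
    onsagerε p ε (n t) (w t) 1 = -(∑' i, rflux p ε n w (i + 1) t) - rflux p ε n w 1 t := by
  have h0 : (1 / ε ^ (1 - p.α + p.γ)) ≠ 0 := by positivity
  have hs' : Summable fun i : ℕ => mob p (n t) (i + 1) * grad p ε w t (i + 1) :=
    (summable_mul_left_iff h0).1 hs
  have e : onsager p (n t) (unscale p ε (w t)) 1 = ∑' i : ℕ, (-(mob p (n t) (i + 1) * grad p ε w t
      (i + 1)) + if i = 0 then -(mob p (n t) 1 * grad p ε w t 1) else 0) := by
    refine tsum_congr fun i => ?_
    rcases Nat.eq_zero_or_pos i with rfl | hi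
    · simp [reaction, mob, grad]; ring
    · have h1 : ¬ (1 = i + 1) := by omega
      have h2 : ¬ (1 = i + 1 + 1) := by omega
      simp [reaction, mob, grad, hi.ne']
  unfold onsagerε
  rw [e,
    (hs'.neg).tsum_add (summable_of_hasFiniteSupport ((Set.finite_singleton 0).subset fun i hi => by
      by_contra h; simp at h; simp [h] at hi)), tsum_neg, tsum_ite_eq]
  simp only [rflux, tsum_mul_left]
  ring

omit hc hT hε hρ₀ in
theorem abs_rflux_le (hε : 0 < ε) {t : ℝ} (h : IsState ρ₀ (n t)) {l : ℕ} (hl : 1 ≤ l) :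
    |rflux p ε n w l t| ≤ 1 / ε ^ (1 - p.α + p.γ) * dominator p (n t) (grad p ε w t) l := by
  rw [rflux, abs_mul, abs_of_nonneg (by positivity)]
  exact mul_le_mul_of_nonneg_left (abs_flux_le_dominator h _ hl) (by positivity)

theorem ae_summable_rflux : ∀ᵐ t ∂vol[T], Summable fun i : ℕ => rflux p ε n w (i + 1) t := by
  filter_upwards [hc.ae_summable_dominator hT hε hρ₀, ae_mem_Icc] with t ht hmem
  refine Summable.of_norm_bounded (ht.mul_left _) fun i =>
    abs_rflux_le hε (hc.isState t hmem) (by omega)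

theorem integrable_dominator {l : ℕ} (hl : 1 ≤ l) :
    Integrable (fun t => dominator p (n t) (grad p ε w t) l) vol[T] := by
  obtain ⟨i, rfl⟩ : ∃ i, l = i + 1 := ⟨l - 1, by omega⟩
  refine (lintegral_ofReal_ne_top_iff_integrable
    (hc.aemeasurable_dominator hT hl).aestronglyMeasurable ?_).1
    ((le_tsum i).trans_lt (hc.tsum_lintegral_dominator_lt_top hT hε hρ₀)).ne
  filter_upwards [ae_mem_Icc] with t hmem
  exact dominator_nonneg (hc.isState t hmem) _ hl

theorem integrable_tsum_dominator :
    Integrable (fun t => ∑' i : ℕ, dominator p (n t) (grad p ε w t) (i + 1)) vol[T] := by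
  have h := hc.tsum_lintegral_dominator_lt_top hT hε hρ₀
  have hm : AEMeasurable (fun t => ∑' i : ℕ, ofReal (dominator p (n t) (grad p ε w t) (i + 1)))
    vol[T] := AEMeasurable.tsum fun i => (hc.aemeasurable_dominator hT (by omega)).ennreal_ofReal
  rw [← lintegral_tsum fun i => (hc.aemeasurable_dominator hT (by omega)).ennreal_ofReal] at h
  refine (integrable_toReal_of_lintegral_ne_top hm h.ne).congr ?_
  filter_upwards [hc.ae_summable_dominator hT hε hρ₀, ae_mem_Icc] with t ht hmem
  rw [← ofReal_tsum_of_nonneg (fun i => dominator_nonneg (hc.isState t hmem) _ (by omega)) ht,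
    toReal_ofReal (tsum_nonneg fun i => dominator_nonneg (hc.isState t hmem) _ (by omega))]

omit hε hρ₀ in
theorem aemeasurable_rflux {l : ℕ} (hl : 1 ≤ l) : AEMeasurable (rflux p ε n w l) vol[T] :=
  (hc.aemeasurable_flux hT hl).const_mul _

theorem integrable_rflux {l : ℕ} (hl : 1 ≤ l) : Integrable (rflux p ε n w l) vol[T] := by
  refine ((hc.integrable_dominator hT hε hρ₀ hl).const_mul (1 / ε ^ (1 - p.α + p.γ))).mono'
    (hc.aemeasurable_rflux hT hl).aestronglyMeasurable ?_
  filter_upwards [ae_mem_Icc] with t hmem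
  exact abs_rflux_le hε (hc.isState t hmem) hl

theorem aemeasurable_tsum_rflux :
    AEMeasurable (fun t => ∑' i : ℕ, rflux p ε n w (i + 1) t) vol[T] := by
  refine aemeasurable_of_tendsto_metrizable_ae'
    (f := fun N t => ∑ i ∈ Finset.range N, rflux p ε n w (i + 1) t) (fun N => ?_) ?_
  · exact Finset.aemeasurable_fun_sum _ fun i _ => hc.aemeasurable_rflux hT (by omega)
  · filter_upwards [hc.ae_summable_rflux hT hε hρ₀] with t ht
    exact ht.hasSum.tendsto_sum_nat

theorem integrable_tsum_rflux : Integrable (fun t => ∑' i : ℕ, rflux p ε n w (i + 1) t) vol[T] := by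
  refine ((hc.integrable_tsum_dominator hT hε hρ₀).const_mul (1 / ε ^ (1 - p.α + p.γ))).mono'
    (hc.aemeasurable_tsum_rflux hT hε hρ₀).aestronglyMeasurable ?_
  filter_upwards [hc.ae_summable_dominator hT hε hρ₀, ae_mem_Icc] with t ht hmem
  rw [← tsum_mul_left]
  exact tsum_of_norm_bounded (ht.mul_left _).hasSum fun i =>
    abs_rflux_le hε (hc.isState t hmem) (by omega)

omit hc hT hε hρ₀ in
theorem intervalIntegrable_of_Icc (hT : 0 < T) {f : ℝ → ℝ} (hf : Integrable f vol[T]) :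
    IntervalIntegrable f volume 0 T :=
  (intervalIntegrable_iff_integrableOn_Icc_of_le hT.le).2 hf

theorem ae_deriv_succ_succ (l : ℕ) : ∀ᵐ t ∂vol[T], deriv (fun t => n t (l + 2)) t
    = rflux p ε n w (l + 1) t - rflux p ε n w (l + 2) t := by
  refine deriv_ae_eq_of_weak hT (hc.absolutelyContinuous _ (by omega))
    (intervalIntegrable_of_Icc hT ((hc.integrable_rflux hT hε hρ₀ (by omega)).sub
    (hc.integrable_rflux hT hε hρ₀ (by omega)))) fun η h1 h2 h3 => ?_
  have := hc.continuityEq η h1 h2 h3 (l + 2) (by omega)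
  simpa only [onsagerε_succ_succ] using this

theorem ae_deriv_one : ∀ᵐ t ∂vol[T], deriv (fun t => n t 1) t
    = -(∑' i, rflux p ε n w (i + 1) t) - rflux p ε n w 1 t := by
  refine deriv_ae_eq_of_weak hT (hc.absolutelyContinuous _ le_rfl)
    (intervalIntegrable_of_Icc hT ((hc.integrable_tsum_rflux hT hε hρ₀).neg.sub
    (hc.integrable_rflux hT hε hρ₀ le_rfl))) fun η h1 h2 h3 => ?_
  refine Eq.trans ?_ (hc.continuityEq η h1 h2 h3 1 le_rfl)
  refine intervalIntegral.integral_congr_ae ?_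
  rw [uIoc_of_le hT.le, ← ae_restrict_iff' measurableSet_Ioc]
  filter_upwards [ae_mono (Measure.restrict_mono Ioc_subset_Icc_self le_rfl)
    (hc.ae_summable_rflux hT hε hρ₀)] with t ht
  rw [onsagerε_one p ε ht hε]

end

end IsRescaledCurve

end Curve

/-- The terms of a convergent series are frequently small compared with the harmonic series. -/
theorem frequently_succ_mul_le {r : ℕ → ℝ≥0∞} (hr : ∑' i, r i ≠ ⊤) {δ : ℝ} (hδ : 0 < δ) :
    ∃ᶠ N : ℕ in atTop, ((N + 1 : ℕ) : ℝ≥0∞) * r N ≤ ofReal δ := by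
  by_contra h
  rw [not_frequently] at h
  have hfin : ∀ i, r i ≠ ⊤ := fun i => ne_top_of_le_ne_top hr (le_tsum i)
  have hs : Summable fun i => (r i).toReal := ENNReal.summable_toReal hr
  have h1 : Summable fun i : ℕ => δ * (1 / ((i : ℝ) + 1)) := by
    refine summable_of_isBigO_nat hs (Asymptotics.IsBigO.of_bound 1 ?_)
    filter_upwards [h] with N hN
    rw [not_le] at hN
    have h2 :=
      (ENNReal.toReal_lt_toReal ofReal_ne_top (mul_ne_top (ENNReal.natCast_ne_top _) (hfin N))).2 hN
    rw [toReal_ofReal hδ.le, toReal_mul, ENNReal.toReal_natCast] at h2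
    rw [Real.norm_of_nonneg (by positivity), Real.norm_of_nonneg toReal_nonneg, one_mul,
      mul_one_div, div_le_iff₀ (by positivity)]
    grind
  rw [summable_mul_left_iff hδ.ne'] at h1
  exact Real.not_summable_one_div_natCast ((summable_nat_add_iff 1).1 (by simpa using h1))

/-- The rate of change of the free energy, `∑_l k^l n̂_l |∇_l φ| |force_l|`, without signs. -/
noncomputable def crossTerm (p : Rates) (n g : ℕ → ℝ) : ℝ≥0∞ :=
  ∑' i : ℕ, ofReal (|mob p n (i + 1) * g (i + 1)| * |force p n (i + 1)|)

namespace IsRescaledCurve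

variable {p : Rates} {ρ₀ T ε : ℝ} {n : ℝ → ℕ → ℝ} {w : ℝ → ℝ → ℝ}

section

variable (hc : IsRescaledCurve p ρ₀ T ε n w) (hT : 0 < T) (hε : 0 < ε) (hρ₀ : 0 < ρ₀)
include hc hT hε hρ₀

theorem ae_bounds :
    ∃ C : ℝ, 0 ≤ C ∧ ∀ᵐ t ∂vol[T], ∀ l, 1 ≤ l → |rflux p ε n w l t| * |force p (n t) l|
    ≤ C * dominator p (n t) (grad p ε w t) l ∧ |rflux p ε n w l t| * |log (dens p (n t) 1)|
    ≤ C * dominator p (n t) (grad p ε w t) l ∧ |rflux p ε n w l t| * |log (dens p (n t) l)|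
    ≤ C * (l * dominator p (n t) (grad p ε w t) l) := by
  obtain ⟨C₁, hC₁, h1⟩ := exists_abs_flux_mul_log_one_le p ρ₀
  obtain ⟨C₂, hC₂, h2⟩ := exists_abs_flux_mul_log_le p ρ₀
  set c := 1 / ε ^ (1 - p.α + p.γ) with hc0
  have hcpos : 0 < c := by positivity
  refine ⟨c * (1 + C₁ + C₂), by positivity, ?_⟩
  filter_upwards [hc.ae_pos hT hε hρ₀, ae_mem_Icc] with t ht hmem l hl
  have hst := hc.isState t hmem
  have hd := dominator_nonneg (p := p) hst (grad p ε w t) hl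
  rw [rflux, abs_mul, abs_of_pos hcpos, mul_assoc, mul_assoc, mul_assoc, mul_assoc, mul_assoc]
  have hd' := mul_nonneg l.cast_nonneg hd
  refine ⟨?_, ?_, ?_⟩ <;> refine mul_le_mul_of_nonneg_left ?_ hcpos.le
  · nlinarith [abs_flux_mul_force_le_dominator (p := p) hst (grad p ε w t) hl]
  · nlinarith [h1 (n t) (grad p ε w t) hst ht l hl]
  · nlinarith [h2 (n t) (grad p ε w t) hst ht l hl]

omit hT hε hρ₀ in
theorem freeEnergy_lt_top (hε : 0 < ε) {t : ℝ} (ht : t ∈ Icc 0 T) : freeEnergy p (n t) < ⊤ := by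
  have h : freeEnergyε p ε (n t) < ⊤ := (le_iSup₂
    (f := fun t (_ : t ∈ Icc 0 T) => freeEnergyε p ε (n t)) t ht).trans_lt hc.energy_bounded
  have := p.zs_pos
  have h0 : ofReal (p.zs / ε ^ p.γ) ≠ 0 := by positivity
  rw [lt_top_iff_ne_top]
  intro htop
  rw [freeEnergyε, htop, mul_top h0] at h
  exact h.false

omit hc hT hε hρ₀ in
theorem tendsto_freeEnergy_partial (h : IsState ρ₀ (n 0)) (hF : freeEnergy p (n 0) < ⊤) :
    Tendsto (fun N => ∑ i ∈ Finset.range N, p.ω (i + 1) * ψ (dens p (n 0) (i + 1))) atTop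
    (𝓝 (freeEnergy p (n 0)).toReal) := by
  have h1 := (tendsto_toReal hF.ne).comp
    (ENNReal.tendsto_nat_tsum fun i : ℕ => ofReal (p.ω (i + 1) * ψ (dens p (n 0) (i + 1))))
  refine h1.congr fun N => ?_
  have hnn : ∀ i : ℕ, 0 ≤ p.ω (i + 1) * ψ (dens p (n 0) (i + 1)) := fun i =>
    mul_nonneg (p.ω_pos _).le (ψ_nonneg (h.dens_nonneg (by omega)))
  simp only [Function.comp]
  rw [← ofReal_sum_of_nonneg fun i _ => hnn i, toReal_ofReal (sum_nonneg fun i _ => hnn i)]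

theorem integrable_deriv_mul_log {l : ℕ} (hl : 1 ≤ l) :
    Integrable (fun t => deriv (fun t => n t l) t * log (dens p (n t) l)) vol[T] := by
  obtain ⟨C, hC0, hC⟩ := hc.ae_bounds hT hε hρ₀
  have hmeas :
      AEStronglyMeasurable (fun t => deriv (fun t => n t l) t * log (dens p (n t) l)) vol[T] :=
      ((measurable_deriv _).aemeasurable.mul (hc.aemeasurable_log hT hl)).aestronglyMeasurable
  obtain ⟨m, rfl | rfl⟩ : ∃ m, l = 1 ∨ l = m + 2 := ⟨l - 2, by omega⟩
  · refine ((hc.integrable_tsum_dominator hT hε hρ₀).const_mul (2 * C)).mono' hmeas ?_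
    filter_upwards [hc.ae_deriv_one hT hε hρ₀, hC, hc.ae_summable_dominator hT hε hρ₀,
      hc.ae_summable_rflux hT hε hρ₀, ae_mem_Icc] with t h1 h2 h3 h4 hmem
    have hst := hc.isState t hmem
    have e1 : |∑' i, rflux p ε n w (i + 1) t| * |log (dens p (n t) 1)|
        ≤ C * ∑' i : ℕ, dominator p (n t) (grad p ε w t) (i + 1) := by
      rw [← abs_mul, ← tsum_mul_right, ← tsum_mul_left, ← norm_eq_abs]
      refine tsum_of_norm_bounded (h3.mul_left C).hasSum fun i => ?_
      rw [norm_eq_abs, abs_mul]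
      grind
    have e2 : |rflux p ε n w 1 t| * |log (dens p (n t) 1)|
        ≤ C * ∑' i : ℕ, dominator p (n t) (grad p ε w t) (i + 1) := ((h2 1 le_rfl).2.1).trans
        (mul_le_mul_of_nonneg_left (h3.le_tsum 0 fun j _ => dominator_nonneg hst _ (by omega)) hC0)
    rw [h1, norm_eq_abs, abs_mul]
    have e3 : |-(∑' i, rflux p ε n w (i + 1) t) - rflux p ε n w 1 t|
        ≤ |∑' i, rflux p ε n w (i + 1) t| + |rflux p ε n w 1 t| := by grind
    nlinarith [mul_le_mul_of_nonneg_right e3 (abs_nonneg (log (dens p (n t) 1)))]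
  · refine (((hc.integrable_dominator hT hε hρ₀ (l := m + 1) (by omega)).const_mul
      (C * (m + 3))).add ((hc.integrable_dominator hT hε hρ₀ (l := m + 2) (by omega)).const_mul
      (C * (m + 2)))).mono' hmeas ?_
    filter_upwards [hc.ae_deriv_succ_succ hT hε hρ₀ m, hC] with t h1 h2
    obtain ⟨a1, a2, a3⟩ := h2 (m + 1) (by omega)
    obtain ⟨-, -, b3⟩ := h2 (m + 2) (by omega)
    rw [h1, norm_eq_abs, abs_mul]
    have e3 := abs_sub (rflux p ε n w (m + 1) t) (rflux p ε n w (m + 2) t)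
    -- the logarithm of the next density is a combination of the force and the other two logarithms
    have e4 : |log (dens p (n t) (m + 2))|
        ≤ |log (dens p (n t) 1)| + |log (dens p (n t) (m + 1))| + |force p (n t) (m + 1)| := by
      have : log (dens p (n t) (m + 2))
          = log (dens p (n t) 1) + log (dens p (n t) (m + 1)) - force p (n t) (m + 1) := by
        rw [force]; ring
      grind
    have e5 := mul_le_mul_of_nonneg_left e4 (abs_nonneg (rflux p ε n w (m + 1) t))
    have e6 := mul_le_mul_of_nonneg_right e3 (abs_nonneg (log (dens p (n t) (m + 2))))
    push_cast at a3 b3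
    simp only [Pi.add_apply]
    linarith

omit hc hT hε hρ₀ in
theorem sum_deriv_mul_log (N : ℕ) {t : ℝ} {d : ℕ → ℝ} {tot : ℝ}
    (h1 : d 1 = -tot - rflux p ε n w 1 t)
    (h2 : ∀ m : ℕ, d (m + 2) = rflux p ε n w (m + 1) t - rflux p ε n w (m + 2) t) :
    ∑ i ∈ Finset.range (N + 1), d (i + 1) * log (dens p (n t) (i + 1))
    = -(∑ i ∈ Finset.range N, rflux p ε n w (i + 1) t * force p (n t) (i + 1))
    - rflux p ε n w (N + 1) t * log (dens p (n t) (N + 1))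
    - (tot - ∑ i ∈ Finset.range N, rflux p ε n w (i + 1) t) * log (dens p (n t) 1) := by
  induction N with
  | zero => simp [h1]; ring
  | succ N ih =>
    rw [sum_range_succ, ih, sum_range_succ, sum_range_succ, h2]
    simp only [force]; ring

theorem freeEnergy_partial_sub {a b : ℝ} (ha : 0 ≤ a) (hab : a ≤ b) (hb : b ≤ T) {l : ℕ}
    (hl : 1 ≤ l) : ∫ t in a..b, deriv (fun t => n t l) t * log (dens p (n t) l)
    = p.ω l * ψ (dens p (n b) l) - p.ω l * ψ (dens p (n a) l) := by
  have hsub : Icc a b ⊆ Icc 0 T := Icc_subset_Icc ha hb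
  have hω := (p.ω_pos l).ne'
  have hac : AbsolutelyContinuousOnInterval (fun t => dens p (n t) l) a b := by
    have h1 := ((hc.absolutelyContinuous l hl).const_mul (p.ω l)⁻¹).mono (c := a) (d := b)
      (by rw [uIcc_of_le hab, uIcc_of_le hT.le]; exact hsub)
    have h2 : (fun t => dens p (n t) l) = fun t => (p.ω l)⁻¹ * n t l := by
      ext t; rw [dens, div_eq_inv_mul]
    rw [h2]; exact h1
  have hd : ∀ t, deriv (fun t => dens p (n t) l) t = deriv (fun t => n t l) t / p.ω l := by
    intro t; simp only [dens]; simp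
  have hint : IntervalIntegrable (fun t => deriv (fun t => n t l) t * log (dens p (n t) l))
      volume a b := (intervalIntegrable_iff_integrableOn_Icc_of_le hab).2
    ((hc.integrable_deriv_mul_log hT hε hρ₀ hl).mono_measure (Measure.restrict_mono hsub le_rfl))
  have key := integral_deriv_mul_log hab hac (fun t ht => (hc.isState t (hsub ht)).dens_nonneg hl)
    (by filter_upwards [ae_mono (Measure.restrict_mono hsub le_rfl) (hc.ae_pos hT hε hρ₀)] with t ht
        exact dens_pos ht hl)
    (by refine (hint.const_mul (p.ω l)⁻¹).congr fun t _ => ?_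
        grind)
  rw [← mul_sub, ← key, ← intervalIntegral.integral_const_mul]
  congr 1; grind

/-- The chain rule in the form of an inequality: the increments of the free energy are controlled by
the fluxes times the forces. -/
theorem freeEnergy_sub_le {a b : ℝ} (ha : 0 ≤ a) (hab : a ≤ b) (hb : b ≤ T) :
    ofReal |(freeEnergy p (n b)).toReal - (freeEnergy p (n a)).toReal|
    ≤ ∫⁻ t in Icc a b, ofReal (1 / ε ^ (1 - p.α + p.γ)) * crossTerm p (n t) (grad p ε w t) := by
  obtain ⟨C, hC0, hC⟩ := hc.ae_bounds hT hε hρ₀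
  have hle := Measure.restrict_mono (Icc_subset_Icc ha hb) (le_refl (volume : Measure ℝ))
  set c := 1 / ε ^ (1 - p.α + p.γ) with hcdef
  have hcpos : 0 < c := by positivity
  set S : ℕ → ℝ → ℝ≥0∞ := fun i t => ofReal (dominator p (n t) (grad p ε w t) (i + 1))
  have hSm : ∀ i, AEMeasurable (S i) vol[T] := fun i =>
    (hc.aemeasurable_dominator hT (by omega)).ennreal_ofReal
  set σ : ℕ → ℝ≥0∞ := fun i => ∫⁻ t in Icc 0 T, S i t
  have hσ : ∑' i, σ i ≠ ⊤ := (hc.tsum_lintegral_dominator_lt_top hT hε hρ₀).ne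
  -- the error made by truncating the sums: the flux between the sizes `N + 1` and `N + 2`, and the
  -- part of the flux of monomers that comes from the larger sizes
  set err : ℕ → ℝ≥0∞ := fun N => ofReal C * (((N + 1 : ℕ) : ℝ≥0∞) * σ N + ∑' i, σ (i + N)) with herr
  set FN : ℕ → ℝ → ℝ := fun N t => ∑ i ∈ Finset.range N, p.ω (i + 1) * ψ (dens p (n t) (i + 1))
  have hbound : ∀ N, ofReal |FN (N + 1) b - FN (N + 1) a|
      ≤ (∫⁻ t in Icc a b, ofReal c * crossTerm p (n t) (grad p ε w t)) + err N := by
    intro N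
    have e1 : FN (N + 1) b - FN (N + 1) a = ∫ t in a..b, ∑ i ∈ Finset.range (N + 1), deriv
        (fun t => n t (i + 1)) t * log (dens p (n t) (i + 1)) := by
      rw [intervalIntegral.integral_finsetSum, ← sum_sub_distrib]
      · refine sum_congr rfl fun i _ => ?_
        rw [hc.freeEnergy_partial_sub hT hε hρ₀ ha hab hb (by omega)]
      · exact fun i _ => (intervalIntegrable_iff_integrableOn_Icc_of_le hab).2
          ((hc.integrable_deriv_mul_log hT hε hρ₀ (by omega)).mono_measure hle)
    rw [e1, ← Real.enorm_eq_ofReal_abs, intervalIntegral.integral_of_le hab,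
      ← integral_Icc_eq_integral_Ioc]
    refine (enorm_integral_le_lintegral_enorm _).trans ?_
    have hall : ∀ᵐ t ∂vol[T], ∀ m : ℕ, deriv (fun t => n t (m + 2)) t = rflux p ε n w (m + 1) t
        - rflux p ε n w (m + 2) t := ae_all_iff.2 fun m => hc.ae_deriv_succ_succ hT hε hρ₀ m
    have hpt : ∀ᵐ t ∂volume.restrict (Icc a b), ‖∑ i ∈ Finset.range (N + 1), deriv (fun t => n t (i
        + 1)) t * log (dens p (n t) (i + 1))‖ₑ ≤ ofReal c * crossTerm p (n t) (grad p ε w t) +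
        ofReal C * (((N + 1 : ℕ) : ℝ≥0∞) * S N t + ∑' i, S (i + N) t) := by
      refine ae_mono hle ?_
      filter_upwards [hc.ae_deriv_one hT hε hρ₀, hall, hC, hc.ae_summable_dominator hT hε hρ₀,
        hc.ae_summable_rflux hT hε hρ₀, ae_mem_Icc] with t h1 h2 h3 h4 h5 hmem
      have hst := hc.isState t hmem
      rw [sum_deriv_mul_log (d := fun l => deriv (fun t => n t l) t) N h1 h2]
      refine (enorm_sub_le).trans ((add_le_add (enorm_sub_le) le_rfl).trans ?_)
      rw [enorm_neg, add_assoc, mul_add]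
      refine add_le_add ?_ (add_le_add ?_ ?_)
      · refine (enorm_sum_le _ _).trans ?_
        refine (sum_le_sum (g := fun i => ofReal c * ofReal (|mob p (n t) (i + 1)
          * grad p ε w t (i + 1)| * |force p (n t) (i + 1)|)) fun i _ => ?_).trans ?_
        · rw [Real.enorm_eq_ofReal_abs, ← ofReal_mul hcpos.le, abs_mul, rflux, abs_mul,
            abs_of_nonneg hcpos.le, mul_assoc]
        · rw [← mul_sum]
          gcongr
          exact sum_le_tsum _
      · rw [Real.enorm_eq_ofReal_abs, abs_mul, ← ENNReal.ofReal_natCast,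
          ← ofReal_mul (by positivity), ← ofReal_mul hC0]
        exact ofReal_le_ofReal (h3 (N + 1) (by omega)).2.2
      · have h7 := (summable_nat_add_iff N).2 h4
        have e2 : (∑' i, rflux p ε n w (i + 1) t) - ∑ i ∈ Finset.range N, rflux p ε n w (i + 1) t
            = ∑' i, rflux p ε n w (i + N + 1) t := by
          rw [← h5.sum_add_tsum_nat_add N]; ring
        rw [e2, ← tsum_mul_right, ← ofReal_tsum_of_nonneg (fun i => dominator_nonneg hst _ (by
          omega)) h7, ← ofReal_mul hC0, Real.enorm_eq_ofReal_abs, ← tsum_mul_left, ← norm_eq_abs]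
        refine ofReal_le_ofReal ?_
        refine tsum_of_norm_bounded (h7.mul_left C).hasSum fun i => ?_
        rw [norm_eq_abs, abs_mul]
        grind
    refine (lintegral_mono_ae hpt).trans ?_
    have m1 := (hSm N).mono_measure hle
    have m2 := fun i => (hSm (i + N)).mono_measure hle
    have m3 : AEMeasurable (fun t => ((N + 1 : ℕ) : ℝ≥0∞) * S N t + ∑' i, S (i + N) t)
      (volume.restrict (Icc a b)) := (m1.const_mul _).add (AEMeasurable.tsum m2)
    rw [lintegral_add_right' _ (m3.const_mul _), lintegral_const_mul'' _ m3,
      lintegral_add_right' _ (AEMeasurable.tsum m2), lintegral_const_mul'' _ m1, lintegral_tsum m2]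
    simp only [herr]
    gcongr <;> exact lintegral_mono' hle le_rfl
  have hfreq : ∀ δ : ℝ, 0 < δ → ∃ᶠ N in atTop, err N ≤ ofReal (2 * (C * δ)) := by
    intro δ hδ
    refine ((frequently_succ_mul_le hσ hδ).and_eventually ((ENNReal.tendsto_sum_nat_add σ
      hσ).eventually (ge_mem_nhds (ofReal_pos.2 hδ)))).mono fun N ⟨g1, g2⟩ => ?_
    rw [show 2 * (C * δ) = C * (δ + δ) by ring, ofReal_mul hC0, ofReal_add hδ.le hδ.le]
    simp only [herr]
    gcongr
  have hlim : Tendsto (fun N => ofReal |FN (N + 1) b - FN (N + 1) a|) atTop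
      (𝓝 (ofReal |(freeEnergy p (n b)).toReal - (freeEnergy p (n a)).toReal|)) := by
    have t := fun s (hs : s ∈ Icc 0 T) => tendsto_freeEnergy_partial (n := fun _ => n s)
      (hc.isState s hs) (hc.freeEnergy_lt_top hε hs)
    exact tendsto_ofReal
      (((t b ⟨ha.trans hab, hb⟩).sub (t a ⟨ha, hab.trans hb⟩)).abs.comp (tendsto_add_atTop_nat 1))
  refine ENNReal.le_of_forall_pos_le_add fun δ hδ _ => ?_
  refine le_of_tendsto_of_frequently hlim ((hfreq (δ / (2 * (C + 1))) (by positivity)).mono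
    fun N hN => (hbound N).trans (add_le_add le_rfl (hN.trans ?_)))
  rw [← ofReal_coe_nnreal]
  refine ofReal_le_ofReal ?_
  rw [show 2 * (C * (δ / (2 * (C + 1)))) = C / (C + 1) * (δ : ℝ) by field_simp]
  exact mul_le_of_le_one_left δ.2 ((div_le_one (by positivity)).2 (by linarith))

end

end IsRescaledCurve

/-! ### The energy-dissipation functional of a rescaled curve -/

theorem two_mul_abs_mul_abs_le {m g f : ℝ} (hm : 0 ≤ m) :
    2 * (|m * g| * |f|) ≤ m * g ^ 2 + m * f ^ 2 := by
  rw [abs_mul, abs_of_nonneg hm, ← sq_abs g, ← sq_abs f]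
  nlinarith [mul_nonneg hm (sq_nonneg (|g| - |f|))]

theorem two_mul_crossTerm_eq (p : Rates) (n g : ℕ → ℝ) : 2 * crossTerm p n g
    = ∑' i : ℕ, ofReal (2 * (|mob p n (i + 1) * g (i + 1)| * |force p n (i + 1)|)) := by
  rw [crossTerm, ← ENNReal.tsum_mul_left]
  simp

theorem action_add_dissipation_eq {p : Rates} {n : ℕ → ℝ} (hn : ∀ l, 1 ≤ l → 0 < n l) (g : ℕ → ℝ) :
    action p n g + dissipation p n = ∑' i : ℕ, ofReal
    (mob p n (i + 1) * g (i + 1) ^ 2 + mob p n (i + 1) * force p n (i + 1) ^ 2) := by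
  rw [dissipation_eq hn, action, ← tsum_add]
  refine tsum_congr fun i => ?_
  have := mob_nonneg (p := p) (n := n) (l := i + 1) (by omega)
  rw [← mob, ofReal_add (by positivity) (by positivity)]

/-- Young's inequality for the rate of change of the free energy. -/
theorem two_mul_crossTerm_le {p : Rates} {n : ℕ → ℝ} (hn : ∀ l, 1 ≤ l → 0 < n l) (g : ℕ → ℝ) :
    2 * crossTerm p n g ≤ action p n g + dissipation p n := by
  rw [two_mul_crossTerm_eq, action_add_dissipation_eq hn]
  exact tsum_le_tsum fun i => ofReal_le_ofReal (two_mul_abs_mul_abs_le (mob_nonneg (by omega)))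

/-- In the case of equality in Young's inequality, action and dissipation agree. -/
theorem action_eq_dissipation {p : Rates} {n : ℕ → ℝ} (hn : ∀ l, 1 ≤ l → 0 < n l) {g : ℕ → ℝ}
    (h : action p n g + dissipation p n ≤ 2 * crossTerm p n g)
    (hfin : action p n g + dissipation p n < ⊤) : action p n g = dissipation p n := by
  rw [dissipation_eq hn, action]
  refine tsum_congr fun i => ?_
  have hm := mob_nonneg (p := p) (n := n) (l := i + 1) (by omega)
  have hle := two_mul_abs_mul_abs_le (g := g (i + 1)) (f := force p n (i + 1)) hm
  have heq : ¬ ofReal (2 * (|mob p n (i + 1) * g (i + 1)| * |force p n (i + 1)|))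
      < ofReal (mob p n (i + 1) * g (i + 1) ^ 2 + mob p n (i + 1) * force p n (i + 1) ^ 2) := by
    intro hlt
    rw [two_mul_crossTerm_eq] at h
    rw [action_add_dissipation_eq hn] at h hfin
    exact (not_lt.2 h) (ENNReal.tsum_lt_tsum (ne_top_of_le_ne_top hfin.ne (tsum_le_tsum fun j =>
      ofReal_le_ofReal (two_mul_abs_mul_abs_le (mob_nonneg (by omega))))) (fun j => ofReal_le_ofReal
      (two_mul_abs_mul_abs_le (mob_nonneg (by omega)))) hlt)
  rw [not_lt, ENNReal.ofReal_le_ofReal_iff (by positivity)] at heq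
  congr 1
  rw [← mob]
  set m := mob p n (i + 1)
  have h1 : m * (|g (i + 1)| - |force p n (i + 1)|) ^ 2 ≤ 0 := by
    rw [abs_mul, abs_of_nonneg hm, ← sq_abs (g (i + 1)), ← sq_abs (force p n (i + 1))] at heq
    nlinarith
  rcases mul_eq_zero.1 (le_antisymm h1 (by positivity)) with h2 | h2
  · rw [h2]; ring
  grind

theorem coe_ennreal_eq_coe_toReal {y : ℝ≥0∞} (hy : y ≠ ⊤) :
    (y : EReal) = ((y.toReal : ℝ) : EReal) := by
  lift y to ℝ≥0 using hy
  rfl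

namespace IsRescaledCurve

variable {p : Rates} {ρ₀ T ε : ℝ} {n : ℝ → ℕ → ℝ} {w : ℝ → ℝ → ℝ}

section

variable (hc : IsRescaledCurve p ρ₀ T ε n w) (hT : 0 < T)
include hc hT

theorem aemeasurable_actionε : AEMeasurable (fun t => actionε p ε (n t) (w t)) vol[T] :=
  (hc.aemeasurable_action hT).const_mul _

theorem aemeasurable_dissipationε : AEMeasurable (fun t => dissipationε p ε (n t)) vol[T] :=
  (hc.aemeasurable_dissipation hT).const_mul _

omit hT in
theorem freeEnergyε_lt_top {t : ℝ} (ht : t ∈ Icc 0 T) : freeEnergyε p ε (n t) < ⊤ :=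
  (le_iSup₂ (f := fun t (_ : t ∈ Icc 0 T) => freeEnergyε p ε (n t)) t ht).trans_lt hc.energy_bounded

end

/-- The rescaled rate of change of the free energy. -/
noncomputable def crossε (p : Rates) (ε : ℝ) (n : ℝ → ℕ → ℝ) (w : ℝ → ℝ → ℝ) (t : ℝ) : ℝ≥0∞ :=
  ofReal (p.zs / ε ^ (1 - p.α + 2 * p.γ)) * crossTerm p (n t) (grad p ε w t)

section

variable (hc : IsRescaledCurve p ρ₀ T ε n w) (hT : 0 < T) (hε : 0 < ε) (hρ₀ : 0 < ρ₀)
include hc hT hε hρ₀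

theorem ae_two_mul_crossε_le :
    ∀ᵐ t ∂vol[T], 2 * crossε p ε n w t ≤ actionε p ε (n t) (w t) + dissipationε p ε (n t) := by
  filter_upwards [hc.ae_pos hT hε hρ₀] with t ht
  rw [crossε, actionε, dissipationε, ← mul_add, mul_left_comm]
  gcongr
  exact two_mul_crossTerm_le ht _

theorem freeEnergyε_sub_le {a b : ℝ} (ha : 0 ≤ a) (hab : a ≤ b) (hb : b ≤ T) :
    ofReal |(freeEnergyε p ε (n b)).toReal - (freeEnergyε p ε (n a)).toReal|
    ≤ ∫⁻ t in Icc a b, crossε p ε n w t := by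
  have hz := p.zs_pos
  have h0 : 0 < p.zs / ε ^ p.γ := by positivity
  have h := mul_le_mul_right (hc.freeEnergy_sub_le hT hε hρ₀ ha hab hb) (ofReal (p.zs / ε ^ p.γ))
  rw [← lintegral_const_mul' _ _ ofReal_ne_top, ← ofReal_mul h0.le] at h
  have e1 : p.zs / ε ^ p.γ * |(freeEnergy p (n b)).toReal - (freeEnergy p (n a)).toReal|
      = |(freeEnergyε p ε (n b)).toReal - (freeEnergyε p ε (n a)).toReal| := by
    rw [freeEnergyε, freeEnergyε, toReal_mul, toReal_mul, toReal_ofReal h0.le, ← mul_sub, abs_mul,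
      abs_of_pos h0]
  rw [e1] at h
  refine h.trans (le_of_eq (lintegral_congr fun t => ?_))
  rw [← mul_assoc, ← ofReal_mul h0.le, crossε]
  congr 2
  rw [div_mul_div_comm, mul_one, ← rpow_add hε]
  congr 2; ring

theorem lintegral_crossε_le {a b : ℝ} (ha : 0 ≤ a) (hb : b ≤ T) :
    ∫⁻ t in Icc a b, crossε p ε n w t ≤ (∫⁻ t in Icc a b, dissipationε p ε (n t)) / 2
    + (∫⁻ t in Icc a b, actionε p ε (n t) (w t)) / 2 := by
  have hle := Measure.restrict_mono (Icc_subset_Icc ha hb) (le_refl (volume : Measure ℝ))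
  rw [← ENNReal.add_div, ENNReal.le_div_iff_mul_le (Or.inl two_ne_zero) (Or.inl ofNat_ne_top),
    mul_comm, ← lintegral_const_mul' _ _ ofNat_ne_top, add_comm,
    ← lintegral_add_left' ((hc.aemeasurable_actionε hT).mono_measure hle)]
  exact lintegral_mono_ae (ae_mono hle (hc.ae_two_mul_crossε_le hT hε hρ₀))

theorem freeEnergyε_le_add {a b : ℝ} (ha : 0 ≤ a) (hab : a ≤ b) (hb : b ≤ T) :
    freeEnergyε p ε (n b) ≤ freeEnergyε p ε (n a) + ∫⁻ t in Icc a b, crossε p ε n w t ∧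
    freeEnergyε p ε (n a) ≤ freeEnergyε p ε (n b) + ∫⁻ t in Icc a b, crossε p ε n w t := by
  have h := hc.freeEnergyε_sub_le hT hε hρ₀ ha hab hb
  have fb := (hc.freeEnergyε_lt_top (t := b) ⟨ha.trans hab, hb⟩).ne
  have fa := (hc.freeEnergyε_lt_top (t := a) ⟨ha, hab.trans hb⟩).ne
  have key : ∀ {y z : ℝ≥0∞}, y ≠ ⊤ → z ≠ ⊤ → y ≤ z + ofReal |y.toReal - z.toReal| := by
    intro y z hy hz
    rw [← ofReal_toReal hy, ← ofReal_toReal hz, ← ofReal_add toReal_nonneg (abs_nonneg _),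
      toReal_ofReal toReal_nonneg, toReal_ofReal toReal_nonneg]
    exact ofReal_le_ofReal (by grind)
  refine ⟨(key fb fa).trans (by gcongr), (key fa fb).trans ?_⟩
  rw [abs_sub_comm]; gcongr

omit hε hρ₀ in
theorem Jε_eq : Jε p T ε n w = (((freeEnergyε p ε (n T)).toReal - (freeEnergyε p ε (n 0)).toReal
    + (∫⁻ t in Icc 0 T, dissipationε p ε (n t)).toReal / 2
    + (∫⁻ t in Icc 0 T, actionε p ε (n t) (w t)).toReal / 2 : ℝ) : EReal) := by
  have h1 := (hc.freeEnergyε_lt_top (t := T) ⟨hT.le, le_rfl⟩).ne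
  have h2 := (hc.freeEnergyε_lt_top (t := 0) ⟨le_rfl, hT.le⟩).ne
  rw [Jε, coe_ennreal_eq_coe_toReal h1, coe_ennreal_eq_coe_toReal h2,
    coe_ennreal_eq_coe_toReal (div_ne_top hc.dissipation_finite.ne two_ne_zero),
    coe_ennreal_eq_coe_toReal (div_ne_top hc.action_finite.ne two_ne_zero)]
  simp

omit hε hρ₀ in
/-- A bound on the energy-dissipation functional bounds action, dissipation and final energy by the
initial energy. -/
theorem add_le_of_Jε_le {C : ℝ} (hC : 0 ≤ C) (hJ : Jε p T ε n w ≤ (C : EReal)) :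
    freeEnergyε p ε (n T) + ((∫⁻ t in Icc 0 T, dissipationε p ε (n t)) / 2
    + (∫⁻ t in Icc 0 T, actionε p ε (n t) (w t)) / 2) ≤ freeEnergyε p ε (n 0) + ofReal C := by
  have h1 := (hc.freeEnergyε_lt_top (t := T) ⟨hT.le, le_rfl⟩).ne
  have h2 := (hc.freeEnergyε_lt_top (t := 0) ⟨le_rfl, hT.le⟩).ne
  have h3 := div_ne_top hc.dissipation_finite.ne two_ne_zero
  have h4 := div_ne_top hc.action_finite.ne two_ne_zero
  rw [hc.Jε_eq hT, EReal.coe_le_coe_iff] at hJ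
  rw [← ENNReal.toReal_le_toReal (by simp [h1, h3, h4]) (by simp [h2]), toReal_add h1 (by simp [h3,
    h4]), toReal_add h3 h4, toReal_add h2 (by simp), toReal_ofReal hC]
  simp only [toReal_div, toReal_ofNat]
  linarith

/-- Along a curve of maximal slope, action and dissipation agree almost everywhere. -/
theorem ae_actionε_eq_of_Jε_le (hJ : Jε p T ε n w ≤ 0) :
    ∀ᵐ t ∂vol[T], actionε p ε (n t) (w t) = dissipationε p ε (n t) := by
  have h1 := hc.add_le_of_Jε_le hT le_rfl (by simpa using hJ)
  rw [ofReal_zero, add_zero] at h1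
  have h2 := h1.trans (hc.freeEnergyε_le_add hT hε hρ₀ le_rfl hT.le le_rfl).2
  have hfT := (hc.freeEnergyε_lt_top (t := T) ⟨hT.le, le_rfl⟩).ne
  rw [ENNReal.add_le_add_iff_left hfT, ← ENNReal.add_div, div_le_iff two_ne_zero ofNat_ne_top,
    mul_comm, ← lintegral_const_mul' _ _ ofNat_ne_top, add_comm,
    ← lintegral_add_left' (hc.aemeasurable_actionε hT)] at h2
  have hfin : ∫⁻ t in Icc 0 T, (actionε p ε (n t) (w t) + dissipationε p ε (n t)) < ⊤ := by
    rw [lintegral_add_left' (hc.aemeasurable_actionε hT)]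
    exact add_lt_top.2 ⟨hc.action_finite, hc.dissipation_finite⟩
  have hle := hc.ae_two_mul_crossε_le hT hε hρ₀
  have heq := ae_eq_of_ae_le_of_lintegral_le hle ((lintegral_mono_ae hle).trans_lt hfin).ne
    ((hc.aemeasurable_actionε hT).add (hc.aemeasurable_dissipationε hT)) h2
  filter_upwards [heq, hc.ae_pos hT hε hρ₀, ae_lt_top'
    ((hc.aemeasurable_actionε hT).add (hc.aemeasurable_dissipationε hT)) hfin.ne] with t h3 h4 h5
  have hs0 := scale_ne_zero p hε
  rw [crossε, actionε, dissipationε, ← mul_add, mul_left_comm,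
    ENNReal.mul_right_inj hs0 ofReal_ne_top] at h3
  simp only [Pi.add_apply] at h5
  rw [actionε, dissipationε, ← mul_add] at h5
  have h6 : action p (n t) (unscale p ε (w t)) + dissipation p (n t) < ⊤ := by
    rw [lt_top_iff_ne_top]; intro htop
    rw [htop, mul_top hs0] at h5; exact h5.false
  rw [actionε, dissipationε, action_eq_dissipation h4 h3.ge h6]

omit hc hT hε hρ₀ in
theorem lintegral_Icc_split {f : ℝ → ℝ≥0∞} {a b c : ℝ} (hab : a ≤ b) (hbc : b ≤ c) :
    ∫⁻ t in Icc a c, f t = (∫⁻ t in Icc a b, f t) + ∫⁻ t in Icc b c, f t := by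
  rw [← Icc_union_Ioc_eq_Icc hab hbc, lintegral_union measurableSet_Ioc ?_,
    setLIntegral_congr (Ioc_ae_eq_Icc (a := b) (b := c) (μ := volume))]
  grind

/-- The energy-dissipation inequality on initial time intervals for curves of maximal slope. -/
theorem freeEnergyε_add_le_of_Jε_le (hJ : Jε p T ε n w ≤ 0) {t : ℝ} (ht : t ∈ Icc 0 T) :
    freeEnergyε p ε (n t) + ∫⁻ s in Icc 0 t, dissipationε p ε (n s) ≤ freeEnergyε p ε (n 0) := by
  have h1 := hc.add_le_of_Jε_le hT le_rfl (by simpa using hJ)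
  have hae := hc.ae_actionε_eq_of_Jε_le hT hε hρ₀ hJ
  have hle := Measure.restrict_mono (Icc_subset_Icc ht.1 (le_refl T)) (le_refl (volume : Measure ℝ))
  rw [ofReal_zero, add_zero, lintegral_congr_ae hae, ENNReal.add_halves,
    lintegral_Icc_split ht.1 ht.2] at h1
  have h2 := (hc.freeEnergyε_le_add hT hε hρ₀ ht.1 ht.2 le_rfl).2
  have h3 := hc.lintegral_crossε_le hT hε hρ₀ ht.1 (le_refl T)
  rw [lintegral_congr_ae (ae_mono hle hae), ENNReal.add_halves] at h3
  calc freeEnergyε p ε (n t) + ∫⁻ s in Icc 0 t, dissipationε p ε (n s)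
      ≤ freeEnergyε p ε (n T) + (∫⁻ s in Icc t T, dissipationε p ε (n s))
        + ∫⁻ s in Icc 0 t, dissipationε p ε (n s) := by gcongr; exact h2.trans (by gcongr)
    _ = freeEnergyε p ε (n T) + ((∫⁻ s in Icc 0 t, dissipationε p ε (n s))
        + ∫⁻ s in Icc t T, dissipationε p ε (n s)) := by grind
    _ ≤ _ := h1

end

end IsRescaledCurve

/-! ### Consequences of a bound on the rescaled free energy -/

theorem exp_sub_one_le (y : ℝ) : exp y - 1 ≤ y + y ^ 2 * exp |y| := by
  have h1 : (1 - y) * exp y ≤ 1 := by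
    have := mul_le_mul_of_nonneg_right (Real.add_one_le_exp (-y)) (exp_pos y).le
    rw [← exp_add, neg_add_cancel, Real.exp_zero] at this
    linarith
  rcases le_total 0 y with hy | hy
  · rw [abs_of_nonneg hy]; nlinarith
  · nlinarith [Real.add_one_le_exp y, Real.one_le_exp (abs_nonneg y), sq_nonneg y]

/-- Young's inequality for the free energy, with the dual variable `s` on the set `S` of sizes. -/
theorem sum_young_le {p : Rates} {ρ₀ : ℝ} {n : ℕ → ℝ} (h : IsState ρ₀ n) (hF : freeEnergy p n < ⊤)
    (S : Finset ℕ) (s : ℕ → ℝ) :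
    ∑ i ∈ S, (n (i + 1) * s i - p.ω (i + 1) * (exp (s i) - 1)) ≤ (freeEnergy p n).toReal := by
  have h1 : ∑ i ∈ S, (n (i + 1) * s i - p.ω (i + 1) * (exp (s i) - 1))
      ≤ ∑ i ∈ S, p.ω (i + 1) * ψ (n (i + 1) / p.ω (i + 1)) :=
      sum_le_sum fun i _ => mul_sub_mul_exp_le (h.1 _ (by omega)) (p.ω_pos _) _
  have hnn : ∀ i : ℕ, 0 ≤ p.ω (i + 1) * ψ (n (i + 1) / p.ω (i + 1)) := fun i =>
    mul_nonneg (p.ω_pos _).le (ψ_nonneg (h.dens_nonneg (by omega)))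
  refine h1.trans ?_
  rw [← ofReal_le_iff_le_toReal hF.ne, ofReal_sum_of_nonneg fun i _ => hnn i]
  exact sum_le_tsum _

theorem freeEnergy_le_of_freeEnergyε_le {p : Rates} {n : ℕ → ℝ} {ε K : ℝ} (hε : 0 < ε) (hK : 0 ≤ K)
    (hF : freeEnergyε p ε n ≤ ofReal K) :
    freeEnergy p n < ⊤ ∧ (freeEnergy p n).toReal ≤ K / p.zs * ε ^ p.γ := by
  have hz := p.zs_pos
  have h0 : 0 < p.zs / ε ^ p.γ := by positivity
  have h1 : freeEnergy p n < ⊤ := by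
    rw [lt_top_iff_ne_top]; intro htop
    rw [freeEnergyε, htop, mul_top (by simpa using h0)] at hF
    exact absurd hF (not_le.2 ofReal_lt_top)
  refine ⟨h1, ?_⟩
  have h2 := toReal_mono ofReal_ne_top hF
  rw [freeEnergyε, toReal_mul, toReal_ofReal h0.le, toReal_ofReal hK, div_mul_eq_mul_div,
    div_le_iff₀ (by positivity)] at h2
  rw [div_mul_eq_mul_div, le_div_iff₀ hz]; linarith

/-- The monomer density is close to its equilibrium value. -/
theorem abs_dens_one_sub_one_le {p : Rates} {ρ₀ ε K : ℝ} {n : ℕ → ℝ} (h : IsState ρ₀ n) (hε : 0 < ε)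
    (hε1 : ε ≤ 1) (hK : 0 ≤ K) (hF : freeEnergyε p ε n ≤ ofReal K) :
    |dens p n 1 - 1| ≤ (K / p.zs ^ 2 + 1) * ε ^ (p.γ / 2) := by
  have hz := p.zs_pos
  obtain ⟨h1, h2⟩ := freeEnergy_le_of_freeEnergyε_le hε hK hF
  set η := ε ^ (p.γ / 2) with hη
  have hη0 : 0 < η := by positivity
  have hη1 : η ≤ 1 := Real.rpow_le_one hε.le hε1 (by linarith [p.γ_pos])
  have hηη : ε ^ p.γ = η * η := by rw [hη, ← rpow_add hε]; congr 1; ring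
  have key : ∀ s : ℝ, |s| ≤ 1 → (dens p n 1 - 1) * s - s ^ 2 ≤ K / p.zs ^ 2 * (η * η) := by
    intro s hs
    have h3 := sum_young_le h h1 {0} fun _ => s
    simp only [Finset.sum_singleton, zero_add] at h3
    have h4 := (abs_le.1 (Real.abs_exp_sub_one_sub_id_le hs)).2
    have h5 : n 1 = p.zs * dens p n 1 := by rw [dens, p.ω_one]; field_simp
    rw [p.ω_one, h5] at h3
    rw [hηη] at h2
    rw [show K / p.zs ^ 2 * (η * η) = (K / p.zs * (η * η)) / p.zs by field_simp, le_div_iff₀ hz]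
    nlinarith
  have e1 := key η (by grind)
  have e2 := key (-η) (by grind)
  rw [abs_le]
  constructor <;> by_contra! hcon <;> nlinarith [mul_lt_mul_of_pos_right hcon hη0]

theorem tendsto_rpow_nhdsGT_zero {s : ℝ} (hs : 0 < s) :
    Tendsto (fun ε : ℝ => ε ^ s) (𝓝[>] 0) (𝓝 0) := by
  have := (Real.continuousAt_rpow_const 0 s (Or.inr hs.le)).tendsto
  rw [zero_rpow hs.ne'] at this
  exact this.mono_left nhdsWithin_le_nhds

theorem tendsto_cutoff {x : ℝ} (hx : 0 < x) : Tendsto (cutoff x) (𝓝[>] 0) atTop := by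
  have h1 : Tendsto (fun ε : ℝ => ε ^ (-x)) (𝓝[>] 0) atTop := by
    have h2 := (tendsto_rpow_atTop hx).comp tendsto_inv_nhdsGT_zero
    refine h2.congr' ?_
    filter_upwards [self_mem_nhdsWithin] with ε (hε : 0 < ε)
    simp [Real.inv_rpow hε.le, rpow_neg hε.le]
  exact tendsto_nat_floor_atTop.comp h1

theorem cutoff_le {x ε : ℝ} (hε : 0 < ε) : (cutoff x ε : ℝ) ≤ ε ^ (-x) :=
  Nat.floor_le (by positivity)

theorem half_le_cutoff {x ε : ℝ} (h : 1 ≤ cutoff x ε) : ε ^ (-x) / 2 ≤ (cutoff x ε : ℝ) := by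
  have h1 := Nat.lt_floor_add_one (ε ^ (-x))
  have h2 : (1 : ℝ) ≤ (cutoff x ε : ℝ) := by exact_mod_cast h
  rw [cutoff] at *; linarith

/-- The mass of the clusters below the cut-off converges to the critical mass. -/
theorem exists_small_mass_bound (p : Rates) {x : ℝ} (hx0 : 0 < x) (hx1 : x < 1) (ρ₀ : ℝ) {K : ℝ}
    (hK : 0 ≤ K) : ∃ r : ℝ → ℝ, Tendsto r (𝓝[>] 0) (𝓝 0) ∧
    ∀ᶠ ε in 𝓝[>] 0, ∀ n : ℕ → ℝ, IsState ρ₀ n → freeEnergyε p ε n ≤ ofReal K →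
    |∑ i ∈ Finset.range (cutoff x ε - 1), (i + 1 : ℕ) * n (i + 1) - p.ρs| ≤ r ε := by
  have hz := p.zs_pos
  have hc := p.c_pos
  obtain ⟨C, hC, hω⟩ := p.ω_le (θ := 1 / 2) (by norm_num) (by norm_num)
  have hsum := (summable_rpow_mul_exp_neg (c := p.c / 4) (by positivity) p.one_sub_γ_pos 2).mul_left C
  set M :=
    ∑' i : ℕ, C * ((i + 1 : ℕ) ^ (2 : ℝ) * exp (-(p.c / 4 * (i + 1 : ℕ) ^ (1 - p.γ)))) with hM
  set η : ℝ → ℝ := fun ε => p.c / 4 * (cutoff x ε : ℝ) ^ (-p.γ) with hη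
  set W : ℝ → ℝ := fun ε => ∑ i ∈ Finset.range (cutoff x ε - 1), (i + 1 : ℕ) * p.ω (i + 1) with hW
  have hcut := tendsto_cutoff hx0
  have hη0 : Tendsto η (𝓝[>] 0) (𝓝 0) := by
    have := ((tendsto_natCast_rpow_neg p.γ_pos).comp hcut).const_mul (p.c / 4)
    grind
  have hWlim : Tendsto W (𝓝[>] 0) (𝓝 p.ρs) :=
    p.hasSum_ρs.tendsto_sum_nat.comp ((tendsto_sub_atTop_nat 1).comp hcut)
  refine ⟨fun ε => K / p.zs * (4 / p.c) * ε ^ (p.γ * (1 - x)) + η ε * M + |W ε - p.ρs|, ?_, ?_⟩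
  · have t1 := (tendsto_rpow_nhdsGT_zero (s := p.γ * (1 - x))
      (mul_pos p.γ_pos (by linarith))).const_mul (K / p.zs * (4 / p.c))
    have t2 := hη0.mul_const M
    have t3 := (hWlim.sub_const p.ρs).abs
    simpa using (t1.add t2).add t3
  · filter_upwards [hcut.eventually_ge_atTop 1, self_mem_nhdsWithin] with ε hl0 (hε : 0 < ε) n h hF
    obtain ⟨h1, h2⟩ := freeEnergy_le_of_freeEnergyε_le hε hK hF
    set L := cutoff x ε with hL
    have hLpos : (0 : ℝ) < L := by positivity
    have hηpos : 0 < η ε := by positivity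
    set R := Finset.range (L - 1)
    -- below the cut-off, `exp (η l)` is dominated by a power of `ω_l⁻¹`
    have hexp : ∀ i ∈ R, p.ω (i + 1) * exp (η ε * (i + 1 : ℕ))
        ≤ C * exp (-(p.c / 4 * (i + 1 : ℕ) ^ (1 - p.γ))) := by
      intro i hi
      have hi' : i + 1 ≤ L := by grind
      have hipos : (0 : ℝ) < ((i + 1 : ℕ) : ℝ) := by positivity
      have e1 : η ε * ((i + 1 : ℕ) : ℝ) ≤ p.c / 4 * ((i + 1 : ℕ) : ℝ) ^ (1 - p.γ) := by
        have e2 : (L : ℝ) ^ (-p.γ) ≤ ((i + 1 : ℕ) : ℝ) ^ (-p.γ) :=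
          rpow_le_rpow_of_nonpos hipos (by gcongr) (by linarith [p.γ_pos])
        have e3 : ((i + 1 : ℕ) : ℝ) ^ (1 - p.γ) = ((i + 1 : ℕ) : ℝ) ^ (-p.γ) * ((i + 1 : ℕ) : ℝ) := by
          rw [sub_eq_neg_add, Real.rpow_add_one hipos.ne']
        rw [e3, ← mul_assoc]
        simp only [hη]
        gcongr
      calc p.ω (i + 1) * exp (η ε * (i + 1 : ℕ))
          ≤ (C * exp (-(1 / 2 * p.c * (i + 1 : ℕ) ^ (1 - p.γ)))) * exp
            (p.c / 4 * (i + 1 : ℕ) ^ (1 - p.γ)) :=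
          mul_le_mul (hω _ (by omega)) (Real.exp_le_exp.2 e1) (exp_pos _).le (by positivity)
        _ = _ := by rw [mul_assoc, ← exp_add]; congr 2; ring
    have hM2 : ∑ i ∈ R, (i + 1 : ℕ) ^ 2 * (p.ω (i + 1) * exp (η ε * (i + 1 : ℕ))) ≤ M := by
      refine le_trans ?_ (hsum.sum_le_tsum R fun i _ => by positivity)
      refine sum_le_sum fun i hi => ?_
      rw [Real.rpow_two, mul_left_comm C]
      exact mul_le_mul_of_nonneg_left (hexp i hi) (by positivity)
    have e5 : (freeEnergy p n).toReal ≤ η ε * (K / p.zs * (4 / p.c) * ε ^ (p.γ * (1 - x))) := by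
      refine h2.trans ?_
      have e6 : (L : ℝ) ^ p.γ ≤ ε ^ (-x * p.γ) := by
        rw [rpow_mul hε.le]
        exact rpow_le_rpow hLpos.le (cutoff_le hε) p.γ_pos.le
      have e7 : ε ^ p.γ ≤ (L : ℝ) ^ (-p.γ) * ε ^ (p.γ * (1 - x)) := by
        rw [rpow_neg hLpos.le, inv_mul_eq_div, le_div_iff₀ (rpow_pos_of_pos hLpos _)]
        calc ε ^ p.γ * (L : ℝ) ^ p.γ ≤ ε ^ p.γ * ε ^ (-x * p.γ) := by gcongr
          _ = ε ^ (p.γ * (1 - x)) := by rw [← rpow_add hε]; congr 1; ring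
      calc K / p.zs * ε ^ p.γ ≤ K / p.zs * ((L : ℝ) ^ (-p.γ) * ε ^ (p.γ * (1 - x))) := by gcongr
        _ = _ := by grind
    set X := ∑ i ∈ R, (i + 1 : ℕ) * n (i + 1) with hX
    -- Young's inequality with the dual variables `± η l`
    have key : ∀ σ : ℝ, |σ| = 1 →
        σ * (X - W ε) ≤ K / p.zs * (4 / p.c) * ε ^ (p.γ * (1 - x)) + η ε * M := by
      intro σ hσ
      refine le_of_mul_le_mul_left ?_ hηpos
      have e6 := sum_young_le h h1 R fun i => σ * (η ε * (i + 1 : ℕ))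
      have e7 := mul_le_mul_of_nonneg_left hM2 (sq_nonneg (η ε))
      have e8 : η ε * (σ * (X - W ε)) ≤ ∑ i ∈ R, (n (i + 1) * (σ * (η ε * (i + 1 : ℕ)))
          - p.ω (i + 1) * (exp (σ * (η ε * (i + 1 : ℕ))) - 1))
          + η ε ^ 2 * ∑ i ∈ R, (i + 1 : ℕ) ^ 2 * (p.ω (i + 1) * exp (η ε * (i + 1 : ℕ))) := by
        rw [hX, hW, ← sum_sub_distrib, mul_sum, mul_sum, mul_sum, ← sum_add_distrib]
        refine sum_le_sum fun i _ => ?_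
        have :=
          mul_le_mul_of_nonneg_left (exp_sub_one_le (σ * (η ε * (i + 1 : ℕ)))) (p.ω_pos (i + 1)).le
        rw [abs_mul, hσ, one_mul, abs_of_nonneg (by positivity), mul_pow, ← sq_abs σ, hσ, one_pow,
          one_mul] at this
        linarith
      linarith
    have := abs_sub_le X (W ε) p.ρs
    have : |X - W ε| ≤ _ := abs_le'.2 ⟨by simpa using key 1 (by simp), by simpa using key (-1) (by simp)⟩
    linarith

/-! ### Integrals with respect to the empirical measure -/

theorem lintegral_macroMeasure (x ε : ℝ) (n : ℕ → ℝ) (f : ℝ → ℝ≥0∞) :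
    ∫⁻ r, f r ∂(macroMeasure x ε n) = ∑' i : ℕ, if cutoff x ε
    ≤ i + 1 then ofReal (n (i + 1) / ε) * f (ε * (i + 1 : ℕ)) else 0 := by
  rw [macroMeasure, lintegral_sum_measure]
  refine tsum_congr fun i => ?_
  split_ifs
  · simp
  · simp

/-- The free energy controls the macroscopic energy of the large clusters. -/
theorem exists_energy_bound (p : Rates) {x : ℝ} (hx0 : 0 < x) (ρ₀ : ℝ) {θ : ℝ} (hθ0 : 0 < θ)
    (hθ : θ < 1) :
    ∃ r : ℝ → ℝ, Tendsto r (𝓝[>] 0) (𝓝 0) ∧ ∀ᶠ ε in 𝓝[>] 0, 0 ≤ r ε ∧ ∀ n : ℕ → ℝ, IsState ρ₀ n →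
    ofReal θ * energyLSW p (macroMeasure x ε n) ≤ freeEnergyε p ε n + ofReal (r ε) := by
  have hz := p.zs_pos
  have hc := p.c_pos
  have hγ := p.γ_pos
  have hγ1 := p.one_sub_γ_pos
  obtain ⟨C, hC, hω⟩ := p.ω_le (θ := (1 + θ) / 2) (by linarith) (by linarith)
  set δ := (1 - θ) / 2 * p.c with hδ
  have hδ0 : 0 < δ := mul_pos (by linarith) hc
  set m := 2 * p.γ / x with hm
  have hm0 : 0 < m := by positivity
  have hsum := (summable_rpow_mul_exp_neg hδ0 hγ1 m).mul_left C
  set M := ∑' i : ℕ, C * ((i + 1 : ℕ) ^ m * exp (-(δ * (i + 1 : ℕ) ^ (1 - p.γ)))) with hM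
  have hM0 : 0 ≤ M := tsum_nonneg fun i => by positivity
  have hcut := tendsto_cutoff hx0
  refine ⟨fun ε => p.zs * 2 ^ m * M * ε ^ p.γ, ?_, ?_⟩
  · simpa using (tendsto_rpow_nhdsGT_zero hγ).const_mul (p.zs * 2 ^ m * M)
  filter_upwards [hcut.eventually_ge_atTop 1, self_mem_nhdsWithin] with ε hl0 (hε : 0 < ε)
  refine ⟨by positivity, fun n h => ?_⟩
  by_cases hF : freeEnergy p n = ⊤
  · have : freeEnergyε p ε n = ⊤ := by
      rw [freeEnergyε, hF, mul_top]
      positivity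
    rw [this, top_add]; exact le_top
  set L := cutoff x ε with hL
  have hLpos : (0 : ℝ) < L := by positivity
  -- the tail of the series is a high power of the cut-off
  have htail : ∀ S : Finset ℕ, (∀ i ∈ S, L ≤ i + 1) →
      ∑ i ∈ S, C * exp (-(δ * (i + 1 : ℕ) ^ (1 - p.γ))) ≤ 2 ^ m * ε ^ (2 * p.γ) * M := by
    intro S hS
    have e1 : ∀ i ∈ S, C * exp (-(δ * (i + 1 : ℕ) ^ (1 - p.γ))) ≤ 2 ^ m * ε ^ (2 * p.γ)
        * (C * ((i + 1 : ℕ) ^ m * exp (-(δ * (i + 1 : ℕ) ^ (1 - p.γ))))) := by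
      intro i hi
      have e2 : (1 : ℝ) ≤ 2 ^ m * ε ^ (2 * p.γ) * (i + 1 : ℕ) ^ m := by
        have e3 :
          ε ^ (-x) / 2 ≤ (i + 1 : ℕ) := (half_le_cutoff hl0).trans (by exact_mod_cast hS i hi)
        have e4 := rpow_le_rpow (by positivity) e3 hm0.le
        rw [div_rpow (by positivity) (by norm_num), ← rpow_mul hε.le, show -x * m
          = -(2 * p.γ) by grind, rpow_neg hε.le] at e4
        calc (1 : ℝ) = 2 ^ m * ε ^ (2 * p.γ) * ((ε ^ (2 * p.γ))⁻¹ / 2 ^ m) := by field_simp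
          _ ≤ _ := by gcongr
      exact (le_mul_of_one_le_left (by positivity) e2).trans_eq (by ring)
    refine (sum_le_sum e1).trans ?_
    rw [← mul_sum]
    exact mul_le_mul_of_nonneg_left (hsum.sum_le_tsum S fun i _ => by positivity) (by positivity)
  -- Young's inequality with the dual variable `θ c l^(1-γ)`
  have key : ∀ S : Finset ℕ, (∀ i ∈ S, L ≤ i + 1) → θ * p.c * ∑ i ∈ S, n (i + 1) * (i + 1 : ℕ) ^ (1
      - p.γ) ≤ (freeEnergy p n).toReal + 2 ^ m * ε ^ (2 * p.γ) * M := by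
    intro S hS
    refine le_trans ?_ (add_le_add (sum_young_le h (lt_top_iff_ne_top.2 hF) S fun i => θ * p.c
      * (i + 1 : ℕ) ^ (1 - p.γ)) (htail S hS))
    rw [mul_sum, ← sum_add_distrib]
    refine sum_le_sum fun i _ => ?_
    have h3 : p.ω (i + 1) * exp (θ * p.c * (i + 1 : ℕ) ^ (1 - p.γ))
        ≤ C * exp (-(δ * (i + 1 : ℕ) ^ (1 - p.γ))) := by
      refine (mul_le_mul_of_nonneg_right (hω (i + 1) (by omega)) (exp_pos _).le).trans ?_
      rw [mul_assoc, ← exp_add]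
      grind
    linarith [p.ω_pos (i + 1)]
  have hfac : 0 ≤ p.q / (1 - p.γ) := (div_pos p.q_pos hγ1).le
  rw [energyLSW, lintegral_macroMeasure, ← mul_assoc, ← ofReal_mul hθ0.le, ← ENNReal.tsum_mul_left]
  refine ENNReal.summable.tsum_le_of_sum_le fun S => ?_
  have hFε : freeEnergyε p ε n = ofReal (p.zs / ε ^ p.γ * (freeEnergy p n).toReal) := by
    rw [freeEnergyε, ofReal_mul (by positivity), ofReal_toReal hF]
  rw [hFε, ← ofReal_add (by positivity) (by positivity)]
  have e1 : ∀ i ∈ S, ofReal (θ * (p.q / (1 - p.γ))) * (if L ≤ i + 1 then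
      ofReal (n (i + 1) / ε) * ofReal ((ε * (i + 1 : ℕ)) ^ (1 - p.γ)) else 0)
      = if L ≤ i + 1 then ofReal (p.zs / ε ^ p.γ * (θ * p.c * (n (i + 1)
        * (i + 1 : ℕ) ^ (1 - p.γ)))) else 0 := by
    intro i _
    have hn := h.1 (i + 1) (by omega)
    split_ifs
    · rw [← ofReal_mul (by positivity), ← ofReal_mul (by positivity)]
      congr 1
      rw [mul_rpow hε.le (by positivity), Rates.c, rpow_sub hε, rpow_one]
      field_simp
    · simp
  rw [sum_congr rfl e1, ← sum_filter, ← ofReal_sum_of_nonneg]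
  · refine ofReal_le_ofReal ?_
    have h1 := key (S.filter fun i => L ≤ i + 1) fun i hi => (mem_filter.1 hi).2
    rw [← mul_sum, ← mul_sum]
    have h2 := mul_le_mul_of_nonneg_left h1 (show 0 ≤ p.zs / ε ^ p.γ by positivity)
    refine h2.trans (le_of_eq ?_)
    have h3 : ε ^ (2 * p.γ) = ε ^ p.γ * ε ^ p.γ := by rw [← rpow_add hε]; congr 1; ring
    grind
  · intro i _
    have hn := h.1 (i + 1) (by omega)
    positivity

/-! ### Empirical sums and the discrete continuity equation -/

/-- The density `ω_l n̂_l` that replaces `n_l` in the macroscopic flux. -/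
noncomputable def nh (p : Rates) (n : ℕ → ℝ) (l : ℕ) : ℝ := p.ω l * nHat p n l

/-- The number of cluster sizes that are relevant for test functions vanishing beyond `b`. -/
noncomputable def numSizes (b ε : ℝ) : ℕ := ⌈b / ε⌉₊ + 1

/-- The empirical sum `ε⁻¹ ∑ n_l f(ε l)` over the cluster sizes relevant for test functions that
vanish beyond `b`. -/
noncomputable def esum (b ε : ℝ) (n : ℕ → ℝ) (f : ℝ → ℝ) : ℝ :=
  ∑ i ∈ Finset.range (numSizes b ε), n (i + 1) / ε * f (ε * (i + 1 : ℕ))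

theorem le_mul_of_numSizes_le {b ε : ℝ} (hε : 0 < ε) {i : ℕ} (hi : numSizes b ε ≤ i + 1) :
    b ≤ ε * i := by
  have h1 : ⌈b / ε⌉₊ ≤ i := by unfold numSizes at hi; omega
  have h2 := (Nat.le_ceil (b / ε)).trans (Nat.cast_le.2 h1)
  rw [div_le_iff₀ hε] at h2; linarith

theorem lt_mul_of_numSizes_le {b ε : ℝ} (hε : 0 < ε) {i : ℕ} (hi : numSizes b ε ≤ i) :
    b < ε * (i + 1 : ℕ) := by
  have := le_mul_of_numSizes_le (b := b) hε (i := i) (by omega)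
  grind

theorem integral_macroMeasure {x ε a b : ℝ} (hε : 0 < ε) {n : ℕ → ℝ} (hn : ∀ l, 1 ≤ l → 0 ≤ n l)
    {f : ℝ → ℝ} (hf : ∀ r, r ∉ Icc a b → f r = 0) (hcut : (cutoff x ε : ℝ) * ε ≤ a) :
    ∫ r, f r ∂(macroMeasure x ε n) = esum b ε n f := by
  set μ : ℕ → Measure ℝ := fun i => if cutoff x ε ≤ i + 1 then
      ofReal (n (i + 1) / ε) • Measure.dirac (ε * (i + 1 : ℕ)) else 0 with hμ
  have hterm : ∀ i, ∫ r, f r ∂(μ i) = n (i + 1) / ε * f (ε * (i + 1 : ℕ)) := by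
    intro i
    have h0 : 0 ≤ n (i + 1) / ε := div_nonneg (hn _ (by omega)) hε.le
    simp only [hμ]
    split_ifs with h
    · rw [integral_smul_measure, integral_dirac, toReal_ofReal h0, smul_eq_mul]
    · rw [integral_zero_measure, hf, mul_zero]
      intro hmem
      push Not at h
      have h1 : ((i + 1 : ℕ) : ℝ) < cutoff x ε := by exact_mod_cast h
      nlinarith [hmem.1]
  have hzero : ∀ i, i ∉ Finset.range (numSizes b ε) → f (ε * ((i + 1 : ℕ) : ℝ)) = 0 := by
    intro i hi
    rw [Finset.mem_range, not_lt] at hi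
    exact hf _ fun hmem => absurd hmem.2 (not_le.2 (lt_mul_of_numSizes_le hε hi))
  have hfm : ∀ i, AEStronglyMeasurable f (μ i) := by
    intro i
    simp only [hμ]
    split_ifs
    · exact (aestronglyMeasurable_dirac).smul_measure _
    · fun_prop
  have hint : Integrable f (Measure.sum μ) := by
    refine ⟨aestronglyMeasurable_sum_measure_iff.2 hfm, ?_⟩
    rw [hasFiniteIntegral_iff_enorm, lintegral_sum_measure,
      tsum_eq_sum (s := Finset.range (numSizes b ε))]
    · refine ENNReal.sum_lt_top.2 fun i _ => ?_
      simp only [hμ]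
      split_ifs
      · rw [lintegral_smul_measure, lintegral_dirac, smul_eq_mul]
        exact mul_lt_top ofReal_lt_top enorm_lt_top
      · simp
    · intro i hi
      simp only [hμ]
      split_ifs
      · rw [lintegral_smul_measure, lintegral_dirac, hzero i hi]; simp
      · simp
  rw [macroMeasure, integral_sum_measure hint, tsum_congr hterm, tsum_eq_sum (s := Finset.range (numSizes b ε))]
  · rfl
  grind

theorem Rates.a_eq (p : Rates) {ε : ℝ} (hε : 0 < ε) (l : ℕ) : p.a l = (ε * l) ^ p.α / ε ^ p.α := by
  rw [Rates.a, mul_rpow hε.le (by positivity)]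
  field_simp

section State

variable {p : Rates} {ρ₀ ε : ℝ} {n : ℕ → ℝ}

theorem nh_nonneg (p : Rates) (n : ℕ → ℝ) (l : ℕ) : 0 ≤ nh p n l :=
  mul_nonneg (p.ω_pos l).le (nHat_nonneg _ _ _)

theorem mob_eq_nh (l : ℕ) : mob p n l = p.zs * p.a l * nh p n l := by
  rw [mob, nh, p.k_eq_a]; ring

section

variable (h : IsState ρ₀ n)
include h

theorem IsState.nh_le {l : ℕ} (hl : 1 ≤ l) :
    nh p n l ≤ (dens p n 1 * n l + p.ω l / p.ω (l + 1) * n (l + 1)) / 2 := by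
  have h1 : nHat p n l ≤ (dens p n 1 * dens p n l + dens p n (l + 1)) / 2 := by
    rw [nHat_eq]
    exact logMean_le_half_add (mul_nonneg (h.dens_nonneg le_rfl) (h.dens_nonneg hl))
      (h.dens_nonneg (by omega))
  have h2 := mul_le_mul_of_nonneg_left h1 (p.ω_pos l).le
  have e : p.ω l * ((dens p n 1 * dens p n l + dens p n (l + 1)) / 2)
      = (dens p n 1 * n l + p.ω l / p.ω (l + 1) * n (l + 1)) / 2 := by
    have := (p.ω_pos l).ne'
    rw [show dens p n l = n l / p.ω l from rfl, show dens p n (l + 1) = n (l + 1) / p.ω (l + 1) from rfl]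
    field_simp
  rw [← e]; exact h2

/-- A bound for the mass `∑ l ω_l n̂_l`. -/
noncomputable def nhMass (p : Rates) (ρ₀ : ℝ) : ℝ := ρ₀ * (ρ₀ / p.zs + p.ratio)

theorem IsState.sum_le (S : Finset ℕ) : ∑ i ∈ S, (i + 1 : ℕ) * n (i + 1) ≤ ρ₀ := by
  have := h.2.summable.sum_le_tsum S fun i _ => mul_nonneg (by positivity) (h.1 _ (by omega))
  rwa [h.2.tsum_eq] at this

theorem IsState.sum_succ_le (S : Finset ℕ) : ∑ i ∈ S, (i + 2 : ℕ) * n (i + 2) ≤ ρ₀ :=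
  (h.summable_succ.sum_le_tsum S fun i _ => mul_nonneg (by positivity) (h.1 _ (by omega))).trans
    h.tsum_succ_le

theorem IsState.nonneg : 0 ≤ ρ₀ := (h.1 1 le_rfl).trans (h.le le_rfl)

theorem IsState.sum_nh_le (S : Finset ℕ) : ∑ i ∈ S, (i + 1 : ℕ) * nh p n (i + 1) ≤ nhMass p ρ₀ := by
  have hz := p.zs_pos
  have hr := p.one_le_ratio
  have h1 : ∀ i ∈ S, (i + 1 : ℕ) * nh p n (i + 1)
      ≤ ρ₀ / p.zs * ((i + 1 : ℕ) * n (i + 1)) + p.ratio * ((i + 2 : ℕ) * n (i + 2)) := by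
    intro i _
    have e1 := h.nh_le (p := p) (l := i + 1) (by omega)
    have e2 : dens p n 1 ≤ ρ₀ / p.zs := by
      rw [dens, p.ω_one]; exact div_le_div_of_nonneg_right (h.le le_rfl) hz.le
    have e3 := p.ω_div_ω_succ_le (l := i + 1) (by omega)
    have n1 := h.1 (i + 1) (by omega)
    have n2 := h.1 (i + 2) (by omega)
    have e4 := mul_le_mul_of_nonneg_right e2 n1
    have e5 := mul_le_mul_of_nonneg_right e3 n2
    have e6 : 0 ≤ ρ₀ / p.zs * n (i + 1) := mul_nonneg (div_nonneg h.nonneg hz.le) n1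
    have e7 : 0 ≤ p.ratio * n (i + 2) := mul_nonneg (by linarith) n2
    have e8 : nh p n (i + 1) ≤ ρ₀ / p.zs * n (i + 1) + p.ratio * n (i + 2) := by linarith
    have e9 := mul_le_mul_of_nonneg_left e8 (show (0 : ℝ) ≤ (i + 1 : ℕ) by positivity)
    grind
  refine (sum_le_sum h1).trans ?_
  rw [sum_add_distrib, ← mul_sum, ← mul_sum, nhMass, mul_add, mul_comm ρ₀, mul_comm ρ₀]
  have := div_nonneg h.nonneg hz.le
  exact add_le_add (mul_le_mul_of_nonneg_left (h.sum_le S) this)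
    (mul_le_mul_of_nonneg_left (h.sum_succ_le S) (by linarith))

omit h in
theorem nhMass_nonneg (p : Rates) (hρ : 0 ≤ ρ₀) : 0 ≤ nhMass p ρ₀ := by
  have := p.one_le_ratio
  have := p.zs_pos
  unfold nhMass; positivity

omit h in
theorem sum_div_mul_rpow_le {c : ℕ → ℝ} (hc : ∀ i, 0 ≤ c i) (hε : 0 < ε) {a s m : ℝ} (ha : 0 < a)
    (hs : s ≤ 1) {S : Finset ℕ} (hS : ∀ i ∈ S, a ≤ ε * (i + 1 : ℕ))
    (hm : ∑ i ∈ S, ((i + 1 : ℕ) : ℝ) * c i ≤ m) :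
    ∑ i ∈ S, c i / ε * (ε * (i + 1 : ℕ)) ^ s ≤ a ^ (s - 1) * m := by
  refine le_trans (sum_le_sum (g := fun i => a ^ (s - 1) * ((i + 1 : ℕ) * c i)) fun i hi => ?_)
    (by rw [← mul_sum]; gcongr)
  have e1 :
      c i / ε * (ε * (i + 1 : ℕ)) ^ s = (ε * (i + 1 : ℕ)) ^ (s - 1) * ((i + 1 : ℕ) * c i) := by
    rw [rpow_sub_one (by positivity)]; field_simp
  have := hc i
  rw [e1]
  exact mul_le_mul_of_nonneg_right (rpow_le_rpow_of_nonpos ha (hS i hi) (by linarith))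
    (by positivity)

theorem IsState.sum_mobility_le (hε : 0 < ε) {a : ℝ} (ha : 0 < a) (S : Finset ℕ)
    (hS : ∀ i ∈ S, a ≤ ε * (i + 1 : ℕ)) :
    ∑ i ∈ S, nh p n (i + 1) / ε * (ε * (i + 1 : ℕ)) ^ p.α ≤ a ^ (p.α - 1) * nhMass p ρ₀ :=
  sum_div_mul_rpow_le (fun _ => nh_nonneg p n _) hε ha p.α_lt_one.le hS (h.sum_nh_le S)

/-- The number of large clusters is bounded by the mass. -/
theorem IsState.sum_div_le (hε : 0 < ε) {a : ℝ} (ha : 0 < a) (S : Finset ℕ)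
    (hS : ∀ i ∈ S, a ≤ ε * (i + 1 : ℕ)) : ∑ i ∈ S, n (i + 1) / ε ≤ ρ₀ / a := by
  simpa [Real.rpow_neg_one, div_eq_inv_mul] using sum_div_mul_rpow_le
    (fun i => h.1 (i + 1) (by omega)) hε ha zero_le_one hS (h.sum_le S)

end

end State

namespace IsRescaledCurve

variable {p : Rates} {ρ₀ T ε : ℝ} {n : ℝ → ℕ → ℝ} {w : ℝ → ℝ → ℝ}

theorem rflux_eq (p : Rates) (hε : 0 < ε) (n : ℝ → ℕ → ℝ) (w : ℝ → ℝ → ℝ) (l : ℕ) (t : ℝ) :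
    rflux p ε n w l t = nh p (n t) l / ε * (ε * l) ^ p.α * w t (ε * l) := by
  have hz := p.zs_pos.ne'
  rw [rflux, mob_eq_nh, p.a_eq hε, grad, unscale, rpow_add hε, rpow_sub hε, rpow_one]
  have h1 := (rpow_pos_of_pos hε p.α).ne'
  have h2 := (rpow_pos_of_pos hε p.γ).ne'
  field_simp

theorem actionε_eq (p : Rates) (hε : 0 < ε) (n : ℕ → ℝ) (w : ℝ → ℝ) :
    actionε p ε n w = ∑' i : ℕ, ofReal
    (nh p n (i + 1) / ε * (ε * (i + 1 : ℕ)) ^ p.α * w (ε * (i + 1 : ℕ)) ^ 2) := by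
  have hz := p.zs_pos
  rw [actionε, action, ← ENNReal.tsum_mul_left]
  refine tsum_congr fun i => ?_
  rw [← ofReal_mul (by positivity), ← mob, mob_eq_nh, p.a_eq hε, unscale, rpow_add hε, rpow_sub hε,
    rpow_one, two_mul, rpow_add hε]
  congr 1
  have h1 := (rpow_pos_of_pos hε p.α).ne'
  have h2 := (rpow_pos_of_pos hε p.γ).ne'
  field_simp

theorem sum_action_le (hε : 0 < ε) (n : ℕ → ℝ) (w : ℝ → ℝ) (S : Finset ℕ) :
    ofReal (∑ i ∈ S, nh p n (i + 1) / ε * (ε * (i + 1 : ℕ)) ^ p.α * w (ε * (i + 1 : ℕ)) ^ 2)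
    ≤ actionε p ε n w := by
  rw [actionε_eq p hε, ofReal_sum_of_nonneg]
  · exact sum_le_tsum _
  · intro i _
    have := nh_nonneg p n (i + 1)
    positivity

/-- Young's inequality for the fluxes. -/
theorem sum_abs_rflux_mul_le (hε : 0 < ε) (t : ℝ) (S : Finset ℕ) (φ : ℕ → ℝ) {θ : ℝ} (hθ : 0 < θ)
    (hA : actionε p ε (n t) (w t) < ⊤) :
    2 * ∑ i ∈ S, |rflux p ε n w (i + 1) t * φ i| ≤ θ * (actionε p ε (n t) (w t)).toReal
    + θ⁻¹ * ∑ i ∈ S, nh p (n t) (i + 1) / ε * (ε * (i + 1 : ℕ)) ^ p.α * φ i ^ 2 := by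
  have h1 := (ofReal_le_iff_le_toReal hA.ne).1 (sum_action_le (p := p) hε (n t) (w t) S)
  have h2 := mul_le_mul_of_nonneg_left h1 hθ.le
  refine le_trans ?_ (add_le_add h2 le_rfl)
  rw [mul_sum, mul_sum, mul_sum, ← sum_add_distrib]
  refine sum_le_sum fun i _ => ?_
  rw [rflux_eq p hε]
  have h3 := nh_nonneg p (n t) (i + 1)
  set m := nh p (n t) (i + 1) / ε * (ε * (i + 1 : ℕ)) ^ p.α
  have hm : 0 ≤ m := by positivity
  set v := w t (ε * (i + 1 : ℕ))
  rw [abs_mul, abs_mul, abs_of_nonneg hm, ← sq_abs v, ← sq_abs (φ i)]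
  have h4 : 2 * (|v| * |φ i|) ≤ θ * |v| ^ 2 + θ⁻¹ * |φ i| ^ 2 := by
    have h5 := mul_nonneg (inv_pos.2 hθ).le (sq_nonneg (θ * |v| - |φ i|))
    have h6 : θ⁻¹ * (θ * |v| - |φ i|) ^ 2 = θ * |v| ^ 2 - 2 * (|v| * |φ i|) + θ⁻¹ * |φ i| ^ 2 := by
      grind
    linarith
  nlinarith [mul_le_mul_of_nonneg_left h4 hm]

theorem sum_abel {R z : ℕ → ℝ} (hz : z 1 = 0) (N : ℕ) :
    ∑ i ∈ Finset.range N, R (i + 1) * (z (i + 2) - z (i + 1))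
    = (∑ i ∈ Finset.range N, if i = 0 then 0 else (R i - R (i + 1)) * z (i + 1))
    + R N * z (N + 1) := by
  induction N with
  | zero => simp [hz]
  | succ N ih =>
    rw [sum_range_succ, ih, sum_range_succ]
    grind

/-- The discrete continuity equation, tested with a function supported away from zero. -/
theorem continuity_esum (hc : IsRescaledCurve p ρ₀ T ε n w) (hT : 0 < T) (hε : 0 < ε) (hρ₀ : 0 < ρ₀)
    {ζ : ℝ × ℝ → ℝ} (hζ : ContDiff ℝ 1 ζ) {a b : ℝ} (hsupp : ∀ t r, r ∉ Icc a b → ζ (t, r) = 0)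
    (hεa : ε < a) {t₁ t₂ : ℝ} (h1 : 0 ≤ t₁) (h12 : t₁ ≤ t₂) (h2 : t₂ ≤ T) :
    esum b ε (n t₂) (fun r => ζ (t₂, r)) - esum b ε (n t₁) (fun r => ζ (t₁, r))
    = ∫ t in t₁..t₂, (esum b ε (n t) (fun r => deriv (fun s => ζ (s, r)) t)
    + ∑ i ∈ Finset.range (numSizes b ε), rflux p ε n w (i + 1) t
    * ((ζ (t, ε * (i + 2 : ℕ)) - ζ (t, ε * (i + 1 : ℕ))) / ε)) := by
  set N := numSizes b ε
  have hsub : Icc t₁ t₂ ⊆ Icc 0 T := Icc_subset_Icc h1 h2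
  have hle := Measure.restrict_mono hsub (le_refl (volume : Measure ℝ))
  set z : ℕ → ℝ → ℝ := fun l t => ζ (t, ε * (l : ℝ)) with hz
  have hz1 : ∀ t, z 1 t = 0 := fun t => hsupp _ _ fun hmem => by grind
  have hzN : ∀ t, z (N + 1) t = 0 := fun t => hsupp _ _ fun hmem =>
    absurd hmem.2 (not_le.2 (lt_mul_of_numSizes_le hε le_rfl))
  have hzc : ∀ l, ContDiff ℝ 1 (z l) := fun l => hζ.comp (contDiff_id.prodMk contDiff_const)
  have hac : ∀ l, AbsolutelyContinuousOnInterval (z l) t₁ t₂ := fun l =>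
    (hzc l).contDiffOn.absolutelyContinuousOnInterval
  have hnac : ∀ l, 1 ≤ l → AbsolutelyContinuousOnInterval (fun t => n t l) t₁ t₂ := fun l hl =>
    (hc.absolutelyContinuous l hl).mono (by rw [uIcc_of_le h12, uIcc_of_le hT.le]; exact hsub)
  set g : ℕ → ℝ → ℝ := fun i t => n t (i + 1) / ε * deriv (z (i + 1)) t
    + (if i = 0 then 0 else (rflux p ε n w i t - rflux p ε n w (i + 1) t) * z (i + 1) t / ε) with hg
  have hterm : ∀ i, n t₂ (i + 1) / ε * z (i + 1) t₂ - n t₁ (i + 1) / ε * z (i + 1) t₁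
      = ∫ t in t₁..t₂, g i t := by
    intro i
    rcases Nat.eq_zero_or_pos i with rfl | hi
    · have hz1' : z 1 = fun _ => 0 := funext hz1
      simp [hg, hz1']
    · obtain ⟨m, rfl⟩ : ∃ m, i = m + 1 := ⟨i - 1, by omega⟩
      have e1 := (hnac (m + 2) (by omega)).integral_deriv_mul_eq_sub (hac (m + 2))
      have e2 : ∫ t in t₁..t₂, g (m + 1) t = ∫ t in t₁..t₂,
          (deriv (fun t => n t (m + 2)) t * z (m + 2) t + n t (m + 2) * deriv (z (m + 2)) t) / ε := by
        refine intervalIntegral.integral_congr_ae ?_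
        rw [uIoc_of_le h12, ← ae_restrict_iff' measurableSet_Ioc]
        filter_upwards [ae_mono ((Measure.restrict_mono Ioc_subset_Icc_self le_rfl).trans hle)
          (hc.ae_deriv_succ_succ hT hε hρ₀ m)] with t ht
        grind
      rw [e2, intervalIntegral.integral_div, e1]
      ring
  have hgint : ∀ i, IntervalIntegrable (g i) volume t₁ t₂ := by
    intro i
    have i1 : IntervalIntegrable (fun t => n t (i + 1) / ε * deriv (z (i + 1)) t) volume t₁ t₂ :=
      (hac (i + 1)).intervalIntegrable_deriv.continuousOn_mul
      ((hnac (i + 1) (by omega)).continuousOn.div_const _)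
    refine i1.add ?_
    rcases Nat.eq_zero_or_pos i with rfl | hi
    · simp
    · have r1 : ∀ l, 1 ≤ l → IntervalIntegrable (rflux p ε n w l) volume t₁ t₂ := fun l hl =>
        (intervalIntegrable_iff_integrableOn_Icc_of_le h12).2
          ((hc.integrable_rflux hT hε hρ₀ hl).mono_measure hle)
      simp only [if_neg hi.ne']
      exact (((r1 i hi).sub (r1 (i + 1) (by omega))).mul_continuousOn
        (hac (i + 1)).continuousOn).div_const _
  have e3 : esum b ε (n t₂) (fun r => ζ (t₂, r)) - esum b ε (n t₁) (fun r => ζ (t₁, r))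
      = ∫ t in t₁..t₂, ∑ i ∈ Finset.range N, g i t := by
    rw [intervalIntegral.integral_finsetSum fun i _ => hgint i, esum, esum, ← sum_sub_distrib]
    grind
  rw [e3]
  refine intervalIntegral.integral_congr fun t _ => ?_
  have e4 := sum_abel (R := fun l => rflux p ε n w l t) (z := fun l => z l t / ε) (by simp [hz1]) N
  simp only [hzN, zero_div, mul_zero, add_zero] at e4
  simp only [hg, esum]
  rw [sum_add_distrib]
  congr 1
  grind

end IsRescaledCurve

/-! ### Comparison of microscopic and macroscopic functionals of a state -/

section State

variable {p : Rates} {ρ₀ ε : ℝ} {n : ℕ → ℝ}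

theorem abs_esum_le (h : IsState ρ₀ n) (hε : 0 < ε) {a b : ℝ} (ha : 0 < a) {f : ℝ → ℝ} {M : ℝ}
    (hM : 0 ≤ M) (hf : ∀ r, r ∉ Icc a b → f r = 0) (hfM : ∀ r, |f r| ≤ M) :
    |esum b ε n f| ≤ ρ₀ / a * M := by
  classical
  set S := (Finset.range (numSizes b ε)).filter fun i => a ≤ ε * (i + 1 : ℕ)
  rw [esum, ← Finset.sum_filter_of_ne (p := fun i => a ≤ ε * (i + 1 : ℕ)) fun i _ hne =>
    by_contra fun hi => hne (by grind)]
  refine (abs_sum_le_sum_abs _ _).trans ?_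
  refine le_trans (sum_le_sum (g := fun i => n (i + 1) / ε * M) fun i _ => ?_) ?_
  · have h0 : 0 ≤ n (i + 1) / ε := div_nonneg (h.1 _ (by omega)) hε.le
    rw [abs_mul, abs_of_nonneg h0]
    exact mul_le_mul_of_nonneg_left (hfM _) h0
  · rw [← sum_mul]
    exact mul_le_mul_of_nonneg_right (h.sum_div_le hε ha S fun i hi => (mem_filter.1 hi).2) hM

/-- The modified densities `ω_l n̂_l` are asymptotically dominated by the densities themselves. -/
theorem IsState.esum_nh_le (h : IsState ρ₀ n) (hε : 0 < ε) {a b : ℝ} (ha : 0 < a) {f : ℝ → ℝ}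
    {M δ δ' : ℝ} (hM : 0 ≤ M) (hδ : 0 ≤ δ) (hf0 : ∀ r, 0 ≤ f r) (hf : ∀ r, r ∉ Icc a b → f r = 0)
    (hfM : ∀ r, f r ≤ M) (hf' : ∀ r, |f (r + ε) - f r| ≤ δ') (h1 : |dens p n 1 - 1| ≤ δ)
    (hratio : ∀ l : ℕ, 1 ≤ l → a ≤ ε * l → |p.ω l / p.ω (l + 1) - 1| ≤ δ) :
    esum b ε (nh p n) f ≤ esum b ε n f + ρ₀ / a * (δ * M + (1 + δ) * δ') := by
  classical
  set N := numSizes b ε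
  set y : ℕ → ℝ := fun i => ε * (i + 1 : ℕ) with hy
  set S := (Finset.range N).filter fun i => a ≤ y i
  have hδ' : 0 ≤ δ' := (abs_nonneg _).trans (hf' 0)
  have hS : ∀ g : ℕ → ℝ, ∑ i ∈ Finset.range N, g i * f (y i) = ∑ i ∈ S, g i * f (y i) := fun g =>
    (Finset.sum_filter_of_ne fun i _ hne => by_contra fun hi =>
      hne (by grind)).symm
  have hn0 : ∀ i, 0 ≤ n (i + 1) / ε := fun i => div_nonneg (h.1 _ (by omega)) hε.le
  have e0 : 0 ≤ esum b ε n f := sum_nonneg fun i _ => mul_nonneg (hn0 i) (hf0 _)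
  have e1 :
    esum b ε n f ≤ ρ₀ / a * M := (le_abs_self _).trans (abs_esum_le h hε ha hM hf fun r => by grind)
  have hyS : ∀ i, y (i + 1) = y i + ε := fun i => by grind
  have hsucc : ∑ i ∈ S, n (i + 2) / ε ≤ ρ₀ / a := by
    have := h.sum_div_le hε ha (S.map ⟨Nat.succ, Nat.succ_injective⟩) (by
      intro i hi
      obtain ⟨j, hj, rfl⟩ := Finset.mem_map.1 hi
      have := (mem_filter.1 hj).2
      change a ≤ y (j + 1)
      grind)
    rwa [Finset.sum_map] at this
  -- the index shift loses only the first summand, which is nonnegative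
  have hshift : ∑ i ∈ Finset.range N, n (i + 2) / ε * f (y (i + 1)) ≤ esum b ε n f := by
    have e2 := Finset.sum_range_succ' (fun i => n (i + 1) / ε * f (y i)) N
    rw [sum_range_succ] at e2
    have e3 : f (y N) = 0 := hf _ fun hmem => absurd hmem.2 (not_le.2 (lt_mul_of_numSizes_le hε le_rfl))
    rw [e3, mul_zero, add_zero] at e2
    have e4 := mul_nonneg (hn0 0) (hf0 (y 0))
    have e5 : esum b ε n f = ∑ i ∈ Finset.range N, n (i + 1) / ε * f (y i) := rfl
    linarith
  have hterm : ∀ i ∈ S, nh p n (i + 1) / ε * f (y i) ≤ (1 + δ) / 2 * (n (i + 1) / ε * f (y i))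
      + (1 + δ) / 2 * (n (i + 2) / ε * f (y (i + 1))) + (1 + δ) / 2 * δ' * (n (i + 2) / ε) := by
    intro i hi
    have b1 := h.nh_le (p := p) (l := i + 1) (by omega)
    have b2 : dens p n 1 ≤ 1 + δ := by grind
    have b3 : p.ω (i + 1) / p.ω (i + 2) ≤ 1 + δ := by grind
    have b4 := mul_le_mul_of_nonneg_right b2 (h.1 (i + 1) (by omega))
    have b5 := mul_le_mul_of_nonneg_right b3 (h.1 (i + 2) (by omega))
    have b6 : nh p n (i + 1) ≤ (1 + δ) / 2 * n (i + 1) + (1 + δ) / 2 * n (i + 2) := by linarith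
    have b7 : nh p n (i + 1) / ε ≤ (1 + δ) / 2 * (n (i + 1) / ε) + (1 + δ) / 2 * (n (i + 2) / ε) := by
      refine (div_le_div_of_nonneg_right b6 hε.le).trans (le_of_eq ?_)
      ring
    have b8 := mul_le_mul_of_nonneg_right b7 (hf0 (y i))
    have b9 : f (y i) ≤ f (y (i + 1)) + δ' := by grind
    have b10 :=
      mul_le_mul_of_nonneg_left b9 (mul_nonneg (show 0 ≤ (1 + δ) / 2 by linarith) (hn0 (i + 1)))
    linarith
  have hle := sum_le_sum hterm
  rw [sum_add_distrib, sum_add_distrib, ← mul_sum, ← mul_sum, ← mul_sum,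
    ← hS (fun i => n (i + 1) / ε), ← hS (fun i => nh p n (i + 1) / ε)] at hle
  have hSle : ∑ i ∈ S, n (i + 2) / ε * f (y (i + 1)) ≤ esum b ε n f :=
    (Finset.sum_le_sum_of_subset_of_nonneg (Finset.filter_subset _ _) fun i _ _ =>
      mul_nonneg (hn0 (i + 1)) (hf0 _)).trans hshift
  have c1 := mul_le_mul_of_nonneg_left hSle (show 0 ≤ (1 + δ) / 2 by linarith)
  have c2 := mul_le_mul_of_nonneg_left hsucc (mul_nonneg (show 0 ≤ (1 + δ) / 2 by linarith) hδ')
  have c3 := mul_le_mul_of_nonneg_left e1 hδ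
  have c4 : 0 ≤ ρ₀ / a * ((1 + δ) * δ') :=
    mul_nonneg (div_nonneg h.nonneg ha.le) (mul_nonneg (by linarith) hδ')
  have c5 : ∑ i ∈ Finset.range N, n (i + 1) / ε * f (y i) = esum b ε n f := rfl
  have c6 : esum b ε (nh p n) f = ∑ i ∈ Finset.range N, nh p n (i + 1) / ε * f (y i) := rfl
  grind

/-- Along states of bounded energy, both `n_1 / ω_1` and the ratios `ω_l / ω_{l+1}` of the large
clusters are close to one. -/
theorem eventually_dens_ratio (p : Rates) (ρ₀ : ℝ) {K a : ℝ} (hK : 0 ≤ K) (ha : 0 < a) {δ : ℝ}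
    (hδ : 0 < δ) : ∀ᶠ ε in 𝓝[>] (0 : ℝ), (∀ n : ℕ → ℝ, IsState ρ₀ n → freeEnergyε p ε n ≤ ofReal K →
    |dens p n 1 - 1| ≤ δ) ∧ ∀ l : ℕ, 1 ≤ l → a ≤ ε * l → |p.ω l / p.ω (l + 1) - 1| ≤ δ := by
  have h1 : ∀ᶠ ε in 𝓝[>] (0 : ℝ), (K / p.zs ^ 2 + 1) * ε ^ (p.γ / 2) ≤ δ := by
    have :=
      (tendsto_rpow_nhdsGT_zero (s := p.γ / 2) (by linarith [p.γ_pos])).const_mul (K / p.zs ^ 2 + 1)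
    rw [mul_zero] at this
    exact (this.eventually (gt_mem_nhds hδ)).mono fun _ => le_of_lt
  obtain ⟨L, hL⟩ := eventually_atTop.1 ((Metric.tendsto_nhds.1 p.tendsto_ω_div_ω_succ) δ hδ)
  have h2 : ∀ᶠ ε in 𝓝[>] (0 : ℝ), ε < a / (L + 1) :=
    mem_nhdsWithin_of_mem_nhds (gt_mem_nhds (by positivity))
  have h3 : ∀ᶠ ε in 𝓝[>] (0 : ℝ), ε < 1 := mem_nhdsWithin_of_mem_nhds (gt_mem_nhds one_pos)
  filter_upwards [h1, h2, h3, self_mem_nhdsWithin] with ε e1 e2 e3 (e4 : 0 < ε)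
  refine ⟨fun n hn hF => (abs_dens_one_sub_one_le hn e4 e3.le hK hF).trans e1, fun l _ hal => ?_⟩
  have h4 : L ≤ l := by
    by_contra hlt
    push Not at hlt
    have h5 : (l : ℝ) < L := by gcongr
    rw [lt_div_iff₀ (by positivity)] at e2
    nlinarith
  have := hL l h4
  rw [dist_eq] at this
  exact this.le

theorem eventually_esum_nh_le (p : Rates) (ρ₀ : ℝ) {K a : ℝ} (b : ℝ) (hK : 0 ≤ K) (ha : 0 < a)
    {M δ : ℝ} (hM : 0 ≤ M) (hδ : 0 < δ) :
    ∀ᶠ ε in 𝓝[>] (0 : ℝ), ∀ n : ℕ → ℝ, IsState ρ₀ n → freeEnergyε p ε n ≤ ofReal K →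
    ∀ f : ℝ → ℝ, (∀ r, 0 ≤ f r) → (∀ r, r ∉ Icc a b → f r = 0) → (∀ r, f r ≤ M) →
    (∀ r, |f (r + ε) - f r| ≤ δ) → esum b ε (nh p n) f ≤ esum b ε n f + ρ₀ / a * ((M + 2) * δ) := by
  filter_upwards [eventually_dens_ratio p ρ₀ hK ha (lt_min hδ one_pos),
    self_mem_nhdsWithin] with ε h1 (hε : 0 < ε) n hn hF f hf0 hf hfM hf'
  have hm0 : 0 ≤ min δ 1 := (lt_min hδ one_pos).le
  refine (hn.esum_nh_le hε ha hM hm0 hf0 hf hfM hf' (h1.1 n hn hF) h1.2).trans ?_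
  have hm1 := min_le_left δ 1
  have hm2 := min_le_right δ 1
  have h2 : min δ 1 * M + (1 + min δ 1) * δ ≤ (M + 2) * δ := by nlinarith
  have := mul_le_mul_of_nonneg_left h2 (div_nonneg hn.nonneg ha.le)
  linarith

/-- The lower bound for the dissipation by the macroscopic dissipation in dual form, with
`u = ε^(-γ) (n_1 - z_s)`. -/
theorem IsState.le_dissipationε (h : IsState ρ₀ n) (hρ₀ : 0 < ρ₀) (hε : 0 < ε)
    (hD : dissipationε p ε n < ⊤) {a b : ℝ} (ha : 0 < a) {φ : ℝ → ℝ} {L : ℝ}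
    (hφ : ∀ r, r ∉ Icc a b → φ r = 0) (hφL : ∀ r, |φ (r + ε) - φ r| ≤ L * ε) :
    2 * ((n 1 - p.zs) / ε ^ p.γ) * esum b ε n (fun r => r ^ p.α * φ r) - 2 * esum b ε n
    (fun r => p.q * r ^ (p.α - p.γ) * φ r) - esum b ε (nh p n) (fun r => r ^ p.α * φ r ^ 2) - 2
    * ((p.zs + p.q) * L * (a ^ (p.α - 1) * ρ₀)) * ε ^ (1 - p.γ) ≤ (dissipationε p ε n).toReal := by
  classical
  have hz := p.zs_pos
  have hq := p.q_pos
  have hL : 0 ≤ L := by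
    have := (abs_nonneg _).trans (hφL 0)
    exact nonneg_of_mul_nonneg_left this hε
  set N := numSizes b ε
  set y : ℕ → ℝ := fun i => ε * (i + 1 : ℕ) with hy
  have hy0 : ∀ i, 0 < y i := fun i => by positivity
  have hsc : 0 < p.zs / ε ^ (1 - p.α + 2 * p.γ) := by positivity
  have hD' : dissipation p n < ⊤ := by
    rw [dissipationε] at hD
    by_contra hcon
    rw [not_lt, top_le_iff] at hcon
    rw [hcon, mul_top (by simpa using hsc)] at hD
    grind
  have hn := h.pos_of_dissipation_lt_top hρ₀ hD'
  have hsum : p.zs / ε ^ (1 - p.α + 2 * p.γ) * ∑ i ∈ Finset.range N, mob p n (i + 1) * force p n (i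
      + 1) ^ 2 ≤ (dissipationε p ε n).toReal := by
    rw [dissipationε, toReal_mul, toReal_ofReal hsc.le]
    refine mul_le_mul_of_nonneg_left ?_ hsc.le
    rw [← ofReal_le_iff_le_toReal hD'.ne, dissipation_eq hn, ofReal_sum_of_nonneg]
    · exact sum_le_tsum _
    · intro i _
      have := (mob_pos (p := p) hn (l := i + 1) (by omega)).le
      positivity
  refine le_trans ?_ hsum
  -- Young's inequality, summand by summand
  have hyoung : ∀ i, 2 * (p.a (i + 1) * n 1 * n (i + 1) - p.b (i + 2) * n (i + 2))
        * (ε ^ p.γ * φ (y i) / p.zs) - p.zs * p.a (i + 1) * nh p n (i + 1)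
        * (ε ^ p.γ * φ (y i) / p.zs) ^ 2 ≤ mob p n (i + 1) * force p n (i + 1) ^ 2 := by
    intro i
    have h1 := mob_mul_force (p := p) hn (l := i + 1) (by omega)
    have h2 := (mob_pos (p := p) hn (l := i + 1) (by omega)).le
    rw [← mob_eq_nh, ← h1]
    nlinarith [mul_nonneg h2 (sq_nonneg (force p n (i + 1) - ε ^ p.γ * φ (y i) / p.zs))]
  have hle :=
    mul_le_mul_of_nonneg_left (sum_le_sum fun i (_ : i ∈ Finset.range N) => hyoung i) hsc.le
  refine le_trans ?_ hle
  rw [sum_sub_distrib, mul_sub]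
  have hεα := (rpow_pos_of_pos hε p.α).ne'
  have hεγ := (rpow_pos_of_pos hε p.γ).ne'
  have hscale : ε ^ (1 - p.α + 2 * p.γ) = ε / ε ^ p.α * (ε ^ p.γ * ε ^ p.γ) := by
    rw [rpow_add hε, rpow_sub hε, rpow_one, two_mul, rpow_add hε]
  have e2 : p.zs / ε ^ (1 - p.α + 2 * p.γ) * ∑ i ∈ Finset.range N, p.zs * p.a (i + 1) * nh p n (i +
      1) * (ε ^ p.γ * φ (y i) / p.zs) ^ 2 = esum b ε (nh p n) (fun r => r ^ p.α * φ r ^ 2) := by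
    rw [esum, mul_sum]
    refine sum_congr rfl fun i _ => ?_
    rw [p.a_eq hε, hscale]
    grind
  rw [e2]
  -- summation by parts
  have s1 : ∑ i ∈ Finset.range N, p.b (i + 2) * n (i + 2) * φ (y i)
      = ∑ i ∈ Finset.range (N + 1), p.b (i + 1) * n (i + 1) * φ (y i - ε) := by
    rw [Finset.sum_range_succ']
    have z0 : φ (y 0 - ε) = 0 := hφ _ fun hm => by grind
    rw [z0, mul_zero, add_zero]
    refine sum_congr rfl fun i _ => ?_
    grind
  have hyN : φ (y N) = 0 := hφ _ fun hm => absurd hm.2 (not_le.2 (lt_mul_of_numSizes_le hε le_rfl))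
  have s2 : ∑ i ∈ Finset.range N, p.a (i + 1) * n 1 * n (i + 1) * φ (y i)
      = ∑ i ∈ Finset.range (N + 1), p.a (i + 1) * n 1 * n (i + 1) * φ (y i) := by
    rw [sum_range_succ, hyN, mul_zero, add_zero]
  have s3 : ∀ f : ℝ → ℝ, esum b ε n (fun r => f r * φ r)
      = ∑ i ∈ Finset.range (N + 1), n (i + 1) / ε * (f (y i) * φ (y i)) := by
    intro f
    rw [sum_range_succ, hyN, mul_zero, mul_zero, add_zero, esum]
  have e1 : p.zs / ε ^ (1 - p.α + 2 * p.γ) * ∑ i ∈ Finset.range N, 2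
      * (p.a (i + 1) * n 1 * n (i + 1) - p.b (i + 2) * n (i + 2)) * (ε ^ p.γ * φ (y i) / p.zs)
      = 2 * (ε ^ p.α / ε / ε ^ p.γ) * ∑ i ∈ Finset.range (N + 1), (p.a (i + 1) * n 1 * n (i + 1)
      * φ (y i) - p.b (i + 1) * n (i + 1) * φ (y i - ε)) := by
    rw [sum_sub_distrib, ← s1, ← s2, ← sum_sub_distrib, mul_sum, mul_sum]
    refine sum_congr rfl fun i _ => ?_
    grind
  rw [e1, s3, s3, mul_sum, mul_sum, mul_sum]
  set err : ℕ → ℝ := fun i => 2 * (ε ^ p.α / ε / ε ^ p.γ)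
    * (p.b (i + 1) * n (i + 1) * (φ (y i) - φ (y i - ε))) with herr
  have e4 : ∑ i ∈ Finset.range (N + 1), 2 * (ε ^ p.α / ε / ε ^ p.γ)
        * (p.a (i + 1) * n 1 * n (i + 1) * φ (y i) - p.b (i + 1) * n (i + 1) * φ (y i - ε))
        = ∑ i ∈ Finset.range (N + 1), 2 * ((n 1 - p.zs) / ε ^ p.γ)
        * (n (i + 1) / ε * (y i ^ p.α * φ (y i))) - ∑ i ∈ Finset.range (N + 1), 2 * (n (i + 1) / ε
        * (p.q * y i ^ (p.α - p.γ) * φ (y i))) + ∑ i ∈ Finset.range (N + 1), err i := by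
    rw [← sum_sub_distrib, ← sum_add_distrib]
    refine sum_congr rfl fun i _ => ?_
    simp only [herr]
    have hyp := (rpow_pos_of_pos (hy0 i) p.γ).ne'
    have hγ1 : (i + 1 : ℕ) ^ (-p.γ) = ε ^ p.γ / y i ^ p.γ := by
      have hl := (rpow_pos_of_pos (show (0 : ℝ) < (i + 1 : ℕ) by positivity) p.γ).ne'
      simp only [hy]
      rw [rpow_neg (by positivity), mul_rpow hε.le (by positivity)]
      field_simp
    have hb : p.b (i + 1) = p.a (i + 1) * (p.zs + p.q * (ε ^ p.γ / y i ^ p.γ)) := by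
      rw [← hγ1]; rfl
    rw [hb, p.a_eq hε, rpow_sub (hy0 i)]
    grind
  rw [e4]
  have e5 : |∑ i ∈ Finset.range (N + 1), err i|
      ≤ 2 * ((p.zs + p.q) * L * (a ^ (p.α - 1) * ρ₀)) * ε ^ (1 - p.γ) := by
    refine (abs_sum_le_sum_abs _ _).trans ?_
    refine le_trans (sum_le_sum (g := fun i => 2 * ((p.zs + p.q) * L * a ^ (p.α - 1))
      * ε ^ (1 - p.γ) * ((i + 1 : ℕ) * n (i + 1))) fun i _ => ?_) ?_
    · have hni := h.1 (i + 1) (by omega)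
      have hbi := (p.b_pos (l := i + 1) (by omega)).le
      have hai := (p.a_pos (l := i + 1) (by omega)).le
      have hc0 : 0 ≤ 2 * (ε ^ p.α / ε / ε ^ p.γ) := by positivity
      by_cases hia : a ≤ y i
      · simp only [herr]
        rw [abs_mul, abs_of_nonneg hc0, abs_mul, abs_of_nonneg (mul_nonneg hbi hni)]
        have d1 : |φ (y i) - φ (y i - ε)| ≤ L * ε := by grind
        have d2 : p.b (i + 1) ≤ (p.zs + p.q) * p.a (i + 1) := by
          have : p.b (i + 1) = p.a (i + 1) * (p.zs + p.q * (i + 1 : ℕ) ^ (-p.γ)) := rfl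
          rw [this, mul_comm]
          exact mul_le_mul_of_nonneg_right (p.fac_le (by omega)) hai
        have d3 : y i ^ (p.α - 1) ≤ a ^ (p.α - 1) :=
          rpow_le_rpow_of_nonpos ha hia (by linarith [p.α_lt_one])
        have d4 : y i ^ p.α = y i ^ (p.α - 1) * y i := by
          rw [rpow_sub_one (hy0 i).ne', div_mul_cancel₀ _ (hy0 i).ne']
        calc 2 * (ε ^ p.α / ε / ε ^ p.γ) * (p.b (i + 1) * n (i + 1) * |φ (y i) - φ (y i - ε)|)
            ≤ 2 * (ε ^ p.α / ε / ε ^ p.γ) * ((p.zs + p.q) * p.a (i + 1) * n (i + 1) * (L * ε)) := by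
              gcongr
          _ = 2 * ((p.zs + p.q) * L * y i ^ (p.α - 1)) * ε ^ (1 - p.γ)
                * ((i + 1 : ℕ) * n (i + 1)) := by
              rw [p.a_eq hε]
              have : (ε * (i + 1 : ℕ)) ^ p.α = y i ^ (p.α - 1) * y i := d4
              rw [this, rpow_sub hε, rpow_one]
              grind
          _ ≤ _ := by gcongr
      · have z1 : φ (y i) = 0 := hφ _ fun hm => hia hm.1
        have z2 : φ (y i - ε) = 0 := hφ _ fun hm => hia (by linarith [hm.1])
        simp only [herr, z1, z2, sub_zero, mul_zero, abs_zero]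
        positivity
    · rw [← mul_sum]
      have := h.sum_le (Finset.range (N + 1))
      calc _ ≤ 2 * ((p.zs + p.q) * L * a ^ (p.α - 1)) * ε ^ (1 - p.γ) * ρ₀ := by gcongr
        _ = _ := by ring
  have e6 := (abs_le.1 e5).1
  linarith

/-- Exchanging `x` for the logarithmic mean of `y * x` and `z` costs a multiple of the dissipation
summand, plus the deviation of the monomer density `y` from one. -/
theorem sub_logMean_sq_le {x y z d : ℝ} (hx : 0 < x) (hy : 0 < y) (hz : 0 < z) (hd : |y - 1| ≤ d)
    (hd1 : d ≤ 1 / 2) : (x - logMean (y * x) z) ^ 2 ≤ logMean (y * x) z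
    * (10 * (logMean (y * x) z * (log (y * x) - log z) ^ 2) + 8 * (x * d ^ 2)) := by
  have hA : 0 < y * x := mul_pos hy hx
  set Λ := logMean (y * x) z
  have hΛ : 0 < Λ := logMean_pos hA hz
  set Δ := log (y * x) - log z
  have h1 : Λ * Δ = y * x - z := logMean_mul_log_sub hA hz
  have h2 : |y * x - Λ| ≤ |y * x - z| := abs_sub_logMean_le hA hz
  have h3 : (y * x - Λ) ^ 2 ≤ (Λ * Δ) ^ 2 := by rw [h1]; exact sq_le_sq.2 h2
  have h4 : (x - y * x) ^ 2 ≤ x ^ 2 * d ^ 2 := by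
    have : (x - y * x) ^ 2 = x ^ 2 * (y - 1) ^ 2 := by ring
    rw [this]
    refine mul_le_mul_of_nonneg_left ?_ (sq_nonneg x)
    rw [← sq_abs (y - 1)]
    gcongr
  have h5 : (Λ * Δ) ^ 2 = Λ * (Λ * Δ ^ 2) := by ring
  have h6 : 0 ≤ x * d ^ 2 := by positivity
  -- either the mean is comparable to `x`, or the difference `y * x - Λ` is
  rcases le_or_gt (x / 4) Λ with hc | hc
  · have h7 : (x - Λ) ^ 2 ≤ 2 * (x - y * x) ^ 2 + 2 * (y * x - Λ) ^ 2 := by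
      nlinarith [sq_nonneg ((x - y * x) - (y * x - Λ))]
    have h8 : x ^ 2 * d ^ 2 ≤ 4 * (Λ * (x * d ^ 2)) := by nlinarith
    nlinarith [sq_nonneg (Λ * Δ)]
  · have hy2 : 1 / 2 ≤ y := by grind
    have h7 : x / 2 ≤ y * x := by nlinarith
    have h9 : 0 ≤ x - Λ := by linarith
    have h10 : x - Λ ≤ 4 * (y * x - Λ) - Λ := by nlinarith
    have h11 : x - Λ ≤ 3 * (y * x - Λ) := by nlinarith
    have h12 : (x - Λ) ^ 2 ≤ 9 * (y * x - Λ) ^ 2 := by nlinarith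
    have h13 : 0 ≤ Λ * (x * d ^ 2) := by positivity
    nlinarith [sq_nonneg (Λ * Δ)]

theorem two_mul_le_of_sq_le {θ P A B : ℝ} (hθ : 0 < θ) (hA : 0 ≤ A) (hB : 0 ≤ B)
    (h : P ^ 2 ≤ A * B) : 2 * P ≤ θ * A + θ⁻¹ * B := by
  refine le_of_sq_le_sq ?_ (by positivity)
  have h1 : (θ * A + θ⁻¹ * B) ^ 2 = (θ * A - θ⁻¹ * B) ^ 2 + 4 * (A * B) := by field_simp; ring
  nlinarith [sq_nonneg (θ * A - θ⁻¹ * B)]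

/-- In the flux, the densities may be exchanged for the modified densities `ω_l n̂_l`. -/
theorem IsState.sum_abs_sub_nh_mul_le (h : IsState ρ₀ n) (hρ₀ : 0 < ρ₀) (hε : 0 < ε)
    (hD : dissipationε p ε n < ⊤) (w : ℝ → ℝ) (hA : actionε p ε n w < ⊤) {a d M θ : ℝ} (ha : 0 < a)
    (hd : |dens p n 1 - 1| ≤ d) (hd1 : d ≤ 1 / 2) (hθ : 0 < θ) (N : ℕ) (z : ℕ → ℝ)
    (h0 : ∀ i, ε * (i + 1 : ℕ) < a → z i = 0) (hM : ∀ i, |z i| ≤ M) :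
    2 * |∑ i ∈ Finset.range N, (n (i + 1) - nh p n (i + 1)) / ε * (ε * (i + 1 : ℕ)) ^ p.α
    * w (ε * (i + 1 : ℕ)) * z i| ≤ θ * (actionε p ε n w).toReal + θ⁻¹ * (M ^ 2 * (10 / p.zs ^ 2
    * ε ^ (2 * p.γ) * (dissipationε p ε n).toReal + 8 * d ^ 2 * (a ^ (p.α - 1) * ρ₀))) := by
  classical
  rw [← Finset.sum_filter_of_ne (p := fun i => a ≤ ε * (i + 1 : ℕ)) fun i _ hne => not_lt.1 fun hi =>
    hne (by grind)]
  set S := (Finset.range N).filter fun i => a ≤ ε * (i + 1 : ℕ)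
  have hz := p.zs_pos
  have hsc : 0 < p.zs / ε ^ (1 - p.α + 2 * p.γ) := by positivity
  have hD' : dissipation p n < ⊤ := by
    rw [dissipationε] at hD
    by_contra hcon
    rw [not_lt, top_le_iff] at hcon
    rw [hcon, mul_top (by simpa using hsc)] at hD
    grind
  have hn := h.pos_of_dissipation_lt_top hρ₀ hD'
  have hsum : p.zs / ε ^ (1 - p.α + 2 * p.γ) * ∑ i ∈ S, mob p n (i + 1) * force p n (i + 1) ^ 2
      ≤ (dissipationε p ε n).toReal := by
    rw [dissipationε, toReal_mul, toReal_ofReal hsc.le]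
    refine mul_le_mul_of_nonneg_left ?_ hsc.le
    rw [← ofReal_le_iff_le_toReal hD'.ne, dissipation_eq hn, ofReal_sum_of_nonneg]
    · exact sum_le_tsum _
    · intro i _
      have := (mob_pos (p := p) hn (l := i + 1) (by omega)).le
      positivity
  have hAsum := (ofReal_le_iff_le_toReal hA.ne).1 (IsRescaledCurve.sum_action_le (p := p) hε n w S)
  have hterm : ∀ i ∈ S, 2 * |(n (i + 1) - nh p n (i + 1)) / ε * (ε * (i + 1 : ℕ)) ^ p.α * w (ε * (i
        + 1 : ℕ)) * z i| ≤ θ * (nh p n (i + 1) / ε * (ε * (i + 1 : ℕ)) ^ p.α * w (ε * (i + 1 : ℕ)) ^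
        2) + θ⁻¹ * (M ^ 2 * (10 / p.zs ^ 2 * ε ^ (2 * p.γ) * (p.zs / ε ^ (1 - p.α + 2 * p.γ) * (mob
        p n (i + 1) * force p n (i + 1) ^ 2)) + 8 * d ^ 2 * (n (i + 1) / ε * (ε * (i + 1 : ℕ)) ^
        p.α))) := by
    intro i hi
    have hy : 0 < ε * (i + 1 : ℕ) := by positivity
    have hx := dens_pos (p := p) hn (l := i + 1) (by omega)
    have hx1 := dens_pos (p := p) hn (l := 1) (by omega)
    have hx2 := dens_pos (p := p) hn (l := i + 2) (by omega)
    have hkey := sub_logMean_sq_le hx hx1 hx2 hd hd1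
    have hΛ := logMean_pos (mul_pos hx1 hx) hx2
    have hom := p.ω_pos (i + 1)
    have hni : n (i + 1) = p.ω (i + 1) * dens p n (i + 1) := by
      rw [dens, mul_div_cancel₀ _ hom.ne']
    have hdis : p.zs / ε ^ (1 - p.α + 2 * p.γ) * (mob p n (i + 1) * force p n (i + 1) ^ 2)
        * (ε ^ (2 * p.γ) / p.zs ^ 2)
        = nh p n (i + 1) / ε * (ε * (i + 1 : ℕ)) ^ p.α * force p n (i + 1) ^ 2 := by
      rw [mob_eq_nh, p.a_eq hε, rpow_add hε, rpow_sub hε, rpow_one]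
      have := (rpow_pos_of_pos hε p.α).ne'
      have := (rpow_pos_of_pos hε (2 * p.γ)).ne'
      field_simp
    have hforce : log (dens p n 1 * dens p n (i + 1)) - log (dens p n (i + 2))
      = force p n (i + 1) := by rw [force, log_mul hx1.ne' hx.ne']
    rw [hforce] at hkey
    have hnh : nh p n (i + 1)
      = p.ω (i + 1) * logMean (dens p n 1 * dens p n (i + 1)) (dens p n (i + 2)) := by
      rw [nh, nHat_eq]
    set Λ := logMean (dens p n 1 * dens p n (i + 1)) (dens p n (i + 2))
    set X := dens p n (i + 1)
    set y := ε * ((i + 1 : ℕ) : ℝ)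
    have hG : 10 / p.zs ^ 2 * ε ^ (2 * p.γ) * (p.zs / ε ^ (1 - p.α + 2 * p.γ)
        * (mob p n (i + 1) * force p n (i + 1) ^ 2)) + 8 * d ^ 2 * (n (i + 1) / ε * y ^ p.α)
        = p.ω (i + 1) / ε * y ^ p.α * (10 * (Λ * force p n (i + 1) ^ 2) + 8 * (X * d ^ 2)) := by
      grind
    rw [hG, hnh, hni]
    have hz2 : z i ^ 2 ≤ M ^ 2 := sq_le_sq' (abs_le.1 (hM i)).1 (abs_le.1 (hM i)).2
    refine two_mul_le_of_sq_le hθ (by positivity) (by positivity) ?_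
    rw [sq_abs]
    calc _ = (p.ω (i + 1) / ε * y ^ p.α * w y) ^ 2 * ((X - Λ) ^ 2 * z i ^ 2) := by ring
      _ ≤ (p.ω (i + 1) / ε * y ^ p.α * w y) ^ 2
          * (Λ * (10 * (Λ * force p n (i + 1) ^ 2) + 8 * (X * d ^ 2)) * M ^ 2) := by gcongr
      _ = _ := by ring
  refine (mul_le_mul_of_nonneg_left (abs_sum_le_sum_abs _ _) zero_le_two).trans ?_
  rw [mul_sum]
  refine (sum_le_sum hterm).trans ?_
  rw [sum_add_distrib, ← mul_sum, ← mul_sum, ← mul_sum, sum_add_distrib, ← mul_sum, ← mul_sum,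
    ← mul_sum]
  have := sum_div_mul_rpow_le (fun i => h.1 (i + 1) (by omega)) hε ha p.α_lt_one.le
    (fun i hi => (mem_filter.1 hi).2) (h.sum_le S)
  gcongr

end State

/-! ### Uniform bounds along sequences of rescaled curves -/

/-- A sequence of rescaled curves with uniformly bounded energy, action and dissipation and with
uniformly integrable first moment at time zero. -/
structure BoundedSeq (p : Rates) (ρ₀ x T K : ℝ) (ε : ℕ → ℝ) (n : ℕ → ℝ → ℕ → ℝ)
    (w : ℕ → ℝ → ℝ → ℝ) : Prop where
  mass : p.ρs < ρ₀
  x_pos : 0 < x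
  x_lt : x < 1
  T_pos : 0 < T
  K_nonneg : 0 ≤ K
  pos : ∀ k, 0 < ε k
  lim : Tendsto ε atTop (𝓝 0)
  curve : ∀ k, IsRescaledCurve p ρ₀ T (ε k) (n k) (w k)
  energy : ∀ k, ∀ t ∈ Icc 0 T, freeEnergyε p (ε k) (n k t) ≤ ofReal K
  action : ∀ k, ∫⁻ t in Icc 0 T, actionε p (ε k) (n k t) (w k t) ≤ ofReal K
  dissipation : ∀ k, ∫⁻ t in Icc 0 T, dissipationε p (ε k) (n k t) ≤ ofReal K
  tight :
    ∀ δ : ℝ≥0∞, 0 < δ → ∃ R : ℝ, ∀ k, ∫⁻ r in Ici R, ofReal r ∂(macroMeasure x (ε k) (n k 0)) ≤ δ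

section StateLevel

variable {p : Rates} {ρ₀ ε : ℝ} {n : ℕ → ℝ}

theorem lintegral_ofReal_macroMeasure {x a b : ℝ} (hε : 0 < ε) (hn : ∀ l, 1 ≤ l → 0 ≤ n l) {f : ℝ →
    ℝ} (hf0 : ∀ r, 0 ≤ f r) (hf : ∀ r, r ∉ Icc a b → f r = 0) (hcut : (cutoff x ε : ℝ) * ε ≤ a) :
    ∫⁻ r, ofReal (f r) ∂(macroMeasure x ε n) = ofReal (esum b ε n f) := by
  rw [lintegral_macroMeasure, tsum_eq_sum (s := Finset.range (numSizes b ε)), esum,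
    ofReal_sum_of_nonneg]
  · refine sum_congr rfl fun i _ => ?_
    have h0 : 0 ≤ n (i + 1) / ε := div_nonneg (hn _ (by omega)) hε.le
    split_ifs with hi
    · rw [ofReal_mul h0]
    · rw [hf, mul_zero, ofReal_zero]
      intro hm
      push Not at hi
      have h1 : ((i + 1 : ℕ) : ℝ) < cutoff x ε := by exact_mod_cast hi
      nlinarith [hm.1]
  · intro i _
    exact mul_nonneg (div_nonneg (hn _ (by omega)) hε.le) (hf0 _)
  · intro i hi
    rw [Finset.mem_range, not_lt] at hi
    rw [hf _ fun hm => absurd hm.2 (not_le.2 (lt_mul_of_numSizes_le hε hi)), ofReal_zero, mul_zero,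
      ite_self]

theorem IsState.lintegral_macroMeasure_eq (h : IsState ρ₀ n) (hε : 0 < ε) (x : ℝ) :
    ∫⁻ r, ofReal r ∂(macroMeasure x ε n)
    = ofReal (ρ₀ - ∑ i ∈ Finset.range (cutoff x ε - 1), (i + 1 : ℕ) * n (i + 1)) := by
  set N := cutoff x ε - 1
  have h0 : ∀ i, 0 ≤ (i + 1 : ℕ) * n (i + 1) := fun i =>
    mul_nonneg (by positivity) (h.1 _ (by omega))
  rw [lintegral_macroMeasure]
  have e1 : ∀ i, (if cutoff x ε ≤ i + 1 then ofReal (n (i + 1) / ε)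
      * ofReal (ε * (i + 1 : ℕ)) else 0)
      = ofReal (if i < N then 0 else (i + 1 : ℕ) * n (i + 1)) := by
    intro i
    by_cases hi : cutoff x ε ≤ i + 1
    · have : ¬ i < N := by omega
      rw [if_pos hi, if_neg this, ← ofReal_mul (div_nonneg (h.1 _ (by omega)) hε.le)]
      grind
    · have : i < N := by omega
      rw [if_neg hi, if_pos this, ofReal_zero]
  have hs : HasSum (fun i => if i < N then 0 else (i + 1 : ℕ) * n (i + 1))
      (ρ₀ - ∑ i ∈ Finset.range N, (i + 1 : ℕ) * n (i + 1)) := by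
    have h2 : HasSum (fun i => if i < N then (i + 1 : ℕ) * n (i + 1) else 0)
        (∑ i ∈ Finset.range N, (i + 1 : ℕ) * n (i + 1)) := by
      have h3 : ∑ i ∈ Finset.range N, (if i < N then (i + 1 : ℕ) * n (i + 1) else 0)
          = ∑ i ∈ Finset.range N, (i + 1 : ℕ) * n (i + 1) :=
        sum_congr rfl fun i hi => if_pos (Finset.mem_range.1 hi)
      rw [← h3]
      exact hasSum_sum_of_ne_finset_zero fun i hi => by grind
    have h3 : (fun i => if i < N then 0 else (i + 1 : ℕ) * n (i + 1)) = fun i =>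
        (i + 1 : ℕ) * n (i + 1) - if i < N then (i + 1 : ℕ) * n (i + 1) else 0 := by grind
    rw [h3]
    exact h.2.sub h2
  rw [tsum_congr e1, ← ofReal_tsum_of_nonneg _ hs.summable, hs.tsum_eq]
  grind

theorem tendsto_cutoff_mul {x : ℝ} (hx1 : x < 1) :
    Tendsto (fun ε : ℝ => (cutoff x ε : ℝ) * ε) (𝓝[>] 0) (𝓝 0) := by
  refine tendsto_of_tendsto_of_tendsto_of_le_of_le' tendsto_const_nhds
    (tendsto_rpow_nhdsGT_zero (s := 1 - x) (by linarith)) ?_ ?_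
  · filter_upwards [self_mem_nhdsWithin] with ε (hε : 0 < ε)
    positivity
  · filter_upwards [self_mem_nhdsWithin] with ε (hε : 0 < ε)
    calc (cutoff x ε : ℝ) * ε ≤ ε ^ (-x) * ε := mul_le_mul_of_nonneg_right (cutoff_le hε) hε.le
      _ = ε ^ (1 - x) := by
        rw [rpow_sub hε, rpow_neg hε.le, rpow_one]; field_simp

end StateLevel

namespace IsRescaledCurve

variable {p : Rates} {ρ₀ T ε : ℝ} {n : ℝ → ℕ → ℝ} {w : ℝ → ℝ → ℝ}

section

variable (hc : IsRescaledCurve p ρ₀ T ε n w) (hT : 0 < T)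
include hc hT

theorem ae_actionε_lt_top : ∀ᵐ t ∂vol[T], actionε p ε (n t) (w t) < ⊤ :=
  ae_lt_top' (hc.aemeasurable_actionε hT) hc.action_finite.ne

theorem ae_dissipationε_lt_top : ∀ᵐ t ∂vol[T], dissipationε p ε (n t) < ⊤ :=
  ae_lt_top' (hc.aemeasurable_dissipationε hT) hc.dissipation_finite.ne

theorem integral_actionε : Integrable (fun t => (actionε p ε (n t) (w t)).toReal) vol[T] ∧
    ∫ t in Icc 0 T, (actionε p ε (n t) (w t)).toReal
    = (∫⁻ t in Icc 0 T, actionε p ε (n t) (w t)).toReal :=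
  ⟨integrable_toReal_of_lintegral_ne_top (hc.aemeasurable_actionε hT) hc.action_finite.ne,
    integral_toReal (hc.aemeasurable_actionε hT) (hc.ae_actionε_lt_top hT)⟩

theorem integral_dissipationε : Integrable (fun t => (dissipationε p ε (n t)).toReal) vol[T] ∧
    ∫ t in Icc 0 T, (dissipationε p ε (n t)).toReal
    = (∫⁻ t in Icc 0 T, dissipationε p ε (n t)).toReal :=
  ⟨integrable_toReal_of_lintegral_ne_top (hc.aemeasurable_dissipationε hT) hc.dissipation_finite.ne,
    integral_toReal (hc.aemeasurable_dissipationε hT) (hc.ae_dissipationε_lt_top hT)⟩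

omit hc hT in
/-- The fluxes, tested away from zero, are uniformly integrable in time. -/
theorem two_mul_sum_abs_rflux_le (hε : 0 < ε) {t : ℝ} (h : IsState ρ₀ (n t))
    (hA : actionε p ε (n t) (w t) < ⊤) {a θ M : ℝ} (ha : 0 < a) (hθ : 0 < θ) (N : ℕ) {φ : ℕ → ℝ}
    (hφ : ∀ i, ε * (i + 1 : ℕ) < a → φ i = 0) (hM : ∀ i, |φ i| ≤ M) :
    2 * ∑ i ∈ Finset.range N, |rflux p ε n w (i + 1) t * φ i|
    ≤ θ * (actionε p ε (n t) (w t)).toReal + θ⁻¹ * (a ^ (p.α - 1) * nhMass p ρ₀ * M ^ 2) := by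
  classical
  set S := (Finset.range N).filter fun i => a ≤ ε * (i + 1 : ℕ)
  rw [← Finset.sum_filter_of_ne (p := fun i => a ≤ ε * (i + 1 : ℕ)) fun i _ hne => not_lt.1 fun hi =>
    hne (by grind)]
  refine (sum_abs_rflux_mul_le hε t S φ hθ hA).trans ?_
  have h2 := h.sum_mobility_le (p := p) hε ha S fun i hi => (mem_filter.1 hi).2
  have h3 : ∑ i ∈ S, nh p (n t) (i + 1) / ε * (ε * (i + 1 : ℕ)) ^ p.α * φ i ^ 2
      ≤ a ^ (p.α - 1) * nhMass p ρ₀ * M ^ 2 := by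
    refine le_trans ?_ (mul_le_mul_of_nonneg_right h2 (sq_nonneg M))
    rw [sum_mul]
    refine sum_le_sum fun i _ => mul_le_mul_of_nonneg_left ?_ ?_
    · rw [← sq_abs (φ i)]; exact pow_le_pow_left₀ (abs_nonneg _) (hM i) 2
    · have := nh_nonneg p (n t) (i + 1)
      positivity
  gcongr

theorem integrable_sum_rflux_mul (hε : 0 < ε) (hρ₀ : 0 < ρ₀) (N : ℕ) {φ : ℕ → ℝ → ℝ}
    (hφ : ∀ i, Continuous (φ i)) :
    Integrable (fun t => ∑ i ∈ Finset.range N, rflux p ε n w (i + 1) t * φ i t) vol[T] ∧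
    Integrable (fun t => ∑ i ∈ Finset.range N, |rflux p ε n w (i + 1) t * φ i t|) vol[T] :=
    by
  have h1 : ∀ i, Integrable (fun t => rflux p ε n w (i + 1) t * φ i t) vol[T] := by
    intro i
    have := (intervalIntegrable_of_Icc hT (hc.integrable_rflux hT hε hρ₀ (l := i + 1)
      (by omega))).mul_continuousOn (g := φ i) (hφ i).continuousOn
    exact (intervalIntegrable_iff_integrableOn_Icc_of_le hT.le).1 this
  exact ⟨integrable_finsetSum _ fun i _ => h1 i, integrable_finsetSum _ fun i _ => (h1 i).abs⟩

theorem integral_sum_abs_rflux_le (hε : 0 < ε) (hρ₀ : 0 < ρ₀) {s t : ℝ} (hs : 0 ≤ s) (hst : s ≤ t)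
    (ht : t ≤ T) {a θ M K : ℝ} (ha : 0 < a) (hθ : 0 < θ) (hK : 0 ≤ K) (N : ℕ) {φ : ℕ → ℝ → ℝ}
    (hφc : ∀ i, Continuous (φ i)) (hφ : ∀ i τ, ε * (i + 1 : ℕ) < a → φ i τ = 0)
    (hM : ∀ i τ, |φ i τ| ≤ M) (hA : ∫⁻ t in Icc 0 T, actionε p ε (n t) (w t) ≤ ofReal K) :
    2 * ∫ τ in s..t, ∑ i ∈ Finset.range N, |rflux p ε n w (i + 1) τ * φ i τ|
    ≤ θ * K + θ⁻¹ * ((t - s) * (a ^ (p.α - 1) * nhMass p ρ₀ * M ^ 2)) := by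
  have hsub : Icc s t ⊆ Icc 0 T := Icc_subset_Icc hs ht
  have hle := Measure.restrict_mono hsub (le_refl (volume : Measure ℝ))
  obtain ⟨hAint, hAeq⟩ := hc.integral_actionε hT
  have hAle : ∫ τ in Icc s t, (actionε p ε (n τ) (w τ)).toReal ≤ K := by
    refine (setIntegral_mono_set hAint (ae_of_all _ fun _ => toReal_nonneg) hsub.eventuallyLE).trans
      ?_
    rw [hAeq]
    exact toReal_le_of_le_ofReal hK hA
  rw [intervalIntegral.integral_of_le hst, ← integral_Icc_eq_integral_Ioc, ← integral_const_mul]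
  have h1 :
      ∫ τ in Icc s t, 2 * ∑ i ∈ Finset.range N, |rflux p ε n w (i + 1) τ * φ i τ| ≤ ∫ τ in Icc s
      t, (θ * (actionε p ε (n τ) (w τ)).toReal + θ⁻¹ * (a ^ (p.α - 1) * nhMass p ρ₀ * M ^ 2)) := by
    refine integral_mono_ae (((hc.integrable_sum_rflux_mul hT hε hρ₀ N hφc).2.mono_measure
      hle).const_mul 2) (((hAint.mono_measure hle).const_mul θ).add (integrable_const _)) ?_
    filter_upwards [ae_mono hle (hc.ae_actionε_lt_top hT), ae_mem_Icc] with τ h2 h3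
    exact two_mul_sum_abs_rflux_le hε (hc.isState τ (hsub h3)) h2 ha hθ N
      (fun i => hφ i τ) fun i => hM i τ
  refine h1.trans ?_
  rw [integral_add ((hAint.mono_measure hle).const_mul θ) (integrable_const _), integral_const_mul,
    setIntegral_const, smul_eq_mul, Measure.real, Real.volume_Icc, toReal_ofReal (by linarith)]
  have := mul_le_mul_of_nonneg_left hAle hθ.le
  linarith

/-- Equicontinuity in time of the empirical sums. -/
theorem two_mul_abs_esum_sub_le (hε : 0 < ε) (hρ₀ : 0 < ρ₀) {s t : ℝ} (hs : 0 ≤ s) (hst : s ≤ t)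
    (ht : t ≤ T) {a b θ L K : ℝ} (hθ : 0 < θ) (hK : 0 ≤ K) (hεa : ε < a / 2) {f : ℝ → ℝ}
    (hf1 : ContDiff ℝ 1 f) (hf : ∀ r, r ∉ Icc a b → f r = 0) (hL : ∀ r, |f (r + ε) - f r| ≤ L * ε)
    (hA : ∫⁻ t in Icc 0 T, actionε p ε (n t) (w t) ≤ ofReal K) :
    2 * |esum b ε (n t) f - esum b ε (n s) f|
    ≤ θ * K + θ⁻¹ * ((t - s) * ((a / 2) ^ (p.α - 1) * nhMass p ρ₀ * L ^ 2)) := by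
  have h1 := hc.continuity_esum hT hε hρ₀ (ζ := fun z => f z.2) (hf1.comp contDiff_snd) (a := a)
    (b := b) (fun _ r hr => hf r hr) (by linarith) hs hst ht
  simp only [deriv_const] at h1
  have h2 : ∀ τ, esum b ε (n τ) (fun _ => (0 : ℝ)) = 0 := fun τ => by simp [esum]
  simp only [h2, zero_add] at h1
  set φ : ℕ → ℝ → ℝ := fun i _ => (f (ε * (i + 2 : ℕ)) - f (ε * (i + 1 : ℕ))) / ε with hφ
  have h3 : |∫ τ in s..t, ∑ i ∈ Finset.range (numSizes b ε), rflux p ε n w (i + 1) τ * φ i τ|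
      ≤ ∫ τ in s..t, ∑ i ∈ Finset.range (numSizes b ε), |rflux p ε n w (i + 1) τ * φ i τ| := by
    refine (intervalIntegral.abs_integral_le_integral_abs hst).trans ?_
    have hsub : Icc s t ⊆ Icc 0 T := Icc_subset_Icc hs ht
    have hle := Measure.restrict_mono hsub (le_refl (volume : Measure ℝ))
    have i1 :=
      hc.integrable_sum_rflux_mul hT hε hρ₀ (numSizes b ε) (φ := φ) fun i => continuous_const
    refine intervalIntegral.integral_mono_on hst ?_ ?_ fun τ _ => abs_sum_le_sum_abs _ _
    · exact (intervalIntegrable_iff_integrableOn_Icc_of_le hst).2 (i1.1.abs.mono_measure hle)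
    · exact (intervalIntegrable_iff_integrableOn_Icc_of_le hst).2 (i1.2.mono_measure hle)
  rw [h1]
  refine (mul_le_mul_of_nonneg_left h3 two_pos.le).trans ?_
  refine hc.integral_sum_abs_rflux_le hT hε hρ₀ hs hst ht (by linarith) hθ hK _
    (fun i => continuous_const) (fun i τ hi => ?_) (fun i τ => ?_) hA
  · grind
  · have e3 : ε * (i + 2 : ℕ) = ε * (i + 1 : ℕ) + ε := by grind
    simp only [hφ]
    rw [abs_div, abs_of_pos hε, div_le_iff₀ hε, e3]
    exact hL _

end

end IsRescaledCurve

/-! ### Smooth cut-offs -/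

theorem exists_abs_deriv_smoothTransition_le :
    ∃ C : ℝ, 0 ≤ C ∧ ∀ r, |deriv smoothTransition r| ≤ C := by
  have hc : Continuous (deriv smoothTransition) :=
    (smoothTransition.contDiff (n := 1)).continuous_deriv le_rfl
  obtain ⟨C, hC⟩ := isCompact_Icc.exists_bound_of_continuousOn (s := Icc (-1 : ℝ) 2) hc.continuousOn
  refine ⟨max C 0, le_max_right _ _, fun r => ?_⟩
  by_cases h1 : r ∈ Icc (-1 : ℝ) 2
  · exact (hC r h1).trans (le_max_left _ _)
  · have h0 : deriv smoothTransition r = 0 := by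
      rcases lt_or_ge r 0 with h2 | h2
      · have : smoothTransition =ᶠ[𝓝 r] fun _ => 0 := by
          filter_upwards [gt_mem_nhds h2] with y hy
          exact smoothTransition.zero_of_nonpos (le_of_lt hy)
        rw [this.deriv_eq, deriv_const]
      · have h3 : 1 < r := by grind
        have : smoothTransition =ᶠ[𝓝 r] fun _ => 1 := by
          filter_upwards [lt_mem_nhds h3] with y hy
          exact smoothTransition.one_of_one_le (le_of_lt hy)
        rw [this.deriv_eq, deriv_const]
    grind

/-- A smooth function that equals one on `[2 R, ∞)` and vanishes on `(-∞, R]`. -/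
noncomputable def upStep (R r : ℝ) : ℝ := smoothTransition (r / R - 1)

section UpStep

variable {R r : ℝ}

theorem upStep_nonneg : 0 ≤ upStep R r := smoothTransition.nonneg _

theorem upStep_le_one : upStep R r ≤ 1 := smoothTransition.le_one _

theorem upStep_eq_zero (hR : 0 < R) (hr : r ≤ R) : upStep R r = 0 :=
  smoothTransition.zero_of_nonpos (by rw [sub_nonpos, div_le_one hR]; exact hr)

theorem upStep_eq_one (hR : 0 < R) (hr : 2 * R ≤ r) : upStep R r = 1 :=
  smoothTransition.one_of_one_le (by rw [le_sub_iff_add_le, le_div_iff₀ hR]; linarith)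

theorem contDiff_upStep (R : ℝ) : ContDiff ℝ ∞ (upStep R) :=
  smoothTransition.contDiff.comp ((contDiff_id.div_const R).sub contDiff_const)

theorem deriv_upStep (R r : ℝ) : deriv (upStep R) r = deriv smoothTransition (r / R - 1) / R := by
  have h1 : HasDerivAt (fun r : ℝ => r / R - 1) (1 / R) r := ((hasDerivAt_id r).div_const R).sub_const 1
  have h2 : HasDerivAt smoothTransition (deriv smoothTransition (r / R - 1)) (r / R - 1) :=
    ((smoothTransition.contDiff (n := 1)).differentiable one_ne_zero _).hasDerivAt
  have := (h2.comp r h1).deriv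
  rw [mul_one_div] at this
  exact this

end UpStep

/-- The derivative of the cut-off `upStep R` is of order `1 / r`, uniformly in `R`. -/
theorem exists_abs_mul_deriv_upStep_le :
    ∃ C : ℝ, 0 ≤ C ∧ ∀ R r, 0 < R → |r * deriv (upStep R) r| ≤ C := by
  obtain ⟨C, hC, h⟩ := exists_abs_deriv_smoothTransition_le
  refine ⟨2 * C, by positivity, fun R r hR => ?_⟩
  by_cases hr : r ∈ Icc 0 (2 * R)
  · rw [deriv_upStep, abs_mul, abs_div, abs_of_pos hR, abs_of_nonneg hr.1]
    calc r * (|deriv smoothTransition (r / R - 1)| / R) ≤ (2 * R) * (C / R) := by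
          have := hr.2; gcongr; exact h _
      _ = 2 * C := by field_simp
  · have h0 : deriv (upStep R) r = 0 := by
      rcases lt_or_ge r 0 with h2 | h2
      · have : upStep R =ᶠ[𝓝 r] fun _ => 0 := by
          filter_upwards [gt_mem_nhds h2] with y hy
          exact upStep_eq_zero hR (by grind)
        rw [this.deriv_eq, deriv_const]
      · have h3 : 2 * R < r := by grind
        have : upStep R =ᶠ[𝓝 r] fun _ => 1 := by
          filter_upwards [lt_mem_nhds h3] with y hy
          exact upStep_eq_one hR (le_of_lt hy)
        rw [this.deriv_eq, deriv_const]
    grind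

/-- A smooth function of `r` that equals `r` on `[2 R, M]` and is supported in `[R, 2 M]`. -/
noncomputable def tent (R M r : ℝ) : ℝ := r * upStep R r * (1 - upStep M r)

section Tent

variable {R M r : ℝ}

theorem contDiff_tent (R M : ℝ) : ContDiff ℝ ∞ (tent R M) :=
  (contDiff_id.mul (contDiff_upStep R)).mul (contDiff_const.sub (contDiff_upStep M))

theorem tent_eq_zero (hR : 0 < R) (hM : 0 < M) (hr : r ∉ Icc R (2 * M)) : tent R M r = 0 := by
  rcases lt_or_ge r R with h | h
  · rw [tent, upStep_eq_zero hR h.le]; ring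
  · have : 2 * M < r := by grind
    rw [tent, upStep_eq_one hM this.le]; ring

theorem tent_nonneg (hR : 0 < R) : 0 ≤ tent R M r := by
  rcases le_or_gt r 0 with h | h
  · rw [tent, upStep_eq_zero hR (by linarith)]; simp
  · exact mul_nonneg (mul_nonneg h.le upStep_nonneg) (by linarith [upStep_le_one (R := M) (r := r)])

theorem tent_le (hr : 0 ≤ r) : tent R M r ≤ r := by
  have h1 := upStep_nonneg (R := R) (r := r)
  have h2 := upStep_le_one (R := R) (r := r)
  have h3 := upStep_nonneg (R := M) (r := r)
  have h4 := upStep_le_one (R := M) (r := r)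
  rw [tent]
  calc r * upStep R r * (1 - upStep M r) ≤ r * 1 * 1 := by
        gcongr
        linarith
    _ = r := by ring

end Tent

theorem exists_tent_lipschitz :
    ∃ L : ℝ, 0 ≤ L ∧ ∀ R M r s, 0 < R → 0 < M → |tent R M r - tent R M s| ≤ L * |r - s| := by
  obtain ⟨C, hC, h⟩ := exists_abs_mul_deriv_upStep_le
  refine ⟨1 + 2 * C, by positivity, fun R M r s hR hM => ?_⟩
  have hd : ∀ y, HasDerivAt (tent R M) ((1 * upStep R y + y * deriv (upStep R) y) * (1 - upStep M y)
      + y * upStep R y * (0 - deriv (upStep M) y)) y := by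
    intro y
    have h1 := ((contDiff_upStep R).differentiable (by simp) y).hasDerivAt
    have h2 := ((contDiff_upStep M).differentiable (by simp) y).hasDerivAt
    exact ((hasDerivAt_id y).mul h1).mul ((hasDerivAt_const y (1 : ℝ)).sub h2)
  have hb : ∀ y, ‖deriv (tent R M) y‖ ≤ 1 + 2 * C := by
    intro y
    rw [(hd y).deriv, norm_eq_abs]
    have a1 := h R y hR
    have a2 := h M y hM
    have h1 := upStep_nonneg (R := R) (r := y)
    have h2 := upStep_le_one (R := R) (r := y)
    have h3 := upStep_nonneg (R := M) (r := y)
    have h4 := upStep_le_one (R := M) (r := y)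
    have e : (1 * upStep R y + y * deriv (upStep R) y) * (1 - upStep M y)
      + y * upStep R y * (0 - deriv (upStep M) y) = upStep R y * (1 - upStep M y)
      + (y * deriv (upStep R) y) * (1 - upStep M y) - (y * deriv (upStep M) y) * upStep R y := by
      ring
    rw [e]
    have b1 : |upStep R y * (1 - upStep M y)| ≤ 1 := by
      rw [abs_of_nonneg (mul_nonneg h1 (by linarith))]; nlinarith
    have b2 : |(y * deriv (upStep R) y) * (1 - upStep M y)| ≤ C := by
      rw [abs_mul, abs_of_nonneg (show 0 ≤ 1 - upStep M y by linarith)]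
      nlinarith [abs_nonneg (y * deriv (upStep R) y)]
    have b3 : |(y * deriv (upStep M) y) * upStep R y| ≤ C := by
      rw [abs_mul, abs_of_nonneg h1]
      nlinarith [abs_nonneg (y * deriv (upStep M) y)]
    grind
  have := Convex.norm_image_sub_le_of_norm_deriv_le (s := univ) (f := tent R M)
    (fun y _ => (hd y).differentiableAt) (fun y _ => hb y) convex_univ (mem_univ s) (mem_univ r)
  simpa [norm_eq_abs] using this

namespace BoundedSeq

variable {p : Rates} {ρ₀ x T K : ℝ} {ε : ℕ → ℝ} {n : ℕ → ℝ → ℕ → ℝ} {w : ℕ → ℝ → ℝ → ℝ}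

section

variable (h : BoundedSeq p ρ₀ x T K ε n w)
include h

theorem ρ₀_pos : 0 < ρ₀ := p.ρs_nonneg.trans_lt h.mass

theorem tendsto_nhdsGT : Tendsto ε atTop (𝓝[>] 0) :=
  tendsto_nhdsWithin_iff.2 ⟨h.lim, Eventually.of_forall h.pos⟩

theorem comp {σ : ℕ → ℕ} (hσ : StrictMono σ) :
    BoundedSeq p ρ₀ x T K (fun k => ε (σ k)) (fun k => n (σ k)) (fun k => w (σ k)) where
  mass := h.mass
  x_pos := h.x_pos
  x_lt := h.x_lt
  T_pos := h.T_pos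
  K_nonneg := h.K_nonneg
  pos _ := h.pos _
  lim := h.lim.comp hσ.tendsto_atTop
  curve _ := h.curve _
  energy _ := h.energy _
  action _ := h.action _
  dissipation _ := h.dissipation _
  tight δ hδ := (h.tight δ hδ).imp fun _ hR _ => hR _

theorem eventually_cutoff {a : ℝ} (ha : 0 < a) :
    ∀ᶠ k in atTop, (cutoff x (ε k) : ℝ) * ε k ≤ a ∧ ε k < a / 2 := by
  have h1 := (tendsto_cutoff_mul h.x_lt).comp h.tendsto_nhdsGT
  filter_upwards
    [h1.eventually (gt_mem_nhds ha), h.lim.eventually (gt_mem_nhds (half_pos ha))] with k h2 h3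
  grind

/-- No mass escapes to infinity, uniformly in time. -/
theorem eventually_tail_le {δ : ℝ} (hδ : 0 < δ) : ∃ R : ℝ, 0 < R ∧ ∀ᶠ k in atTop, ∀ t ∈ Icc 0 T,
    ∫⁻ r in Ici R, ofReal r ∂(macroMeasure x (ε k) (n k t)) ≤ ofReal δ := by
  obtain ⟨L, hL0, hL⟩ := exists_tent_lipschitz
  obtain ⟨R₀, hR₀⟩ := h.tight (ofReal (δ / 2)) (by simpa using hδ)
  have hK := h.K_nonneg
  set θ := δ / (2 * (K + 1)) with hθ
  have hθ0 : 0 < θ := by positivity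
  have hθK : θ * K ≤ δ / 2 := by
    rw [hθ, div_mul_eq_mul_div, div_le_div_iff₀ (by positivity) two_pos]; nlinarith
  have hlim : Tendsto (fun R : ℝ => θ⁻¹ * (T * ((R / 2) ^ (p.α - 1) * nhMass p ρ₀ * L ^ 2)))
      atTop (𝓝 0) := by
    have h1 : Tendsto (fun R : ℝ => (R / 2) ^ (p.α - 1)) atTop (𝓝 0) := by
      have := (tendsto_rpow_neg_atTop (y := 1 - p.α) (by linarith [p.α_lt_one])).comp
        (tendsto_id.atTop_div_const (two_pos (α := ℝ)))
      refine this.congr fun R => ?_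
      grind
    have := (((h1.mul_const (nhMass p ρ₀)).mul_const (L ^ 2)).const_mul T).const_mul θ⁻¹
    grind
  obtain ⟨R, hR1, hR2, hR3⟩ := ((hlim.eventually (gt_mem_nhds (half_pos hδ))).and
    ((eventually_ge_atTop R₀).and (eventually_gt_atTop 0))).exists
  refine ⟨2 * R, by linarith, ?_⟩
  filter_upwards [h.eventually_cutoff hR3] with k hk t ht
  have hst := (h.curve k).isState t ht
  have hs0 := (h.curve k).isState 0 ⟨le_rfl, h.T_pos.le⟩
  -- the tent functions have Lipschitz constants independent of `M`
  have hbound :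
      ∀ M : ℝ, 0 < M → ∫⁻ r, ofReal (tent R M r) ∂(macroMeasure x (ε k) (n k t)) ≤ ofReal δ := by
    intro M hM
    rw [lintegral_ofReal_macroMeasure (h.pos k) hst.1 (fun r => tent_nonneg hR3)
      (fun r hr => tent_eq_zero hR3 hM hr) hk.1]
    refine ofReal_le_ofReal ?_
    have e1 := (h.curve k).two_mul_abs_esum_sub_le h.T_pos (h.pos k) h.ρ₀_pos le_rfl ht.1 ht.2
      (a := R) (b := 2 * M) hθ0 hK hk.2 ((contDiff_tent R M).of_le (by simp))
      (fun r hr => tent_eq_zero hR3 hM hr) (L := L) (fun r => by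
        have := hL R M (r + ε k) r hR3 hM
        rwa [add_sub_cancel_left, abs_of_pos (h.pos k)] at this) (h.action k)
    have e2 : θ⁻¹ * ((t - 0) * ((R / 2) ^ (p.α - 1) * nhMass p ρ₀ * L ^ 2))
        ≤ θ⁻¹ * (T * ((R / 2) ^ (p.α - 1) * nhMass p ρ₀ * L ^ 2)) := by
      have := nhMass_nonneg p h.ρ₀_pos.le
      have ht2 := ht.2
      gcongr
      linarith
    have e3 : esum (2 * M) (ε k) (n k 0) (tent R M) ≤ δ / 2 := by
      have e4 : ofReal (esum (2 * M) (ε k) (n k 0) (tent R M)) ≤ ofReal (δ / 2) := by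
        rw [← lintegral_ofReal_macroMeasure (h.pos k) hs0.1 (fun r => tent_nonneg hR3)
          (fun r hr => tent_eq_zero hR3 hM hr) hk.1]
        refine le_trans ?_ (hR₀ k)
        rw [← lintegral_indicator measurableSet_Ici]
        refine lintegral_mono fun r => ?_
        by_cases hr : r ∈ Ici R₀
        · rw [indicator_of_mem hr]
          rcases le_or_gt 0 r with h0 | h0
          · exact ofReal_le_ofReal (tent_le h0)
          · rw [tent_eq_zero hR3 hM (fun hm => by grind), ofReal_zero]; exact zero_le
        · have : r < R₀ := not_le.1 hr
          rw [tent_eq_zero hR3 hM (fun hm => by grind), ofReal_zero]; exact zero_le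
      exact (ENNReal.ofReal_le_ofReal_iff (by linarith)).1 e4
    grind
  -- let `M → ∞` by Fatou's lemma
  have hfatou : ∫⁻ r in Ici (2 * R), ofReal r ∂(macroMeasure x (ε k) (n k t)) ≤ ∫⁻ r, liminf
      (fun j : ℕ => ofReal (tent R (j + 1) r)) atTop ∂(macroMeasure x (ε k) (n k t)) := by
    rw [← lintegral_indicator measurableSet_Ici]
    refine lintegral_mono fun r => ?_
    by_cases hr : r ∈ Ici (2 * R)
    · rw [indicator_of_mem hr]
      have hev : ∀ᶠ j : ℕ in atTop, ofReal (tent R (j + 1) r) = ofReal r := by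
        filter_upwards [eventually_ge_atTop ⌈r⌉₊] with j hj
        have h5 : r ≤ j := (Nat.le_ceil r).trans (Nat.cast_le.2 hj)
        rw [tent, upStep_eq_one hR3 hr, upStep_eq_zero (by positivity) (by linarith)]
        simp
      rw [(tendsto_congr' hev).2 tendsto_const_nhds |>.liminf_eq]
    · rw [indicator_of_notMem hr]; exact zero_le
  refine hfatou.trans ((lintegral_liminf_le fun j : ℕ =>
    ((contDiff_tent R ((j : ℝ) + 1)).continuous.measurable.ennreal_ofReal)).trans ?_)
  exact liminf_le_of_le (by isBoundedDefault) fun b hb =>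
    (hb.exists.choose_spec).trans (hbound _ (by positivity))

theorem eventually_energy : ∃ C : ℝ, 0 ≤ C ∧
    ∀ᶠ k in atTop, ∀ t ∈ Icc 0 T, energyLSW p (macroMeasure x (ε k) (n k t)) ≤ ofReal C := by
  obtain ⟨r, hr, hev⟩ := exists_energy_bound p h.x_pos ρ₀ (θ := 1 / 2) (by norm_num) (by norm_num)
  refine ⟨2 * (K + 1), by linarith [h.K_nonneg], ?_⟩
  filter_upwards [h.tendsto_nhdsGT.eventually hev,
    (hr.comp h.tendsto_nhdsGT).eventually (gt_mem_nhds one_pos)] with k h1 h2 t ht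
  have h3 := h1.2 (n k t) ((h.curve k).isState t ht)
  have h4 := h3.trans (add_le_add (h.energy k t ht) (ofReal_le_ofReal (le_of_lt h2)))
  rw [← ofReal_add h.K_nonneg zero_le_one] at h4
  have h5 : ofReal 2 * (ofReal (1 / 2) * energyLSW p (macroMeasure x (ε k) (n k t)))
      = energyLSW p (macroMeasure x (ε k) (n k t)) := by
    rw [← mul_assoc, ← ofReal_mul zero_le_two]; norm_num
  rw [← h5, ofReal_mul zero_le_two]
  gcongr

end

end BoundedSeq

/-! ### Vague convergence on the half line -/

open scoped CompactlySupported

/-- Measures on the half line that are finite on compact subsets of `(0, ∞)`. -/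
def LocFin (μ : Measure ℝ) : Prop := ∀ a b : ℝ, 0 < a → μ (Icc a b) < ⊤

theorem LocFin.of_lintegral_rpow {μ : Measure ℝ} {s : ℝ} (hs : 0 ≤ s)
    (h : ∫⁻ r, ofReal (r ^ s) ∂μ < ⊤) : LocFin μ := by
  intro a b ha
  have h0 : 0 < a ^ s := rpow_pos_of_pos ha s
  have h1 : ofReal (a ^ s) * μ (Icc a b) ≤ ∫⁻ r, ofReal (r ^ s) ∂μ := by
    rw [← setLIntegral_const]
    refine (setLIntegral_mono' measurableSet_Icc fun r hr => ?_).trans (setLIntegral_le_lintegral _ _)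
    exact ofReal_le_ofReal (rpow_le_rpow ha.le hr.1 hs)
  by_contra hcon
  rw [not_lt, top_le_iff] at hcon
  rw [hcon, mul_top (by simpa using h0)] at h1
  grind

theorem LocFin.of_lintegral {μ : Measure ℝ} (h : ∫⁻ r, ofReal r ∂μ < ⊤) : LocFin μ :=
  LocFin.of_lintegral_rpow (s := 1) zero_le_one (by simpa using h)

theorem LocFin.integrable {μ : Measure ℝ} (hμ : LocFin μ) {f : ℝ → ℝ} (hf : Continuous f) {a b : ℝ}
    (ha : 0 < a) (hf0 : ∀ r, r ∉ Icc a b → f r = 0) : Integrable f μ := by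
  have h1 : IntegrableOn f (Icc a b) μ := by
    obtain ⟨C, hC⟩ := isCompact_Icc.exists_bound_of_continuousOn (s := Icc a b) hf.continuousOn
    exact Measure.integrableOn_of_bounded (hμ a b ha).ne hf.aestronglyMeasurable (M := C)
      ((ae_restrict_iff' measurableSet_Icc).2 (ae_of_all _ hC))
  refine (integrableOn_iff_integrable_of_support_subset fun r hr => ?_).1 h1
  by_contra h2
  exact hr (hf0 r h2)

theorem exists_Icc_of_tsupport_subset {f : ℝ → ℝ} (hc : HasCompactSupport f)
    (hs : tsupport f ⊆ Ioi 0) : ∃ a b : ℝ, 0 < a ∧ a ≤ b ∧ ∀ r, r ∉ Icc a b → f r = 0 := by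
  rcases (tsupport f).eq_empty_or_nonempty with h | h
  · exact ⟨1, 1, one_pos, le_rfl, fun r _ => image_eq_zero_of_notMem_tsupport (by rw [h]; simp)⟩
  · obtain ⟨a, ha⟩ := hc.isCompact.exists_isLeast h
    obtain ⟨b, hb⟩ := hc.isCompact.exists_isGreatest h
    exact ⟨a, b, hs ha.1, ha.2 hb.1, fun r hr => image_eq_zero_of_notMem_tsupport fun hm =>
      hr ⟨ha.2 hm, hb.2 hm⟩⟩

theorem tsupport_subset_of_zero {f : ℝ → ℝ} {a b : ℝ} (ha : 0 < a)
    (hf : ∀ r, r ∉ Icc a b → f r = 0) : HasCompactSupport f ∧ tsupport f ⊆ Ioi 0 := by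
  have h : tsupport f ⊆ Icc a b := closure_minimal (fun r hr => by
    by_contra h; exact hr (hf r h)) isClosed_Icc
  exact ⟨HasCompactSupport.of_support_subset_isCompact isCompact_Icc (subset_tsupport f |>.trans h),
    h.trans fun r hr => ha.trans_le hr.1⟩

theorem VagueTendsto.tendsto {ι : Type*} {F : Filter ι} {μ : ι → Measure ℝ} {ν : Measure ℝ}
    (h : VagueTendsto F μ ν) {f : ℝ → ℝ} (hf : Continuous f) {a b : ℝ} (ha : 0 < a)
    (hf0 : ∀ r, r ∉ Icc a b → f r = 0) : Tendsto (fun i => ∫ r, f r ∂(μ i)) F (𝓝 (∫ r, f r ∂ν)) :=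
  h f hf (tsupport_subset_of_zero ha hf0).1 (tsupport_subset_of_zero ha hf0).2

/-- Smooth cut-offs supported in `[1 / (j + 1), 2 (j + 1)]` that equal one on
`[2 / (j + 1), j + 1]`. -/
noncomputable def chi (j : ℕ) (r : ℝ) : ℝ := upStep (1 / (j + 1)) r * (1 - upStep (j + 1) r)

section Chi

variable {j : ℕ} {r : ℝ}

theorem contDiff_chi (j : ℕ) : ContDiff ℝ ∞ (chi j) :=
  (contDiff_upStep _).mul (contDiff_const.sub (contDiff_upStep _))

theorem chi_nonneg : 0 ≤ chi j r :=
  mul_nonneg upStep_nonneg (by linarith [upStep_le_one (R := (j : ℝ) + 1) (r := r)])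

theorem chi_le_one : chi j r ≤ 1 :=
  mul_le_one₀ upStep_le_one (by linarith [upStep_le_one (R := (j : ℝ) + 1) (r := r)])
    (by linarith [upStep_nonneg (R := (j : ℝ) + 1) (r := r)])

theorem abs_chi_le_one : |chi j r| ≤ 1 := by rw [abs_of_nonneg chi_nonneg]; exact chi_le_one

theorem chi_eq_zero (hr : r ∉ Icc (1 / ((j : ℝ) + 1)) (2 * (j + 1))) : chi j r = 0 := by
  rcases lt_or_ge r (1 / ((j : ℝ) + 1)) with h | h
  · rw [chi, upStep_eq_zero (by positivity) h.le, zero_mul]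
  · have : 2 * ((j : ℝ) + 1) < r := by grind
    rw [chi, upStep_eq_one (R := (j : ℝ) + 1) (by positivity) this.le]; ring

theorem chi_eq_one (h1 : 2 / ((j : ℝ) + 1) ≤ r) (h2 : r ≤ j + 1) : chi j r = 1 := by
  rw [chi, upStep_eq_one (by positivity) (by grind), upStep_eq_zero (by positivity) h2]; ring

theorem inv_succ_pos (j : ℕ) : 0 < 1 / ((j : ℝ) + 1) := by positivity

theorem eventually_chi_eq_one_Icc {a : ℝ} (ha : 0 < a) (b : ℝ) :
    ∀ᶠ j : ℕ in atTop, ∀ r ∈ Icc a b, chi j r = 1 := by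
  filter_upwards [eventually_ge_atTop ⌈2 / a⌉₊, eventually_ge_atTop ⌈b⌉₊] with j h1 h2 r hr
  have h3 := (Nat.le_ceil _).trans (Nat.cast_le (α := ℝ).2 h1)
  have h4 := (Nat.le_ceil _).trans (Nat.cast_le (α := ℝ).2 h2)
  rw [div_le_iff₀ ha] at h3
  refine chi_eq_one ?_ (by linarith [hr.2])
  rw [div_le_iff₀ (by positivity)]
  nlinarith [hr.1]

theorem eventually_chi_eq_one (hr : 0 < r) : ∀ᶠ j : ℕ in atTop, chi j r = 1 :=
  (eventually_chi_eq_one_Icc hr r).mono fun _ h => h r ⟨le_rfl, le_rfl⟩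

end Chi

theorem continuous_mul_of_continuousOn {g χ : ℝ → ℝ} (hg : ContinuousOn g (Ioi 0))
    (hχ : Continuous χ) {a b : ℝ} (ha : 0 < a) (h0 : ∀ r, r ∉ Icc a b → χ r = 0) :
    Continuous fun r => g r * χ r := by
  refine continuous_iff_continuousAt.2 fun r => ?_
  rcases lt_or_ge 0 r with hr | hr
  · exact (hg.continuousAt (Ioi_mem_nhds hr)).mul hχ.continuousAt
  · have : (fun r => g r * χ r) =ᶠ[𝓝 r] fun _ => 0 := by
      filter_upwards [gt_mem_nhds (hr.trans_lt ha)] with y hy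
      grind
    exact continuousAt_const.congr this.symm

theorem chi_continuous (j : ℕ) : Continuous (chi j) := (contDiff_chi j).continuous

theorem continuous_mul_chi {g : ℝ → ℝ} (hg : ContinuousOn g (Ioi 0)) (j : ℕ) :
    Continuous fun r => g r * chi j r :=
  continuous_mul_of_continuousOn hg (chi_continuous j) (inv_succ_pos j) fun _ => chi_eq_zero

theorem mul_chi_eq_zero {g : ℝ → ℝ} (j : ℕ) (r : ℝ)
    (hr : r ∉ Icc (1 / ((j : ℝ) + 1)) (2 * (j + 1))) : g r * chi j r = 0 := by
  rw [chi_eq_zero hr, mul_zero]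

theorem ae_pos_of_Iic {ν : Measure ℝ} (h : ν (Iic 0) = 0) : ∀ᵐ r ∂ν, 0 < r := by
  rw [ae_iff]; convert h using 2; ext; simp

/-- Fatou's lemma for the cut-offs. -/
theorem lintegral_le_of_forall_chi {ν : Measure ℝ} (hν : ν (Iic 0) = 0) {g : ℝ → ℝ}
    (hg : ContinuousOn g (Ioi 0)) {c : ℝ≥0∞}
    (h : ∀ᶠ j : ℕ in atTop, ∫⁻ r, ofReal (g r * chi j r) ∂ν ≤ c) : ∫⁻ r, ofReal (g r) ∂ν ≤ c := by
  have h1 :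
      ∫⁻ r, ofReal (g r) ∂ν ≤ ∫⁻ r, liminf (fun j : ℕ => ofReal (g r * chi j r)) atTop ∂ν := by
    refine lintegral_mono_ae ((ae_pos_of_Iic hν).mono fun r hr => ?_)
    have hev : ∀ᶠ j : ℕ in atTop, ofReal (g r * chi j r) = ofReal (g r) :=
      (eventually_chi_eq_one hr).mono fun j hj => by rw [hj, mul_one]
    rw [((tendsto_congr' hev).2 tendsto_const_nhds).liminf_eq]
  refine h1.trans ((lintegral_liminf_le fun j =>
    (continuous_mul_chi hg j).measurable.ennreal_ofReal).trans ?_)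
  exact liminf_le_of_frequently_le' h.frequently

/-- Lower semicontinuity of integrals of nonnegative continuous functions. -/
theorem VagueTendsto.lintegral_le {ι : Type*} {F : Filter ι} [F.NeBot] {μ : ι → Measure ℝ}
    {ν : Measure ℝ} (h : VagueTendsto F μ ν) (hν0 : ν (Iic 0) = 0) (hν : LocFin ν)
    (hμ : ∀ᶠ i in F, LocFin (μ i)) {g : ℝ → ℝ} (hg : ContinuousOn g (Ioi 0))
    (hg0 : ∀ r, 0 < r → 0 ≤ g r) {c : ℝ≥0∞} (hc : ∃ᶠ i in F, ∫⁻ r, ofReal (g r) ∂(μ i) ≤ c) :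
    ∫⁻ r, ofReal (g r) ∂ν ≤ c := by
  refine lintegral_le_of_forall_chi hν0 hg (Eventually.of_forall fun j => ?_)
  have hcont := continuous_mul_chi hg j
  have hnn : ∀ r, 0 ≤ g r * chi j r := fun r => by
    rcases lt_or_ge 0 r with hr | hr
    · exact mul_nonneg (hg0 r hr) chi_nonneg
    · rw [mul_chi_eq_zero]
      exact fun hm => absurd (hm.1.trans hr) (not_le.2 (inv_succ_pos j))
  have hlim := h.tendsto hcont (inv_succ_pos j) (mul_chi_eq_zero j)
  rw [← ofReal_integral_eq_lintegral_ofReal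
    (hν.integrable hcont (inv_succ_pos j) (mul_chi_eq_zero j)) (ae_of_all _ hnn)]
  refine le_of_tendsto_of_frequently (tendsto_ofReal hlim) ?_
  refine (hc.and_eventually hμ).mono fun i hi => ?_
  rw [ofReal_integral_eq_lintegral_ofReal
    (hi.2.integrable hcont (inv_succ_pos j) (mul_chi_eq_zero j)) (ae_of_all _ hnn)]
  refine (lintegral_mono fun r => ?_).trans hi.1
  rcases lt_or_ge 0 r with hr | hr
  · exact ofReal_le_ofReal (mul_le_of_le_one_right (hg0 r hr) chi_le_one)
  · rw [mul_chi_eq_zero _ _ fun hm => absurd (hm.1.trans hr) (not_le.2 (inv_succ_pos j)),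
      ofReal_zero]
    exact zero_le

/-- Conservation of the first moment under vague convergence, if no mass is lost at zero or at
infinity. -/
theorem VagueTendsto.lintegral_id_eq {ι : Type*} {F : Filter ι} [F.NeBot] {μ : ι → Measure ℝ}
    {ν : Measure ℝ} (h : VagueTendsto F μ ν) (hν0 : ν (Iic 0) = 0) (hν : LocFin ν) {s C ρ : ℝ}
    (hs : s < 1) (hE : ∀ᶠ i in F, ∫⁻ r, ofReal (r ^ s) ∂(μ i) ≤ ofReal C)
    (htail : ∀ δ : ℝ, 0 < δ → ∃ R : ℝ, ∀ᶠ i in F, ∫⁻ r in Ici R, ofReal r ∂(μ i) ≤ ofReal δ)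
    (hm : Tendsto (fun i => ∫⁻ r, ofReal r ∂(μ i)) F (𝓝 (ofReal ρ))) :
    ∫⁻ r, ofReal r ∂ν = ofReal ρ := by
  have hμ : ∀ᶠ i in F, LocFin (μ i) := by
    filter_upwards [hm.eventually (gt_mem_nhds ofReal_lt_top)] with i hi
    exact LocFin.of_lintegral hi
  refine le_antisymm ?_ ?_
  · refine ENNReal.le_of_forall_pos_le_add fun δ hδ _ => ?_
    have h1 : ∀ᶠ i in F, ∫⁻ r, ofReal r ∂(μ i) ≤ ofReal ρ + δ := (hm.eventually
      (gt_mem_nhds (ENNReal.lt_add_right ofReal_ne_top (by positivity)))).mono fun _ => le_of_lt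
    exact h.lintegral_le hν0 hν hμ (g := fun r => r) continuousOn_id (fun r hr => hr.le) h1.frequently
  · refine ENNReal.le_of_forall_pos_le_add fun δ hδ _ => ?_
    have hδ' : (0 : ℝ) < δ / 2 := half_pos hδ
    obtain ⟨R, hR⟩ := htail (δ / 2) hδ'
    have hsmall : Tendsto (fun j : ℕ => (2 / ((j : ℝ) + 1)) ^ (1 - s) * C) atTop (𝓝 0) := by
      have t1 : Tendsto (fun j : ℕ => 2 / ((j : ℝ) + 1)) atTop (𝓝 0) :=
        tendsto_const_nhds.div_atTop (tendsto_natCast_atTop_atTop.atTop_add tendsto_const_nhds)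
      have := (t1.rpow_const (p := 1 - s) (Or.inr (by linarith))).mul_const C
      rwa [zero_rpow (by linarith), zero_mul] at this
    obtain ⟨j, hj1, hj2⟩ :=
      ((hsmall.eventually (gt_mem_nhds hδ')).and (eventually_ge_atTop ⌈R⌉₊)).exists
    have hjR : R ≤ j := (Nat.le_ceil _).trans (Nat.cast_le.2 hj2)
    have hcont := continuous_mul_chi (g := fun r => r) continuousOn_id j
    have hnn : ∀ r : ℝ, 0 ≤ r * chi j r := fun r => by
      rcases lt_or_ge 0 r with hr | hr
      · exact mul_nonneg hr.le chi_nonneg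
      · rw [mul_chi_eq_zero (g := fun r => r)]
        exact fun hm => absurd (hm.1.trans hr) (not_le.2 (inv_succ_pos j))
    have hlim := h.tendsto hcont (inv_succ_pos j) (mul_chi_eq_zero j)
    have hle : ∀ᶠ i in F, ∫⁻ r, ofReal r ∂(μ i) ≤ ofReal (∫ r, r * chi j r ∂(μ i)) + δ := by
      filter_upwards [hE, hR, hμ] with i h1 h2 h3
      rw [ofReal_integral_eq_lintegral_ofReal
        (h3.integrable hcont (inv_succ_pos j) (mul_chi_eq_zero j)) (ae_of_all _ hnn)]
      -- near zero the moment of order `s < 1` controls the mass, beyond `R` the tail bound does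
      have h4 : ∀ r, ofReal r ≤ ofReal (r * chi j r) + (ofReal ((2 / ((j : ℝ) + 1)) ^ (1 - s))
          * ofReal (r ^ s) + (Ici R).indicator (fun r => ofReal r) r) := by
        intro r
        rcases le_or_gt r 0 with hr | hr
        · rw [ENNReal.ofReal_of_nonpos hr]; exact zero_le
        rcases le_or_gt (2 / ((j : ℝ) + 1)) r with h5 | h5
        · rcases le_or_gt r (j + 1) with h6 | h6
          · rw [chi_eq_one h5 h6, mul_one]; exact le_self_add
          · rw [indicator_of_mem (show r ∈ Ici R by grind)]
            exact le_add_left (le_add_left le_rfl)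
        · refine le_add_left (le_add_right ?_)
          rw [← ofReal_mul (by positivity)]
          refine ofReal_le_ofReal ?_
          calc r = r ^ (1 - s) * r ^ s := by rw [← rpow_add hr]; simp
            _ ≤ _ := by gcongr
      refine (lintegral_mono h4).trans ?_
      rw [lintegral_add_left hcont.measurable.ennreal_ofReal,
        lintegral_add_right _ (measurable_ofReal.indicator measurableSet_Ici),
        lintegral_const_mul' _ _ ofReal_ne_top, lintegral_indicator measurableSet_Ici]
      refine add_le_add le_rfl ?_
      have h5 : ofReal ((2 / ((j : ℝ) + 1)) ^ (1 - s)) * ∫⁻ r, ofReal (r ^ s) ∂(μ i)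
          ≤ ofReal (δ / 2) := by
        refine (mul_le_mul_right h1 _).trans ?_
        rw [← ofReal_mul (by positivity)]
        gcongr
      refine (add_le_add h5 h2).trans (le_of_eq ?_)
      rw [← ofReal_add hδ'.le hδ'.le, add_halves, ofReal_coe_nnreal]
    refine (le_of_tendsto_of_tendsto hm ((tendsto_ofReal hlim).add_const _) hle).trans ?_
    refine add_le_add ?_ le_rfl
    rw [ofReal_integral_eq_lintegral_ofReal
      (hν.integrable hcont (inv_succ_pos j) (mul_chi_eq_zero j)) (ae_of_all _ hnn)]
    refine lintegral_mono_ae ((ae_pos_of_Iic hν0).mono fun r hr => ofReal_le_ofReal ?_)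
    exact mul_le_of_le_one_right (le_of_lt hr) chi_le_one

/-- The Riesz representation of the limit of the integrals of test functions. -/
theorem exists_vagueTendsto {F : Filter ℕ} [F.NeBot] {μ : ℕ → Measure ℝ}
    (hμ : ∀ᶠ k in F, LocFin (μ k)) (h : ∀ f : ℝ → ℝ, Continuous f → ∀ a b : ℝ, 0 < a →
    (∀ r, r ∉ Icc a b → f r = 0) → ∃ l, Tendsto (fun k => ∫ r, f r ∂(μ k)) F (𝓝 l)) :
    ∃ ν : Measure ℝ, ν (Iic 0) = 0 ∧ LocFin ν ∧ VagueTendsto F μ ν := by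
  classical
  set X := Ioi (0 : ℝ)
  have : LocallyCompactSpace X := isOpen_Ioi.locallyCompactSpace
  set ext : C_c(X, ℝ) → ℝ → ℝ := fun g => Subtype.val.extend g 0 with hext
  have hcont : ∀ g, Continuous (ext g) := fun g =>
    g.hasCompactSupport.continuous_extend_zero isOpen_Ioi g.continuous
  have hext_val : ∀ g (y : X), ext g y = g y := fun g y => Subtype.val_injective.extend_apply _ _ _
  have hext_out : ∀ g r, r ∉ X → ext g r = 0 := fun g r hr => Function.extend_apply' _ _ _ (by
    grind)
  have hsupp : ∀ g, ∃ a b : ℝ, 0 < a ∧ ∀ r, r ∉ Icc a b → ext g r = 0 := by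
    intro g
    have hc : HasCompactSupport (ext g) ∧ tsupport (ext g) ⊆ Ioi 0 := by
      have h1 := g.hasCompactSupport.tsupport_extend_zero_subset (continuous_subtype_val (p := (· ∈ X)))
      refine ⟨HasCompactSupport.of_support_subset_isCompact (g.hasCompactSupport.isCompact.image
        continuous_subtype_val) ((subset_tsupport _).trans h1), h1.trans ?_⟩
      grind
    obtain ⟨a, b, ha, _, hab⟩ := exists_Icc_of_tsupport_subset hc.1 hc.2
    exact ⟨a, b, ha, hab⟩
  have hlim : ∀ g : C_c(X, ℝ), ∃ l, Tendsto (fun k => ∫ r, ext g r ∂(μ k)) F (𝓝 l) := fun g => by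
    obtain ⟨a, b, ha, hab⟩ := hsupp g
    exact h _ (hcont g) a b ha hab
  choose L hL using hlim
  have hint : ∀ g : C_c(X, ℝ), ∀ᶠ k in F, Integrable (ext g) (μ k) := fun g => by
    obtain ⟨a, b, ha, hab⟩ := hsupp g
    exact hμ.mono fun k hk => hk.integrable (hcont g) ha hab
  have hadd : ∀ f g : C_c(X, ℝ), ∀ r, ext (f + g) r = ext f r + ext g r := by
    intro f g r
    by_cases hr : r ∈ X
    · have := hext_val (f + g) ⟨r, hr⟩
      rw [CompactlySupportedContinuousMap.add_apply] at this
      grind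
    grind
  have hsmul : ∀ (c : ℝ) (f : C_c(X, ℝ)), ∀ r, ext (c • f) r = c * ext f r := by
    intro c f r
    by_cases hr : r ∈ X
    · have := hext_val (c • f) ⟨r, hr⟩
      rw [show ext (c • f) r = c * f ⟨r, hr⟩ from this, ← hext_val f]
    grind
  let Λ : C_c(X, ℝ) →ₚ[ℝ] ℝ := PositiveLinearMap.mk₀ {
      toFun := L
      map_add' := fun f g => by
        refine tendsto_nhds_unique (hL (f + g)) (((hL f).add (hL g)).congr' ?_)
        filter_upwards [hint f, hint g] with k h1 h2
        rw [← integral_add h1 h2]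
        exact integral_congr_ae (ae_of_all _ fun r => (hadd f g r).symm)
      map_smul' := fun c f => by
        refine tendsto_nhds_unique (hL (c • f)) (((hL f).const_mul c).congr fun k => ?_)
        rw [← integral_const_mul]
        exact integral_congr_ae (ae_of_all _ fun r => (hsmul c f r).symm) }
    (fun g hg => by
      refine ge_of_tendsto (hL g) (Eventually.of_forall fun k => integral_nonneg fun r => ?_)
      by_cases hr : r ∈ X
      · have := hext_val g ⟨r, hr⟩
        rw [show ext g r = g ⟨r, hr⟩ from this]; exact hg _
      · rw [hext_out _ _ hr]; exact le_rfl)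
  have hΛ : ∀ g, Λ g = L g := fun g => rfl
  have hemb : MeasurableEmbedding (Subtype.val : X → ℝ) := MeasurableEmbedding.subtype_coe measurableSet_Ioi
  have hpre : ∀ a b : ℝ, 0 < a → IsCompact ((Subtype.val : X → ℝ) ⁻¹' Icc a b) := by
    intro a b ha
    rw [Subtype.isCompact_iff, Subtype.image_preimage_coe, inter_eq_right.2]
    · exact isCompact_Icc
    grind
  refine ⟨(RealRMK.rieszMeasure Λ).map Subtype.val, ?_, ?_, ?_⟩
  · rw [hemb.map_apply]
    convert measure_empty (μ := RealRMK.rieszMeasure Λ)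
    ext y
    simp only [mem_preimage, mem_Iic, mem_empty_iff_false, iff_false, not_le]
    exact y.2
  · intro a b ha
    rw [hemb.map_apply]
    exact (hpre a b ha).measure_lt_top
  · intro f hf hc hs
    obtain ⟨a, b, ha, _, hab⟩ := exists_Icc_of_tsupport_subset hc hs
    let g : C_c(X, ℝ) := ⟨⟨fun y => f y, hf.comp continuous_subtype_val⟩,
      HasCompactSupport.of_support_subset_isCompact (hpre a b ha) fun y hy => by
        by_contra h2; exact hy (hab _ h2)⟩
    have hgf : ext g = f := by
      funext r
      by_cases hr : r ∈ X
      · exact hext_val g ⟨r, hr⟩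
      · rw [hext_out _ _ hr, hab]
        grind
    have h1 := RealRMK.integral_rieszMeasure Λ g
    rw [hemb.integral_map, show (∫ y : X, f y ∂(RealRMK.rieszMeasure Λ)) = L g from h1.trans (hΛ g)]
    have := hL g
    rwa [hgf] at this

/-! ### Compactness of the empirical measures -/

theorem exists_tendsto_of_approx {u : ℕ → ℝ} (h : ∀ δ : ℝ, 0 < δ →
    ∃ v : ℕ → ℝ, (∃ l, Tendsto v atTop (𝓝 l)) ∧ ∀ᶠ k in atTop, |u k - v k| ≤ δ) :
    ∃ l, Tendsto u atTop (𝓝 l) := by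
  refine cauchySeq_tendsto_of_complete (Metric.cauchySeq_iff'.2 fun δ hδ => ?_)
  obtain ⟨v, ⟨l, hl⟩, hv⟩ := h (δ / 5) (by positivity)
  obtain ⟨N, hN⟩ := eventually_atTop.1 (hv.and (Metric.tendsto_nhds.1 hl (δ / 5) (by positivity)))
  refine ⟨N, fun k hk => ?_⟩
  have h1 := (hN k hk).1
  have h2 := (hN k hk).2
  have h3 := (hN N le_rfl).1
  have h4 := (hN N le_rfl).2
  rw [dist_eq] at *
  grind

theorem tendsto_of_approx {u : ℕ → ℝ} {l : ℝ} (h : ∀ δ : ℝ, 0 < δ →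
    ∃ (v : ℕ → ℝ) (m : ℝ), Tendsto v atTop (𝓝 m) ∧ |m - l| ≤ δ ∧ ∀ᶠ k in atTop, |u k - v k| ≤ δ) :
    Tendsto u atTop (𝓝 l) := by
  refine Metric.tendsto_nhds.2 fun δ hδ => ?_
  obtain ⟨v, m, hm, hml, hv⟩ := h (δ / 4) (by positivity)
  filter_upwards [hv, Metric.tendsto_nhds.1 hm (δ / 4) (by positivity)] with k h1 h2
  rw [dist_eq] at *
  grind

/-- Uniform approximation of test functions by polynomials times cut-offs. -/
theorem exists_polynomial_mul_chi {f : ℝ → ℝ} (hf : Continuous f) {a b : ℝ} (ha : 0 < a)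
    (hf0 : ∀ r, r ∉ Icc a b → f r = 0) :
    ∃ j : ℕ, ∀ δ : ℝ, 0 < δ → ∃ P : Polynomial ℝ, ∀ r, |f r - P.eval r * chi j r| ≤ δ := by
  obtain ⟨j, hj⟩ := (eventually_chi_eq_one_Icc ha b).exists
  refine ⟨j, fun δ hδ => ?_⟩
  obtain ⟨P, hP⟩ :=
    exists_polynomial_near_of_continuousOn (1 / ((j : ℝ) + 1)) (2 * (j + 1)) f hf.continuousOn δ hδ
  refine ⟨P, fun r => ?_⟩
  have h1 : f r = f r * chi j r := by grind
  by_cases hr : r ∈ Icc (1 / ((j : ℝ) + 1)) (2 * (j + 1))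
  · rw [h1, ← sub_mul, abs_mul]
    have h2 := (hP r hr).le
    rw [abs_sub_comm] at h2
    exact (mul_le_of_le_one_right (abs_nonneg _) abs_chi_le_one).trans h2
  · rw [h1, chi_eq_zero hr]; grind

namespace BoundedSeq

variable {p : Rates} {ρ₀ x T K : ℝ} {ε : ℕ → ℝ} {n : ℕ → ℝ → ℕ → ℝ} {w : ℕ → ℝ → ℝ → ℝ}

section

variable (h : BoundedSeq p ρ₀ x T K ε n w)
include h

theorem locFin (k : ℕ) {t : ℝ} (ht : t ∈ Icc 0 T) : LocFin (macroMeasure x (ε k) (n k t)) :=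
  LocFin.of_lintegral (by
    rw [((h.curve k).isState t ht).lintegral_macroMeasure_eq (h.pos k)]
    simp)

theorem eventually_integral_eq {a : ℝ} (ha : 0 < a) :
    ∀ᶠ k in atTop, ∀ t ∈ Icc 0 T, ∀ (b : ℝ) (f : ℝ → ℝ), (∀ r, r ∉ Icc a b → f r = 0) →
    ∫ r, f r ∂(macroMeasure x (ε k) (n k t)) = esum b (ε k) (n k t) f := by
  filter_upwards [h.eventually_cutoff ha] with k hk t ht b f hf
  exact integral_macroMeasure (h.pos k) ((h.curve k).isState t ht).1 hf hk.1

theorem eventually_abs_integral_le {a : ℝ} (ha : 0 < a) :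
    ∀ᶠ k in atTop, ∀ t ∈ Icc 0 T, ∀ (b M : ℝ) (f : ℝ → ℝ), (∀ r, r ∉ Icc a b → f r = 0) →
    (∀ r, |f r| ≤ M) → |∫ r, f r ∂(macroMeasure x (ε k) (n k t))| ≤ ρ₀ / a * M := by
  filter_upwards [h.eventually_integral_eq ha] with k hk t ht b M f hf hM
  rw [hk t ht b f hf]
  exact abs_esum_le ((h.curve k).isState t ht) (h.pos k) ha ((abs_nonneg _).trans (hM 0)) hf hM

theorem equicontinuous_of_contDiff {a b : ℝ} (ha : 0 < a) {f : ℝ → ℝ} (hf1 : ContDiff ℝ 1 f)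
    (hf : ∀ r, r ∉ Icc a b → f r = 0) {δ : ℝ} (hδ : 0 < δ) :
    ∃ η : ℝ, 0 < η ∧ ∀ᶠ k in atTop, ∀ s ∈ Icc 0 T, ∀ t ∈ Icc 0 T, |t - s| ≤ η →
    |(∫ r, f r ∂(macroMeasure x (ε k) (n k t))) - ∫ r, f r ∂(macroMeasure x (ε k) (n k s))|
    ≤ δ := by
  obtain ⟨L, hL⟩ := hf1.lipschitzWith_of_hasCompactSupport (tsupport_subset_of_zero ha hf).1 one_ne_zero
  have hK := h.K_nonneg
  set C := (a / 2) ^ (p.α - 1) * nhMass p ρ₀ * (L : ℝ) ^ 2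
  have hC : 0 ≤ C := by
    have := nhMass_nonneg p h.ρ₀_pos.le
    positivity
  set θ := δ / (K + 1) with hθ
  have hθ0 : 0 < θ := by positivity
  have hθK : θ * K ≤ δ := by rw [hθ, div_mul_eq_mul_div, div_le_iff₀ (by positivity)]; nlinarith
  refine ⟨θ * δ / (C + 1), by positivity, ?_⟩
  filter_upwards [h.eventually_cutoff ha, h.eventually_integral_eq ha] with k hk1 hk2
  have key : ∀ s ∈ Icc 0 T, ∀ t ∈ Icc 0 T, s ≤ t → t - s ≤ θ * δ / (C + 1) →
      |esum b (ε k) (n k t) f - esum b (ε k) (n k s) f| ≤ δ := by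
    intro s hs t ht hst hη
    have h1 := (h.curve k).two_mul_abs_esum_sub_le h.T_pos (h.pos k) h.ρ₀_pos hs.1 hst ht.2
      (b := b) hθ0 hK hk1.2 hf1 hf (L := L) (fun r => by
        have := hL.dist_le_mul (r + ε k) r
        rwa [dist_eq, dist_eq, add_sub_cancel_left, abs_of_pos (h.pos k)] at this)
        (h.action k)
    have h2 : θ⁻¹ * ((t - s) * C) ≤ δ := by
      rw [le_div_iff₀ (by positivity)] at hη
      rw [inv_mul_le_iff₀ hθ0]
      nlinarith
    linarith
  intro s hs t ht hη
  rw [hk2 t ht b f hf, hk2 s hs b f hf]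
  rcases le_total s t with hst | hst
  · exact key s hs t ht hst ((le_abs_self _).trans hη)
  · rw [abs_sub_comm]
    rw [abs_sub_comm] at hη
    exact key t ht s hs hst ((le_abs_self _).trans hη)

theorem integral_sub_le {f g : ℝ → ℝ} (hf : Continuous f) (hg : Continuous g) {a b : ℝ} (ha : 0 < a)
    (hf0 : ∀ r, r ∉ Icc a b → f r = 0) (hg0 : ∀ r, r ∉ Icc a b → g r = 0) {δ : ℝ}
    (hfg : ∀ r, |f r - g r| ≤ δ) :
    ∀ᶠ k in atTop, ∀ t ∈ Icc 0 T, |(∫ r, f r ∂(macroMeasure x (ε k) (n k t)))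
    - ∫ r, g r ∂(macroMeasure x (ε k) (n k t))| ≤ ρ₀ / a * δ := by
  filter_upwards [h.eventually_abs_integral_le ha] with k hk t ht
  rw [← integral_sub ((h.locFin k ht).integrable hf ha hf0) ((h.locFin k ht).integrable hg ha hg0)]
  exact hk t ht b δ _ (fun r hr => by grind) hfg

omit h in
/-- A test function and its approximation by a smooth test function, with a common support. -/
theorem exists_approx {f : ℝ → ℝ} (hf : Continuous f) {a b : ℝ} (ha : 0 < a)
    (hf0 : ∀ r, r ∉ Icc a b → f r = 0) : ∃ (j : ℕ) (c d : ℝ), 0 < c ∧ (∀ r, r ∉ Icc c d → f r = 0) ∧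
    (∀ (P : Polynomial ℝ) r, r ∉ Icc c d → P.eval r * chi j r = 0) ∧ ∀ δ : ℝ, 0 < δ →
    ∃ P : Polynomial ℝ, ∀ r, |f r - P.eval r * chi j r| ≤ δ := by
  obtain ⟨j, hj⟩ := exists_polynomial_mul_chi hf ha hf0
  refine ⟨j, min a (1 / ((j : ℝ) + 1)), max b (2 * (j + 1)), lt_min ha (inv_succ_pos j),
    fun r hr => hf0 r fun hm => hr ⟨(min_le_left _ _).trans hm.1, hm.2.trans (le_max_left _ _)⟩,
    fun P r hr => ?_, hj⟩
  rw [chi_eq_zero, mul_zero]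
  exact fun hm => hr ⟨(min_le_right _ _).trans hm.1, hm.2.trans (le_max_right _ _)⟩

omit h in
theorem contDiff_poly_mul_chi (P : Polynomial ℝ) (j : ℕ) :
    ContDiff ℝ ∞ fun r => P.eval r * chi j r :=
  by
  have h : (fun r : ℝ => P.eval r) = fun r : ℝ => Polynomial.aeval r P := by simp
  have h2 : ContDiff ℝ ∞ fun r : ℝ => P.eval r := by rw [h]; exact P.contDiff_aeval ∞
  exact h2.mul (contDiff_chi j)

theorem equicontinuous {a b : ℝ} (ha : 0 < a) {f : ℝ → ℝ} (hf1 : Continuous f)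
    (hf : ∀ r, r ∉ Icc a b → f r = 0) {δ : ℝ} (hδ : 0 < δ) :
    ∃ η : ℝ, 0 < η ∧ ∀ᶠ k in atTop, ∀ s ∈ Icc 0 T, ∀ t ∈ Icc 0 T, |t - s| ≤ η →
    |(∫ r, f r ∂(macroMeasure x (ε k) (n k t))) - ∫ r, f r ∂(macroMeasure x (ε k) (n k s))|
    ≤ δ := by
  obtain ⟨j, c, d, hc, hf0, hP0, happ⟩ := exists_approx hf1 ha hf
  have hρ := h.ρ₀_pos
  obtain ⟨P, hP⟩ := happ (δ / 3 / (ρ₀ / c)) (by positivity)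
  have hs := contDiff_poly_mul_chi P j
  obtain ⟨η, hη, hk⟩ :=
    h.equicontinuous_of_contDiff hc (hs.of_le (by simp)) (hP0 P) (δ := δ / 3) (by positivity)
  refine ⟨η, hη, ?_⟩
  filter_upwards [hk, h.integral_sub_le hf1 hs.continuous hc hf0 (hP0 P) hP] with k h1 h2 s hs t ht hst
  have h3 := h1 s hs t ht hst
  have h4 := h2 s hs
  have h5 := h2 t ht
  rw [mul_div_cancel₀ _ (by positivity)] at h4 h5
  rw [abs_le] at *
  constructor <;> linarith

/-- Compactness of the empirical measures: along a subsequence they converge vaguely, at every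
time. -/
theorem exists_subseq_vagueTendsto :
    ∃ (σ : ℕ → ℕ) (ν : ℝ → Measure ℝ), StrictMono σ ∧ ∀ t ∈ Icc 0 T, ν t (Iic 0) = 0 ∧
    LocFin (ν t) ∧ VagueTendsto atTop (fun k => macroMeasure x (ε (σ k)) (n (σ k) t)) (ν t) := by
  classical
  have hne : Nonempty (Icc (0 : ℝ) T) := ⟨⟨0, le_rfl, h.T_pos.le⟩⟩
  set τ : ℕ → Icc (0 : ℝ) T := TopologicalSpace.denseSeq (Icc (0 : ℝ) T)
  set f : ℕ → ℕ → ℝ → ℝ := fun j m r => r ^ m * chi j r with hf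
  have hfP : ∀ j m : ℕ, f j m = fun r => (Polynomial.X ^ m : Polynomial ℝ).eval r * chi j r := by
    intro j m; simp [hf]
  have hf0 : ∀ (j m : ℕ) (r : ℝ), r ∉ Icc (1 / ((j : ℝ) + 1)) (2 * (j + 1)) → f j m r = 0 := fun j m r hr => by
    simp only [hf]; rw [chi_eq_zero hr, mul_zero]
  have hfc : ∀ j m, Continuous (f j m) := fun j m => by
    rw [hfP]; exact (contDiff_poly_mul_chi _ _).continuous
  have hbd : ∀ j m, ∃ M, 0 ≤ M ∧ ∀ r, |f j m r| ≤ M := by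
    intro j m
    obtain ⟨C, hC⟩ := (hfc j m).bounded_above_of_compact_support
      (tsupport_subset_of_zero (inv_succ_pos j) (hf0 j m)).1
    exact ⟨C, (norm_nonneg _).trans (hC 0), hC⟩
  choose M hM0 hM using hbd
  set u : ℕ → (ℕ × ℕ × ℕ → ℝ) := fun k i =>
    esum (2 * ((i.2.1 : ℝ) + 1)) (ε k) (n k (τ i.1)) (f i.2.1 i.2.2) with hu
  set B : ℕ × ℕ × ℕ → ℝ := fun i => ρ₀ / (1 / ((i.2.1 : ℝ) + 1)) * M i.2.1 i.2.2
  have hmem : ∀ k, u k ∈ Set.pi univ fun i => Icc (-B i) (B i) := by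
    intro k i _
    rw [mem_Icc, ← abs_le]
    exact abs_esum_le ((h.curve k).isState _ (τ i.1).2) (h.pos k) (inv_succ_pos _) (hM0 _ _)
      (hf0 _ _) (hM _ _)
  obtain ⟨l, -, σ, hσ, hl⟩ := (isCompact_univ_pi fun i => isCompact_Icc).tendsto_subseq hmem
  rw [tendsto_pi_nhds] at hl
  have h' := h.comp hσ
  refine ⟨σ, ?_⟩
  -- convergence of the integrals of all test functions at all times
  have hconv :
      ∀ t ∈ Icc 0 T, ∀ f : ℝ → ℝ, Continuous f → ∀ a b : ℝ, 0 < a → (∀ r, r ∉ Icc a b → f r = 0) →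
      ∃ l, Tendsto (fun k => ∫ r, f r ∂(macroMeasure x (ε (σ k)) (n (σ k) t))) atTop (𝓝 l) := by
    intro t ht
    have hmono : ∀ j m, ∃ l,
        Tendsto (fun k => ∫ r, f j m r ∂(macroMeasure x (ε (σ k)) (n (σ k) t))) atTop (𝓝 l) := by
      intro j m
      refine exists_tendsto_of_approx fun δ hδ => ?_
      obtain ⟨η, hη, hk⟩ := h'.equicontinuous (inv_succ_pos j) (hfc j m) (hf0 j m) hδ
      obtain ⟨i, hi⟩ :=
        (TopologicalSpace.denseRange_denseSeq (Icc (0 : ℝ) T)).exists_dist_lt ⟨t, ht⟩ hη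
      refine ⟨fun k => ∫ r, f j m r ∂(macroMeasure x (ε (σ k)) (n (σ k) (τ i))),
        ⟨l (i, j, m), (hl (i, j, m)).congr' ?_⟩, ?_⟩
      · filter_upwards [h'.eventually_integral_eq (inv_succ_pos j)] with k hk
        grind
      · filter_upwards [hk] with k hk
        exact hk _ (τ i).2 t ht (le_of_lt hi)
    have hpoly : ∀ j (P : Polynomial ℝ), ∃ l, Tendsto
        (fun k => ∫ r, P.eval r * chi j r ∂(macroMeasure x (ε (σ k)) (n (σ k) t))) atTop (𝓝 l) := by
      intro j P
      choose l' hl' using hmono j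
      refine ⟨∑ m ∈ P.support, P.coeff m * l' m, ?_⟩
      refine (tendsto_finsetSum _ fun m _ => (hl' m).const_mul (P.coeff m)).congr fun k => ?_
      rw [← sum_congr rfl fun m _ => integral_const_mul _ _, ← integral_finsetSum]
      · refine integral_congr_ae (ae_of_all _ fun r => ?_)
        simp only [hf]
        rw [Polynomial.eval_eq_sum, Polynomial.sum, sum_mul]
        grind
      · exact fun m _ => ((h'.locFin k ht).integrable (hfc j m) (inv_succ_pos j) (hf0 j m)).const_mul _
    intro g hg a b ha hg0
    obtain ⟨j, c, d, hc, hg1, hP0, happ⟩ := exists_approx hg ha hg0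
    have hρ := h.ρ₀_pos
    refine exists_tendsto_of_approx fun δ hδ => ?_
    obtain ⟨P, hP⟩ := happ (δ / (ρ₀ / c)) (by positivity)
    refine ⟨_, hpoly j P, ?_⟩
    filter_upwards
      [h'.integral_sub_le hg (contDiff_poly_mul_chi P j).continuous hc hg1 (hP0 P) hP] with k hk
    grind
  have hex : ∀ t : ℝ, ∃ ν : Measure ℝ, t ∈ Icc 0 T → ν (Iic 0) = 0 ∧ LocFin ν ∧
      VagueTendsto atTop (fun k => macroMeasure x (ε (σ k)) (n (σ k) t)) ν := by
    intro t
    by_cases ht : t ∈ Icc 0 T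
    · obtain ⟨ν, hν⟩ :=
        exists_vagueTendsto (Eventually.of_forall fun k => h'.locFin k ht) (hconv t ht)
      grind
    · exact ⟨0, fun h => absurd h ht⟩
  choose ν hν using hex
  exact ⟨ν, hσ, hν⟩

end

end BoundedSeq

/-! ### Properties of the limit curve -/

/-- A curve of measures on `(0, ∞)` is the pointwise vague limit of the empirical measures. -/
def IsVagueLimit (T x : ℝ) (ε : ℕ → ℝ) (n : ℕ → ℝ → ℕ → ℝ) (ν : ℝ → Measure ℝ) : Prop :=
  ∀ t ∈ Icc 0 T, ν t (Iic 0) = 0 ∧ LocFin (ν t) ∧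
    VagueTendsto atTop (fun k => macroMeasure x (ε k) (n k t)) (ν t)

namespace BoundedSeq

variable {p : Rates} {ρ₀ x T K : ℝ} {ε : ℕ → ℝ} {n : ℕ → ℝ → ℕ → ℝ} {w : ℕ → ℝ → ℝ → ℝ}
  {ν : ℝ → Measure ℝ}

section

variable (h : BoundedSeq p ρ₀ x T K ε n w) (hν : IsVagueLimit T x ε n ν)
include h hν

theorem continuousOn_integral {a b : ℝ} (ha : 0 < a) {f : ℝ → ℝ} (hf : Continuous f)
    (hf0 : ∀ r, r ∉ Icc a b → f r = 0) : ContinuousOn (fun t => ∫ r, f r ∂(ν t)) (Icc 0 T) := by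
  refine Metric.continuousOn_iff.2 fun s hs δ hδ => ?_
  obtain ⟨η, hη, hk⟩ := h.equicontinuous ha hf hf0 (half_pos hδ)
  refine ⟨η, hη, fun t ht hts => ?_⟩
  have h1 := (((hν t ht).2.2.tendsto hf ha hf0).sub ((hν s hs).2.2.tendsto hf ha hf0)).abs
  have h2 := le_of_tendsto h1 (hk.mono fun k hk => hk s hs t ht (le_of_lt hts))
  rw [dist_eq]; linarith

omit hν in
theorem lintegral_rpow_le : ∃ C : ℝ, 0 ≤ C ∧ ∀ᶠ k in atTop, ∀ t ∈ Icc 0 T,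
    ∫⁻ r, ofReal (r ^ (1 - p.γ)) ∂(macroMeasure x (ε k) (n k t)) ≤ ofReal C := by
  obtain ⟨C, hC, hev⟩ := h.eventually_energy
  have hq : 0 < p.q / (1 - p.γ) := div_pos p.q_pos p.one_sub_γ_pos
  refine ⟨C / (p.q / (1 - p.γ)), by positivity, hev.mono fun k hk t ht => ?_⟩
  have := hk t ht
  rw [energyLSW] at this
  rw [ENNReal.ofReal_div_of_pos hq]
  exact (ENNReal.le_div_iff_mul_le (Or.inl (by simpa using hq)) (Or.inl ofReal_ne_top)).2
    (by rwa [mul_comm])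

theorem isLSWState {t : ℝ} (ht : t ∈ Icc 0 T) : IsLSWState (ρ₀ - p.ρs) (ν t) := by
  refine ⟨(hν t ht).1, ?_⟩
  obtain ⟨C, -, hev⟩ := h.lintegral_rpow_le
  refine (hν t ht).2.2.lintegral_id_eq (hν t ht).1 (hν t ht).2.1 (s := 1 - p.γ)
    (by linarith [p.γ_pos]) (hev.mono fun k hk => hk t ht) (fun δ hδ => ?_) ?_
  · obtain ⟨R, _, hR⟩ := h.eventually_tail_le hδ
    exact ⟨R, hR.mono fun k hk => hk t ht⟩
  · have h1 : ∀ᶠ k in atTop, ∫⁻ r, ofReal r ∂(macroMeasure x (ε k) (n k t)) = ofReal (ρ₀ - ∑ i ∈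
        Finset.range (cutoff x (ε k) - 1), (i + 1 : ℕ) * n k t (i + 1)) := Eventually.of_forall fun
        k => ((h.curve k).isState t ht).lintegral_macroMeasure_eq (h.pos k) x
    refine (tendsto_congr' h1).2 (tendsto_ofReal (tendsto_const_nhds.sub ?_))
    obtain ⟨r, hr, hev⟩ := exists_small_mass_bound p h.x_pos h.x_lt ρ₀ h.K_nonneg
    refine tendsto_iff_dist_tendsto_zero.2
      (squeeze_zero' (Eventually.of_forall fun _ => dist_nonneg) ?_ (hr.comp h.tendsto_nhdsGT))
    filter_upwards [h.tendsto_nhdsGT.eventually hev] with k hk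
    exact hk _ ((h.curve k).isState t ht) (h.energy k t ht)

/-- The lower bound for the energy. -/
theorem energyLSW_le {t : ℝ} (ht : t ∈ Icc 0 T) {c : ℝ≥0∞}
    (hc : ∃ᶠ k in atTop, freeEnergyε p (ε k) (n k t) ≤ c) : energyLSW p (ν t) ≤ c := by
  rcases eq_or_ne c ⊤ with rfl | hctop
  · exact le_top
  have hq : 0 < p.q / (1 - p.γ) := div_pos p.q_pos p.one_sub_γ_pos
  have hform :
      ∀ μ : Measure ℝ, energyLSW p μ = ∫⁻ r, ofReal (p.q / (1 - p.γ) * r ^ (1 - p.γ)) ∂μ := by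
    intro μ
    rw [energyLSW, ← lintegral_const_mul' _ _ ofReal_ne_top]
    exact lintegral_congr fun r => (ofReal_mul hq.le).symm
  have hθ : ∀ θ : ℝ, 0 < θ → θ < 1 → ∀ δ : ℝ≥0, 0 < δ → energyLSW p (ν t) ≤ (c + δ) / ofReal θ := by
    intro θ h0 h1 δ hδ
    obtain ⟨r, hr, hev⟩ := exists_energy_bound p h.x_pos ρ₀ h0 h1
    rw [hform]
    refine (hν t ht).2.2.lintegral_le (hν t ht).1 (hν t ht).2.1
      (Eventually.of_forall fun k => h.locFin k ht) (g := fun r => p.q / (1 - p.γ) * r ^ (1 - p.γ))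
      (continuousOn_const.mul (continuousOn_id.rpow_const fun r hr => Or.inl (ne_of_gt hr)))
      (fun r hr => mul_nonneg hq.le (rpow_nonneg hr.le _)) ?_
    refine (hc.and_eventually ((h.tendsto_nhdsGT.eventually hev).and ((hr.comp
      h.tendsto_nhdsGT).eventually (gt_mem_nhds (NNReal.coe_pos.2 hδ))))).mono fun k hk => ?_
    rw [← hform, ENNReal.le_div_iff_mul_le (Or.inl (by simpa using h0)) (Or.inl ofReal_ne_top),
      mul_comm]
    refine (hk.2.1.2 _ ((h.curve k).isState t ht)).trans (add_le_add hk.1 ?_)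
    rw [← ofReal_coe_nnreal]
    exact ofReal_le_ofReal (le_of_lt hk.2.2)
  refine ENNReal.le_of_forall_pos_le_add fun δ hδ _ => ?_
  have hlim : Tendsto (fun θ : ℝ => (c + δ) / ofReal θ) (𝓝[<] 1) (𝓝 ((c + δ) / ofReal 1)) := by
    refine ENNReal.Tendsto.div tendsto_const_nhds (Or.inr (by simp))
      (tendsto_ofReal tendsto_id |>.mono_left nhdsWithin_le_nhds) (Or.inl ofReal_ne_top)
  rw [ofReal_one, div_one] at hlim
  refine ge_of_tendsto hlim ?_
  have h1 : ∀ᶠ θ : ℝ in 𝓝[<] 1, 0 < θ := mem_nhdsWithin_of_mem_nhds (lt_mem_nhds one_pos)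
  filter_upwards [h1, self_mem_nhdsWithin] with θ h2 h3
  grind

/-- The limit curve has uniformly small tails. -/
theorem tail_le {δ : ℝ} (hδ : 0 < δ) :
    ∃ R : ℝ, 0 < R ∧ ∀ t ∈ Icc 0 T, ∫⁻ r in Ici R, ofReal r ∂(ν t) ≤ ofReal δ := by
  obtain ⟨R, hR, hev⟩ := h.eventually_tail_le hδ
  refine ⟨2 * R, by linarith, fun t ht => ?_⟩
  have hg : ∀ r, (0 : ℝ) < r → 0 ≤ r * upStep R r := fun r hr => mul_nonneg hr.le upStep_nonneg
  have h1 := (hν t ht).2.2.lintegral_le (hν t ht).1 (hν t ht).2.1 (Eventually.of_forall fun k =>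
    h.locFin k ht) (g := fun r => r * upStep R r) ((continuous_id.mul (contDiff_upStep
    R).continuous).continuousOn) hg (c := ofReal δ) (hev.mono fun k hk => by
      refine le_trans ?_ (hk t ht)
      rw [← lintegral_indicator measurableSet_Ici]
      refine lintegral_mono fun r => ?_
      by_cases hr : r ∈ Ici R
      · rw [indicator_of_mem hr]
        exact ofReal_le_ofReal (mul_le_of_le_one_right (hR.le.trans hr) upStep_le_one)
      · rw [upStep_eq_zero hR (le_of_lt (not_le.1 hr)), mul_zero, ofReal_zero]
        exact zero_le).frequently
  refine le_trans ?_ h1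
  rw [← lintegral_indicator measurableSet_Ici]
  refine lintegral_mono fun r => ?_
  by_cases hr : r ∈ Ici (2 * R)
  · rw [indicator_of_mem hr, upStep_eq_one hR hr, mul_one]
  · rw [indicator_of_notMem hr]; exact zero_le

end

end BoundedSeq

/-! ### Curves of measures as kernels, and the representation of fluxes by velocities -/

/-- Vaguely continuous curves in the state manifold. -/
structure IsStateCurve (ρ T : ℝ) (ν : ℝ → Measure ℝ) : Prop where
  isState : ∀ t ∈ Icc 0 T, IsLSWState ρ (ν t)
  continuousOn : ∀ (f : ℝ → ℝ) (a b : ℝ), 0 < a → Continuous f → (∀ r, r ∉ Icc a b → f r = 0) →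
    ContinuousOn (fun t => ∫ r, f r ∂(ν t)) (Icc 0 T)

theorem IsLSWState.locFin {ρ : ℝ} {ν : Measure ℝ} (h : IsLSWState ρ ν) : LocFin ν :=
  LocFin.of_lintegral (by rw [h.2]; simp)

theorem BoundedSeq.isStateCurve {p : Rates} {ρ₀ x T K : ℝ} {ε : ℕ → ℝ} {n : ℕ → ℝ → ℕ → ℝ} {w : ℕ →
    ℝ → ℝ → ℝ} {ν : ℝ → Measure ℝ} (h : BoundedSeq p ρ₀ x T K ε n w) (hν : IsVagueLimit T x ε n ν) :
    IsStateCurve (ρ₀ - p.ρs) T ν :=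
  ⟨fun _ ht => h.isLSWState hν ht, fun _ _ _ ha hf hf0 => h.continuousOn_integral hν ha hf hf0⟩

open scoped Classical in
/-- The finite measures `r ν_t(dr)`, extended by zero to all times. -/
noncomputable def momentCurve (T : ℝ) (ν : ℝ → Measure ℝ) (t : ℝ) : Measure ℝ :=
  if t ∈ Icc 0 T then (ν t).withDensity fun r => ofReal r else 0

/-- Bounded continuous test functions on `ℝ × (0, ∞)` that vanish for `r` outside a compact subset
of `(0, ∞)`. -/
def IsTestFn (φ : ℝ × ℝ → ℝ) : Prop :=
  Continuous φ ∧ ∃ a b M : ℝ, 0 < a ∧ (∀ z, |φ z| ≤ M) ∧ ∀ t r, r ∉ Icc a b → φ (t, r) = 0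

/-- The space of test functions. -/
def testFns : Submodule ℝ (ℝ × ℝ → ℝ) where
  carrier := {φ | IsTestFn φ}
  zero_mem' := ⟨continuous_const, 1, 1, 0, one_pos, by simp, by simp⟩
  add_mem' := by
    rintro φ ψ ⟨h1, a, b, M, ha, hM, h0⟩ ⟨h2, a', b', M', ha', hM', h0'⟩
    refine ⟨h1.add h2, min a a', max b b', M + M', lt_min ha ha', fun z =>
      (abs_add_le _ _).trans (add_le_add (hM z) (hM' z)), fun t r hr => ?_⟩
    rw [Pi.add_apply, h0, h0', add_zero]
    · grind
    grind
  smul_mem' := by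
    rintro c φ ⟨h1, a, b, M, ha, hM, h0⟩
    refine ⟨h1.const_smul c, a, b, |c| * M, ha, fun z => ?_, fun t r hr => ?_⟩
    · rw [Pi.smul_apply, smul_eq_mul, abs_mul]
      exact mul_le_mul_of_nonneg_left (hM z) (abs_nonneg c)
    · rw [Pi.smul_apply, h0 t r hr, smul_zero]

namespace IsStateCurve

variable {ρ T : ℝ} {ν : ℝ → Measure ℝ}

theorem momentCurve_of_mem {t : ℝ} (ht : t ∈ Icc 0 T) :
    momentCurve T ν t = (ν t).withDensity fun r => ofReal r := if_pos ht

theorem momentCurve_univ_le (h : IsStateCurve ρ T ν) (t : ℝ) :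
    momentCurve T ν t univ ≤ ofReal ρ := by
  by_cases ht : t ∈ Icc 0 T
  · rw [momentCurve_of_mem ht, withDensity_apply _ MeasurableSet.univ, Measure.restrict_univ,
      (h.isState t ht).2]
  · rw [momentCurve, if_neg ht]; simp

theorem measurable_momentCurve (h : IsStateCurve ρ T ν) : Measurable (momentCurve T ν) := by
  classical
  have hfin : ∀ t, IsFiniteMeasure (momentCurve T ν t) := fun t =>
    ⟨(h.momentCurve_univ_le t).trans_lt ofReal_lt_top⟩
  have hite : ∀ (f : ℝ → ℝ≥0∞), ContinuousOn f (Icc 0 T) →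
      Measurable fun t => if t ∈ Icc 0 T then f t else 0 := fun f hf =>
    hf.measurable_piecewise continuousOn_const measurableSet_Icc
  refine Measurable.measure_of_isPiSystem ((BorelSpace.measurable_eq (α := ℝ)).trans
    borel_eq_generateFrom_isClosed) isPiSystem_isClosed (fun s hs => ?_) ?_
  · have hs : IsClosed s := hs
    set g : ℕ → ℝ → ℝ := fun j r => hs.apprSeq j r * chi j r with hg
    have hgc : ∀ j : ℕ, Continuous fun r => r * g j r := fun j => by
      have := chi_continuous j
      simp only [hg]; fun_prop
    have hg0 : ∀ (j : ℕ) (r : ℝ), r ∉ Icc (1 / ((j : ℝ) + 1)) (2 * (j + 1)) → r * g j r = 0 :=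
      fun j r hr => by simp only [hg]; rw [chi_eq_zero hr, mul_zero, mul_zero]
    have hgnn : ∀ j r, 0 ≤ g j r := fun j r => mul_nonneg NNReal.zero_le_coe chi_nonneg
    have hgle : ∀ j r, g j r ≤ 1 := fun j r => mul_le_one₀
      (mod_cast HasOuterApproxClosed.apprSeq_apply_le_one hs j r) chi_nonneg chi_le_one
    have hlim : ∀ r, 0 < r →
        Tendsto (fun j => ofReal (r * g j r)) atTop (𝓝 (s.indicator (fun r => ofReal r) r)) := by
      intro r hr
      have h1 := (NNReal.tendsto_coe.2 (tendsto_pi_nhds.1 (HasOuterApproxClosed.tendsto_apprSeq hs) r)).mul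
        (tendsto_const_nhds.congr' ((eventually_chi_eq_one hr).mono fun _ h => h.symm))
      convert tendsto_ofReal (h1.const_mul r) using 2
      by_cases hm : r ∈ s <;> simp [hm]
    refine ENNReal.measurable_of_tendsto (f := fun j t => if t ∈ Icc 0 T then
      ofReal (∫ r, r * g j r ∂(ν t)) else 0) (fun j => hite _ ?_) ?_
    · exact ENNReal.continuous_ofReal.comp_continuousOn
        (h.continuousOn _ _ _ (inv_succ_pos j) (hgc j) (hg0 j))
    · refine tendsto_pi_nhds.2 fun t => ?_
      by_cases ht : t ∈ Icc 0 T
      · simp only [if_pos ht]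
        rw [momentCurve_of_mem ht, withDensity_apply _ hs.measurableSet,
          ← lintegral_indicator hs.measurableSet]
        have hst := h.isState t ht
        have hpos := ae_pos_of_Iic hst.1
        have heq : ∀ j, ofReal (∫ r, r * g j r ∂(ν t)) = ∫⁻ r, ofReal (r * g j r) ∂(ν t) := fun j =>
          ofReal_integral_eq_lintegral_ofReal (hst.locFin.integrable (hgc j) (inv_succ_pos j) (hg0
          j)) (hpos.mono fun r hr => mul_nonneg (le_of_lt hr) (hgnn j r))
        simp only [heq]
        refine tendsto_lintegral_of_dominated_convergence (fun r => ofReal r)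
          (fun j => (hgc j).measurable.ennreal_ofReal) (fun j => hpos.mono fun r hr =>
            ofReal_le_ofReal (mul_le_of_le_one_right (le_of_lt hr) (hgle j r)))
          (by rw [hst.2]; simp) (hpos.mono fun r hr => hlim r hr)
      · simp only [if_neg ht, momentCurve]
        simp
  · have : (fun t => momentCurve T ν t univ) = fun t => if t ∈ Icc 0 T then ofReal ρ else 0 := by
      funext t
      split_ifs with ht
      · rw [momentCurve_of_mem ht, withDensity_apply _ MeasurableSet.univ, Measure.restrict_univ,
          (h.isState t ht).2]
      · rw [momentCurve, if_neg ht]; simp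
    rw [this]
    fun_prop

/-- The kernel of the finite measures `r ν_t(dr)`. -/
noncomputable def kernel (h : IsStateCurve ρ T ν) : ProbabilityTheory.Kernel ℝ ℝ :=
  ⟨momentCurve T ν, h.measurable_momentCurve⟩

instance isFiniteKernel (h : IsStateCurve ρ T ν) :
  ProbabilityTheory.IsFiniteKernel h.kernel := ⟨⟨ofReal ρ, ofReal_lt_top, h.momentCurve_univ_le⟩⟩

/-- The measure `r ν_t(dr) dt` on `[0, T] × (0, ∞)`. -/
noncomputable def spaceTime (h : IsStateCurve ρ T ν) : Measure (ℝ × ℝ) :=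
  vol[T].compProd h.kernel

instance (h : IsStateCurve ρ T ν) : IsFiniteMeasure h.spaceTime := by
  unfold spaceTime; infer_instance

section

variable (h : IsStateCurve ρ T ν)
include h

theorem lintegral_kernel {t : ℝ} (ht : t ∈ Icc 0 T) {F : ℝ → ℝ≥0∞} (hF : Measurable F) :
    ∫⁻ r, F r ∂(h.kernel t) = ∫⁻ r, ofReal r * F r ∂(ν t) := by
  change ∫⁻ r, F r ∂(momentCurve T ν t) = _
  rw [momentCurve_of_mem ht, lintegral_withDensity_eq_lintegral_mul _ measurable_ofReal hF]
  rfl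

theorem integral_kernel {t : ℝ} (ht : t ∈ Icc 0 T) (F : ℝ → ℝ) :
    ∫ r, F r ∂(h.kernel t) = ∫ r, r * F r ∂(ν t) := by
  change ∫ r, F r ∂(momentCurve T ν t) = _
  rw [momentCurve_of_mem ht, integral_withDensity_eq_integral_toReal_smul measurable_ofReal
    (ae_of_all _ fun _ => ofReal_lt_top)]
  refine integral_congr_ae ((ae_pos_of_Iic (h.isState t ht).1).mono fun r hr => ?_)
  change (ofReal r).toReal • F r = _
  rw [toReal_ofReal (le_of_lt hr), smul_eq_mul]

theorem lintegral_spaceTime {F : ℝ × ℝ → ℝ≥0∞} (hF : Measurable F) :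
    ∫⁻ z, F z ∂h.spaceTime = ∫⁻ t in Icc 0 T, ∫⁻ r, ofReal r * F (t, r) ∂(ν t) := by
  rw [spaceTime, Measure.lintegral_compProd hF]
  exact setLIntegral_congr_fun measurableSet_Icc fun t ht =>
    h.lintegral_kernel ht (hF.comp measurable_prodMk_left)

theorem integral_spaceTime {F : ℝ × ℝ → ℝ} (hF : Integrable F h.spaceTime) :
    ∫ z, F z ∂h.spaceTime = ∫ t in Icc 0 T, ∫ r, r * F (t, r) ∂(ν t) := by
  rw [spaceTime, Measure.integral_compProd hF]
  exact setIntegral_congr_fun measurableSet_Icc fun t ht => h.integral_kernel ht _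

/-- Integrals over `ν_t` of functions of time and size depend measurably on time. -/
theorem aemeasurable_lintegral {F : ℝ × ℝ → ℝ≥0∞} (hF : Measurable F) :
    AEMeasurable (fun t => ∫⁻ r, F (t, r) ∂(ν t)) vol[T] := by
  obtain ⟨G, hG, hGF⟩ :
      ∃ G : ℝ × ℝ → ℝ≥0∞, Measurable G ∧ ∀ t r, 0 < r → ofReal r * G (t, r) = F (t, r) := by
    refine ⟨fun z => ofReal z.2⁻¹ * F z, measurable_snd.inv.ennreal_ofReal.mul hF, fun t r hr => ?_⟩
    change ofReal r * (ofReal r⁻¹ * F (t, r)) = F (t, r)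
    rw [← mul_assoc, ← ofReal_mul hr.le, mul_inv_cancel₀ hr.ne', ofReal_one, one_mul]
  refine ⟨fun t => ∫⁻ r, G (t, r) ∂(h.kernel t), hG.lintegral_kernel_prod_right', ?_⟩
  filter_upwards [ae_mem_Icc] with t ht
  refine Eq.trans ?_ (h.lintegral_kernel ht (hG.comp measurable_prodMk_left)).symm
  exact lintegral_congr_ae ((ae_pos_of_Iic (h.isState t ht).1).mono fun r hr => (hGF t r hr).symm)

theorem integrable_integral {F : ℝ × ℝ → ℝ} (hF : Integrable F h.spaceTime) :
    Integrable (fun t => ∫ r, r * F (t, r) ∂(ν t)) vol[T] := by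
  refine hF.integral_compProd.congr ?_
  filter_upwards [ae_mem_Icc] with t ht
  rw [ProbabilityTheory.Kernel.prodMkLeft_apply, h.integral_kernel ht]

end

end IsStateCurve

/-- A linear functional `L` that satisfies `2 L φ ≤ A + |ι φ|²` is represented by a vector of
squared length at most `A`. -/
theorem exists_inner_eq {V H : Type*} [AddCommGroup V] [Module ℝ V] [NormedAddCommGroup H]
    [InnerProductSpace ℝ H] [CompleteSpace H] (L : V →ₗ[ℝ] ℝ) (ι : V →ₗ[ℝ] H) {A : ℝ} (hA : 0 ≤ A)
    (h : ∀ φ, 2 * L φ ≤ A + ‖ι φ‖ ^ 2) : ∃ y : H, ‖y‖ ^ 2 ≤ A ∧ ∀ φ, L φ = inner ℝ y (ι φ) := by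
  have hb : ∀ φ, |L φ| ≤ sqrt A * ‖ι φ‖ := by
    intro φ
    -- the hypothesis for all multiples of `φ` says that a quadratic polynomial is nonnegative
    have h1 : ∀ s : ℝ, 0 ≤ ‖ι φ‖ ^ 2 * (s * s) + (-(2 * L φ)) * s + A := by
      intro s
      have := h (s • φ)
      rw [map_smul, map_smul, norm_smul, smul_eq_mul, mul_pow, norm_eq_abs, sq_abs] at this
      linarith
    have h2 := discrim_le_zero h1
    rw [discrim] at h2
    rw [← Real.sqrt_sq (norm_nonneg (ι φ)), ← Real.sqrt_mul hA]
    exact Real.abs_le_sqrt (by linarith)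
  obtain ⟨s, hs⟩ := ι.rangeRestrict.exists_rightInverse_of_surjective ι.range_rangeRestrict
  have hs' : ∀ y : LinearMap.range ι, ι (s y) = y := fun y => by
    have := LinearMap.congr_fun hs y
    exact congrArg Subtype.val this
  set L₀ : StrongDual ℝ (LinearMap.range ι) := (L.comp s).mkContinuous (sqrt A) fun y => by
    have := hb (s y)
    rw [hs'] at this
    exact this
  obtain ⟨g, hg, hgn⟩ := exists_extension_norm_eq (LinearMap.range ι) L₀
  refine ⟨(InnerProductSpace.toDual ℝ H).symm g, ?_, fun φ => ?_⟩
  · rw [LinearIsometryEquiv.norm_map, hgn]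
    have hn : ‖L₀‖ ≤ sqrt A := LinearMap.mkContinuous_norm_le _ (sqrt_nonneg _) _
    calc ‖L₀‖ ^ 2 ≤ sqrt A ^ 2 := pow_le_pow_left₀ (norm_nonneg L₀) hn 2
      _ = A := sq_sqrt hA
  · rw [InnerProductSpace.toDual_symm_apply]
    have h1 := hg ⟨ι φ, LinearMap.mem_range_self ι φ⟩
    change g (ι φ) = L (s ⟨ι φ, LinearMap.mem_range_self ι φ⟩) at h1
    rw [h1]
    have h2 := hb (φ - s ⟨ι φ, LinearMap.mem_range_self ι φ⟩)
    rw [map_sub ι, hs', sub_self, norm_zero, mul_zero, map_sub] at h2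
    grind

/-- Fluxes of finite action are given by velocities. -/
theorem IsStateCurve.exists_velocity {ρ T : ℝ} {ν : ℝ → Measure ℝ} (h : IsStateCurve ρ T ν)
    (p : Rates) {A : ℝ} (hA : 0 ≤ A) (L : testFns →ₗ[ℝ] ℝ)
    (hL : ∀ φ : testFns, 2 * L φ ≤ A + ∫ t in Icc 0 T, ∫ r, r ^ p.α * φ.1 (t, r) ^ 2 ∂(ν t)) :
    ∃ v : ℝ → ℝ → ℝ, Measurable (Function.uncurry v) ∧ ∫⁻ t in Icc 0 T, actionLSW p (ν t) (v t)
    ≤ ofReal A ∧ ∀ φ : testFns, L φ = ∫ t in Icc 0 T, ∫ r, r ^ p.α * v t r * φ.1 (t, r) ∂(ν t) := by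
  -- this weight makes up for the difference between `r ∂ν`, which defines `h.spaceTime`, and `r ^ α ∂ν`
  set wt : ℝ × ℝ → ℝ := fun z => z.2 ^ ((p.α - 1) / 2) with hwt
  have hwm : Measurable wt := measurable_snd.pow_const _
  have hmem : ∀ φ : testFns, MemLp (fun z => wt z * φ.1 z) 2 h.spaceTime := by
    rintro ⟨φ, hφ, a, b, M, ha, hM, h0⟩
    refine MemLp.of_bound (hwm.mul hφ.measurable).aestronglyMeasurable (a ^ ((p.α - 1) / 2) * M)
      (ae_of_all _ fun z => ?_)
    by_cases hz : z.2 ∈ Icc a b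
    · rw [norm_mul, norm_eq_abs, norm_eq_abs, hwt, abs_of_nonneg (rpow_nonneg (ha.le.trans hz.1) _)]
      exact mul_le_mul (rpow_le_rpow_of_nonpos ha hz.1 (by linarith [p.α_lt_one])) (hM z)
        (abs_nonneg _) (by positivity)
    · have : φ z = 0 := h0 z.1 z.2 hz
      simp only [this, mul_zero, norm_zero]
      exact mul_nonneg (by positivity) ((abs_nonneg _).trans (hM z))
  let ι : testFns →ₗ[ℝ] Lp ℝ 2 h.spaceTime := {
      toFun := fun φ => (hmem φ).toLp
      map_add' := fun φ ψ => by
        rw [← MemLp.toLp_add]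
        refine MemLp.toLp_congr _ _ (ae_of_all _ fun z => ?_)
        change wt z * (φ.1 z + ψ.1 z) = wt z * φ.1 z + wt z * ψ.1 z
        ring
      map_smul' := fun c φ => by
        rw [RingHom.id_apply, ← MemLp.toLp_const_smul]
        refine MemLp.toLp_congr _ _ (ae_of_all _ fun z => ?_)
        change wt z * (c * φ.1 z) = c * (wt z * φ.1 z)
        ring }
  have hι : ∀ φ, ι φ =ᵐ[h.spaceTime] fun z => wt z * φ.1 z := fun φ => (hmem φ).coeFn_toLp
  have hpow : ∀ r : ℝ, 0 < r → r * (r ^ ((p.α - 1) / 2)) ^ 2 = r ^ p.α := fun r hr => by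
    rw [← rpow_natCast, ← rpow_mul hr.le]
    nth_rewrite 1 [← rpow_one r]
    rw [← rpow_add hr]; simp
  have hnorm : ∀ φ, ‖ι φ‖ ^ 2 = ∫ t in Icc 0 T, ∫ r, r ^ p.α * φ.1 (t, r) ^ 2 ∂(ν t) := by
    intro φ
    rw [← real_inner_self_eq_norm_sq, L2.inner_def]
    have h1 : ∫ z, inner ℝ (ι φ z) (ι φ z) ∂h.spaceTime = ∫ z, (wt z * φ.1 z) ^ 2 ∂h.spaceTime :=
      integral_congr_ae ((hι φ).mono fun z hz => by
        change inner ℝ (ι φ z) (ι φ z) = _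
        rw [hz, real_inner_self_eq_norm_sq, norm_eq_abs, sq_abs])
    rw [h1, h.integral_spaceTime (hmem φ).integrable_sq]
    refine setIntegral_congr_fun measurableSet_Icc fun t ht => ?_
    refine integral_congr_ae ((ae_pos_of_Iic (h.isState t ht).1).mono fun r hr => ?_)
    grind
  obtain ⟨y, hyA, hy⟩ := exists_inner_eq L ι hA fun φ => by grind
  have hym : Measurable y := (Lp.stronglyMeasurable y).measurable
  refine ⟨fun t r => y (t, r) * r ^ ((1 - p.α) / 2), ?_, ?_, fun φ => ?_⟩
  · fun_prop
  · have h1 : ∫⁻ z, ofReal (y z ^ 2) ∂h.spaceTime = ofReal (‖y‖ ^ 2) := by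
      rw [← real_inner_self_eq_norm_sq, L2.inner_def, ofReal_integral_eq_lintegral_ofReal]
      · simp
      · exact L2.integrable_inner y y
      · exact ae_of_all _ fun z => real_inner_self_nonneg
    rw [h.lintegral_spaceTime (hym.pow_const 2).ennreal_ofReal] at h1
    refine le_trans (le_of_eq ?_) (h1.le.trans (ofReal_le_ofReal hyA))
    refine setLIntegral_congr_fun measurableSet_Icc fun t ht => ?_
    refine lintegral_congr_ae ((ae_pos_of_Iic (h.isState t ht).1).mono fun r hr => ?_)
    change ofReal (r ^ p.α * (y (t, r) * r ^ ((1 - p.α) / 2)) ^ 2) = ofReal r * ofReal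
      (y (t, r) ^ 2)
    rw [← ofReal_mul (le_of_lt hr), mul_pow, ← rpow_natCast (r ^ ((1 - p.α) / 2)),
      ← rpow_mul (le_of_lt hr)]
    have : r ^ p.α * r ^ ((1 - p.α) / 2 * ((2 : ℕ) : ℝ)) = r := by
      rw [← rpow_add hr]
      simp
    grind
  · rw [hy, L2.inner_def]
    have h1 : ∫ z, inner ℝ (y z) (ι φ z) ∂h.spaceTime = ∫ z, y z * (wt z * φ.1 z) ∂h.spaceTime :=
      integral_congr_ae ((hι φ).mono fun z hz => by
        change inner ℝ (y z) (ι φ z) = _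
        rw [hz]
        simp only [RCLike.inner_apply, conj_trivial]
        ring)
    rw [h1, h.integral_spaceTime (F := fun z => y z * (wt z * φ.1 z))
      ((Lp.memLp y).integrable_mul (hmem φ))]
    refine setIntegral_congr_fun measurableSet_Icc fun t ht => ?_
    refine integral_congr_ae ((ae_pos_of_Iic (h.isState t ht).1).mono fun r hr => ?_)
    change r * (y (t, r) * (r ^ ((p.α - 1) / 2) * φ.1 (t, r)))
      = r ^ p.α * (y (t, r) * r ^ ((1 - p.α) / 2)) * φ.1 (t, r)
    have : r ^ p.α * r ^ ((1 - p.α) / 2) = r * r ^ ((p.α - 1) / 2) := by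
      rw [← rpow_add hr]
      nth_rewrite 2 [← rpow_one r]
      rw [← rpow_add hr]; congr 1; ring
    grind

/-! ### Compactness of the fluxes -/

/-- The pairing `∑_l J_l(t) φ(t, ε l)` of the rescaled fluxes at time `t` with a test function. -/
noncomputable def fluxAt (p : Rates) (ε : ℝ) (n : ℝ → ℕ → ℝ) (w : ℝ → ℝ → ℝ) (φ : ℝ × ℝ → ℝ)
    (t : ℝ) : ℝ :=
  ∑' i : ℕ, IsRescaledCurve.rflux p ε n w (i + 1) t * φ (t, ε * (i + 1 : ℕ))

/-- The pairing of the rescaled fluxes with a test function of time and size. -/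
noncomputable def totalFlux (p : Rates) (T ε : ℝ) (n : ℝ → ℕ → ℝ) (w : ℝ → ℝ → ℝ) (φ : ℝ × ℝ → ℝ) :
    ℝ :=
  ∫ t in Icc 0 T, fluxAt p ε n w φ t

/-- A countable family that approximates all test functions uniformly, with control of supports. -/
theorem exists_dense_testFn {T : ℝ} (hT : 0 < T) :
    ∃ ψ : ℕ → ℕ → ℝ × ℝ → ℝ, (∀ m j, IsTestFn (ψ m j)) ∧ ∀ φ, IsTestFn φ →
    ∃ (m : ℕ) (c d : ℝ), 0 < c ∧ (∀ t r, r ∉ Icc c d → φ (t, r) = 0 ∧ ∀ j, ψ m j (t, r) = 0) ∧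
    ∀ δ : ℝ, 0 < δ → ∃ j, ∀ t ∈ Icc 0 T, ∀ r, |φ (t, r) - ψ m j (t, r)| ≤ δ := by
  have hle : ∀ m : ℕ, 1 / ((m : ℝ) + 1) ≤ 2 * (m + 1) := fun m => by
    have : (0 : ℝ) ≤ m := m.cast_nonneg
    rw [div_le_iff₀ (by positivity)]; nlinarith
  let D : ∀ m : ℕ, ℕ → C(Icc (0 : ℝ) T × Icc (1 / ((m : ℝ) + 1)) (2 * (m + 1)), ℝ) := fun m =>
    have : Nonempty (C(Icc (0 : ℝ) T × Icc (1 / ((m : ℝ) + 1)) (2 * (m + 1)), ℝ)) := ⟨0⟩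
    TopologicalSpace.denseSeq _
  refine ⟨fun m j z => chi m z.2 * D m j (projIcc 0 T hT.le z.1, projIcc _ _ (hle m) z.2), fun m j
    => ⟨?_, _, 2 * ((m : ℝ) + 1), ‖D m j‖, inv_succ_pos m, fun z => ?_, fun t r hr => ?_⟩, ?_⟩
  · have := chi_continuous m
    have h2 := (D m j).continuous
    have h3 : Continuous (projIcc 0 T hT.le) := continuous_projIcc
    have h4 : Continuous (projIcc _ _ (hle m)) := continuous_projIcc
    fun_prop
  · rw [abs_mul]
    exact (mul_le_of_le_one_left (abs_nonneg _) abs_chi_le_one).trans ((D m j).norm_coe_le_norm _)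
  · simp only [chi_eq_zero hr, zero_mul]
  · rintro φ ⟨hφ, a, b, M, ha, hM, h0⟩
    obtain ⟨m, hm⟩ := (eventually_chi_eq_one_Icc ha b).exists
    have hchi : ∀ t r, φ (t, r) = chi m r * φ (t, r) := fun t r => by grind
    refine ⟨m, _, 2 * ((m : ℝ) + 1), inv_succ_pos m, fun t r hr => ⟨?_, fun j => ?_⟩, fun δ hδ => ?_⟩
    · rw [hchi, chi_eq_zero hr, zero_mul]
    · simp only [chi_eq_zero hr, zero_mul]
    · let F : C(Icc (0 : ℝ) T × Icc (1 / ((m : ℝ) + 1)) (2 * (m + 1)), ℝ) :=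
        ⟨fun z => φ (z.1, z.2), by fun_prop⟩
      have : Nonempty (C(Icc (0 : ℝ) T × Icc (1 / ((m : ℝ) + 1)) (2 * (m + 1)), ℝ)) := ⟨0⟩
      obtain ⟨j, hj⟩ := (TopologicalSpace.denseRange_denseSeq
        (C(Icc (0 : ℝ) T × Icc (1 / ((m : ℝ) + 1)) (2 * (m + 1)), ℝ))).exists_dist_lt F hδ
      refine ⟨j, fun t ht r => ?_⟩
      rw [hchi]
      simp only
      rw [← mul_sub, abs_mul]
      by_cases hr : r ∈ Icc (1 / ((m : ℝ) + 1)) (2 * (m + 1))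
      · refine (mul_le_of_le_one_left (abs_nonneg _) abs_chi_le_one).trans ?_
        rw [projIcc_of_mem hT.le ht, projIcc_of_mem (hle m) hr]
        exact (ContinuousMap.dist_apply_le_dist
          ((⟨t, ht⟩, ⟨r, hr⟩) : Icc (0 : ℝ) T × Icc (1 / ((m : ℝ) + 1)) (2 * (m + 1)))).trans hj.le
      · rw [chi_eq_zero hr, abs_zero, zero_mul]; exact hδ.le

section Curve

variable {p : Rates} {ρ₀ T ε : ℝ} {n : ℝ → ℕ → ℝ} {w : ℝ → ℝ → ℝ} {φ ψ : ℝ × ℝ → ℝ}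

theorem fluxAt_eq (hε : 0 < ε) {a b : ℝ} (h0 : ∀ t r, r ∉ Icc a b → φ (t, r) = 0) (t : ℝ) :
    fluxAt p ε n w φ t = ∑ i ∈ Finset.range (numSizes b ε), IsRescaledCurve.rflux p ε n w (i + 1) t
    * φ (t, ε * (i + 1 : ℕ)) :=
  tsum_eq_sum fun i hi => by
    rw [h0 _ _ fun hm => not_lt.2 hm.2 (lt_mul_of_numSizes_le hε (by simpa using hi)), mul_zero]

namespace IsRescaledCurve

section

variable (hc : IsRescaledCurve p ρ₀ T ε n w) (hT : 0 < T) (hε : 0 < ε) (hρ₀ : 0 < ρ₀)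
include hc hT hε hρ₀

theorem integrable_fluxAt (hφ : IsTestFn φ) : Integrable (fluxAt p ε n w φ) vol[T] := by
  obtain ⟨h1, a, b, M, ha, hM, h0⟩ := hφ
  refine (hc.integrable_sum_rflux_mul hT hε hρ₀ (numSizes b ε) (φ := fun i t => φ (t,
    ε * (i + 1 : ℕ))) fun i => by fun_prop).1.congr (ae_of_all _ fun t => (fluxAt_eq hε h0 t).symm)

theorem totalFlux_add (hφ : IsTestFn φ) (hψ : IsTestFn ψ) :
    totalFlux p T ε n w (φ + ψ) = totalFlux p T ε n w φ + totalFlux p T ε n w ψ := by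
  rw [totalFlux, totalFlux, totalFlux,
    ← integral_add (hc.integrable_fluxAt hT hε hρ₀ hφ) (hc.integrable_fluxAt hT hε hρ₀ hψ)]
  refine integral_congr_ae (ae_of_all _ fun t => ?_)
  obtain ⟨h1, a, b, M, ha, hM, h0⟩ := testFns.add_mem hφ hψ
  obtain ⟨-, a₁, b₁, -, -, -, h01⟩ := hφ
  obtain ⟨-, a₂, b₂, -, -, -, h02⟩ := hψ
  -- a common interval that contains both supports
  set c := max b₁ b₂
  set e := min a₁ a₂
  have h1' : ∀ t r, r ∉ Icc e c → φ (t, r) = 0 := fun t r hr => h01 t r fun hm =>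
    hr ⟨(min_le_left _ _).trans hm.1, hm.2.trans (le_max_left _ _)⟩
  have h2' : ∀ t r, r ∉ Icc e c → ψ (t, r) = 0 := fun t r hr => h02 t r fun hm =>
    hr ⟨(min_le_right _ _).trans hm.1, hm.2.trans (le_max_right _ _)⟩
  change fluxAt p ε n w (φ + ψ) t = fluxAt p ε n w φ t + fluxAt p ε n w ψ t
  rw [fluxAt_eq hε h1', fluxAt_eq hε h2', fluxAt_eq (b := c) (a := e) hε fun t r hr => by
    rw [Pi.add_apply, h1' t r hr, h2' t r hr, add_zero], ← sum_add_distrib]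
  exact sum_congr rfl fun i _ => by rw [Pi.add_apply, mul_add]

end

end IsRescaledCurve

theorem totalFlux_smul (p : Rates) (T ε : ℝ) (n : ℝ → ℕ → ℝ) (w : ℝ → ℝ → ℝ) (φ : ℝ × ℝ → ℝ)
    (c : ℝ) : totalFlux p T ε n w (c • φ) = c * totalFlux p T ε n w φ := by
  rw [totalFlux, totalFlux, ← integral_const_mul]
  congr 1
  funext t
  rw [fluxAt, fluxAt, ← tsum_mul_left]
  congr 1
  funext i
  rw [Pi.smul_apply, smul_eq_mul]; ring

theorem totalFlux_congr (h : ∀ t ∈ Icc 0 T, ∀ r, φ (t, r) = ψ (t, r)) :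
    totalFlux p T ε n w φ = totalFlux p T ε n w ψ :=
  setIntegral_congr_fun measurableSet_Icc fun t ht => by
    simp only [fluxAt, h t ht]

theorem IsRescaledCurve.abs_totalFlux_le (hc : IsRescaledCurve p ρ₀ T ε n w) (hT : 0 < T) (hε : 0
    < ε) (hρ₀ : 0 < ρ₀) {a b M K : ℝ} (ha : 0 < a) (hM : 0 < M) (hK : 0 ≤ K) (hφ : Continuous φ)
    (h0 : ∀ t r, r ∉ Icc a b → φ (t, r) = 0) (hφM : ∀ t ∈ Icc 0 T, ∀ r, |φ (t, r)| ≤ M)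
    (hA : ∫⁻ t in Icc 0 T, actionε p ε (n t) (w t) ≤ ofReal K) :
    |totalFlux p T ε n w φ| ≤ M * ((K + T * (a ^ (p.α - 1) * nhMass p ρ₀)) / 2) := by
  set φ' : ℝ × ℝ → ℝ := fun z => φ (projIcc 0 T hT.le z.1, z.2) with hφ'
  have hcont : Continuous φ' := by fun_prop
  rw [totalFlux_congr (ψ := φ') fun t ht r => by simp only [hφ', projIcc_of_mem hT.le ht]]
  have hint := hc.integrable_sum_rflux_mul hT hε hρ₀ (numSizes b ε)
    (φ := fun i t => φ' (t, ε * (i + 1 : ℕ))) fun i => by fun_prop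
  have h1 := hc.integral_sum_abs_rflux_le hT hε hρ₀ le_rfl hT.le le_rfl ha hM hK (numSizes b ε)
    (φ := fun i t => φ' (t, ε * (i + 1 : ℕ))) (fun i => by fun_prop)
    (fun i τ hi => h0 _ _ fun hm => not_lt.2 hm.1 hi) (fun i τ => hφM _ (projIcc 0 T hT.le τ).2 _) hA
  have h2 : |totalFlux p T ε n w φ'| ≤ ∫ τ in (0 : ℝ)..T, ∑ i ∈ Finset.range (numSizes b ε),
      |rflux p ε n w (i + 1) τ * φ' (τ, ε * (i + 1 : ℕ))| := by
    rw [intervalIntegral.integral_of_le hT.le, ← integral_Icc_eq_integral_Ioc, totalFlux]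
    refine (abs_integral_le_integral_abs).trans
      (integral_mono_of_nonneg (ae_of_all _ fun _ => abs_nonneg _) hint.2 (ae_of_all _ fun t => ?_))
    simp only
    rw [fluxAt_eq (φ := φ') (a := a) (b := b) hε fun t r hr => h0 _ _ hr]
    exact abs_sum_le_sum_abs _ _
  have h3 : M⁻¹ * ((T - 0) * (a ^ (p.α - 1) * nhMass p ρ₀ * M ^ 2))
      = M * (T * (a ^ (p.α - 1) * nhMass p ρ₀)) := by field_simp; ring
  linarith

end Curve

namespace BoundedSeq

variable {p : Rates} {ρ₀ x T K : ℝ} {ε : ℕ → ℝ} {n : ℕ → ℝ → ℕ → ℝ} {w : ℕ → ℝ → ℝ → ℝ}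

section

variable (h : BoundedSeq p ρ₀ x T K ε n w)
include h

theorem abs_totalFlux_sub_le {φ ψ : ℝ × ℝ → ℝ} (hφ : IsTestFn φ) (hψ : IsTestFn ψ) {a b : ℝ}
    (ha : 0 < a) (h0 : ∀ t r, r ∉ Icc a b → φ (t, r) = 0 ∧ ψ (t, r) = 0) {δ : ℝ} (hδ : 0 < δ)
    (hd : ∀ t ∈ Icc 0 T, ∀ r, |φ (t, r) - ψ (t, r)| ≤ δ) (k : ℕ) :
    |totalFlux p T (ε k) (n k) (w k) φ - totalFlux p T (ε k) (n k) (w k) ψ|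
    ≤ δ * ((K + T * (a ^ (p.α - 1) * nhMass p ρ₀)) / 2) := by
  have h1 := (h.curve k).totalFlux_add h.T_pos (h.pos k) h.ρ₀_pos hφ (testFns.smul_mem (-1 : ℝ) hψ)
  rw [totalFlux_smul, neg_one_mul, ← sub_eq_add_neg] at h1
  rw [← h1]
  refine (h.curve k).abs_totalFlux_le h.T_pos (h.pos k) h.ρ₀_pos ha hδ h.K_nonneg (b := b)
    (hφ.1.add (hψ.1.const_smul (-1 : ℝ))) (fun t r hr => ?_) (fun t ht r => ?_) (h.action k)
  · rw [Pi.add_apply, Pi.smul_apply, (h0 t r hr).1, (h0 t r hr).2, smul_zero, add_zero]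
  · rw [Pi.add_apply, Pi.smul_apply, smul_eq_mul, neg_one_mul, ← sub_eq_add_neg]
    exact hd t ht r

theorem exists_subseq_flux : ∃ (σ : ℕ → ℕ) (L : testFns →ₗ[ℝ] ℝ), StrictMono σ ∧ ∀ φ : testFns,
    Tendsto (fun k => totalFlux p T (ε (σ k)) (n (σ k)) (w (σ k)) φ.1) atTop (𝓝 (L φ)) := by
  obtain ⟨ψ, hψ, hdense⟩ := exists_dense_testFn h.T_pos
  have hbd : ∀ φ, IsTestFn φ → ∃ C : ℝ, ∀ k, |totalFlux p T (ε k) (n k) (w k) φ| ≤ C := by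
    rintro φ ⟨hφ, a, b, M, ha, hM, h0⟩
    exact ⟨_, fun k => (h.curve k).abs_totalFlux_le h.T_pos (h.pos k) h.ρ₀_pos ha (M := M + 1) (by
      linarith [(abs_nonneg _).trans (hM 0)]) h.K_nonneg hφ h0 (fun t _ r => by grind) (h.action k)⟩
  choose C hC using fun z : ℕ × ℕ => hbd _ (hψ z.1 z.2)
  have hcomp : IsCompact (Set.pi univ fun z : ℕ × ℕ => Icc (-C z) (C z)) :=
    isCompact_univ_pi fun _ => isCompact_Icc
  obtain ⟨y, -, σ, hσ, hlim⟩ := hcomp.tendsto_subseq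
    (x := fun k z => totalFlux p T (ε k) (n k) (w k) (ψ z.1 z.2)) fun k z _ => abs_le.1 (hC z k)
  have h' := h.comp hσ
  have hex : ∀ φ : testFns, ∃ l,
      Tendsto (fun k => totalFlux p T (ε (σ k)) (n (σ k)) (w (σ k)) φ.1) atTop (𝓝 l) := by
    intro φ
    obtain ⟨m, c, d, hc, h0, hap⟩ := hdense φ.1 φ.2
    refine exists_tendsto_of_approx fun δ hδ => ?_
    set B := (K + T * (c ^ (p.α - 1) * nhMass p ρ₀)) / 2 with hB
    have hB0 : 0 ≤ B := by
      have := h.K_nonneg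
      have := h.T_pos
      have := nhMass_nonneg p h.ρ₀_pos.le
      positivity
    obtain ⟨j, hj⟩ := hap (δ / (B + 1)) (by positivity)
    refine ⟨_, ⟨y (m, j), (tendsto_pi_nhds.1 hlim (m, j))⟩, Eventually.of_forall fun k => ?_⟩
    refine (h'.abs_totalFlux_sub_le φ.2 (hψ m j) hc (fun t r hr => ⟨(h0 t r hr).1, (h0 t r hr).2 j⟩)
      (by positivity) hj k).trans ?_
    rw [div_mul_eq_mul_div, div_le_iff₀ (by positivity)]
    nlinarith
  choose l hl using hex
  refine ⟨σ, { toFun := l, map_add' := fun φ ψ => ?_, map_smul' := fun c φ => ?_ }, hσ, hl⟩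
  · refine tendsto_nhds_unique (hl (φ + ψ)) (((hl φ).add (hl ψ)).congr fun k => ?_)
    exact ((h.curve _).totalFlux_add h.T_pos (h.pos _) h.ρ₀_pos φ.2 ψ.2).symm
  · refine tendsto_nhds_unique (hl (c • φ)) (((hl φ).const_mul c).congr fun k => ?_)
    exact (totalFlux_smul _ _ _ _ _ _ _).symm

end

end BoundedSeq

/-! ### Limits of the fluxes and of the continuity equation -/

/-- The partial derivative in time of a function of time and size. -/
noncomputable def dTime (ζ : ℝ × ℝ → ℝ) (z : ℝ × ℝ) : ℝ := deriv (fun s => ζ (s, z.2)) z.1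

/-- The partial derivative in size of a function of time and size. -/
noncomputable def dSize (ζ : ℝ × ℝ → ℝ) (z : ℝ × ℝ) : ℝ := deriv (fun s => ζ (z.1, s)) z.2

section Partial

variable {ζ : ℝ × ℝ → ℝ}

theorem hasDerivAt_dSize (hζ : ContDiff ℝ 1 ζ) (z : ℝ × ℝ) :
    HasDerivAt (fun s => ζ (z.1, s)) (fderiv ℝ ζ z (0, 1)) z.2 :=
  ((hζ.differentiable one_ne_zero z).hasFDerivAt).comp_hasDerivAt (f := fun s => (z.1, s)) z.2
    ((hasDerivAt_const z.2 z.1).prodMk (hasDerivAt_id z.2))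

theorem hasDerivAt_dTime (hζ : ContDiff ℝ 1 ζ) (z : ℝ × ℝ) :
    HasDerivAt (fun s => ζ (s, z.2)) (fderiv ℝ ζ z (1, 0)) z.1 :=
  ((hζ.differentiable one_ne_zero z).hasFDerivAt).comp_hasDerivAt (f := fun s => (s, z.2)) z.1
    ((hasDerivAt_id z.1).prodMk (hasDerivAt_const z.1 z.2))

theorem exists_Icc_of_tsupport_subset_prod (hc : HasCompactSupport ζ)
    (hs : tsupport ζ ⊆ univ ×ˢ Ioi 0) :
    ∃ a b : ℝ, 0 < a ∧ ∀ t r, r ∉ Icc a b → (t, r) ∉ tsupport ζ := by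
  have hcomp : IsCompact (Prod.snd '' tsupport ζ) := IsCompact.image hc continuous_snd
  rcases (Prod.snd '' tsupport ζ).eq_empty_or_nonempty with he | hne
  · exact ⟨1, 1, one_pos, fun t r _ hm => (he ▸ mem_image_of_mem Prod.snd hm : r ∈ ∅)⟩
  · obtain ⟨r, hr, hmin⟩ := hcomp.exists_isLeast hne
    obtain ⟨R, hR, hmax⟩ := hcomp.exists_isGreatest hne
    obtain ⟨z, hz, rfl⟩ := hr
    exact ⟨z.2, R, (hs hz).2, fun t r hr hm => hr ⟨hmin ⟨_, hm, rfl⟩, hmax ⟨_, hm, rfl⟩⟩⟩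

theorem isTestFn_of_hasCompactSupport (hζ : Continuous ζ) (hc : HasCompactSupport ζ)
    (hs : tsupport ζ ⊆ univ ×ˢ Ioi 0) : IsTestFn ζ := by
  obtain ⟨a, b, ha, hout⟩ := exists_Icc_of_tsupport_subset_prod hc hs
  obtain ⟨M, hM⟩ := hζ.bounded_above_of_compact_support hc
  exact ⟨hζ, a, b, M, ha, hM, fun t r hr => image_eq_zero_of_notMem_tsupport (hout t r hr)⟩

theorem isTestFn_of_contDiff (hζ : ContDiff ℝ 1 ζ) (hc : HasCompactSupport ζ)
    (hs : tsupport ζ ⊆ univ ×ˢ Ioi 0) :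
    ∃ a b : ℝ, 0 < a ∧ IsTestFn ζ ∧ IsTestFn (dTime ζ) ∧ IsTestFn (dSize ζ) ∧ ∀ t r, r ∉ Icc a b →
    ζ (t, r) = 0 ∧ dTime ζ (t, r) = 0 ∧ dSize ζ (t, r) = 0 := by
  obtain ⟨a, b, ha, hout⟩ := exists_Icc_of_tsupport_subset_prod hc hs
  have hfd : ∀ v : ℝ × ℝ, IsTestFn (fun z => fderiv ℝ ζ z v) ∧ ∀ t r, r ∉ Icc a b →
      fderiv ℝ ζ (t, r) v = 0 := fun v => by
    have h0 : ∀ t r, r ∉ Icc a b → fderiv ℝ ζ (t, r) v = 0 := fun t r hr => by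
      rw [fderiv_of_notMem_tsupport ℝ (hout t r hr)]; rfl
    have hcont : Continuous fun z => fderiv ℝ ζ z v :=
      (hζ.continuous_fderiv one_ne_zero).clm_apply continuous_const
    have hcs : HasCompactSupport fun z => fderiv ℝ ζ z v := by
      refine hc.mono' fun z hz => ?_
      by_contra hcon
      exact hz (by simp [fderiv_of_notMem_tsupport ℝ hcon])
    obtain ⟨M, hM⟩ := hcont.bounded_above_of_compact_support hcs
    exact ⟨⟨hcont, a, b, M, ha, hM, h0⟩, h0⟩
  have e1 : dTime ζ = fun z => fderiv ℝ ζ z (1, 0) := funext fun z => (hasDerivAt_dTime hζ z).deriv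
  have e2 : dSize ζ = fun z => fderiv ℝ ζ z (0, 1) := funext fun z => (hasDerivAt_dSize hζ z).deriv
  rw [e1, e2]
  exact ⟨a, b, ha, isTestFn_of_hasCompactSupport hζ.continuous hc hs, (hfd _).1, (hfd _).1, fun t r
    hr => ⟨image_eq_zero_of_notMem_tsupport (hout t r hr), (hfd _).2 t r hr, (hfd _).2 t r hr⟩⟩

theorem exists_bound_comp_snd_mul {g : ℝ → ℝ} (hg : ContinuousOn g (Ioi 0)) (hc : Continuous ζ)
    {a b M : ℝ} (ha : 0 < a) (hM : ∀ z, |ζ z| ≤ M) (h0 : ∀ t r, r ∉ Icc a b → ζ (t, r) = 0) :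
    Continuous (fun z => g z.2 * ζ z) ∧ ∃ N, ∀ z, |g z.2 * ζ z| ≤ N := by
  constructor
  · have he : (fun z => g z.2 * ζ z) = fun z => g (max z.2 a) * ζ z := funext fun z => by grind
    rw [he]
    exact (hg.comp_continuous (by fun_prop) fun z => ha.trans_le (le_max_right _ _)).mul hc
  · obtain ⟨C, hC⟩ := isCompact_Icc.exists_bound_of_continuousOn (hg.mono fun r hr => ha.trans_le hr.1)
    refine ⟨|C| * M, fun z => ?_⟩
    by_cases hz : z.2 ∈ Icc a b
    · rw [abs_mul]
      exact mul_le_mul ((hC _ hz).trans (le_abs_self C)) (hM z) (abs_nonneg _) (abs_nonneg C)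
    · rw [show ζ z = 0 from h0 z.1 z.2 hz, mul_zero, abs_zero]
      exact mul_nonneg (abs_nonneg C) ((abs_nonneg _).trans (hM z))

theorem IsTestFn.exists_modulus (hφ : IsTestFn ζ) (T : ℝ) {δ : ℝ} (hδ : 0 < δ) :
    ∃ η : ℝ, 0 < η ∧ ∀ t ∈ Icc 0 T, ∀ r s, |s - r| < η → |ζ (t, s) - ζ (t, r)| ≤ δ := by
  obtain ⟨h1, a, b, M, ha, hM, h0⟩ := hφ
  have huc := ((isCompact_Icc (a := (0 : ℝ)) (b := T)).prod
    (isCompact_Icc (a := a - 1) (b := b + 1))).uniformContinuousOn_of_continuous h1.continuousOn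
  obtain ⟨η, hη, hη'⟩ := Metric.uniformContinuousOn_iff.1 huc δ hδ
  refine ⟨min η 1, lt_min hη one_pos, fun t ht r s hrs => ?_⟩
  obtain ⟨h2, h3⟩ := lt_min_iff.1 hrs
  rw [abs_lt] at h3
  by_cases hm : r ∈ Icc a b ∨ s ∈ Icc a b
  · have hr : r ∈ Icc (a - 1) (b + 1) := by grind
    have hs : s ∈ Icc (a - 1) (b + 1) := by grind
    have := hη' (t, s) ⟨ht, hs⟩ (t, r) ⟨ht, hr⟩ (by
      rw [Prod.dist_eq, dist_self, max_eq_right dist_nonneg]; exact h2)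
    exact this.le
  grind

end Partial

namespace BoundedSeq

variable {p : Rates} {ρ₀ x T K : ℝ} {ε : ℕ → ℝ} {n : ℕ → ℝ → ℕ → ℝ} {w : ℕ → ℝ → ℝ → ℝ}
  {ν : ℝ → Measure ℝ}

section

variable (h : BoundedSeq p ρ₀ x T K ε n w)
include h

theorem aemeasurable_esum (k : ℕ) (b : ℝ) {F : ℝ × ℝ → ℝ} (hF : Continuous F) :
    AEMeasurable (fun t => esum b (ε k) (n k t) fun r => F (t, r)) vol[T] :=
  Finset.aemeasurable_fun_sum _ fun i _ =>
    (((h.curve k).aemeasurable_comp h.T_pos (Nat.succ_pos i)).div_const _).mul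
      (by fun_prop : Continuous fun t => F (t, ε k * (i + 1 : ℕ))).measurable.aemeasurable

theorem integrable_esum (k : ℕ) {a b M : ℝ} {F : ℝ × ℝ → ℝ} (hF : Continuous F) (ha : 0 < a)
    (hM : ∀ z, |F z| ≤ M) (h0 : ∀ t r, r ∉ Icc a b → F (t, r) = 0) :
    Integrable (fun t => esum b (ε k) (n k t) fun r => F (t, r)) vol[T] :=
  Integrable.of_bound (h.aemeasurable_esum k b hF).aestronglyMeasurable (ρ₀ / a * M)
    ((ae_restrict_iff' measurableSet_Icc).2 (ae_of_all _ fun t ht =>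
      abs_esum_le ((h.curve k).isState t ht) (h.pos k) ha ((abs_nonneg _).trans (hM 0))
        (h0 t) fun _ => hM _))

theorem tendsto_integral_integral (hν : IsVagueLimit T x ε n ν) {a b M : ℝ} {F : ℝ × ℝ → ℝ}
    (hF : Continuous F) (ha : 0 < a) (hM : ∀ z, |F z| ≤ M)
    (h0 : ∀ t r, r ∉ Icc a b → F (t, r) = 0) :
    Tendsto (fun k => ∫ t in Icc 0 T, esum b (ε k) (n k t) fun r => F (t, r)) atTop
    (𝓝 (∫ t in Icc 0 T, ∫ r, F (t, r) ∂(ν t))) := by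
  refine tendsto_integral_of_dominated_convergence (fun _ => ρ₀ / a * M) (fun k =>
    (h.aemeasurable_esum k b hF).aestronglyMeasurable) (integrable_const _) (fun k => ?_) ?_
  · filter_upwards [ae_mem_Icc] with t ht
    exact abs_esum_le ((h.curve k).isState t ht) (h.pos k) ha ((abs_nonneg _).trans (hM 0))
      (h0 t) fun r => hM _
  · filter_upwards [ae_mem_Icc] with t ht
    refine ((hν t ht).2.2.tendsto (f := fun r => F (t, r)) (by fun_prop) ha (h0 t)).congr' ?_
    filter_upwards [h.eventually_integral_eq ha] with k hk
    grind

/-- The limits of the fluxes are controlled by the limits of the action. -/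
theorem two_mul_flux_le (hν : IsVagueLimit T x ε n ν) {φ : ℝ × ℝ → ℝ} (hφ : IsTestFn φ) {l A : ℝ}
    (hA0 : 0 ≤ A) (hl : Tendsto (fun k => totalFlux p T (ε k) (n k) (w k) φ) atTop (𝓝 l))
    (hA : ∃ᶠ k in atTop, ∫⁻ t in Icc 0 T, actionε p (ε k) (n k t) (w k t) ≤ ofReal A) :
    2 * l ≤ A + ∫ t in Icc 0 T, ∫ r, r ^ p.α * φ (t, r) ^ 2 ∂(ν t) := by
  obtain ⟨hc, a, b, M, ha, hM, h0⟩ := id hφ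
  set g : ℝ × ℝ → ℝ := fun z => z.2 ^ p.α * φ z ^ 2 with hg
  have hg0 : ∀ t r, r ∉ Icc a b → g (t, r) = 0 := fun t r hr => by grind
  have hgn : ∀ z, 0 ≤ g z := fun z => by
    by_cases hz : z.2 ∈ Icc a b
    · exact mul_nonneg (rpow_nonneg (ha.le.trans hz.1) _) (sq_nonneg _)
    grind
  obtain ⟨hgc, N, hgM⟩ := exists_bound_comp_snd_mul (g := fun r => r ^ p.α) (ζ := fun z => φ z ^ 2)
    (continuousOn_id.rpow_const fun r hr => Or.inl (ne_of_gt hr)) (hc.pow 2) ha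
    (M := M ^ 2) (fun z => by rw [abs_pow]; exact pow_le_pow_left₀ (abs_nonneg _) (hM z) 2)
    fun t r hr => by rw [h0 t r hr, sq, zero_mul]
  have hN0 : 0 ≤ N := (hgn 0).trans ((le_abs_self _).trans (hgM 0))
  have hlim := (hl.const_mul 2).sub (h.tendsto_integral_integral hν hgc ha hgM hg0)
  -- Young's inequality for each `k`, up to the cost of replacing the modified densities
  have key : ∀ δ : ℝ, 0 < δ →
      2 * l - ∫ t in Icc 0 T, ∫ r, g (t, r) ∂(ν t) ≤ A + T * (ρ₀ / a * ((N + 2) * δ)) := by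
    intro δ hδ
    obtain ⟨η, hη, hmod⟩ := (show IsTestFn g from ⟨hgc, a, b, N, ha, hgM, hg0⟩).exists_modulus T hδ
    have hnh := h.tendsto_nhdsGT.eventually (eventually_esum_nh_le p ρ₀ b h.K_nonneg ha hN0 hδ)
    refine le_of_tendsto_of_frequently hlim
      ((hA.and_eventually (hnh.and (h.lim.eventually (gt_mem_nhds hη)))).mono ?_)
    rintro k ⟨hAk, hnk, hεk⟩
    have hcv := h.curve k
    have hAt := hcv.ae_actionε_lt_top h.T_pos
    obtain ⟨hAint, hAeq⟩ := hcv.integral_actionε h.T_pos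
    have hE := h.integrable_esum k hgc ha hgM hg0
    have hpt : ∀ᵐ t ∂vol[T], 2 * fluxAt p (ε k) (n k) (w k) φ t ≤ (actionε p (ε k) (n k t) (w k
        t)).toReal + (esum b (ε k) (n k t) fun r => g (t, r)) + ρ₀ / a * ((N + 2) * δ) := by
      filter_upwards [hAt, ae_mem_Icc] with t ht htm
      rw [fluxAt_eq (h.pos k) h0]
      have h1 := IsRescaledCurve.sum_abs_rflux_mul_le (p := p) (n := n k) (w := w k) (h.pos k) t
        (Finset.range (numSizes b (ε k))) (fun i => φ (t, ε k * (i + 1 : ℕ))) one_pos ht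
      have h2 := hnk (n k t) (hcv.isState t htm) (h.energy k t htm) (fun r => g (t, r))
        (fun r => hgn _) (hg0 t) (fun r => (le_abs_self _).trans (hgM _)) fun r =>
          hmod t htm _ _ (by rw [add_sub_cancel_left, abs_of_pos (h.pos k)]; exact hεk)
      have h3 : ∑ i ∈ Finset.range (numSizes b (ε k)), nh p (n k t) (i + 1) / ε k
          * (ε k * (i + 1 : ℕ)) ^ p.α * φ (t, ε k * (i + 1 : ℕ)) ^ 2
          = esum b (ε k) (nh p (n k t)) fun r => g (t, r) := sum_congr rfl fun i _ => by linarith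
      rw [h3, one_mul, inv_one, one_mul] at h1
      have h4 := (le_abs_self _).trans (abs_sum_le_sum_abs (fun i =>
        IsRescaledCurve.rflux p (ε k) (n k) (w k) (i + 1) t * φ (t, ε k * (i + 1 : ℕ)))
        (Finset.range (numSizes b (ε k))))
      linarith
    have h5 := integral_mono_ae ((hcv.integrable_fluxAt h.T_pos (h.pos k) h.ρ₀_pos hφ).const_mul 2)
      ((hAint.add hE).add (integrable_const (ρ₀ / a * ((N + 2) * δ)))) hpt
    rw [integral_const_mul, integral_add' (hAint.add hE) (integrable_const _),
      integral_add' hAint hE, hAeq, integral_const, smul_eq_mul, measureReal_restrict_apply_univ,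
      Real.volume_real_Icc_of_le h.T_pos.le, sub_zero] at h5
    have h6 := toReal_mono ofReal_ne_top hAk
    rw [toReal_ofReal hA0] at h6
    change 2 * totalFlux p T (ε k) (n k) (w k) φ ≤ _ at h5
    linarith
  have hB : 0 ≤ T * (ρ₀ / a * (N + 2)) := by
    have := h.T_pos; have := h.ρ₀_pos; positivity
  rw [← sub_le_iff_le_add]
  refine le_of_forall_pos_le_add fun δ hδ => ?_
  refine (key (δ / (T * (ρ₀ / a * (N + 2)) + 1)) (by positivity)).trans ?_
  have : T * (ρ₀ / a * ((N + 2) * (δ / (T * (ρ₀ / a * (N + 2)) + 1))))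
      = δ * ((T * (ρ₀ / a * (N + 2))) / (T * (ρ₀ / a * (N + 2)) + 1)) := by ring
  rw [this]
  have h7 : (T * (ρ₀ / a * (N + 2))) / (T * (ρ₀ / a * (N + 2)) + 1) ≤ 1 := by
    rw [div_le_one (by positivity)]; linarith
  nlinarith

/-- The continuity equation for the limits. -/
theorem continuity_limit (hν : IsVagueLimit T x ε n ν) {ζ : ℝ × ℝ → ℝ} (hζ : ContDiff ℝ 1 ζ)
    (hc : HasCompactSupport ζ) (hs : tsupport ζ ⊆ univ ×ˢ Ioi 0) {l : ℝ}
    (hl : Tendsto (fun k => totalFlux p T (ε k) (n k) (w k) (dSize ζ)) atTop (𝓝 l)) :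
    (∫ r, ζ (T, r) ∂(ν T)) - (∫ r, ζ (0, r) ∂(ν 0))
    = (∫ t in Icc 0 T, ∫ r, dTime ζ (t, r) ∂(ν t)) + l := by
  obtain ⟨a, b, ha, h1, h2, h3, h0⟩ := isTestFn_of_contDiff hζ hc hs
  have hT := h.T_pos
  have hT0 : T ∈ Icc 0 T := ⟨hT.le, le_rfl⟩
  have h00 : (0 : ℝ) ∈ Icc 0 T := ⟨le_rfl, hT.le⟩
  have hL : ∀ t ∈ Icc 0 T, Tendsto (fun k => esum b (ε k) (n k t) fun r => ζ (t, r)) atTop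
      (𝓝 (∫ r, ζ (t, r) ∂(ν t))) := fun t ht => by
    have := h1.1
    refine ((hν t ht).2.2.tendsto (f := fun r => ζ (t, r)) (by fun_prop) ha
      fun r hr => (h0 t r hr).1).congr' ?_
    filter_upwards [h.eventually_integral_eq ha] with k hk
    grind
  obtain ⟨-, -, -, M', -, hM', -⟩ := id h2
  have hI := h.tendsto_integral_integral hν h2.1 ha hM' fun t r hr => (h0 t r hr).2.1
  -- the difference quotients in size are test functions
  set dq : ℕ → ℝ × ℝ → ℝ := fun k z => (ζ (z.1, z.2 + ε k) - ζ z) / ε k with hdq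
  have hdq0 : ∀ k, ε k < a / 2 → ∀ t r, r ∉ Icc (a / 2) b → dq k (t, r) = 0 := by
    intro k hk t r hr
    have e1 : ζ (t, r) = 0 := (h0 t r fun hm => hr ⟨by linarith [hm.1], hm.2⟩).1
    have e2 : ζ (t, r + ε k) = 0 := (h0 t _ fun hm => hr ⟨by linarith [hm.1], by
      linarith [hm.2, h.pos k]⟩).1
    grind
  have hsmall : ∀ᶠ k in atTop, ε k < a / 2 := h.lim.eventually (gt_mem_nhds (by positivity))
  have hdqT : ∀ k, ε k < a / 2 → IsTestFn (dq k) := by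
    intro k hk
    obtain ⟨hζc, -, -, M, -, hM, -⟩ := h1
    refine ⟨by fun_prop, a / 2, b, 2 * M / ε k, by positivity, fun z => ?_,
      hdq0 k hk⟩
    simp only [hdq]
    rw [abs_div, abs_of_pos (h.pos k)]
    refine div_le_div_of_nonneg_right ?_ (h.pos k).le
    grind
  have hflux : Tendsto (fun k => totalFlux p T (ε k) (n k) (w k) (dq k)) atTop (𝓝 l) := by
    refine tendsto_of_approx fun δ hδ => ⟨_, l, hl, by grind, ?_⟩
    set B := (K + T * ((a / 2) ^ (p.α - 1) * nhMass p ρ₀)) / 2 with hB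
    have hB0 : 0 ≤ B := by
      have := h.K_nonneg
      have := nhMass_nonneg p h.ρ₀_pos.le
      positivity
    obtain ⟨η, hη, hmod⟩ := h3.exists_modulus T (δ := δ / (B + 1)) (by positivity)
    filter_upwards [hsmall, h.lim.eventually (gt_mem_nhds hη)] with k hk hk'
    have hεk := h.pos k
    refine (h.abs_totalFlux_sub_le (hdqT k hk) h3 (half_pos ha) (b := b)
      (fun t r hr => ⟨hdq0 k hk t r hr, (h0 t r fun hm => hr ⟨by linarith [hm.1], hm.2⟩).2.2⟩)
      (δ := δ / (B + 1)) (by positivity) (fun t ht r => ?_) k).trans ?_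
    · obtain ⟨c, hc1, hc2⟩ := exists_hasDerivAt_eq_slope (fun s => ζ (t, s)) (fun s => dSize ζ (t,
        s)) (show r < r + ε k by linarith) (Continuous.continuousOn (by fun_prop)) fun s _ => by
          have := hasDerivAt_dSize hζ (t, s)
          rw [dSize, this.deriv]; exact this
      have : dq k (t, r) = dSize ζ (t, c) := by grind
      rw [this]
      exact hmod t ht _ _ (by rw [abs_of_pos] <;> grind)
    · rw [div_mul_eq_mul_div, div_le_iff₀ (by positivity)]
      nlinarith
  refine tendsto_nhds_unique ((hL T hT0).sub (hL 0 h00)) ((hI.add hflux).congr' ?_)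
  filter_upwards [hsmall] with k hk
  have hcv := h.curve k
  rw [hcv.continuity_esum hT (h.pos k) h.ρ₀_pos hζ (fun t r hr => (h0 t r hr).1) (by linarith)
    le_rfl hT.le le_rfl, intervalIntegral.integral_of_le hT.le, ← integral_Icc_eq_integral_Ioc,
    totalFlux, ← integral_add (h.integrable_esum k h2.1 ha hM' fun t r hr => (h0 t r hr).2.1)
    (hcv.integrable_fluxAt hT (h.pos k) h.ρ₀_pos (hdqT k hk))]
  refine integral_congr_ae (ae_of_all _ fun t => ?_)
  change (esum b (ε k) (n k t) fun r => dTime ζ (t, r)) + fluxAt p (ε k) (n k) (w k) (dq k) t = _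
  rw [fluxAt_eq (h.pos k) (hdq0 k hk)]
  congr 1
  grind

/-- The momenta `r ^ α w ν` have the same limits as the fluxes. -/
theorem tendsto_momentum {ψ : ℝ × ℝ → ℝ} (hψ : IsTestFn ψ) {l : ℝ}
    (hl : Tendsto (fun k => totalFlux p T (ε k) (n k) (w k) ψ) atTop (𝓝 l)) :
    Tendsto (fun k => ∫ t in (0 : ℝ)..T, ∫ r, r ^ p.α * w k t r
    * ψ (t, r) ∂(macroMeasure x (ε k) (n k t))) atTop (𝓝 l) := by
  obtain ⟨hc, a, b, M, ha, hM, h0⟩ := id hψ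
  have hT := h.T_pos
  have hρ := h.ρ₀_pos
  have hK := h.K_nonneg
  set G : ℕ → ℝ → ℝ := fun k t => esum b (ε k) (n k t) fun r => r ^ p.α * w k t r * ψ (t, r) with hG
  set B := (K + M ^ 2 * (K + 8 * (a ^ (p.α - 1) * ρ₀) * T)) / 2 with hB
  have hB0 : 0 ≤ B := by positivity
  have hdiff : ∀ θ : ℝ, 0 < θ → ∀ᶠ k in atTop,
      |(∫ t in Icc 0 T, G k t) - totalFlux p T (ε k) (n k) (w k) ψ| ≤ θ * B := by
    intro θ hθ
    have hε0 := ((tendsto_rpow_nhdsGT_zero (mul_pos two_pos p.γ_pos)).comp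
      h.tendsto_nhdsGT).const_mul (10 / p.zs ^ 2)
    rw [mul_zero] at hε0
    filter_upwards [h.tendsto_nhdsGT.eventually (eventually_dens_ratio p ρ₀ hK ha
      (lt_min one_half_pos hθ)), hε0.eventually (ge_mem_nhds (pow_pos hθ 2))] with k hk hεθ
    have hcv := h.curve k
    have hεk := h.pos k
    obtain ⟨hAi, hAe⟩ := hcv.integral_actionε hT
    obtain ⟨hDi, hDe⟩ := hcv.integral_dissipationε hT
    have hFi := hcv.integrable_fluxAt hT hεk hρ hψ
    have hGm : AEMeasurable (G k) vol[T] := Finset.aemeasurable_fun_sum _ fun i _ =>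
        ((hcv.aemeasurable_comp hT (Nat.succ_pos i)).div_const _).mul
          (((hcv.measurable (i + 1) (Nat.succ_pos i)).const_mul _).mul
          (by fun_prop : Continuous fun t => ψ (t, ε k * (i + 1 : ℕ))).measurable.aemeasurable)
    set A : ℝ → ℝ := fun t => (actionε p (ε k) (n k t) (w k t)).toReal
    set D : ℝ → ℝ := fun t => (dissipationε p (ε k) (n k t)).toReal
    have hpt : ∀ᵐ t ∂vol[T], |G k t - fluxAt p (ε k) (n k) (w k) ψ t|
        ≤ θ / 2 * A t + θ / 2 * M ^ 2 * (D t + 8 * (a ^ (p.α - 1) * ρ₀)) := by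
      filter_upwards
        [hcv.ae_actionε_lt_top hT, hcv.ae_dissipationε_lt_top hT, ae_mem_Icc] with t hAt hDt htm
      have h1 := (hcv.isState t htm).sum_abs_sub_nh_mul_le hρ hεk hDt (w k t) hAt ha (hk.1 _
        (hcv.isState t htm) (h.energy k t htm)) (min_le_left _ _) hθ (numSizes b (ε k)) (fun i => ψ
        (t, ε k * (i + 1 : ℕ))) (fun i hi => h0 _ _ fun hm => not_lt.2 hm.1 hi) fun i => hM _
      have e : G k t - fluxAt p (ε k) (n k) (w k) ψ t
          = ∑ i ∈ Finset.range (numSizes b (ε k)), (n k t (i + 1) - nh p (n k t) (i + 1)) / ε k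
          * (ε k * (i + 1 : ℕ)) ^ p.α * w k t (ε k * (i + 1 : ℕ)) * ψ (t, ε k * (i + 1 : ℕ)) := by
        rw [fluxAt_eq hεk h0]
        simp only [hG, esum, ← sum_sub_distrib]
        exact sum_congr rfl fun i _ => by rw [IsRescaledCurve.rflux_eq p hεk]; ring
      rw [← e] at h1
      -- eventually `10 / z_s² ε^(2γ) ≤ θ²`
      have h2 : θ⁻¹ * (M ^ 2 * (10 / p.zs ^ 2 * ε k ^ (2 * p.γ) * D t + 8 * min (1 / 2) θ ^ 2 * (a ^
          (p.α - 1) * ρ₀))) ≤ θ⁻¹ * (M ^ 2 * (θ ^ 2 * D t + 8 * θ ^ 2 * (a ^ (p.α - 1) * ρ₀))) := by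
        have : 0 ≤ D t := toReal_nonneg
        have := min_le_right (1 / 2) θ
        gcongr
        exact hεθ
      have h3 : θ⁻¹ * (M ^ 2 * (θ ^ 2 * D t + 8 * θ ^ 2 * (a ^ (p.α - 1) * ρ₀)))
          = θ * M ^ 2 * (D t + 8 * (a ^ (p.α - 1) * ρ₀)) := by field_simp
      linarith
    have hi1 : Integrable (fun t => θ / 2 * A t) vol[T] := hAi.const_mul _
    have hi2 :
      Integrable (fun t => D t + 8 * (a ^ (p.α - 1) * ρ₀)) vol[T] := hDi.add (integrable_const _)
    have hHi := hi1.add (hi2.const_mul (θ / 2 * M ^ 2))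
    have hdi := hHi.mono' (hGm.aestronglyMeasurable.sub hFi.aestronglyMeasurable) hpt
    have hGi : Integrable (G k) vol[T] := (hdi.add hFi).congr (ae_of_all _ fun t => by simp)
    rw [totalFlux, ← integral_sub hGi hFi]
    refine abs_integral_le_integral_abs.trans ((integral_mono_ae hdi.abs hHi hpt).trans ?_)
    rw [integral_add' hi1 (hi2.const_mul _), integral_const_mul, integral_const_mul,
      integral_add hDi (integrable_const _), hAe, hDe, setIntegral_const, smul_eq_mul,
      Real.volume_real_Icc_of_le hT.le, sub_zero]
    have h6 := toReal_le_of_le_ofReal hK (h.action k)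
    have h7 := toReal_le_of_le_ofReal hK (h.dissipation k)
    calc _ ≤ θ / 2 * K + θ / 2 * M ^ 2 * (K + T * (8 * (a ^ (p.α - 1) * ρ₀))) := by gcongr
      _ = _ := by rw [hB]; ring
  refine tendsto_of_approx fun δ hδ => ⟨_, l, hl, by grind, ?_⟩
  filter_upwards [hdiff (δ / (B + 1)) (by positivity), h.eventually_integral_eq ha] with k h1 hk
  rw [intervalIntegral.integral_of_le hT.le, ← integral_Icc_eq_integral_Ioc,
    setIntegral_congr_fun measurableSet_Icc fun t ht => hk t ht b _ fun r hr => by grind]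
  refine h1.trans ?_
  rw [div_mul_eq_mul_div, div_le_iff₀ (by positivity)]
  nlinarith

end

end BoundedSeq

/-! ### Moments of states of finite dissipation -/

section Moments

variable {p : Rates} {ρ : ℝ} {ν : Measure ℝ}

/-- The weighted square in the dissipation, together with the mass, controls the moments of order
`α` and `α - 2γ`. -/
theorem exists_moment_bound (p : Rates) (c : ℝ) : ∃ C : ℝ, 0 ≤ C ∧ ∀ r : ℝ, 0 < r →
    r ^ p.α * (1 + (r ^ (-p.γ)) ^ 2) ≤ C * (r ^ p.α * (c - p.q * r ^ (-p.γ)) ^ 2 + r) := by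
  have hq := p.q_pos
  have hγ := p.γ_pos
  have h1α : 0 < 1 - p.α := by linarith [p.α_lt_one]
  set Y := 2 * (|c| + 1) / p.q with hY
  have hY0 : 0 < Y := by positivity
  have hE : 0 ≤ (1 + Y ^ 2) * Y ^ ((1 - p.α) / p.γ) := by positivity
  refine ⟨(1 + 4 / p.q ^ 2) + (1 + Y ^ 2) * Y ^ ((1 - p.α) / p.γ), by positivity, fun r hr => ?_⟩
  set y := r ^ (-p.γ) with hy
  have hy0 : 0 < y := rpow_pos_of_pos hr _
  have hX : 0 < r ^ p.α := rpow_pos_of_pos hr _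
  have hZ : 0 ≤ r ^ p.α * (c - p.q * y) ^ 2 := by positivity
  -- for small `r` the weighted square dominates, for large `r` the mass does
  rcases le_total Y y with h | h
  · have h1 : 2 * (|c| + 1) ≤ p.q * y := by
      rw [hY, div_le_iff₀ hq] at h; linarith
    have h2 : p.q * y / 2 + 1 ≤ p.q * y - c := by grind
    have h3 : (p.q * y / 2) ^ 2 + 1 ≤ (c - p.q * y) ^ 2 := by nlinarith [abs_nonneg c]
    have h4 : y ^ 2 = 4 / p.q ^ 2 * (p.q * y / 2) ^ 2 := by field_simp; ring
    have h5 : 1 + y ^ 2 ≤ (1 + 4 / p.q ^ 2) * (c - p.q * y) ^ 2 := by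
      have : 0 ≤ 4 / p.q ^ 2 := by positivity
      rw [h4]; nlinarith [sq_nonneg (p.q * y / 2)]
    calc r ^ p.α * (1 + y ^ 2) ≤ r ^ p.α * ((1 + 4 / p.q ^ 2) * (c - p.q * y) ^ 2) := by gcongr
      _ = (1 + 4 / p.q ^ 2) * (r ^ p.α * (c - p.q * y) ^ 2) := by ring
      _ ≤ (1 + 4 / p.q ^ 2 + (1 + Y ^ 2) * Y ^ ((1 - p.α) / p.γ)) * (r ^ p.α * (c - p.q * y) ^ 2
          + r) := mul_le_mul (by linarith) (by linarith) hZ (by positivity)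
  · have h1 : r ^ p.α = r * y ^ ((1 - p.α) / p.γ) := by
      rw [hy, ← rpow_mul hr.le]
      nth_rewrite 2 [← rpow_one r]
      rw [← rpow_add hr]
      grind
    calc r ^ p.α * (1 + y ^ 2) ≤ (r * Y ^ ((1 - p.α) / p.γ)) * (1 + Y ^ 2) := by
          rw [h1]; gcongr
      _ = ((1 + Y ^ 2) * Y ^ ((1 - p.α) / p.γ)) * r := by ring
      _ ≤ _ := mul_le_mul (by linarith [show 0 ≤ 1 + 4 / p.q ^ 2 by positivity])
          (by linarith) hr.le (by positivity)

theorem integrable_of_lintegral_ofReal_lt_top {f : ℝ → ℝ} (hf : Measurable f)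
    (h0 : ∀ᵐ r ∂ν, 0 ≤ f r) (h : ∫⁻ r, ofReal (f r) ∂ν < ⊤) : Integrable f ν :=
  ⟨hf.aestronglyMeasurable, (hasFiniteIntegral_iff_ofReal h0).2 h⟩

section

variable (h : IsLSWState ρ ν)
include h

theorem IsLSWState.integrable_id : Integrable (fun r => r) ν :=
  integrable_of_lintegral_ofReal_lt_top measurable_id
    ((ae_pos_of_Iic h.1).mono fun r hr => le_of_lt hr) (by rw [h.2]; simp)

theorem IsLSWState.integral_id (hρ : 0 ≤ ρ) : ∫ r, r ∂ν = ρ := by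
  rw [integral_eq_lintegral_of_nonneg_ae ((ae_pos_of_Iic h.1).mono fun r hr => le_of_lt hr)
    measurable_id.aestronglyMeasurable, h.2, toReal_ofReal hρ]

omit h in
theorem measurable_weighted_sq (p : Rates) (c : ℝ) :
    Measurable fun r : ℝ => r ^ p.α * (c - p.q * r ^ (-p.γ)) ^ 2 :=
  (measurable_id.pow_const _).mul
    ((measurable_const.sub (measurable_const.mul (measurable_id.pow_const _))).pow_const _)

theorem IsLSWState.integrable_moments {c : ℝ}
    (hc : actionLSW p ν (fun r => c - p.q * r ^ (-p.γ)) < ⊤) : Integrable (fun r => r ^ p.α) ν ∧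
    Integrable (fun r => r ^ (p.α - p.γ)) ν ∧ Integrable (fun r => r ^ p.α * (r ^ (-p.γ)) ^ 2) ν ∧
    Integrable (fun r => r ^ p.α * (c - p.q * r ^ (-p.γ)) ^ 2) ν := by
  have hpos := ae_pos_of_Iic h.1
  have h1 : Integrable (fun r => r ^ p.α * (c - p.q * r ^ (-p.γ)) ^ 2) ν :=
    integrable_of_lintegral_ofReal_lt_top (measurable_weighted_sq p c)
    (hpos.mono fun r hr => mul_nonneg (rpow_nonneg (le_of_lt hr) _) (sq_nonneg _)) hc
  obtain ⟨C, hC, hb⟩ := exists_moment_bound p c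
  have h2 := (h1.add h.integrable_id).const_mul C
  have hm : ∀ s : ℝ, Measurable fun r : ℝ => r ^ s := fun s => measurable_id.pow_const s
  have key : ∀ f : ℝ → ℝ, Measurable f → (∀ r, 0 < r → 0 ≤ f r ∧
      f r ≤ r ^ p.α * (1 + (r ^ (-p.γ)) ^ 2)) → Integrable f ν := fun f hf hle =>
    h2.mono' hf.aestronglyMeasurable (hpos.mono fun r hr => by
      rw [norm_eq_abs, abs_of_nonneg (hle r hr).1]
      exact (hle r hr).2.trans (hb r hr))
  refine ⟨key _ (hm _) fun r hr => ?_, key _ (hm _) fun r hr => ?_,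
    key _ ((hm _).mul ((hm _).pow_const 2)) fun r hr => ?_, h1⟩
  · have := rpow_nonneg hr.le p.α
    exact ⟨this, by nlinarith [sq_nonneg (r ^ (-p.γ))]⟩
  · have := rpow_nonneg hr.le p.α
    rw [sub_eq_add_neg, rpow_add hr]
    have h3 := rpow_nonneg hr.le (-p.γ)
    exact ⟨by positivity, mul_le_mul_of_nonneg_left (by nlinarith [sq_nonneg (r ^ (-p.γ) - 1)]) this⟩
  · have := rpow_nonneg hr.le p.α
    exact ⟨by positivity, by nlinarith⟩

theorem IsLSWState.integral_rpow_pos (hρ : 0 < ρ) (hi : Integrable (fun r => r ^ p.α) ν) :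
    0 < ∫ r, r ^ p.α ∂ν := by
  have hpos := ae_pos_of_Iic h.1
  have hn : ∀ᵐ r ∂ν, 0 ≤ r ^ p.α := hpos.mono fun r hr => rpow_nonneg (le_of_lt hr) _
  refine (integral_nonneg_of_ae hn).lt_of_ne' fun h0 => ?_
  have h1 := (integral_eq_zero_iff_of_nonneg_ae hn hi).1 h0
  have h2 : ∫⁻ r, ofReal r ∂ν = 0 := by
    rw [lintegral_eq_zero_iff measurable_ofReal]
    filter_upwards [h1, hpos] with r hr hr0
    exact absurd hr (rpow_pos_of_pos hr0 _).ne'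
  rw [h.2, ofReal_eq_zero] at h2
  linarith

/-- Expansion of the weighted squares in the moments. -/
theorem IsLSWState.integral_weighted_sq {c : ℝ}
    (hc : actionLSW p ν (fun r => c - p.q * r ^ (-p.γ)) < ⊤) (d : ℝ) :
    Integrable (fun r => r ^ p.α * (d - p.q * r ^ (-p.γ)) ^ 2) ν ∧
    ∫ r, r ^ p.α * (d - p.q * r ^ (-p.γ)) ^ 2 ∂ν = d ^ 2 * (∫ r, r ^ p.α ∂ν)
    - 2 * d * p.q * (∫ r, r ^ (p.α - p.γ) ∂ν) + p.q ^ 2 * ∫ r, r ^ p.α * (r ^ (-p.γ)) ^ 2 ∂ν := by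
  obtain ⟨h0, h1, h2, -⟩ := h.integrable_moments hc
  have he : (fun r => r ^ p.α * (d - p.q * r ^ (-p.γ)) ^ 2) =ᵐ[ν] fun r => d ^ 2 * r ^ p.α
      - 2 * d * p.q * r ^ (p.α - p.γ) + p.q ^ 2 * (r ^ p.α * (r ^ (-p.γ)) ^ 2) := by
    filter_upwards [ae_pos_of_Iic h.1] with r hr
    rw [sub_eq_add_neg p.α, rpow_add hr]; ring
  have hi := ((h0.const_mul (d ^ 2)).sub (h1.const_mul (2 * d * p.q))).add (h2.const_mul (p.q ^ 2))
  refine ⟨hi.congr he.symm, ?_⟩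
  have hi0 : Integrable (fun r => d ^ 2 * r ^ p.α - 2 * d * p.q * r ^ (p.α - p.γ)) ν :=
    (h0.const_mul _).sub (h1.const_mul _)
  rw [integral_congr_ae he, integral_add hi0 (h2.const_mul _), integral_sub (h0.const_mul _)
    (h1.const_mul _), integral_const_mul, integral_const_mul, integral_const_mul]

/-- The mean field minimizes the weighted squares. -/
theorem IsLSWState.dissipationLSW_le (hρ : 0 < ρ) (c : ℝ) :
    dissipationLSW p ν ≤ actionLSW p ν fun r => c - p.q * r ^ (-p.γ) := by
  rcases eq_top_or_lt_top (actionLSW p ν fun r => c - p.q * r ^ (-p.γ)) with hc | hc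
  · rw [hc]; exact le_top
  obtain ⟨h0, -, -, -⟩ := h.integrable_moments hc
  have hm := h.integral_rpow_pos hρ h0
  have hn : ∀ d : ℝ, ∀ᵐ r ∂ν, 0 ≤ r ^ p.α * (d - p.q * r ^ (-p.γ)) ^ 2 := fun d =>
    (ae_pos_of_Iic h.1).mono fun r hr =>
      mul_nonneg (rpow_nonneg (le_of_lt hr) _) (sq_nonneg _)
  have hconv : ∀ d : ℝ, actionLSW p ν (fun r => d - p.q * r ^ (-p.γ))
      = ofReal (∫ r, r ^ p.α * (d - p.q * r ^ (-p.γ)) ^ 2 ∂ν) := fun d =>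
    (ofReal_integral_eq_lintegral_ofReal (h.integral_weighted_sq hc d).1 (hn d)).symm
  change actionLSW p ν (fun r => meanField p ν - p.q * r ^ (-p.γ)) ≤ _
  rw [hconv, hconv]
  refine ofReal_le_ofReal ?_
  rw [(h.integral_weighted_sq hc _).2, (h.integral_weighted_sq hc c).2]
  have hu : meanField p ν * (∫ r, r ^ p.α ∂ν) = p.q * ∫ r, r ^ (p.α - p.γ) ∂ν := by
    rw [meanField, div_mul_cancel₀ _ hm.ne']
  linear_combination
    (mul_nonneg hm.le (sq_nonneg (c - meanField p ν))) + 2 * (meanField p ν - c) * hu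

end

/-- States whose mass neither concentrates at zero nor at infinity: there, large values of the
constant `c` cost dissipation. -/
theorem exists_sq_le_dissipation (p : Rates) {ρ C R : ℝ} (hρ : 0 < ρ) (hR : 0 < R) :
    ∃ B : ℝ, 0 ≤ B ∧ ∀ ν : Measure ℝ, IsLSWState ρ ν → ∫⁻ r, ofReal (r ^ (1 - p.γ)) ∂ν ≤ ofReal C →
    ∫⁻ r in Ici R, ofReal r ∂ν ≤ ofReal (ρ / 4) →
    ∀ c : ℝ, actionLSW p ν (fun r => c - p.q * r ^ (-p.γ)) < ⊤ →
    c ^ 2 ≤ B * (1 + (actionLSW p ν fun r => c - p.q * r ^ (-p.γ)).toReal) := by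
  set A := R ^ (1 - p.α) with hA
  set Q := p.q * max C 0 with hQ
  have hA0 : 0 < A := rpow_pos_of_pos hR _
  refine ⟨2 / ρ * (A + 4 * Q ^ 2 / ρ), by positivity, fun ν h hE hT c hc => ?_⟩
  have hpos := ae_pos_of_Iic h.1
  set f : ℝ → ℝ := fun r => r ^ p.α * (c - p.q * r ^ (-p.γ)) ^ 2
  have key : ∀ {g : ℝ → ℝ} {K : ℝ}, Measurable g → (∀ r, 0 < r → 0 ≤ g r) → 0 ≤ K →
      ∫⁻ r, ofReal (g r) ∂ν ≤ ofReal K → Integrable g ν ∧ ∫ r, g r ∂ν ≤ K := fun hg h0 hK hl =>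
    have h0 := hpos.mono h0
    ⟨integrable_of_lintegral_ofReal_lt_top hg h0 (hl.trans_lt ofReal_lt_top), by
      rw [integral_eq_lintegral_of_nonneg_ae h0 hg.aestronglyMeasurable]
      exact toReal_le_of_le_ofReal hK hl⟩
  obtain ⟨i1, h1⟩ := key (measurable_weighted_sq p c) (fun r hr => by positivity) toReal_nonneg
    (ofReal_toReal hc.ne).ge
  obtain ⟨i2, h2⟩ := key (measurable_id.pow_const (1 - p.γ)) (fun r hr => rpow_nonneg hr.le _)
    (le_max_right C 0) (hE.trans (ofReal_le_ofReal (le_max_left _ _)))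
  obtain ⟨i3, h3⟩ := key (measurable_id.indicator (measurableSet_Ici (a := R)))
    (fun r hr => indicator_apply_nonneg fun _ => hr.le) (K := ρ / 4) (by positivity) (by
    rw [← lintegral_indicator measurableSet_Ici] at hT
    refine (lintegral_congr fun r => ?_).trans_le hT
    by_cases hr : r ∈ Ici R <;> simp [hr])
  have hpt : ∀ r : ℝ, 0 < r → 3 / 4 * c ^ 2 * r ≤ A * f r + |c| * p.q * r ^ (1 - p.γ)
      + 3 / 4 * c ^ 2 * (Ici R).indicator id r := fun r hr => by
    have hf : 0 ≤ f r := by positivity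
    have hg : 0 ≤ |c| * p.q * r ^ (1 - p.γ) := by have := p.q_pos; positivity
    by_cases h4 : R ≤ r
    · rw [indicator_of_mem (mem_Ici.2 h4), id]
      nlinarith
    · have h5 : r ≤ A * r ^ p.α := by
        calc r = r ^ (1 - p.α) * r ^ p.α := by rw [← rpow_add hr, sub_add_cancel, rpow_one]
          _ ≤ A * r ^ p.α := by
              have := p.α_lt_one
              exact mul_le_mul_of_nonneg_right (rpow_le_rpow hr.le (not_le.1 h4).le (by linarith))
                (rpow_nonneg hr.le _)
      have h6 : r ^ (1 - p.γ) = r * r ^ (-p.γ) := by rw [sub_eq_add_neg, rpow_add hr, rpow_one]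
      rw [h6] at hg ⊢
      rw [indicator_of_notMem (by simpa using h4)]
      simp only [f]
      set y := r ^ (-p.γ)
      have h7 : c * p.q * (r * y) ≤ |c| * p.q * (r * y) := by
        have := p.q_pos
        gcongr
        grind
      nlinarith [mul_nonneg hr.le (sq_nonneg (c / 2 - (c - p.q * y))),
        mul_le_mul_of_nonneg_right h5 (sq_nonneg (c - p.q * y))]
  have hint := integral_mono_ae (h.integrable_id.const_mul _) (((i1.const_mul A).add (i2.const_mul
    (|c| * p.q))).add (i3.const_mul (3 / 4 * c ^ 2))) (hpos.mono hpt)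
  rw [integral_const_mul, h.integral_id hρ.le, integral_add' ((i1.const_mul A).add
    (i2.const_mul (|c| * p.q))) (i3.const_mul _), integral_add' (i1.const_mul A) (i2.const_mul _),
    integral_const_mul, integral_const_mul, integral_const_mul] at hint
  set D := (actionLSW p ν fun r => c - p.q * r ^ (-p.γ)).toReal
  have hD : 0 ≤ D := toReal_nonneg
  have h8 : |c| * Q ≤ c ^ 2 * ρ / 16 + 4 * Q ^ 2 / ρ := by
    rw [← sub_nonneg, ← sq_abs c, show |c| ^ 2 * ρ / 16 + 4 * Q ^ 2 / ρ - |c| * Q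
      = (|c| * ρ - 8 * Q) ^ 2 / (16 * ρ) by field_simp; ring]
    positivity
  have h9 : c ^ 2 * ρ / 2 ≤ A * D + 4 * Q ^ 2 / ρ := by
    have := mul_le_mul_of_nonneg_left h1 hA0.le
    have := mul_le_mul_of_nonneg_left h2 (mul_nonneg (abs_nonneg c) p.q_pos.le)
    have := mul_le_mul_of_nonneg_left h3 (sq_nonneg c)
    linarith
  rw [mul_assoc, div_mul_eq_mul_div, le_div_iff₀ hρ]
  have : 0 ≤ 4 * Q ^ 2 / ρ * D := by positivity
  linarith

end Moments

/-! ### Lower semicontinuity of the dissipation -/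

namespace BoundedSeq

variable {p : Rates} {ρ₀ x T K : ℝ} {ε : ℕ → ℝ} {n : ℕ → ℝ → ℕ → ℝ} {w : ℕ → ℝ → ℝ → ℝ}
  {ν : ℝ → Measure ℝ}

section

variable (h : BoundedSeq p ρ₀ x T K ε n w)
include h

theorem eventually_le_of_dissipationε_le {t : ℝ} (ht : t ∈ Icc 0 T) {c : ℝ} (hc : 0 ≤ c)
    (hD : ∀ k, dissipationε p (ε k) (n k t) ≤ ofReal c) {φ : ℝ → ℝ} (hφ : ContDiff ℝ 1 φ) {a b : ℝ}
    (ha : 0 < a) (h0 : ∀ r, r ∉ Icc a b → φ r = 0) {δ : ℝ} (hδ : 0 < δ) : ∀ᶠ k in atTop,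
    2 * ((n k t 1 - p.zs) / ε k ^ p.γ) * (∫ r, r ^ p.α * φ r ∂(macroMeasure x (ε k) (n k t)))
    - 2 * (∫ r, p.q * r ^ (p.α - p.γ) * φ r ∂(macroMeasure x (ε k) (n k t)))
    - ∫ r, r ^ p.α * φ r ^ 2 ∂(macroMeasure x (ε k) (n k t)) ≤ c + δ := by
  have hcs := (tsupport_subset_of_zero ha h0).1
  obtain ⟨L, hL⟩ := hφ.lipschitzWith_of_hasCompactSupport hcs one_ne_zero
  obtain ⟨M, hM⟩ := hφ.continuous.bounded_above_of_compact_support hcs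
  have hM0 : 0 ≤ M := (norm_nonneg _).trans (hM 0)
  set g : ℝ → ℝ := fun r => r ^ p.α * φ r ^ 2 with hg
  have hgc :
    Continuous g := (continuous_id.rpow_const fun _ => Or.inr p.α_nonneg).mul (hφ.continuous.pow 2)
  have hg0 : ∀ r, r ∉ Icc a b → g r = 0 := fun r hr => by grind
  have hgn : ∀ r, 0 ≤ g r := fun r => by
    by_cases hr : r ∈ Icc a b
    · exact mul_nonneg (rpow_nonneg (ha.le.trans hr.1) _) (sq_nonneg _)
    grind
  obtain ⟨N, hN⟩ := hgc.bounded_above_of_compact_support (tsupport_subset_of_zero ha hg0).1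
  have hN0 : 0 ≤ N := (norm_nonneg _).trans (hN 0)
  have hρ := h.ρ₀_pos
  set θ := δ / 2 / (ρ₀ / a * (N + 2)) with hθ
  have hθ0 : 0 < θ := by positivity
  obtain ⟨η, hη, hmod⟩ := (show IsTestFn fun z : ℝ × ℝ => g z.2 from ⟨by fun_prop, a, b, N, ha,
    fun z => hN _, fun _ r hr => hg0 r hr⟩).exists_modulus 0 hθ0
  have herr : Tendsto (fun k => 2 * ((p.zs + p.q) * L * (a ^ (p.α - 1) * ρ₀)) * ε k ^ (1 - p.γ))
      atTop (𝓝 (2 * ((p.zs + p.q) * L * (a ^ (p.α - 1) * ρ₀)) * 0)) :=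
      ((tendsto_rpow_nhdsGT_zero (by linarith [p.γ_lt_one])).comp h.tendsto_nhdsGT).const_mul _
  rw [mul_zero] at herr
  filter_upwards [h.eventually_integral_eq ha, h.eventually_cutoff ha, h.tendsto_nhdsGT.eventually
    (eventually_esum_nh_le p ρ₀ b h.K_nonneg ha hN0 hθ0), h.lim.eventually (gt_mem_nhds hη),
    herr.eventually (ge_mem_nhds (half_pos hδ))] with k hk hcut hnh hεη he
  have hst := (h.curve k).isState t ht
  rw [hk t ht b _ fun r hr => by grind,
    hk t ht b _ fun r hr => by grind, hk t ht b g hg0]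
  have h1 :=
    hst.le_dissipationε hρ (h.pos k) ((hD k).trans_lt ofReal_lt_top) ha h0 (L := L) fun r => by
      have := hL.dist_le_mul (r + ε k) r
      rwa [dist_eq, dist_eq, add_sub_cancel_left, abs_of_pos (h.pos k)] at this
  have h2 := hnh (n k t) hst (h.energy k t ht) g hgn hg0
    (fun r => (le_abs_self _).trans (hN r)) fun r => hmod 0 ⟨le_rfl, le_rfl⟩ _ _ (by
      rw [add_sub_cancel_left, abs_of_pos (h.pos k)]; exact hεη)
  have h3 := toReal_mono ofReal_ne_top (hD k)
  rw [toReal_ofReal hc] at h3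
  have h4 : ρ₀ / a * ((N + 2) * θ) = δ / 2 := by rw [hθ]; field_simp
  linarith

/-- The dissipation is lower semicontinuous along the sequence: the rescaled excess of monomers is
bounded, and each of its limits `c` satisfies `∫ r ^ α (c - q r ^ (-γ)) ^ 2 dν ≤ liminf D`. -/
theorem dissipationLSW_le (hν : IsVagueLimit T x ε n ν) {t : ℝ} (ht : t ∈ Icc 0 T) {c : ℝ}
    (hc : 0 ≤ c) (hD : ∃ᶠ k in atTop, dissipationε p (ε k) (n k t) ≤ ofReal c) :
    dissipationLSW p (ν t) ≤ ofReal c := by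
  obtain ⟨σ, hσ, hDσ⟩ := extraction_of_frequently_atTop hD
  have h' := h.comp hσ
  have hv : VagueTendsto atTop (fun k => macroMeasure x (ε (σ k)) (n (σ k) t)) (ν t) :=
    fun ζ h1 h2 h3 => ((hν t ht).2.2 ζ h1 h2 h3).comp hσ.tendsto_atTop
  have hst := h.isLSWState hν ht
  have hρ : 0 < ρ₀ - p.ρs := sub_pos.2 h.mass
  set u : ℕ → ℝ := fun k => (n (σ k) t 1 - p.zs) / ε (σ k) ^ p.γ with hu
  have hcα : Continuous fun r : ℝ => r ^ p.α := continuous_id.rpow_const fun _ => Or.inr p.α_nonneg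
  have hcγ : ContinuousOn (fun r : ℝ => p.q * r ^ (p.α - p.γ)) (Ioi 0) :=
    continuousOn_const.mul (continuousOn_id.rpow_const fun r hr => Or.inl (ne_of_gt hr))
  have hlim : ∀ {φ : ℝ → ℝ}, Continuous φ → ∀ {a b : ℝ}, 0 < a → (∀ r, r ∉ Icc a b → φ r = 0) →
      Tendsto (fun k => ∫ r, r ^ p.α * φ r ∂(macroMeasure x (ε (σ k)) (n (σ k) t))) atTop (𝓝 (∫ r, r
      ^ p.α * φ r ∂(ν t))) ∧ Tendsto (fun k => ∫ r, p.q * r ^ (p.α - p.γ) * φ r ∂(macroMeasure x (ε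
      (σ k)) (n (σ k) t))) atTop (𝓝 (∫ r, p.q * r ^ (p.α - p.γ) * φ r ∂(ν t))) ∧ Tendsto (fun k => ∫
      r, r ^ p.α * φ r ^ 2 ∂(macroMeasure x (ε (σ k)) (n (σ k) t))) atTop (𝓝 (∫ r, r ^ p.α * φ r ^ 2
      ∂(ν t))) := fun {φ} hφ {a b} ha h0 =>
    ⟨hv.tendsto (hcα.mul hφ) ha fun r hr => mul_eq_zero_of_right _ (h0 r hr),
      hv.tendsto (continuous_mul_of_continuousOn hcγ hφ ha h0) ha fun r hr =>
        mul_eq_zero_of_right _ (h0 r hr),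
      hv.tendsto (hcα.mul (hφ.pow 2)) ha fun r hr =>
        mul_eq_zero_of_right _ ((pow_eq_zero_iff two_ne_zero).2 (h0 r hr))⟩
  -- the excess of monomers is bounded
  obtain ⟨m, hm⟩ : ∃ m : ℕ, 0 < ∫ r, r ^ p.α * chi m r ∂(ν t) := by
    by_contra! hcon
    have hpos := ae_pos_of_Iic hst.1
    have h1 : ∫⁻ r, ofReal (r ^ p.α) ∂(ν t) ≤ 0 :=
      lintegral_le_of_forall_chi hst.1 hcα.continuousOn (Eventually.of_forall fun j => by
        rw [← ofReal_integral_eq_lintegral_ofReal (hst.locFin.integrable (f := fun r => r ^ p.α *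
          chi j r) (hcα.mul (chi_continuous j)) (inv_succ_pos j) (mul_chi_eq_zero j)) (hpos.mono fun
          r hr => mul_nonneg (rpow_nonneg (le_of_lt hr) _) chi_nonneg), ofReal_eq_zero.2 (hcon j)])
    have h2 : Integrable (fun r => r ^ p.α) (ν t) := integrable_of_lintegral_ofReal_lt_top
      hcα.measurable (hpos.mono fun r hr => rpow_nonneg (le_of_lt hr) _) (h1.trans_lt zero_lt_top)
    have h3 := hst.integral_rpow_pos hρ h2
    rw [← ofReal_pos, ofReal_integral_eq_lintegral_ofReal h2
      (hpos.mono fun r hr => rpow_nonneg (le_of_lt hr) _)] at h3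
    grind
  have hbdd : ∃ B : ℝ, ∀ᶠ k in atTop, u k ∈ Icc (-B) B := by
    obtain ⟨l1, l2, l3⟩ := hlim (chi_continuous m) (inv_succ_pos m) (fun r hr => chi_eq_zero hr)
    set S := ∫ r, r ^ p.α * chi m r ∂(ν t) with hS
    set P := ∫ r, p.q * r ^ (p.α - p.γ) * chi m r ∂(ν t) with hP
    set Q := ∫ r, r ^ p.α * chi m r ^ 2 ∂(ν t) with hQ
    have hch : ContDiff ℝ 1 (chi m) := (contDiff_chi m).of_le (by simp)
    refine ⟨(c + 1 + (2 * |P| + Q + 1)) / S, ?_⟩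
    filter_upwards [h'.eventually_le_of_dissipationε_le ht hc hDσ hch (inv_succ_pos m)
      (fun r hr => chi_eq_zero hr) one_pos, h'.eventually_le_of_dissipationε_le ht hc hDσ hch.neg
      (inv_succ_pos m) (fun r hr => neg_eq_zero.2 (chi_eq_zero hr)) one_pos,
      l1.eventually (lt_mem_nhds (half_lt_self hm)),
      ((l2.abs.const_mul 2).add l3).eventually (gt_mem_nhds (lt_add_one _))] with k k1 k2 k3 k4
    simp only [mul_neg, neg_sq, integral_neg] at k2
    change 2 * u k * _ - _ - _ ≤ _ at k1
    change -(2 * u k * _) - _ - _ ≤ _ at k2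
    set Sk := ∫ r, r ^ p.α * chi m r ∂(macroMeasure x (ε (σ k)) (n (σ k) t))
    set Pk := ∫ r, p.q * r ^ (p.α - p.γ) * chi m r ∂(macroMeasure x (ε (σ k)) (n (σ k) t))
    have habs : |u k| * S ≤ c + 1 + (2 * |P| + Q + 1) := by
      have : 2 * (|u k| * Sk) ≤ c + 1 + (2 * |P| + Q + 1) := by
        have := neg_abs_le Pk
        have := le_abs_self Pk
        rcases abs_cases (u k) with ⟨e, -⟩ | ⟨e, -⟩ <;> rw [e] <;> linarith
      nlinarith [abs_nonneg (u k)]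
    exact abs_le.1 ((le_div_iff₀ hm).2 habs)
  obtain ⟨B, hB⟩ := hbdd
  obtain ⟨d, -, τ, hτ, hlimu⟩ := isCompact_Icc.tendsto_subseq' hB.frequently
  -- the limit of the excess of monomers is a competitor for the mean field
  refine (hst.dissipationLSW_le hρ d).trans ?_
  have hcont : ContinuousOn (fun r : ℝ => r ^ p.α * (d - p.q * r ^ (-p.γ)) ^ 2) (Ioi 0) :=
    hcα.continuousOn.mul ((continuousOn_const.sub
    (continuousOn_const.mul (continuousOn_id.rpow_const fun r hr => Or.inl (ne_of_gt hr)))).pow 2)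
  have hpos := ae_pos_of_Iic hst.1
  refine lintegral_le_of_forall_chi hst.1 hcont (Eventually.of_forall fun j => ?_)
  rw [← ofReal_integral_eq_lintegral_ofReal (hst.locFin.integrable (continuous_mul_chi hcont j)
    (inv_succ_pos j) (mul_chi_eq_zero j)) (hpos.mono fun r hr => mul_nonneg
    (mul_nonneg (rpow_nonneg (le_of_lt hr) _) (sq_nonneg _)) chi_nonneg)]
  refine ofReal_le_ofReal (le_of_forall_pos_le_add fun δ hδ => ?_)
  set φ : ℝ → ℝ := fun r => (d - p.q * r ^ (-p.γ)) * chi j r with hφ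
  have hφ0 : ∀ r, r ∉ Icc (1 / ((j : ℝ) + 1)) (2 * (j + 1)) → φ r = 0 := fun r hr => by
    simp only [hφ, chi_eq_zero hr, mul_zero]
  have hφ1 : ContDiff ℝ 1 φ := by
    refine contDiff_iff_contDiffAt.2 fun r => ?_
    by_cases hr : 0 < r
    · exact (contDiffAt_const.sub (contDiffAt_const.mul (Real.contDiffAt_rpow_const_of_ne
        hr.ne'))).mul ((contDiff_chi j).of_le (by simp)).contDiffAt
    · have : φ =ᶠ[𝓝 r] fun _ => 0 := by
        have hlt : r < 1 / ((j : ℝ) + 1) := (not_lt.1 hr).trans_lt (inv_succ_pos j)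
        filter_upwards [gt_mem_nhds hlt] with s hs
        grind
      exact contDiffAt_const.congr_of_eventuallyEq this
  obtain ⟨l1, l2, l3⟩ := hlim hφ1.continuous (inv_succ_pos j) hφ0
  have hle := le_of_tendsto (((((hlimu.const_mul 2).mul (l1.comp hτ.tendsto_atTop)).sub ((l2.comp
    hτ.tendsto_atTop).const_mul 2)).sub (l3.comp hτ.tendsto_atTop))) (hτ.tendsto_atTop.eventually
    (h'.eventually_le_of_dissipationε_le ht hc hDσ hφ1 (inv_succ_pos j) hφ0 hδ))
  refine le_trans ?_ hle
  have i1 : Integrable (fun r => r ^ p.α * φ r) (ν t) := hst.locFin.integrable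
    (hcα.mul hφ1.continuous) (inv_succ_pos j) fun r hr => mul_eq_zero_of_right _ (hφ0 r hr)
  have i2 := hst.locFin.integrable (continuous_mul_of_continuousOn hcγ hφ1.continuous (inv_succ_pos
    j) hφ0) (inv_succ_pos j) fun r hr => mul_eq_zero_of_right _ (hφ0 r hr)
  have i3 : Integrable (fun r => r ^ p.α * φ r ^ 2) (ν t) :=
    hst.locFin.integrable (hcα.mul (hφ1.continuous.pow 2)) (inv_succ_pos j) fun r hr =>
    mul_eq_zero_of_right _ ((pow_eq_zero_iff two_ne_zero).2 (hφ0 r hr))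
  have i12 : Integrable (fun r => 2 * d * (r ^ p.α * φ r)
      - 2 * (p.q * r ^ (p.α - p.γ) * φ r)) (ν t) := (i1.const_mul _).sub (i2.const_mul _)
  rw [← integral_const_mul, ← integral_const_mul, ← integral_sub (i1.const_mul _) (i2.const_mul _),
    ← integral_sub i12 i3]
  refine integral_mono_ae (hst.locFin.integrable (continuous_mul_chi hcont j) (inv_succ_pos j)
    (mul_chi_eq_zero j)) (i12.sub i3) ?_
  filter_upwards [hpos] with r hr
  simp only [hφ]
  rw [sub_eq_add_neg p.α, rpow_add hr]
  have h1 : 0 ≤ r ^ p.α * (d - p.q * r ^ (-p.γ)) ^ 2 := by positivity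
  -- `χ ≤ 2 χ - χ ^ 2`
  nlinarith [mul_nonneg h1
    (mul_nonneg (chi_nonneg (j := j) (r := r)) (sub_nonneg.2 (chi_le_one (j := j) (r := r))))]

end

end BoundedSeq

/-! ### Finite curves and the chain rule for the energy -/

/-- Curves of states with velocity `v` that have finite action and dissipation and solve the
continuity equation; `U` is a measurable version of the mean field. -/
structure FiniteCurve (p : Rates) (ρ T : ℝ) (ν : ℝ → Measure ℝ) (v : ℝ → ℝ → ℝ) (U : ℝ → ℝ) : Prop
    extends IsStateCurve ρ T ν where
  ρ_pos : 0 < ρ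
  T_pos : 0 < T
  exponent : 1 - 3 * p.γ ≤ p.α
  measurable_v : Measurable (Function.uncurry v)
  measurable_U : Measurable U
  U_nonneg : ∀ t, 0 ≤ U t
  U_eq : ∀ t ∈ Icc 0 T, U t = meanField p (ν t)
  action : ∫⁻ t in Icc 0 T, actionLSW p (ν t) (v t) < ⊤
  dissipation : ∫⁻ t in Icc 0 T, dissipationLSW p (ν t) < ⊤
  moment : ∃ C : ℝ, ∀ t ∈ Icc 0 T, ∫⁻ r, ofReal (r ^ (1 - p.γ)) ∂(ν t) ≤ ofReal C
  meanField_le : ∃ B : ℝ, 0 ≤ B ∧ ∀ t ∈ Icc 0 T, dissipationLSW p (ν t) < ⊤ →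
    meanField p (ν t) ^ 2 ≤ B * (1 + (dissipationLSW p (ν t)).toReal)
  continuityEq : ∀ ζ : ℝ × ℝ → ℝ, ContDiff ℝ 1 ζ → HasCompactSupport ζ → tsupport ζ ⊆ univ ×ˢ Ioi 0
    → (∫ r, ζ (T, r) ∂(ν T)) - (∫ r, ζ (0, r) ∂(ν 0)) = (∫ t in Icc 0 T, ∫ r, dTime ζ (t, r) ∂(ν t))
    + ∫ t in Icc 0 T, ∫ r, r ^ p.α * v t r * dSize ζ (t, r) ∂(ν t)

theorem IsStateCurve.exists_meanField {ρ T : ℝ} {ν : ℝ → Measure ℝ} (h : IsStateCurve ρ T ν)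
    (p : Rates) :
    ∃ U : ℝ → ℝ, Measurable U ∧ (∀ t, 0 ≤ U t) ∧ ∀ t ∈ Icc 0 T, U t = meanField p (ν t) := by
  have hm : ∀ s : ℝ, Measurable fun t => ∫ r, r ^ s ∂(h.kernel t) := fun s =>
    ((measurable_snd.pow_const s).stronglyMeasurable.integral_kernel_prod_right'
      (f := fun z : ℝ × ℝ => z.2 ^ s) (κ := h.kernel)).measurable
  refine ⟨fun t => max 0 (p.q * (∫ r, r ^ (p.α - p.γ - 1) ∂(h.kernel t)) / ∫ r, r ^ (p.α
    - 1) ∂(h.kernel t)), measurable_const.max (((hm _).const_mul _).div (hm _)),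
    fun t => le_max_left _ _, fun t ht => ?_⟩
  have hpos := ae_pos_of_Iic (h.isState t ht).1
  have he : ∀ s : ℝ, ∫ r, r ^ (s - 1) ∂(h.kernel t) = ∫ r, r ^ s ∂(ν t) := fun s => by
    rw [h.integral_kernel ht]
    refine integral_congr_ae (hpos.mono fun r hr => ?_)
    change r * r ^ (s - 1) = r ^ s
    rw [rpow_sub_one (ne_of_gt hr)]; field_simp
  have hn : ∀ s : ℝ, 0 ≤ ∫ r, r ^ s ∂(ν t) := fun s =>
    integral_nonneg_of_ae (hpos.mono fun r hr => rpow_nonneg (le_of_lt hr) _)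
  simp only
  rw [he, he, max_eq_right]
  · rfl
  · have := p.q_pos; have := hn (p.α - p.γ); have := hn p.α; positivity

theorem rpow_α_le {p : Rates} (hα : 1 - 3 * p.γ ≤ p.α) (c : ℝ) {r : ℝ} (hr : 0 < r) : r ^ p.α
    ≤ r ^ p.α * (c - p.q * r ^ (-p.γ)) ^ 2 + 2 / p.q ^ 2 * (1 + c ^ 2) * r ^ (1 - p.γ) + r := by
  have hq := p.q_pos
  have hX : 0 < r ^ p.α := rpow_pos_of_pos hr _
  have hZ : 0 < r ^ (1 - p.γ) := rpow_pos_of_pos hr _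
  have hy : 0 < r ^ (-p.γ) := rpow_pos_of_pos hr _
  have h1 : 0 ≤ r ^ p.α * (c - p.q * r ^ (-p.γ)) ^ 2 := by positivity
  have h2 : 0 ≤ 2 / p.q ^ 2 * (1 + c ^ 2) * r ^ (1 - p.γ) := by positivity
  rcases le_total (|c| + 1) (p.q * r ^ (-p.γ)) with h | h
  · have : 1 ≤ (c - p.q * r ^ (-p.γ)) ^ 2 := by nlinarith [le_abs_self c]
    nlinarith
  rcases le_total 1 r with h3 | h3
  · have := Real.rpow_le_rpow_of_exponent_le h3 p.α_lt_one.le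
    rw [rpow_one] at this
    linarith
  · have h4 : r ^ p.α ≤ r ^ (1 - p.γ) * (r ^ (-p.γ)) ^ 2 := by
      rw [← rpow_natCast, ← rpow_mul hr.le, ← rpow_add hr]
      exact Real.rpow_le_rpow_of_exponent_ge hr h3 (by grind)
    have h5 : p.q ^ 2 * (r ^ (-p.γ)) ^ 2 ≤ 2 * (1 + c ^ 2) := by
      rw [← mul_pow]
      calc (p.q * r ^ (-p.γ)) ^ 2 ≤ (|c| + 1) ^ 2 := by gcongr
        _ ≤ 2 * (1 + c ^ 2) := by rw [← sq_abs c]; nlinarith [sq_nonneg (|c| - 1)]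
    have h6 : (r ^ (-p.γ)) ^ 2 ≤ 2 / p.q ^ 2 * (1 + c ^ 2) := by
      rw [div_mul_eq_mul_div, le_div_iff₀ (by positivity)]; linarith
    nlinarith

theorem abs_mul_deriv_chi_le : ∃ C : ℝ, 0 ≤ C ∧ ∀ (j : ℕ) (r : ℝ), |r * deriv (chi j) r| ≤ C := by
  obtain ⟨C, hC, h⟩ := exists_abs_mul_deriv_upStep_le
  refine ⟨C + C, by positivity, fun j r => ?_⟩
  have hd : ∀ R, DifferentiableAt ℝ (upStep R) r := fun R =>
    (contDiff_upStep R).differentiable (by simp) r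
  have : deriv (chi j) r = deriv (upStep (1 / (j + 1))) r * (1 - upStep (j + 1) r)
      + upStep (1 / (j + 1)) r * -deriv (upStep (j + 1)) r :=
      ((hd _).hasDerivAt.mul ((hd _).hasDerivAt.const_sub 1)).deriv
  rw [this, mul_add]
  refine (abs_add_le _ _).trans (add_le_add ?_ ?_)
  · rw [← mul_assoc, abs_mul]
    refine (mul_le_of_le_one_right (abs_nonneg _) ?_).trans (h _ r (inv_succ_pos j))
    rw [abs_le]
    constructor <;> linarith [upStep_nonneg (R := (j : ℝ) + 1) (r := r),
      upStep_le_one (R := (j : ℝ) + 1) (r := r)]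
  · rw [mul_left_comm, mul_neg, abs_mul, abs_neg]
    refine (mul_le_of_le_one_left (abs_nonneg _) ?_).trans (h _ r (by positivity))
    rw [abs_of_nonneg upStep_nonneg]
    exact upStep_le_one

namespace FiniteCurve

variable {p : Rates} {ρ T : ℝ} {ν : ℝ → Measure ℝ} {v : ℝ → ℝ → ℝ} {U : ℝ → ℝ}

/-- The measure `r ν_t(dr) dt`. -/
noncomputable abbrev mes (h : FiniteCurve p ρ T ν v U) : Measure (ℝ × ℝ) :=
  h.toIsStateCurve.spaceTime

section

variable (h : FiniteCurve p ρ T ν v U)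
include h

theorem ae_pos : ∀ᵐ z ∂h.mes, 0 < z.2 := by
  refine Measure.ae_compProd_of_ae_ae (measurableSet_lt measurable_const measurable_snd) ?_
  filter_upwards [ae_mem_Icc] with t ht
  change ∀ᵐ r ∂(momentCurve T ν t), 0 < r
  rw [IsStateCurve.momentCurve_of_mem ht]
  exact withDensity_absolutelyContinuous _ _ (ae_pos_of_Iic (h.isState t ht).1)

theorem lintegral_mes {g : ℝ × ℝ → ℝ} (hg : Measurable g) :
    ∫⁻ z, ofReal (z.2 ^ (p.α - 1) * g z) ∂h.mes
    = ∫⁻ t in Icc 0 T, ∫⁻ r, ofReal (r ^ p.α * g (t, r)) ∂(ν t) := by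
  have hm : Measurable fun z : ℝ × ℝ => ofReal (z.2 ^ (p.α - 1) * g z) :=
    ((measurable_snd.pow_const _).mul hg).ennreal_ofReal
  rw [mes, h.toIsStateCurve.lintegral_spaceTime hm]
  refine setLIntegral_congr_fun measurableSet_Icc fun t ht => ?_
  refine lintegral_congr_ae ((ae_pos_of_Iic (h.isState t ht).1).mono fun r hr => ?_)
  simp only
  rw [← ofReal_mul (le_of_lt hr), ← mul_assoc, rpow_sub_one (ne_of_gt hr),
    mul_div_cancel₀ _ (ne_of_gt hr)]

theorem integral_mes {g : ℝ × ℝ → ℝ} (hg : Integrable (fun z => z.2 ^ (p.α - 1) * g z) h.mes) :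
    ∫ z, z.2 ^ (p.α - 1) * g z ∂h.mes = ∫ t in Icc 0 T, ∫ r, r ^ p.α * g (t, r) ∂(ν t) := by
  rw [mes, h.toIsStateCurve.integral_spaceTime hg]
  refine setIntegral_congr_fun measurableSet_Icc fun t ht => ?_
  refine integral_congr_ae ((ae_pos_of_Iic (h.isState t ht).1).mono fun r hr => ?_)
  simp only
  rw [← mul_assoc, rpow_sub_one (ne_of_gt hr), mul_div_cancel₀ _ (ne_of_gt hr)]

theorem integrable_slice {g : ℝ × ℝ → ℝ} (hg : Integrable (fun z => z.2 ^ (p.α - 1) * g z) h.mes) :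
    Integrable (fun t => ∫ r, r ^ p.α * g (t, r) ∂(ν t)) vol[T] := by
  refine (h.toIsStateCurve.integrable_integral hg).congr ?_
  filter_upwards [ae_mem_Icc] with t ht
  refine integral_congr_ae ((ae_pos_of_Iic (h.isState t ht).1).mono fun r hr => ?_)
  simp only
  rw [← mul_assoc, rpow_sub_one (ne_of_gt hr), mul_div_cancel₀ _ (ne_of_gt hr)]

theorem integral_mes_Iic {g : ℝ × ℝ → ℝ} (hg : Integrable (fun z => z.2 ^ (p.α - 1) * g z) h.mes)
    {t : ℝ} (ht : t ∈ Icc 0 T) : ∫ z in {z | z.1 ≤ t}, z.2 ^ (p.α - 1) * g z ∂h.mes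
    = ∫ s in Icc 0 t, ∫ r, r ^ p.α * g (s, r) ∂(ν s) := by
  have hm : MeasurableSet {z : ℝ × ℝ | z.1 ≤ t} := measurableSet_le measurable_fst measurable_const
  have h1 : ({z : ℝ × ℝ | z.1 ≤ t}.indicator fun z => z.2 ^ (p.α - 1) * g z)
      = fun z => z.2 ^ (p.α - 1) * {z : ℝ × ℝ | z.1 ≤ t}.indicator g z := by
    funext z
    by_cases hz : z.1 ≤ t <;> simp [indicator, hz]
  have h2 : Icc 0 t = Icc 0 T ∩ Iic t := Set.ext fun s =>
    ⟨fun hs => ⟨⟨hs.1, hs.2.trans ht.2⟩, hs.2⟩, fun hs => ⟨hs.1.1, hs.2⟩⟩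
  rw [← integral_indicator hm, h1, h.integral_mes (h1 ▸ hg.indicator hm), h2,
    ← setIntegral_indicator measurableSet_Iic]
  congr 1 with s
  by_cases hs : s ≤ t <;> simp [indicator, hs]

theorem integrable_mes {g : ℝ × ℝ → ℝ} (hg : Measurable g) (h0 : ∀ z, 0 ≤ g z)
    (hfin : ∫⁻ t in Icc 0 T, ∫⁻ r, ofReal (r ^ p.α * g (t, r)) ∂(ν t) < ⊤) :
    Integrable (fun z => z.2 ^ (p.α - 1) * g z) h.mes := by
  refine ⟨((measurable_snd.pow_const _).mul hg).aestronglyMeasurable,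
    (hasFiniteIntegral_iff_ofReal (h.ae_pos.mono fun z hz =>
      mul_nonneg (rpow_nonneg (le_of_lt hz) _) (h0 z))).2 ?_⟩
  rw [h.lintegral_mes hg]; exact hfin

/-- The velocity field of the LSW equation, in a measurable version. -/
noncomputable def lsw (p : Rates) (U : ℝ → ℝ) (z : ℝ × ℝ) : ℝ := U z.1 - p.q * z.2 ^ (-p.γ)

theorem measurable_lsw : Measurable (lsw p U) :=
  (h.measurable_U.comp measurable_fst).sub ((measurable_snd.pow_const _).const_mul _)

theorem lsw_eq {t : ℝ} (ht : t ∈ Icc 0 T) (r : ℝ) : lsw p U (t, r) = velocityLSW p (ν t) r := by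
  rw [lsw, velocityLSW, h.U_eq t ht]

theorem lintegral_lsw : ∫⁻ t in Icc 0 T, ∫⁻ r, ofReal (r ^ p.α * lsw p U (t, r) ^ 2) ∂(ν t)
    = ∫⁻ t in Icc 0 T, dissipationLSW p (ν t) :=
  setLIntegral_congr_fun measurableSet_Icc fun t ht => by
    simp only [h.lsw_eq ht]; rfl

theorem integrable_sq_v : Integrable (fun z => z.2 ^ (p.α - 1) * v z.1 z.2 ^ 2) h.mes :=
  h.integrable_mes (h.measurable_v.pow_const 2) (fun _ => sq_nonneg _) h.action

theorem integrable_sq_lsw : Integrable (fun z => z.2 ^ (p.α - 1) * lsw p U z ^ 2) h.mes :=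
  h.integrable_mes (h.measurable_lsw.pow_const 2) (fun _ => sq_nonneg _)
    (h.lintegral_lsw.trans_lt h.dissipation)

theorem aemeasurable_dissipation : AEMeasurable (fun t => dissipationLSW p (ν t)) vol[T] := by
  have hm : Measurable fun z : ℝ × ℝ => z.2 ^ p.α * lsw p U z ^ 2 :=
    (measurable_snd.pow_const _).mul (h.measurable_lsw.pow_const 2)
  refine (h.toIsStateCurve.aemeasurable_lintegral hm.ennreal_ofReal).congr ?_
  filter_upwards [ae_mem_Icc] with t ht
  simp only [h.lsw_eq ht]
  rfl

theorem ae_dissipation_lt_top : ∀ᵐ t ∂vol[T], dissipationLSW p (ν t) < ⊤ :=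
  ae_lt_top' h.aemeasurable_dissipation h.dissipation.ne

theorem integrable_weight : Integrable (fun z => z.2 ^ (p.α - 1)) h.mes := by
  obtain ⟨C, hC⟩ := h.moment
  obtain ⟨B, hB0, hB⟩ := h.meanField_le
  have hq := p.q_pos
  have hρ := h.ρ_pos
  have key : ∀ᵐ t ∂vol[T], ∫⁻ r, ofReal (r ^ p.α * 1) ∂(ν t) ≤ ofReal (2 / p.q ^ 2 * (1 + B) * |C| +
      ρ) + ofReal (1 + 2 / p.q ^ 2 * B * |C|) * dissipationLSW p (ν t) := by
    filter_upwards [h.ae_dissipation_lt_top, ae_mem_Icc] with t hD ht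
    set c := meanField p (ν t)
    set d := (dissipationLSW p (ν t)).toReal with hd
    have hd0 : 0 ≤ d := toReal_nonneg
    have hc : c ^ 2 ≤ B * (1 + d) := hB t ht hD
    have hDd : dissipationLSW p (ν t) = ofReal d := (ofReal_toReal hD.ne).symm
    have hst := h.isState t ht
    have hm1 : Measurable fun r : ℝ => ofReal (r ^ p.α * (c - p.q * r ^ (-p.γ)) ^ 2) :=
      (measurable_weighted_sq p c).ennreal_ofReal
    have hm2 :
      Measurable fun r : ℝ => ofReal (r ^ (1 - p.γ)) := (measurable_id.pow_const _).ennreal_ofReal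
    have hm3 : Measurable fun r : ℝ => ofReal (2 / p.q ^ 2 * (1 + c ^ 2))
      * ofReal (r ^ (1 - p.γ)) := hm2.const_mul _
    calc ∫⁻ r, ofReal (r ^ p.α * 1) ∂(ν t)
        ≤ ∫⁻ r, (ofReal (r ^ p.α * (c - p.q * r ^ (-p.γ)) ^ 2)
          + (ofReal (2 / p.q ^ 2 * (1 + c ^ 2)) * ofReal (r ^ (1 - p.γ)) + ofReal r)) ∂(ν t) := by
          refine lintegral_mono_ae ((ae_pos_of_Iic hst.1).mono fun r hr => ?_)
          have := rpow_pos_of_pos hr (1 - p.γ)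
          have := rpow_pos_of_pos hr p.α
          have hr' : 0 < r := hr
          rw [mul_one, ← ofReal_mul (by positivity), ← ofReal_add (by positivity) (by positivity),
            ← ofReal_add (by positivity) (by positivity), ← add_assoc]
          exact ofReal_le_ofReal (rpow_α_le h.exponent c hr)
      _ = ofReal d + (ofReal (2 / p.q ^ 2 * (1 + c ^ 2)) * (∫⁻ r, ofReal (r ^ (1 - p.γ)) ∂(ν t))
          + ofReal ρ) := by
          rw [lintegral_add_left hm1, lintegral_add_left hm3, lintegral_const_mul _ hm2, hst.2,
            ← hDd]; rfl
      _ ≤ ofReal d + (ofReal (2 / p.q ^ 2 * (1 + c ^ 2)) * ofReal |C| + ofReal ρ) := by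
          gcongr
          exact (hC t ht).trans (ofReal_le_ofReal (le_abs_self C))
      _ ≤ _ := by
          rw [hDd, ← ofReal_mul (by positivity), ← ofReal_mul (by positivity), ← ofReal_add (by
            positivity) (by positivity), ← ofReal_add (by positivity) (by positivity), ← ofReal_add
            (by positivity) (by positivity)]
          refine ofReal_le_ofReal ?_
          have h1 : 2 / p.q ^ 2 * (1 + c ^ 2) * |C| ≤ 2 / p.q ^ 2 * (1 + B * (1 + d)) * |C| := by
            gcongr
          linarith
  have hfin := lintegral_mono_ae key
  rw [lintegral_add_left measurable_const, lintegral_const,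
    lintegral_const_mul' _ _ ofReal_ne_top] at hfin
  refine (h.integrable_mes measurable_const (g := fun _ => 1) (fun _ => zero_le_one)
    (hfin.trans_lt (add_lt_top.2 ⟨mul_lt_top ofReal_lt_top (by simp),
    mul_lt_top ofReal_lt_top h.dissipation⟩))).congr (ae_of_all _ fun z => mul_one _)

theorem integrable_v : Integrable (fun z => z.2 ^ (p.α - 1) * v z.1 z.2) h.mes := by
  refine (h.integrable_sq_v.add h.integrable_weight).mono' ((measurable_snd.pow_const _).mul
    h.measurable_v).aestronglyMeasurable (h.ae_pos.mono fun z hz => ?_)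
  have := rpow_pos_of_pos hz (p.α - 1)
  rw [norm_mul, norm_eq_abs, norm_eq_abs, abs_of_pos this, Pi.add_apply]
  have : |v z.1 z.2| ≤ v z.1 z.2 ^ 2 + 1 := by
    rw [← sq_abs]; nlinarith [sq_nonneg (|v z.1 z.2| - 1), abs_nonneg (v z.1 z.2)]
  nlinarith

theorem integrable_v_mul {g : ℝ × ℝ → ℝ} (hg : Measurable g) {C : ℝ} (hC : ∀ᵐ z ∂h.mes, |g z| ≤ C) :
    Integrable (fun z => z.2 ^ (p.α - 1) * (v z.1 z.2 * g z)) h.mes :=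
  (h.integrable_v.mul_bdd hg.aestronglyMeasurable hC).congr (ae_of_all _ fun z => by linarith)

theorem integrable_v_mul_lsw :
    Integrable (fun z => z.2 ^ (p.α - 1) * (v z.1 z.2 * lsw p U z)) h.mes := by
  refine (h.integrable_sq_v.add h.integrable_sq_lsw).mono' ((measurable_snd.pow_const _).mul
    (h.measurable_v.mul h.measurable_lsw)).aestronglyMeasurable (h.ae_pos.mono fun z hz => ?_)
  have := rpow_pos_of_pos hz (p.α - 1)
  rw [norm_mul, norm_eq_abs, norm_eq_abs, abs_of_pos this, Pi.add_apply, ← mul_add]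
  refine mul_le_mul_of_nonneg_left (abs_le.2 ⟨?_, ?_⟩) this.le <;>
    nlinarith [sq_nonneg (v z.1 z.2 + lsw p U z), sq_nonneg (v z.1 z.2 - lsw p U z)]

end

end FiniteCurve

namespace FiniteCurve

variable {p : Rates} {ρ T : ℝ} {ν : ℝ → Measure ℝ} {v : ℝ → ℝ → ℝ} {U : ℝ → ℝ}

section

variable (h : FiniteCurve p ρ T ν v U)
include h

theorem ae_mem : ∀ᵐ z ∂h.mes, z.1 ∈ Icc 0 T := by
  refine Measure.ae_compProd_of_ae_ae (measurable_fst measurableSet_Icc) ?_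
  filter_upwards [ae_mem_Icc] with t ht
  exact ae_of_all _ fun _ => ht

theorem continuity_mul {f η : ℝ → ℝ} (hf : ContDiff ℝ 1 f) {a b : ℝ} (ha : 0 < a)
    (h0 : ∀ r, r ∉ Icc a b → f r = 0) (hη : ContDiff ℝ 1 η) :
    η T * (∫ r, f r ∂(ν T)) - η 0 * (∫ r, f r ∂(ν 0)) = (∫ t in Icc 0 T, deriv η t
    * ∫ r, f r ∂(ν t)) + ∫ t in Icc 0 T, η t * ∫ r, r ^ p.α * (v t r * deriv f r) ∂(ν t) := by
  -- a cutoff in time that is one near `[0, T]`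
  set κ : ℝ → ℝ := fun t => smoothTransition (t + 2) * smoothTransition (T + 2 - t) with hκ
  have hκc : ContDiff ℝ 1 κ := (smoothTransition.contDiff.comp (by fun_prop)).mul
    (smoothTransition.contDiff.comp (by fun_prop))
  have hκ1 : ∀ t, -1 < t → t < T + 1 → κ t = 1 := fun t h1 h2 => by
    simp only [hκ]
    rw [smoothTransition.one_of_one_le (by linarith), smoothTransition.one_of_one_le (by linarith),
      one_mul]
  set ζ : ℝ × ℝ → ℝ := fun z => κ z.1 * η z.1 * f z.2 with hζ
  have hζK : ∀ z, z ∉ Icc (-2) (T + 2) ×ˢ Icc a b → ζ z = 0 := by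
    intro z hz
    by_cases hr : z.2 ∈ Icc a b
    · have : κ z.1 = 0 := by
        simp only [hκ, mul_eq_zero, smoothTransition.zero_iff_nonpos]
        grind
      grind
    grind
  have hsub : Function.support ζ ⊆ Icc (-2) (T + 2) ×ˢ Icc a b := fun z hz =>
    by_contra fun hcon => hz (hζK z hcon)
  have hs : tsupport ζ ⊆ univ ×ˢ Ioi 0 :=
    (closure_minimal hsub (isClosed_Icc.prod isClosed_Icc)).trans fun z hz => ⟨mem_univ _, ha.trans_le hz.2.1⟩
  have hmain := h.continuityEq ζ (((hκc.mul hη).comp contDiff_fst).mul (hf.comp contDiff_snd))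
    (HasCompactSupport.intro (isCompact_Icc.prod isCompact_Icc) hζK) hs
  have hT := h.T_pos
  have e1 : ∀ t ∈ Icc 0 T, ∀ r, ζ (t, r) = η t * f r := fun t ht r => by grind
  have e2 : ∀ t ∈ Icc 0 T, ∀ r, dTime ζ (t, r) = deriv η t * f r := fun t ht r => by
    have : (fun s => ζ (s, r)) =ᶠ[𝓝 t] fun s => η s * f r := by
      filter_upwards [Ioo_mem_nhds (show -1 < t by linarith [ht.1]) (show t
        < T + 1 by linarith [ht.2])] with s hs
      grind
    rw [dTime]
    simp only
    rw [this.deriv_eq, deriv_mul_const_field]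
  have e3 : ∀ t ∈ Icc 0 T, ∀ r, dSize ζ (t, r) = η t * deriv f r := fun t ht r => by
    rw [dSize]
    simp only [e1 t ht, deriv_const_mul_field']
  simp only [e1 T ⟨hT.le, le_rfl⟩, e1 0 ⟨le_rfl, hT.le⟩, integral_const_mul] at hmain
  rw [hmain]
  congr 1
  · exact setIntegral_congr_fun measurableSet_Icc fun t ht => by
      simp only [e2 t ht, integral_const_mul]
  · exact setIntegral_congr_fun measurableSet_Icc fun t ht => by
      simp only [e3 t ht, ← integral_const_mul]
      grind

/-- The continuity equation on `[0, t]` for functions of the size with compact support. -/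
theorem continuity_Iic {f : ℝ → ℝ} (hf : ContDiff ℝ 1 f) {a b : ℝ} (ha : 0 < a)
    (h0 : ∀ r, r ∉ Icc a b → f r = 0) {t : ℝ} (ht : t ∈ Icc 0 T) :
    (∫ r, f r ∂(ν t)) - (∫ r, f r ∂(ν 0))
    = ∫ z in {z | z.1 ≤ t}, z.2 ^ (p.α - 1) * (v z.1 z.2 * deriv f z.2) ∂h.mes := by
  have hT := h.T_pos.le
  set g : ℝ → ℝ := fun s => ∫ r, f r ∂(ν s) with hg
  set F : ℝ → ℝ := fun s => ∫ r, r ^ p.α * (v s r * deriv f r) ∂(ν s) with hF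
  obtain ⟨M, hM⟩ := (hf.continuous_deriv le_rfl).bounded_above_of_compact_support
    (tsupport_subset_of_zero ha h0).1.deriv
  have hfi := h.integrable_v_mul (g := fun z => deriv f z.2)
    ((measurable_deriv f).comp measurable_snd) (ae_of_all _ fun z => hM _)
  have hFi : IntervalIntegrable F volume 0 T :=
    IsRescaledCurve.intervalIntegrable_of_Icc h.T_pos (h.integrable_slice hfi)
  set Φ : ℝ → ℝ := fun t => ∫ s in (0 : ℝ)..t, F s with hΦ
  have hΦa : AbsolutelyContinuousOnInterval Φ 0 T :=
    hFi.absolutelyContinuousOnInterval_intervalIntegral (by simp)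
  have hΦc : ContinuousOn Φ (Icc 0 T) := by simpa [uIcc_of_le hT] using hΦa.continuousOn
  set H : ℝ → ℝ := fun t => g t - g 0 - Φ t with hH
  have hgc : ContinuousOn g (Icc 0 T) := h.continuousOn f a b ha hf.continuous h0
  have hHc : ContinuousOn H (Icc 0 T) := (hgc.sub continuousOn_const).sub hΦc
  -- the weak form of `H' = 0`
  have hmain : ∀ η : ℝ → ℝ, ContDiff ℝ 1 η → η T * H T = ∫ s in Icc 0 T, deriv η s * H s := by
    intro η hη
    have h1 := h.continuity_mul hf ha h0 hη
    have h2 := hη.contDiffOn.absolutelyContinuousOnInterval (a := 0) (b := T)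
      |>.integral_mul_deriv_eq_deriv_mul hΦa
    have h3 : ∫ s in (0 : ℝ)..T, η s * deriv Φ s = ∫ s in (0 : ℝ)..T, η s * F s := by
      refine intervalIntegral.integral_congr_ae ?_
      filter_upwards [hFi.ae_hasDerivAt_integral] with s hs hs'
      rw [(hs (uIoc_subset_uIcc hs') 0 left_mem_uIcc).deriv]
    have h4 :
      IntervalIntegrable (deriv η) volume 0 T := (hη.continuous_deriv le_rfl).intervalIntegrable _ _
    have h5 :=
      intervalIntegral.integral_deriv_eq_sub (fun s _ => hη.differentiable one_ne_zero s) h4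
    rw [h3, show Φ 0 = 0 from intervalIntegral.integral_same] at h2
    simp only [integral_Icc_eq_integral_Ioc, ← intervalIntegral.integral_of_le hT] at h1 ⊢
    rw [← uIcc_of_le hT] at hgc hΦc
    simp only [hH, mul_sub]
    rw [intervalIntegral.integral_sub ((h4.mul_continuousOn hgc).sub (h4.mul_const _))
      (h4.mul_continuousOn hΦc), intervalIntegral.integral_sub (h4.mul_continuousOn hgc)
      (h4.mul_const _), intervalIntegral.integral_mul_const, h5]
    linarith
  have hHT : H T = 0 := by simpa using hmain (fun _ => 1) contDiff_const
  -- testing with a primitive of `H`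
  have hHe : Continuous (IccExtend hT ((Icc 0 T).domRestrict H)) := hHc.domRestrict.Icc_extend'
  set P : ℝ → ℝ := fun t => ∫ s in (0 : ℝ)..t, IccExtend hT ((Icc 0 T).domRestrict H) s
  have hHd :
    deriv P = IccExtend hT ((Icc 0 T).domRestrict H) := funext fun t => hHe.deriv_integral _ 0 t
  have h2 := hmain P (contDiff_one_iff_deriv.2 ⟨fun t =>
    (hHe.integral_hasStrictDerivAt 0 t).hasDerivAt.differentiableAt, by rwa [hHd]⟩)
  rw [hHd, hHT, mul_zero, setIntegral_congr_fun (g := fun s => H s ^ 2) measurableSet_Icc fun s hs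
    => by simp [IccExtend_of_mem hT _ hs, sq], eq_comm, setIntegral_eq_zero_iff_of_nonneg_ae
    (ae_of_all _ fun s => sq_nonneg (H s)) (hHc.pow 2).integrableOn_Icc] at h2
  have h4 :
    H t ^ 2 = 0 := Measure.eqOn_Icc_of_ae_eq volume h.T_pos.ne h2 (hHc.pow 2) continuousOn_const ht
  rw [h.integral_mes_Iic (g := fun z => v z.1 z.2 * deriv f z.2) hfi ht,
    integral_Icc_eq_integral_Ioc, ← intervalIntegral.integral_of_le ht.1]
  grind

/-- The continuity equation on `[0, t]` for Lipschitz functions of the size. -/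
theorem continuity_lipschitz {G : ℝ → ℝ} (hG : ContDiff ℝ 1 G) {C : ℝ} (hGC : ∀ r, |deriv G r| ≤ C)
    (hG0 : G 0 = 0) {t : ℝ} (ht : t ∈ Icc 0 T) : (∫ r, G r ∂(ν t)) - (∫ r, G r ∂(ν 0))
    = ∫ z in {z | z.1 ≤ t}, z.2 ^ (p.α - 1) * (v z.1 z.2 * deriv G z.2) ∂h.mes := by
  obtain ⟨B, hB, hχ⟩ := abs_mul_deriv_chi_le
  have hGr : ∀ r, |G r| ≤ C * |r| := fun r => by
    have := (convex_univ : Convex ℝ (univ : Set ℝ)).norm_image_sub_le_of_norm_deriv_le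
      (fun s _ => hG.differentiable one_ne_zero s) (fun s _ => hGC s) (mem_univ 0) (mem_univ r)
    simpa [hG0] using this
  have hC : 0 ≤ C := (abs_nonneg _).trans (hGC 0)
  have hfc : ∀ j, ContDiff ℝ 1 fun r => G r * chi j r := fun j =>
    hG.mul ((contDiff_chi j).of_le (by simp))
  have hd : ∀ j r, deriv (fun r => G r * chi j r) r = deriv G r * chi j r + G r * deriv (chi j) r :=
    fun j r => ((hG.differentiable one_ne_zero r).hasDerivAt.mul
    (((contDiff_chi j).differentiable (by simp)) r).hasDerivAt).deriv
  have hlim : ∀ s ∈ Icc 0 T, Tendsto (fun j => ∫ r, G r * chi j r ∂(ν s)) atTop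
      (𝓝 (∫ r, G r ∂(ν s))) := fun s hs => by
    have hst := h.isState s hs
    refine tendsto_integral_of_dominated_convergence (fun r => C * |r|)
      (fun j => (hfc j).continuous.aestronglyMeasurable) (hst.integrable_id.norm.const_mul C)
      (fun j => ae_of_all _ fun r => ?_) ((ae_pos_of_Iic hst.1).mono fun r hr => ?_)
    · rw [norm_mul]
      exact (mul_le_of_le_one_right (norm_nonneg _) abs_chi_le_one).trans (hGr r)
    · refine tendsto_const_nhds.congr' ((eventually_chi_eq_one hr).mono fun j hj => ?_)
      grind
  refine tendsto_nhds_unique ((hlim t ht).sub (hlim 0 ⟨le_rfl, h.T_pos.le⟩)) (Tendsto.congr (fun j =>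
    (h.continuity_Iic (hfc j) (inv_succ_pos j) (mul_chi_eq_zero j) ht).symm) ?_)
  refine tendsto_integral_of_dominated_convergence
    (fun z => (C + C * B) * ‖z.2 ^ (p.α - 1) * v z.1 z.2‖) (fun j =>
      ((measurable_snd.pow_const _).mul (h.measurable_v.mul ((measurable_deriv _).comp
        measurable_snd))).aestronglyMeasurable) (h.integrable_v.norm.const_mul _).integrableOn
    (fun j => ae_restrict_of_ae (ae_of_all _ fun z => ?_))
    (ae_restrict_of_ae (h.ae_pos.mono fun z hz => ?_))
  · rw [← mul_assoc, norm_mul, mul_comm]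
    refine mul_le_mul_of_nonneg_right ?_ (norm_nonneg _)
    rw [hd, norm_eq_abs]
    refine (abs_add_le _ _).trans (add_le_add ?_ ?_)
    · rw [abs_mul]
      exact (mul_le_of_le_one_right (abs_nonneg _) abs_chi_le_one).trans (hGC _)
    · rw [abs_mul]
      calc |G z.2| * |deriv (chi j) z.2| ≤ C * |z.2| * |deriv (chi j) z.2| := by gcongr; exact hGr _
        _ = C * |z.2 * deriv (chi j) z.2| := by grind
        _ ≤ C * B := by gcongr; exact hχ j _
  · refine tendsto_const_nhds.congr' ?_
    filter_upwards [eventually_chi_eq_one_Icc (half_pos hz) (2 * z.2)] with j hj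
    have h1 : chi j =ᶠ[𝓝 z.2] fun _ => 1 := by
      filter_upwards
        [Icc_mem_nhds (half_lt_self hz) (by linarith : z.2 < 2 * z.2)] with r hr using hj r hr
    rw [hd, h1.deriv_eq, h1.eq_of_nhds, deriv_const, mul_one, mul_zero, add_zero]

/-- Since the first moment is conserved, the velocity is a covector at almost every time. -/
theorem ae_isCovectorLSW : ∀ᵐ t ∂vol[T], IsCovectorLSW p (ν t) (v t) := by
  set B : ℝ → ℝ := fun t => ∫ r, r ^ p.α * v t r ∂(ν t) with hB
  have hTT := h.T_pos
  have hi : Integrable (fun z => z.2 ^ (p.α - 1) * Function.uncurry v z) h.mes := h.integrable_v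
  have hBi : Integrable B vol[T] := h.integrable_slice hi
  have hzero : ∀ t ∈ Icc 0 T, ∫ s in (0 : ℝ)..t, B s = 0 := by
    intro t ht
    have h1 := h.continuity_lipschitz (G := fun r => r) contDiff_id (C := 1) (by simp) rfl ht
    rw [(h.isState t ht).integral_id h.ρ_pos.le,
      (h.isState 0 ⟨le_rfl, hTT.le⟩).integral_id h.ρ_pos.le, sub_self] at h1
    simp only [deriv_id'', mul_one] at h1
    rw [intervalIntegral.integral_of_le ht.1, ← integral_Icc_eq_integral_Ioc]
    exact (h.integral_mes_Iic hi ht).symm.trans h1.symm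
  have hBint : IntervalIntegrable B volume 0 T := IsRescaledCurve.intervalIntegrable_of_Icc hTT hBi
  have hae : ∀ᵐ t ∂vol[T], B t = 0 := by
    rw [← restrict_Ioo_eq_restrict_Icc, ae_restrict_iff' measurableSet_Ioo]
    filter_upwards [hBint.ae_hasDerivAt_integral] with t ht hm
    have h1 := ht (by rw [uIcc_of_le hTT.le]; grind) 0 (by simp)
    have h2 : (fun s => ∫ τ in (0 : ℝ)..s, B τ) =ᶠ[𝓝 t] fun _ => 0 := by
      filter_upwards [Ioo_mem_nhds hm.1 hm.2] with s hs using hzero s (Ioo_subset_Icc_self hs)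
    exact h1.unique ((hasDerivAt_const t (0 : ℝ)).congr_of_eventuallyEq h2)
  have hA := ae_lt_top' (h.toIsStateCurve.aemeasurable_lintegral
    (F := fun z => ofReal (z.2 ^ p.α * Function.uncurry v z ^ 2)) (Measurable.ennreal_ofReal
    ((measurable_snd.pow_const _).mul (h.measurable_v.pow_const 2)))) h.action.ne
  filter_upwards [hae, hA, h.ae_dissipation_lt_top, ae_mem_Icc] with t h1 h2 h3 ht
  refine ⟨?_, h1⟩
  have hst := h.isState t ht
  have hpos := ae_pos_of_Iic hst.1
  have hvm : Measurable (v t) := h.measurable_v.comp measurable_prodMk_left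
  have i1 : Integrable (fun r => r ^ p.α * v t r ^ 2) (ν t) :=
    integrable_of_lintegral_ofReal_lt_top ((measurable_id.pow_const _).mul (hvm.pow_const 2))
    (hpos.mono fun r hr => mul_nonneg (rpow_nonneg (le_of_lt hr) _) (sq_nonneg _)) h2
  refine (i1.add (hst.integrable_moments h3).1).mono'
    ((measurable_id.pow_const _).mul hvm).aestronglyMeasurable (hpos.mono fun r hr => ?_)
  have := rpow_pos_of_pos hr p.α
  rw [norm_mul, norm_eq_abs, norm_eq_abs, abs_of_pos this, Pi.add_apply]
  have : |v t r| ≤ v t r ^ 2 + 1 := by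
    rw [← sq_abs]; nlinarith [sq_nonneg (|v t r| - 1), abs_nonneg (v t r)]
  nlinarith

end

end FiniteCurve

/-- The truncation of `q r^(-γ)` at the size `κ`. -/
noncomputable def truncRate (p : Rates) (κ s : ℝ) : ℝ := p.q * max s κ ^ (-p.γ)

theorem truncRate_nonneg (p : Rates) {κ : ℝ} (hκ : 0 < κ) (s : ℝ) : 0 ≤ truncRate p κ s :=
  mul_nonneg p.q_pos.le (rpow_nonneg (hκ.le.trans (le_max_right _ _)) _)

theorem truncRate_le (p : Rates) {κ : ℝ} (hκ : 0 < κ) (s : ℝ) :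
    truncRate p κ s ≤ p.q * κ ^ (-p.γ) :=
  mul_le_mul_of_nonneg_left
    (rpow_le_rpow_of_nonpos hκ (le_max_right _ _) (by linarith [p.γ_pos])) p.q_pos.le

theorem truncRate_eq_min (p : Rates) {κ s : ℝ} (hκ : 0 < κ) (hs : 0 < s) :
    truncRate p κ s = min (p.q * s ^ (-p.γ)) (p.q * κ ^ (-p.γ)) := by
  rw [← mul_min_of_nonneg _ _ p.q_pos.le, truncRate]
  congr 1
  rcases le_total s κ with h | h
  · rw [max_eq_right h, min_eq_right (rpow_le_rpow_of_nonpos hs h (by linarith [p.γ_pos]))]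
  · rw [max_eq_left h, min_eq_left (rpow_le_rpow_of_nonpos hκ h (by linarith [p.γ_pos]))]

theorem continuous_truncRate (p : Rates) {κ : ℝ} (hκ : 0 < κ) : Continuous (truncRate p κ) :=
  continuous_const.mul (Continuous.rpow_const (by fun_prop) fun s =>
    Or.inl (hκ.trans_le (le_max_right _ _)).ne')

theorem eventually_truncRate_eq (p : Rates) {s : ℝ} (hs : 0 < s) :
    ∀ᶠ j : ℕ in atTop, truncRate p (1 / (j + 1)) s = p.q * s ^ (-p.γ) := by
  filter_upwards [tendsto_one_div_add_atTop_nhds_zero_nat.eventually (gt_mem_nhds hs)] with j hj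
  rw [truncRate, max_eq_left (le_of_lt hj)]

theorem intervalIntegrable_rate (p : Rates) (r : ℝ) :
    IntervalIntegrable (fun s => p.q * s ^ (-p.γ)) volume 0 r :=
  (intervalIntegral.intervalIntegrable_rpow' (by linarith [p.γ_lt_one])).const_mul _

theorem integral_rate (p : Rates) (r : ℝ) :
    ∫ s in (0 : ℝ)..r, p.q * s ^ (-p.γ) = p.q / (1 - p.γ) * r ^ (1 - p.γ) := by
  have := p.γ_lt_one
  rw [intervalIntegral.integral_const_mul, integral_rpow (Or.inl (by linarith)),
    zero_rpow (by linarith), sub_zero, show -p.γ + 1 = 1 - p.γ by ring]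
  ring

theorem truncRate_le_rate (p : Rates) {κ s : ℝ} (hκ : 0 < κ) (hs : 0 < s) :
    truncRate p κ s ≤ p.q * s ^ (-p.γ) := (truncRate_eq_min p hκ hs).trans_le (min_le_left _ _)

theorem integral_truncRate_mem (p : Rates) {κ r : ℝ} (hκ : 0 < κ) (hr : 0 < r) :
    ‖∫ s in (0 : ℝ)..r, truncRate p κ s‖ ≤ p.q / (1 - p.γ) * r ^ (1 - p.γ) := by
  rw [← integral_rate]
  refine intervalIntegral.norm_integral_le_of_norm_le hr.le (ae_of_all _ fun s hs => ?_)
    (intervalIntegrable_rate p r)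
  rw [norm_eq_abs, abs_of_nonneg (truncRate_nonneg p hκ s)]
  exact truncRate_le_rate p hκ hs.1

theorem tendsto_integral_truncRate (p : Rates) {r : ℝ} (hr : 0 < r) :
    Tendsto (fun j : ℕ => ∫ s in (0 : ℝ)..r, truncRate p (1 / (j + 1)) s) atTop
    (𝓝 (p.q / (1 - p.γ) * r ^ (1 - p.γ))) := by
  rw [← integral_rate]
  refine intervalIntegral.tendsto_integral_filter_of_dominated_convergence _ (Eventually.of_forall
    fun j => (continuous_truncRate p (inv_succ_pos j)).aestronglyMeasurable) (Eventually.of_forall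
    fun j => ae_of_all _ fun s hs => ?_) (intervalIntegrable_rate p r) (ae_of_all _ fun s hs => ?_)
  · rw [uIoc_of_le hr.le] at hs
    rw [norm_eq_abs, abs_of_nonneg (truncRate_nonneg p (inv_succ_pos j) s)]
    exact truncRate_le_rate p (inv_succ_pos j) hs.1
  · rw [uIoc_of_le hr.le] at hs
    exact tendsto_const_nhds.congr' ((eventually_truncRate_eq p hs.1).mono fun j hj => hj.symm)

namespace FiniteCurve

variable {p : Rates} {ρ T : ℝ} {ν : ℝ → Measure ℝ} {v : ℝ → ℝ → ℝ} {U : ℝ → ℝ}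

section

variable (h : FiniteCurve p ρ T ν v U)
include h

theorem integral_covector_mul {c : ℝ → ℝ} (hc : Measurable c) {C : ℝ} (hC : ∀ t, |c t| ≤ C) {t : ℝ}
    (ht : t ∈ Icc 0 T) :
    ∫ z in {z | z.1 ≤ t}, z.2 ^ (p.α - 1) * (v z.1 z.2 * c z.1) ∂h.mes = 0 := by
  rw [h.integral_mes_Iic (g := fun z => v z.1 z.2 * c z.1)
    (h.integrable_v_mul (hc.comp measurable_fst) (ae_of_all _ fun z => hC z.1)) ht]
  refine integral_eq_zero_of_ae (ae_restrict_of_ae_restrict_of_subset (Icc_subset_Icc_right ht.2)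
    (h.ae_isCovectorLSW.mono fun s hs => ?_))
  simp only [← mul_assoc, integral_mul_const, hs.2, zero_mul, Pi.zero_apply]

theorem energy_eq {t : ℝ} (ht : t ∈ Icc 0 T) :
    Integrable (fun r => p.q / (1 - p.γ) * r ^ (1 - p.γ)) (ν t) ∧
    energyLSW p (ν t) = ofReal (∫ r, p.q / (1 - p.γ) * r ^ (1 - p.γ) ∂(ν t)) := by
  obtain ⟨C, hC⟩ := h.moment
  have hpos := ae_pos_of_Iic (h.isState t ht).1
  have hq : 0 ≤ p.q / (1 - p.γ) := div_nonneg p.q_pos.le (by linarith [p.γ_lt_one])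
  have hi : Integrable (fun r => r ^ (1 - p.γ)) (ν t) :=
    integrable_of_lintegral_ofReal_lt_top (measurable_id.pow_const _)
    (hpos.mono fun r hr => rpow_nonneg (le_of_lt hr) _) ((hC t ht).trans_lt ofReal_lt_top)
  refine ⟨hi.const_mul _, ?_⟩
  rw [integral_const_mul, ofReal_mul hq, energyLSW,
    ofReal_integral_eq_lintegral_ofReal hi (hpos.mono fun r hr => rpow_nonneg (le_of_lt hr) _)]

/-- The chain rule for the energy. It is obtained from functions with bounded derivative that
approximate `q / (1 - γ) r^(1-γ)`; since the velocity is a covector, the truncated rates may be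
shifted by the truncated mean field, and the differences are dominated by the velocity of the LSW
equation. -/
theorem energy_identity {t : ℝ} (ht : t ∈ Icc 0 T) :
    (energyLSW p (ν t)).toReal = (energyLSW p (ν 0)).toReal
    - ∫ z in {z | z.1 ≤ t}, z.2 ^ (p.α - 1) * (v z.1 z.2 * lsw p U z) ∂h.mes := by
  have hE : ∀ s ∈ Icc 0 T, Tendsto (fun j : ℕ => ∫ r, (∫ τ in (0 : ℝ)..r, truncRate p (1 / (j + 1))
      τ) ∂(ν s)) atTop (𝓝 (energyLSW p (ν s)).toReal) := fun s hs => by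
    have hpos := ae_pos_of_Iic (h.isState s hs).1
    obtain ⟨hi, he⟩ := h.energy_eq hs
    have hq : 0 ≤ p.q / (1 - p.γ) := div_nonneg p.q_pos.le (by linarith [p.γ_lt_one])
    rw [he, toReal_ofReal (integral_nonneg_of_ae (hpos.mono fun r hr =>
      mul_nonneg hq (rpow_nonneg (le_of_lt hr) _)))]
    exact tendsto_integral_of_dominated_convergence _ (fun j =>
      (intervalIntegral.continuous_primitive (fun a b => (continuous_truncRate p
        (inv_succ_pos j)).intervalIntegrable a b) 0).aestronglyMeasurable) hi
      (fun j => hpos.mono fun r hr => integral_truncRate_mem p (inv_succ_pos j) hr)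
      (hpos.mono fun r hr => tendsto_integral_truncRate p hr)
  have h0 : (0 : ℝ) ∈ Icc 0 T := ⟨le_rfl, h.T_pos.le⟩
  set K : ℕ → ℝ := fun j => p.q * (1 / ((j : ℝ) + 1)) ^ (-p.γ) with hK
  have hKlim : Tendsto K atTop atTop := by
    have h1 : ∀ j : ℕ, K j = p.q * ((j : ℝ) + 1) ^ p.γ := fun j => by
      simp only [hK]
      rw [one_div, Real.inv_rpow (by positivity), rpow_neg (by positivity), inv_inv]
    rw [show K = _ from funext h1]
    exact ((tendsto_rpow_atTop p.γ_pos).comp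
      (tendsto_atTop_add_const_right _ _ tendsto_natCast_atTop_atTop)).const_mul_atTop p.q_pos
  have hKpos : ∀ j, 0 ≤ K j := fun j =>
    mul_nonneg p.q_pos.le (rpow_nonneg (inv_succ_pos j).le _)
  -- since `v` is a covector, the truncated mean field may be subtracted from the truncated rate
  have hd : ∀ j : ℕ, (∫ r, (∫ τ in (0 : ℝ)..r, truncRate p (1 / (j + 1)) τ) ∂(ν t)) - (∫ r, (∫ τ in
      (0 : ℝ)..r, truncRate p (1 / (j + 1)) τ) ∂(ν 0)) = ∫ z in {z | z.1 ≤ t}, z.2 ^ (p.α - 1) * (v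
      z.1 z.2 * (truncRate p (1 / (j + 1)) z.2 - min (U z.1) (K j))) ∂h.mes := fun j => by
    have hκ := inv_succ_pos j
    have hcont := continuous_truncRate p hκ
    have hder : deriv (fun r => ∫ τ in (0 : ℝ)..r, truncRate p (1 / (j + 1)) τ)
        = truncRate p (1 / (j + 1)) := funext fun r => hcont.deriv_integral _ 0 r
    have hb : ∀ r, |truncRate p (1 / ((j : ℝ) + 1)) r| ≤ K j := fun r => by
      rw [abs_of_nonneg (truncRate_nonneg p hκ r)]
      exact truncRate_le p hκ r
    have hbU : ∀ s, |min (U s) (K j)| ≤ K j := fun s => by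
      rw [abs_of_nonneg (le_min (h.U_nonneg s) (hKpos j))]
      simp
    have hmU : Measurable fun s => min (U s) (K j) := h.measurable_U.min measurable_const
    rw [h.continuity_lipschitz (contDiff_one_iff_deriv.2
      ⟨intervalIntegral.differentiable_integral_of_continuous hcont, by grind⟩)
      (C := K j) (by rw [hder]; exact hb) intervalIntegral.integral_same ht, hder,
      ← sub_zero (∫ z in {z : ℝ × ℝ | z.1 ≤ t}, _ ∂h.mes), ← h.integral_covector_mul hmU hbU ht]
    have i1 : Integrable (fun z => z.2 ^ (p.α - 1) * (v z.1 z.2 * truncRate p (1 / (j + 1)) z.2))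
        (h.mes.restrict {z | z.1 ≤ t}) := (h.integrable_v_mul (hcont.measurable.comp measurable_snd)
        (ae_of_all _ fun z => hb _)).integrableOn
    have i2 : Integrable (fun z => z.2 ^ (p.α - 1) * (v z.1 z.2 * min (U z.1) (K j)))
        (h.mes.restrict {z | z.1 ≤ t}) :=
        (h.integrable_v_mul (hmU.comp measurable_fst) (ae_of_all _ fun z => hbU _)).integrableOn
    rw [← integral_sub i1 i2]
    grind
  -- truncation at the common level `K j` does not increase the distance of rate and mean field
  have hlim := tendsto_nhds_unique ((hE t ht).sub (hE 0 h0)) (Tendsto.congr (fun j => (hd j).symm)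
    (tendsto_integral_of_dominated_convergence (f := fun z => -(z.2 ^ (p.α - 1)
    * (v z.1 z.2 * lsw p U z))) (fun z => ‖z.2 ^ (p.α - 1) * (v z.1 z.2 * lsw p U z)‖) (fun j =>
        ((measurable_snd.pow_const _).mul (h.measurable_v.mul
          (((continuous_truncRate p (inv_succ_pos j)).measurable.comp measurable_snd).sub
          ((h.measurable_U.comp measurable_fst).min measurable_const)))).aestronglyMeasurable)
      h.integrable_v_mul_lsw.norm.integrableOn
      (fun j => ae_restrict_of_ae (h.ae_pos.mono fun z hz => by
        rw [norm_mul, norm_mul, norm_mul, norm_mul]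
        refine mul_le_mul_of_nonneg_left (mul_le_mul_of_nonneg_left ?_ (norm_nonneg _))
          (norm_nonneg _)
        rw [truncRate_eq_min p (inv_succ_pos j) hz, lsw, norm_eq_abs, norm_eq_abs,
          abs_sub_comm (U z.1)]
        grind))
      (ae_restrict_of_ae (h.ae_pos.mono fun z hz => by
        refine tendsto_const_nhds.congr' ?_
        filter_upwards [eventually_truncRate_eq p hz, hKlim.eventually_ge_atTop (U z.1)] with j h1 h2
        rw [h1, min_eq_left h2, lsw]
        ring))))
  rw [integral_neg] at hlim
  linarith

theorem JLSW_eq_toReal : JLSW p T ν v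
    = (((energyLSW p (ν T)).toReal - (energyLSW p (ν 0)).toReal + (∫⁻ t in Icc 0 T, dissipationLSW p
    (ν t)).toReal / 2 + (∫⁻ t in Icc 0 T, actionLSW p (ν t) (v t)).toReal / 2 : ℝ) : EReal) := by
  have hfin : ∀ s ∈ Icc 0 T, energyLSW p (ν s) ≠ ⊤ := fun s hs => by
    rw [(h.energy_eq hs).2]; simp
  rw [JLSW, coe_ennreal_eq_coe_toReal (hfin T ⟨h.T_pos.le, le_rfl⟩), coe_ennreal_eq_coe_toReal (hfin
    0 ⟨le_rfl, h.T_pos.le⟩), coe_ennreal_eq_coe_toReal (div_ne_top h.dissipation.ne two_ne_zero),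
    coe_ennreal_eq_coe_toReal (div_ne_top h.action.ne two_ne_zero)]
  simp

/-- The energy-dissipation functional measures the distance of the velocity to the one of the LSW
equation. -/
theorem JLSW_eq : JLSW p T ν v
    = ((1 / 2 * ∫ z, z.2 ^ (p.α - 1) * (v z.1 z.2 - lsw p U z) ^ 2 ∂h.mes : ℝ) : EReal) := by
  have hsq : ∀ g : ℝ × ℝ → ℝ, Integrable (fun z => z.2 ^ (p.α - 1) * g z ^ 2) h.mes → Measurable g →
      (∫⁻ t in Icc 0 T, ∫⁻ r, ofReal (r ^ p.α * g (t, r) ^ 2) ∂(ν t)).toReal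
      = ∫ z, z.2 ^ (p.α - 1) * g z ^ 2 ∂h.mes := fun g hg hm => by
    have hn : 0 ≤ᵐ[h.mes] fun z => z.2 ^ (p.α - 1) * g z ^ 2 := h.ae_pos.mono fun z hz =>
      mul_nonneg (rpow_nonneg (le_of_lt hz) _) (sq_nonneg _)
    rw [← h.lintegral_mes (hm.pow_const 2), ← ofReal_integral_eq_lintegral_ofReal hg hn,
      toReal_ofReal (integral_nonneg_of_ae hn)]
  have hA : (∫⁻ t in Icc 0 T, actionLSW p (ν t) (v t)).toReal = _ :=
    hsq (fun z => v z.1 z.2) h.integrable_sq_v h.measurable_v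
  have hD := hsq (lsw p U) h.integrable_sq_lsw h.measurable_lsw
  rw [h.lintegral_lsw] at hD
  have hset : ∫ z in {z : ℝ × ℝ | z.1 ≤ T}, z.2 ^ (p.α - 1) * (v z.1 z.2 * lsw p U z) ∂h.mes
      = ∫ z, z.2 ^ (p.α - 1) * (v z.1 z.2 * lsw p U z) ∂h.mes :=
      setIntegral_eq_integral_of_ae_compl_eq_zero (h.ae_mem.mono fun z hz hz' => absurd hz.2 hz')
  have he : ∀ z : ℝ × ℝ, z.2 ^ (p.α - 1) * (v z.1 z.2 - lsw p U z) ^ 2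
      = z.2 ^ (p.α - 1) * v z.1 z.2 ^ 2 + z.2 ^ (p.α - 1) * lsw p U z ^ 2
      - 2 * (z.2 ^ (p.α - 1) * (v z.1 z.2 * lsw p U z)) := fun z => by ring
  have i1 : Integrable (fun z => z.2 ^ (p.α - 1) * v z.1 z.2 ^ 2 + z.2 ^ (p.α - 1) * lsw p U z ^ 2)
    h.mes := h.integrable_sq_v.add h.integrable_sq_lsw
  simp only [he]
  rw [h.JLSW_eq_toReal, EReal.coe_eq_coe_iff, hD, hA, h.energy_identity ⟨h.T_pos.le, le_rfl⟩, hset,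
    integral_sub i1 (h.integrable_v_mul_lsw.const_mul 2),
    integral_add h.integrable_sq_v h.integrable_sq_lsw, integral_const_mul]
  ring

theorem JLSW_nonneg : 0 ≤ JLSW p T ν v := by
  rw [h.JLSW_eq]
  exact_mod_cast mul_nonneg one_half_pos.le (integral_nonneg_of_ae (h.ae_pos.mono fun z hz =>
    mul_nonneg (rpow_nonneg (le_of_lt hz) _) (sq_nonneg _)))

theorem integral_sub_sq_eq_zero (hJ : JLSW p T ν v ≤ 0) :
    (∀ᵐ t ∂vol[T], v t =ᵐ[ν t] velocityLSW p (ν t)) ∧ ∀ᵐ z ∂h.mes, v z.1 z.2 = lsw p U z := by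
  have hn : 0 ≤ᵐ[h.mes] fun z => z.2 ^ (p.α - 1) * (v z.1 z.2 - lsw p U z) ^ 2 :=
    h.ae_pos.mono fun z hz => mul_nonneg (rpow_nonneg (le_of_lt hz) _) (sq_nonneg _)
  have hi : Integrable (fun z => z.2 ^ (p.α - 1) * (v z.1 z.2 - lsw p U z) ^ 2) h.mes :=
    ((h.integrable_sq_v.add h.integrable_sq_lsw).sub (h.integrable_v_mul_lsw.const_mul 2)).congr
      (ae_of_all _ fun z => by simp only [Pi.sub_apply, Pi.add_apply]; ring)
  have h0 : ∫ z, z.2 ^ (p.α - 1) * (v z.1 z.2 - lsw p U z) ^ 2 ∂h.mes = 0 := by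
    rw [h.JLSW_eq] at hJ
    have : (1 / 2 * ∫ z, z.2 ^ (p.α - 1) * (v z.1 z.2 - lsw p U z) ^ 2 ∂h.mes : ℝ) ≤ 0 := by
      exact_mod_cast hJ
    linarith [integral_nonneg_of_ae hn]
  have hm : Measurable fun z => (v z.1 z.2 - lsw p U z) ^ 2 :=
    (h.measurable_v.sub h.measurable_lsw).pow_const 2
  have hm2 : Measurable fun z : ℝ × ℝ => z.2 ^ p.α * (v z.1 z.2 - lsw p U z) ^ 2 :=
    (measurable_snd.pow_const _).mul hm
  constructor
  · have h1 := h.lintegral_mes hm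
    rw [← ofReal_integral_eq_lintegral_ofReal hi hn, h0, ofReal_zero, eq_comm,
      lintegral_eq_zero_iff' (h.toIsStateCurve.aemeasurable_lintegral hm2.ennreal_ofReal)] at h1
    filter_upwards [h1, ae_mem_Icc] with t h2 ht
    have h3 := (lintegral_eq_zero_iff (hm2.comp measurable_prodMk_left).ennreal_ofReal).1 h2
    filter_upwards [h3, ae_pos_of_Iic (h.isState t ht).1] with r h4 hr
    rw [← h.lsw_eq ht]
    simp only [Pi.zero_apply, ofReal_eq_zero] at h4
    by_contra hne
    exact absurd h4 (not_le.2 (mul_pos (rpow_pos_of_pos hr _)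
      (pow_pos (abs_pos.2 (sub_ne_zero.2 hne)) 2 |>.trans_eq (sq_abs _))))
  · filter_upwards [(integral_eq_zero_iff_of_nonneg_ae hn hi).1 h0, h.ae_pos] with z h1 hz
    simpa [(rpow_pos_of_pos hz (p.α - 1)).ne', sub_eq_zero] using h1

/-- Along curves of maximal slope the energy decreases by the dissipation. -/
theorem energy_add_dissipation (hJ : JLSW p T ν v ≤ 0) {t : ℝ} (ht : t ∈ Icc 0 T) :
    energyLSW p (ν t) + ∫⁻ s in Icc 0 t, dissipationLSW p (ν s) = energyLSW p (ν 0) := by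
  have hmeas :
    MeasurableSet {z : ℝ × ℝ | z.1 ≤ t} := measurableSet_le measurable_fst measurable_const
  have hT0 : (0 : ℝ) ∈ Icc 0 T := ⟨le_rfl, h.T_pos.le⟩
  have hfin : ∀ s ∈ Icc 0 T, energyLSW p (ν s) ≠ ⊤ := fun s hs => by
    rw [(h.energy_eq hs).2]; simp
  have hDfin : ∫⁻ s in Icc 0 t, dissipationLSW p (ν s) ≠ ⊤ :=
    ((lintegral_mono_set (Icc_subset_Icc_right ht.2)).trans_lt h.dissipation).ne
  have hD : (∫⁻ s in Icc 0 t, dissipationLSW p (ν s)).toReal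
      = ∫ z in {z | z.1 ≤ t}, z.2 ^ (p.α - 1) * (v z.1 z.2 * lsw p U z) ∂h.mes := by
    have hn : 0 ≤ᵐ[h.mes.restrict {z | z.1 ≤ t}] fun z => z.2 ^ (p.α - 1) * lsw p U z ^ 2 :=
      ae_restrict_of_ae (h.ae_pos.mono fun z hz =>
        mul_nonneg (rpow_nonneg (le_of_lt hz) _) (sq_nonneg _))
    have he : ({z : ℝ × ℝ | z.1 ≤ t}.indicator fun z => ofReal (z.2 ^ (p.α - 1) * lsw p U z ^ 2))
        = fun z => ofReal
        (z.2 ^ (p.α - 1) * ({z : ℝ × ℝ | z.1 ≤ t}.indicator (fun z => lsw p U z ^ 2) z)) := by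
      funext z
      by_cases hz : z.1 ≤ t <;> simp [indicator, hz]
    have h1 : ∫ z in {z | z.1 ≤ t}, z.2 ^ (p.α - 1) * (v z.1 z.2 * lsw p U z) ∂h.mes
        = ∫ z in {z | z.1 ≤ t}, z.2 ^ (p.α - 1) * lsw p U z ^ 2 ∂h.mes :=
        integral_congr_ae (ae_restrict_of_ae ((h.integral_sub_sq_eq_zero hJ).2.mono fun z hz => by
        grind))
    rw [h1, integral_eq_lintegral_of_nonneg_ae hn
      h.integrable_sq_lsw.integrableOn.aestronglyMeasurable, ← lintegral_indicator hmeas, he,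
      h.lintegral_mes ((h.measurable_lsw.pow_const 2).indicator hmeas), show Icc 0 t
      = Icc 0 T ∩ Iic t from Set.ext fun s =>
          ⟨fun hs => ⟨⟨hs.1, hs.2.trans ht.2⟩, hs.2⟩, fun hs => ⟨hs.1.1, hs.2⟩⟩,
      inter_comm, ← setLIntegral_indicator measurableSet_Iic]
    congr 1
    refine setLIntegral_congr_fun measurableSet_Icc fun s hs => ?_
    by_cases hst : s ≤ t
    · simp only [indicator, mem_Iic, mem_ofPred_eq, hst, if_true, h.lsw_eq hs]
      rfl
    · simp [indicator, hst]
  rw [← ENNReal.toReal_eq_toReal_iff' (ENNReal.add_ne_top.2 ⟨hfin t ht, hDfin⟩) (hfin 0 hT0),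
    toReal_add (hfin t ht) hDfin, hD, h.energy_identity ht]
  ring

theorem isLSWCurve {w : ℝ → ℝ → ℝ}
    (hm : Measurable ((Icc 0 T ×ˢ Ioi (0 : ℝ)).indicator (Function.uncurry w)))
    (hw : ∀ᵐ t ∂vol[T], w t =ᵐ[ν t] v t) : IsLSWCurve p ρ T ν w where
  isState := h.isState
  continuous ζ hζ hc hs := by
    obtain ⟨a, b, ha, -, h0⟩ := exists_Icc_of_tsupport_subset hc hs
    exact h.continuousOn ζ a b ha hζ h0
  measurable := hm
  isCovector := by
    filter_upwards [h.ae_isCovectorLSW, hw] with t ht hwt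
    have he : (fun r => r ^ p.α * v t r) =ᵐ[ν t] fun r => r ^ p.α * w t r :=
      hwt.mono fun r hr => by simp only [hr]
    exact ⟨ht.1.congr he, (integral_congr_ae he).symm.trans ht.2⟩
  action_finite := by
    refine (lintegral_congr_ae (hw.mono fun t ht => ?_)).trans_lt h.action
    exact lintegral_congr_ae (ht.mono fun r hr => by simp only [hr])
  continuityEq ζ hζ hc hs := by
    have hζ1 : ContDiff ℝ 1 ζ := hζ.of_le (by simp)
    obtain ⟨a, b, ha, -, ⟨hT1, a', b', M, ha', hM, hT0⟩, ⟨hS1, _, _, M', -, hM', -⟩, -⟩ :=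
      isTestFn_of_contDiff hζ1 hc hs
    have iT : Integrable (fun z : ℝ × ℝ => z.2⁻¹ * dTime ζ z) h.mes := by
      refine Integrable.of_bound (measurable_snd.inv.mul hT1.measurable).aestronglyMeasurable
        (a'⁻¹ * M) (ae_of_all _ fun z => ?_)
      have hM0 : 0 ≤ M := (abs_nonneg _).trans (hM 0)
      by_cases hz : z.2 ∈ Icc a' b'
      · have : 0 < z.2 := ha'.trans_le hz.1
        rw [norm_mul, norm_eq_abs, abs_of_pos (inv_pos.2 this)]
        exact mul_le_mul (inv_anti₀ ha' hz.1) (hM z) (norm_nonneg _) (by positivity)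
      · rw [show dTime ζ z = 0 from hT0 z.1 z.2 hz, mul_zero, norm_zero]
        positivity
    have iS := h.integrable_v_mul hS1.measurable (ae_of_all _ hM')
    have eT : ∀ t ∈ Icc 0 T, ∫ r, r * (r⁻¹ * dTime ζ (t, r)) ∂(ν t) = ∫ r, dTime ζ (t, r) ∂(ν t) :=
      fun t ht => integral_congr_ae ((ae_pos_of_Iic (h.isState t ht).1).mono fun r hr => by grind)
    have jT : Integrable (fun t => ∫ r, dTime ζ (t, r) ∂(ν t)) vol[T] :=
      (h.toIsStateCurve.integrable_integral iT).congr (ae_mem_Icc.mono eT)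
    have jS : Integrable (fun t => ∫ r, r ^ p.α * v t r * dSize ζ (t, r) ∂(ν t)) vol[T] := by
      simpa only [mul_assoc] using h.integrable_slice (g := fun z => v z.1 z.2 * dSize ζ z) iS
    rw [h.continuityEq ζ hζ1 hc hs, intervalIntegral.integral_of_le h.T_pos.le,
      ← integral_Icc_eq_integral_Ioc, ← integral_add jT jS]
    refine integral_congr_ae ?_
    filter_upwards [h.ae_isCovectorLSW, hw, ae_mem_Icc] with t h1 h2 ht
    have k1 : Integrable (fun r => dTime ζ (t, r)) (ν t) := (h.isState t ht).locFin.integrable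
      (a := a') (b := b') (hT1.comp (Continuous.prodMk_right t)) ha' (hT0 t)
    have k2 : Integrable (fun r => r ^ p.α * v t r * dSize ζ (t, r)) (ν t) := h1.1.mul_bdd
      (hS1.comp (Continuous.prodMk_right t)).aestronglyMeasurable (ae_of_all _ fun r => hM' _)
    rw [← integral_add k1 k2]
    exact integral_congr_ae (h2.mono fun r hr => by simp only [hr]; rfl)

theorem isLSWSolution (hJ : JLSW p T ν v ≤ 0) : IsLSWSolution p ρ T ν := by
  refine h.isLSWCurve ?_ ((h.integral_sub_sq_eq_zero hJ).1.mono fun t ht => ht.symm)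
  rw [show (Icc 0 T ×ˢ Ioi (0 : ℝ)).indicator (Function.uncurry fun t => velocityLSW p (ν t))
    = (Icc 0 T ×ˢ Ioi (0 : ℝ)).indicator (lsw p U) from indicator_congr
    fun z hz => (h.lsw_eq hz.1 z.2).symm]
  exact h.measurable_lsw.indicator (measurableSet_Icc.prod measurableSet_Ioi)

end

end FiniteCurve

/-! ### Limits of bounded sequences of curves -/

theorem le_liminf_of_frequently {u : ℕ → ℝ≥0∞} {a : ℝ≥0∞}
    (h : ∀ c : ℝ, 0 ≤ c → (∃ᶠ k in atTop, u k ≤ ofReal c) → a ≤ ofReal c) : a ≤ liminf u atTop := by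
  refine le_of_forall_gt_imp_ge_of_dense fun c hc => ?_
  rcases eq_or_ne c ⊤ with rfl | hct
  · exact le_top
  rw [← ofReal_toReal hct]
  refine h _ toReal_nonneg ((frequently_lt_of_liminf_lt (by isBoundedDefault) hc).mono ?_)
  intro k hk
  rw [ofReal_toReal hct]
  exact hk.le

/-- If the sum of two sequences is bounded by a sequence that converges to a lower bound of the sum
of their lower limits, then the first sequence converges to its bound. -/
theorem tendsto_of_add_le {u v s : ℕ → ℝ≥0∞} {a b : ℝ≥0∞} (hb : b ≠ ⊤)
    (hs : Tendsto s atTop (𝓝 (a + b))) (huv : ∀ k, u k + v k ≤ s k) (hu : a ≤ liminf u atTop)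
    (hv : b ≤ liminf v atTop) : Tendsto u atTop (𝓝 a) := by
  refine tendsto_order.2 ⟨fun c hc => eventually_lt_of_lt_liminf (hc.trans_le hu), fun c hc => ?_⟩
  obtain ⟨r, hr, hrc⟩ := ENNReal.lt_iff_exists_add_pos_lt.1 hc
  have hev : ∀ᶠ k in atTop, b - r ≤ v k := by
    rcases eq_or_ne b 0 with rfl | hb0
    · simp
    · exact (eventually_lt_of_lt_liminf ((ENNReal.sub_lt_self hb hb0
        (ENNReal.coe_pos.2 hr).ne').trans_le hv)).mono fun k hk => hk.le
  have hbr : b - r ≠ ⊤ := ENNReal.sub_ne_top hb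
  have hlt : a + b < c + (b - r) :=
    calc a + b ≤ a + (r + (b - r)) := by gcongr; exact le_add_tsub
      _ = (a + r) + (b - r) := (add_assoc _ _ _).symm
      _ < c + (b - r) := (ENNReal.add_lt_add_iff_right hbr).2 hrc
  filter_upwards [hev, hs.eventually (gt_mem_nhds hlt)] with k h1 h2
  refine (ENNReal.add_lt_add_iff_right hbr).1 (lt_of_le_of_lt ?_ h2)
  exact (add_le_add le_rfl h1).trans (huv k)

/-- Convergence of the integrals to the integral of a pointwise lower bound of the lower limits
implies convergence almost everywhere along a subsequence. -/
theorem exists_subseq_ae_tendsto {Ω : Type*} [MeasurableSpace Ω] {μ : Measure Ω} {f : ℕ → Ω → ℝ≥0∞}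
    {g : Ω → ℝ≥0∞} (hf : ∀ k, AEMeasurable (f k) μ) (hg : AEMeasurable g μ)
    (hfin : ∫⁻ z, g z ∂μ ≠ ⊤) (hle : ∀ᵐ z ∂μ, g z ≤ liminf (fun k => f k z) atTop)
    (hlim : Tendsto (fun k => ∫⁻ z, f k z ∂μ) atTop (𝓝 (∫⁻ z, g z ∂μ))) :
    ∃ τ : ℕ → ℕ, StrictMono τ ∧ ∀ᵐ z ∂μ, Tendsto (fun k => f (τ k) z) atTop (𝓝 (g z)) := by
  have hm : ∀ᵐ z ∂μ, Tendsto (fun k => min (f k z) (g z)) atTop (𝓝 (g z)) := hle.mono fun z hz =>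
    tendsto_order.2 ⟨fun c hc => (eventually_lt_of_lt_liminf (hc.trans_le hz)).mono fun k hk =>
      lt_min hk hc, fun c hc => Eventually.of_forall fun k => (min_le_right _ _).trans_lt hc⟩
  have hmm : ∀ k, AEMeasurable (fun z => min (f k z) (g z)) μ := fun k => (hf k).min hg
  have hI := tendsto_lintegral_of_dominated_convergence' g hmm
    (fun k => ae_of_all _ fun z => min_le_right _ _) hfin hm
  have hz : Tendsto (fun k => ∫⁻ z, f k z - min (f k z) (g z) ∂μ) atTop (𝓝 0) := by
    have h1 := ENNReal.Tendsto.sub hlim hI (Or.inl hfin)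
    rw [tsub_self] at h1
    refine h1.congr fun k => (lintegral_sub' (hmm k) (ne_top_of_le_ne_top hfin
      (lintegral_mono fun z => min_le_right _ _)) (ae_of_all _ fun z => min_le_left _ _)).symm
  obtain ⟨τ, hτ, hτb⟩ := extraction_forall_of_eventually (P := fun j k =>
    ∫⁻ z, f k z - min (f k z) (g z) ∂μ < (2⁻¹ : ℝ≥0∞) ^ j)
    fun j => hz.eventually (gt_mem_nhds (ENNReal.pow_pos (by simp) j))
  refine ⟨τ, hτ, ?_⟩
  have hsub :
    ∀ j, AEMeasurable (fun z => f (τ j) z - min (f (τ j) z) (g z)) μ := fun j => (hf _).sub (hmm _)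
  have hsum : ∫⁻ z, ∑' j, (f (τ j) z - min (f (τ j) z) (g z)) ∂μ ≠ ⊤ := by
    rw [lintegral_tsum hsub]
    refine ne_top_of_le_ne_top ?_ (tsum_le_tsum fun j => (hτb j).le)
    simp
  filter_upwards [hm, ae_lt_top' (AEMeasurable.tsum hsub) hsum] with z h1 h2
  have h3 := (ENNReal.tendsto_atTop_zero_of_tsum_ne_top h2.ne).add (h1.comp hτ.tendsto_atTop)
  rw [zero_add] at h3
  exact h3.congr fun j => tsub_add_cancel_of_le (min_le_left _ _)

theorem exists_boundedSeq {p : Rates} {ρ₀ x T : ℝ} (hρ₀ : p.ρs < ρ₀) (hx : x ∈ Ioo (0 : ℝ) (1 / 2))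
    (hT : 0 < T) {ε : ℕ → ℝ} (hε : ∀ k, 0 < ε k) (hlim : Tendsto ε atTop (𝓝 0)) {n : ℕ → ℝ → ℕ → ℝ}
    {w : ℕ → ℝ → ℝ → ℝ} (hcurve : ∀ k, IsRescaledCurve p ρ₀ T (ε k) (n k) (w k))
    (hJ : ∃ C : ℝ, ∀ k, Jε p T (ε k) (n k) (w k) ≤ (C : EReal)) (htight : ∀ δ : ℝ≥0∞, 0 < δ →
    ∃ R : ℝ, ∀ k, ∫⁻ r in Ici R, ofReal r ∂(macroMeasure x (ε k) (n k 0)) ≤ δ) {e : ℝ≥0∞}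
    (he : e ≠ ⊤) (hF : Tendsto (fun k => freeEnergyε p (ε k) (n k 0)) atTop (𝓝 e)) :
    ∃ K, BoundedSeq p ρ₀ x T K ε n w := by
  obtain ⟨C, hC⟩ := hJ
  have h00 : (0 : ℝ) ∈ Icc 0 T := ⟨le_rfl, hT.le⟩
  obtain ⟨M, hM⟩ := ((tendsto_toReal he).comp hF).bddAbove_range
  have hF0 : ∀ k, freeEnergyε p (ε k) (n k 0) ≤ ofReal |M| := fun k => by
    rw [← ofReal_toReal ((hcurve k).freeEnergyε_lt_top h00).ne]
    exact ofReal_le_ofReal ((hM ⟨k, rfl⟩).trans (le_abs_self M))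
  have hpos : 0 < ρ₀ := p.ρs_nonneg.trans_lt hρ₀
  set S := ofReal |M| + ofReal |C| with hS
  have hDA : ∀ k, (∫⁻ t in Icc 0 T, dissipationε p (ε k) (n k t)) / 2
      + (∫⁻ t in Icc 0 T, actionε p (ε k) (n k t) (w k t)) / 2 ≤ S := fun k =>
    (le_add_self.trans ((hcurve k).add_le_of_Jε_le hT (abs_nonneg C)
      ((hC k).trans (EReal.coe_le_coe_iff.2 (le_abs_self C))))).trans (add_le_add (hF0 k) le_rfl)
  have hK : ofReal (2 * (|M| + |C|)) = 2 * S := by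
    rw [ofReal_mul zero_le_two, ofReal_add (abs_nonneg _) (abs_nonneg _)]
    simp [hS]
  have hhalf : ∀ y : ℝ≥0∞, y / 2 ≤ S → y ≤ 2 * S := fun y hy => by
    rw [mul_comm]
    exact (div_le_iff two_ne_zero ofNat_ne_top).1 hy
  refine ⟨2 * (|M| + |C|), hρ₀, hx.1, by linarith [hx.2], hT, by positivity, hε, hlim, hcurve,
    fun k t ht => ?_, fun k => ?_, fun k => ?_, htight⟩
  · rw [hK, two_mul]
    refine ((hcurve k).freeEnergyε_le_add hT (hε k) hpos le_rfl ht.1 ht.2).1.trans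
      (add_le_add ((hF0 k).trans le_self_add) ?_)
    refine (lintegral_mono_set (Icc_subset_Icc_right ht.2)).trans
      (((hcurve k).lintegral_crossε_le hT (hε k) hpos le_rfl le_rfl).trans (hDA k))
  · rw [hK]; exact hhalf _ (le_add_self.trans (hDA k))
  · rw [hK]; exact hhalf _ (le_self_add.trans (hDA k))

namespace BoundedSeq

variable {p : Rates} {ρ₀ x T K : ℝ} {ε : ℕ → ℝ} {n : ℕ → ℝ → ℕ → ℝ} {w : ℕ → ℝ → ℝ → ℝ}
  {ν : ℝ → Measure ℝ}

section

variable (h : BoundedSeq p ρ₀ x T K ε n w) (hν : IsVagueLimit T x ε n ν)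
include h hν

theorem energyLSW_le_liminf {t : ℝ} (ht : t ∈ Icc 0 T) :
    energyLSW p (ν t) ≤ liminf (fun k => freeEnergyε p (ε k) (n k t)) atTop :=
  le_liminf_of_frequently fun _ _ hc => h.energyLSW_le hν ht hc

theorem dissipationLSW_le_liminf {t : ℝ} (ht : t ∈ Icc 0 T) :
    dissipationLSW p (ν t) ≤ liminf (fun k => dissipationε p (ε k) (n k t)) atTop :=
  le_liminf_of_frequently fun _ hc hD => h.dissipationLSW_le hν ht hc hD

theorem lintegral_dissipationLSW_le {t : ℝ} (ht : t ∈ Icc 0 T) :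
    ∫⁻ s in Icc 0 t, dissipationLSW p (ν s)
    ≤ liminf (fun k => ∫⁻ s in Icc 0 t, dissipationε p (ε k) (n k s)) atTop :=
  (setLIntegral_mono' measurableSet_Icc fun _ hs =>
    h.dissipationLSW_le_liminf hν ⟨hs.1, hs.2.trans ht.2⟩).trans (lintegral_liminf_le' fun k =>
      ((h.curve k).aemeasurable_dissipationε h.T_pos).mono_measure
        (Measure.restrict_mono (Icc_subset_Icc_right ht.2) le_rfl))

omit hν in
/-- The limit of the curves, of their fluxes, and the lower semicontinuity of the action and of the
dissipation. -/
theorem exists_finiteCurve (hα : 1 - 3 * p.γ ≤ p.α) (hν : IsVagueLimit T x ε n ν)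
    {L : testFns →ₗ[ℝ] ℝ} (hL : ∀ φ : testFns,
    Tendsto (fun k => totalFlux p T (ε k) (n k) (w k) φ.1) atTop (𝓝 (L φ))) {A D : ℝ} (hA0 : 0 ≤ A)
    (hA : Tendsto (fun k => ∫⁻ t in Icc 0 T, actionε p (ε k) (n k t) (w k t)) atTop (𝓝 (ofReal A)))
    (hD : Tendsto (fun k => ∫⁻ t in Icc 0 T, dissipationε p (ε k) (n k t)) atTop (𝓝 (ofReal D))) :
    ∃ v U, FiniteCurve p (ρ₀ - p.ρs) T ν v U ∧ ∫⁻ t in Icc 0 T, actionLSW p (ν t) (v t) ≤ ofReal A ∧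
    ∫⁻ t in Icc 0 T, dissipationLSW p (ν t) ≤ ofReal D ∧ ∀ ζ, IsTestFn ζ →
    Tendsto (fun k => ∫ t in (0 : ℝ)..T, ∫ r, ζ (t, r) * w k t r ∂(macroMeasure x (ε k) (n k t)))
    atTop (𝓝 (∫ t in (0 : ℝ)..T, ∫ r, ζ (t, r) * v t r ∂(ν t))) := by
  have hT := h.T_pos
  have hρ : 0 < ρ₀ - p.ρs := sub_pos.2 h.mass
  have hst := h.isStateCurve hν
  obtain ⟨v, hvm, hvA, hLv⟩ := hst.exists_velocity p hA0 L fun φ =>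
    le_of_forall_pos_le_add fun δ hδ => by
      have := h.two_mul_flux_le hν φ.2 (A := A + δ) (by linarith) (hL φ)
        ((hA.eventually_lt_const ((ENNReal.ofReal_lt_ofReal_iff (by linarith)).2
        (lt_add_of_pos_right A hδ))).mono fun k hk => hk.le).frequently
      linarith
  have hDL : ∫⁻ t in Icc 0 T, dissipationLSW p (ν t) ≤ ofReal D :=
    (h.lintegral_dissipationLSW_le hν ⟨hT.le, le_rfl⟩).trans_eq hD.liminf_eq
  obtain ⟨U, hUm, hU0, hU⟩ := hst.exists_meanField p
  obtain ⟨C, hC0, hC⟩ := h.lintegral_rpow_le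
  have hmom : ∀ t ∈ Icc 0 T, ∫⁻ r, ofReal (r ^ (1 - p.γ)) ∂(ν t) ≤ ofReal C :=
    fun t ht => (hν t ht).2.2.lintegral_le (hν t ht).1 (hν t ht).2.1 (Eventually.of_forall
    fun k => h.locFin k ht) (continuousOn_id.rpow_const fun r hr => Or.inl (ne_of_gt hr))
    (fun r hr => rpow_nonneg hr.le _) (hC.mono fun k hk => hk t ht).frequently
  refine ⟨v, U, ⟨hst, hρ, hT, hα, hvm, hUm, hU0, hU, hvA.trans_lt ofReal_lt_top,
    hDL.trans_lt ofReal_lt_top, ⟨C, hmom⟩, ?_, fun ζ hζ hc hs => ?_⟩, hvA, hDL, fun ζ hζ => ?_⟩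
  · obtain ⟨R, hR, htail⟩ := h.tail_le hν (δ := (ρ₀ - p.ρs) / 4) (by linarith)
    obtain ⟨B, hB0, hB⟩ := exists_sq_le_dissipation p (C := C) hρ hR
    exact ⟨B, hB0, fun t ht => hB (ν t) (hst.isState t ht) (hmom t ht) (htail t ht) _⟩
  · obtain ⟨-, -, -, -, -, hd, -⟩ := isTestFn_of_contDiff hζ hc hs
    rw [h.continuity_limit hν hζ hc hs (hL ⟨_, hd⟩), hLv]
  · obtain ⟨hcz, a, b, M, ha, hM, h0⟩ := id hζ
    obtain ⟨hψc, N, hN⟩ := exists_bound_comp_snd_mul (g := fun r => r ^ (-p.α))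
      (continuousOn_id.rpow_const fun r hr => Or.inl (ne_of_gt hr)) hcz ha hM h0
    have hψ : IsTestFn fun z => z.2 ^ (-p.α) * ζ z :=
      ⟨hψc, a, b, N, ha, hN, fun t r hr => by simp [h0 t r hr]⟩
    have e : ∀ (f : ℝ → ℝ → ℝ) (μ : ℝ → Measure ℝ), ∫ t in (0 : ℝ)..T, ∫ r, ζ (t, r) * f t r ∂(μ t)
        = ∫ t in (0 : ℝ)..T, ∫ r, r ^ p.α * f t r * (r ^ (-p.α) * ζ (t, r)) ∂(μ t) := by
      intro f μ
      congr! 4 with t r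
      by_cases hr : r ∈ Icc a b
      · have : r ^ p.α * r ^ (-p.α) = 1 := by
          rw [← rpow_add (ha.trans_le hr.1), add_neg_cancel, Real.rpow_zero]
        grind
      grind
    simp only [e]
    have h3 := h.tendsto_momentum hψ (hL ⟨_, hψ⟩)
    rwa [hLv, integral_Icc_eq_integral_Ioc, ← intervalIntegral.integral_of_le hT.le] at h3

/-- Convergence of energies and dissipations for curves of maximal slope. -/
theorem tendsto_of_Jε_le {v : ℝ → ℝ → ℝ} {U : ℝ → ℝ} {ρ : ℝ} (hf : FiniteCurve p ρ T ν v U)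
    (hJ : JLSW p T ν v ≤ 0) (hJε : ∀ k, Jε p T (ε k) (n k) (w k) ≤ 0)
    (hF : Tendsto (fun k => freeEnergyε p (ε k) (n k 0)) atTop (𝓝 (energyLSW p (ν 0)))) :
    (∀ t ∈ Icc 0 T, Tendsto (fun k => freeEnergyε p (ε k) (n k t)) atTop (𝓝 (energyLSW p (ν t)))) ∧
    Tendsto (fun k => ∫⁻ t in Icc 0 T, dissipationε p (ε k) (n k t)) atTop
    (𝓝 (∫⁻ t in Icc 0 T, dissipationLSW p (ν t))) := by
  have hfin : ∀ t ∈ Icc 0 T, energyLSW p (ν t) ≠ ⊤ ∧ ∫⁻ s in Icc 0 t, dissipationLSW p (ν s) ≠ ⊤ :=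
    fun t ht => ⟨by rw [(hf.energy_eq ht).2]; simp,
      ((lintegral_mono_set (Icc_subset_Icc_right ht.2)).trans_lt hf.dissipation).ne⟩
  have hT : T ∈ Icc 0 T := ⟨h.T_pos.le, le_rfl⟩
  refine ⟨fun t ht => tendsto_of_add_le (hfin t ht).2 ((hf.energy_add_dissipation hJ ht).symm ▸ hF)
    (fun k => (h.curve k).freeEnergyε_add_le_of_Jε_le h.T_pos (h.pos k) h.ρ₀_pos (hJε k) ht)
    (h.energyLSW_le_liminf hν ht) (h.lintegral_dissipationLSW_le hν ht), tendsto_of_add_le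
    (hfin T hT).1 (add_comm (energyLSW p _) _ ▸ (hf.energy_add_dissipation hJ hT).symm ▸ hF)
    (fun k => (add_comm _ _).trans_le ((h.curve k).freeEnergyε_add_le_of_Jε_le h.T_pos (h.pos k)
    h.ρ₀_pos (hJε k) hT)) (h.lintegral_dissipationLSW_le hν hT) (h.energyLSW_le_liminf hν hT)⟩

omit h hν in
theorem _root_.BeckerDoring.IsVagueLimit.comp (hν : IsVagueLimit T x ε n ν) {σ : ℕ → ℕ}
    (hσ : StrictMono σ) : IsVagueLimit T x (fun k => ε (σ k)) (fun k => n (σ k)) ν := fun t ht =>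
  ⟨(hν t ht).1, (hν t ht).2.1, fun ζ h1 h2 h3 => ((hν t ht).2.2 ζ h1 h2 h3).comp hσ.tendsto_atTop⟩

omit hν in
/-- A subsequence along which the final energies, the total actions and the total dissipations
converge. -/
theorem exists_subseq_tendsto : ∃ (σ : ℕ → ℕ) (f A D : ℝ), StrictMono σ ∧ 0 ≤ A ∧ 0 ≤ D ∧
    Tendsto (fun k => (freeEnergyε p (ε (σ k)) (n (σ k) T)).toReal) atTop (𝓝 f) ∧ Tendsto
    (fun k => (∫⁻ t in Icc 0 T, actionε p (ε (σ k)) (n (σ k) t) (w (σ k) t)).toReal) atTop (𝓝 A) ∧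
    Tendsto (fun k => (∫⁻ t in Icc 0 T, dissipationε p (ε (σ k)) (n (σ k) t)).toReal) atTop
    (𝓝 D) := by
  have hT : T ∈ Icc 0 T := ⟨h.T_pos.le, le_rfl⟩
  have hb : ∀ {y : ℝ≥0∞}, y ≤ ofReal K → y.toReal ∈ Icc 0 K := fun hy =>
    ⟨toReal_nonneg, toReal_le_of_le_ofReal h.K_nonneg hy⟩
  obtain ⟨l, hl, σ, hσ, hlim⟩ := (isCompact_Icc.prod (isCompact_Icc.prod
    isCompact_Icc)).tendsto_subseq (x := fun k => ((freeEnergyε p (ε k) (n k T)).toReal, (∫⁻ t in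
    Icc 0 T, actionε p (ε k) (n k t) (w k t)).toReal, (∫⁻ t in Icc 0 T, dissipationε p (ε k) (n k
    t)).toReal)) fun k => ⟨hb (h.energy k T hT), hb (h.action k), hb (h.dissipation k)⟩
  exact ⟨σ, l.1, l.2.1, l.2.2, hσ, hl.2.1.1, hl.2.2.1, hlim.fst_nhds, hlim.snd_nhds.fst_nhds,
    hlim.snd_nhds.snd_nhds⟩

end

end BoundedSeq

end BeckerDoring

theorem corollary2p3 (p : Rates) (hα : 1 - 3 * p.γ ≤ p.α)
    (ρ₀ : ℝ) (hρ₀ : p.ρs < ρ₀) (x : ℝ) (hx : x ∈ Ioo (0 : ℝ) (1 / 2)) (T : ℝ) (hT : 0 < T)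
    (ε : ℕ → ℝ) (hε : ∀ k, 0 < ε k) (hε_lim : Tendsto ε atTop (𝓝 0))
    (n : ℕ → ℝ → ℕ → ℝ) (w : ℕ → ℝ → ℝ → ℝ)
    (hcurve : ∀ k, IsRescaledCurve p ρ₀ T (ε k) (n k) (w k))
    (hJ : ∃ C : ℝ, ∀ k, Jε p T (ε k) (n k) (w k) ≤ (C : EReal))
    (htight : ∀ δ : ℝ≥0∞, 0 < δ → ∃ R : ℝ, ∀ k,
      ∫⁻ r in Ici R, ENNReal.ofReal r ∂(macroMeasure x (ε k) (n k 0)) ≤ δ)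
    (ν₀ : Measure ℝ) (hν₀ : ν₀ (Iic 0) = 0) (hν₀_energy : energyLSW p ν₀ < ⊤)
    (hν₀_lim : VagueTendsto atTop (fun k => macroMeasure x (ε k) (n k 0)) ν₀)
    (hwell : Tendsto (fun k => freeEnergyε p (ε k) (n k 0)) atTop (𝓝 (energyLSW p ν₀))) :
    ∃ (σ : ℕ → ℕ) (ν : ℝ → Measure ℝ) (v : ℝ → ℝ → ℝ),
      StrictMono σ ∧
      IsLSWCurve p (ρ₀ - p.ρs) T ν v ∧
      ν 0 = ν₀ ∧
      (∀ t ∈ Icc 0 T,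
        VagueTendsto atTop (fun k => macroMeasure x (ε (σ k)) (n (σ k) t)) (ν t)) ∧
      (∀ ζ : ℝ × ℝ → ℝ, Continuous ζ → HasCompactSupport ζ → tsupport ζ ⊆ univ ×ˢ Ioi 0 →
        Tendsto (fun k => ∫ t in (0 : ℝ)..T, ∫ r, ζ (t, r) * w (σ k) t r
            ∂(macroMeasure x (ε (σ k)) (n (σ k) t)))
          atTop (𝓝 (∫ t in (0 : ℝ)..T, ∫ r, ζ (t, r) * v t r ∂(ν t)))) ∧
      JLSW p T ν v ≤ liminf (fun k => Jε p T (ε k) (n k) (w k)) atTop ∧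
      0 ≤ JLSW p T ν v ∧
      ((∀ k, Jε p T (ε k) (n k) (w k) = 0) →
        JLSW p T ν v = 0 ∧
        IsLSWSolution p (ρ₀ - p.ρs) T ν ∧
        (∀ t ∈ Icc 0 T, Tendsto (fun k => freeEnergyε p (ε (σ k)) (n (σ k) t)) atTop
          (𝓝 (energyLSW p (ν t)))) ∧
        (∀ᵐ t ∂(volume.restrict (Icc 0 T)),
          Tendsto (fun k => actionε p (ε (σ k)) (n (σ k) t) (w (σ k) t)) atTop
            (𝓝 (actionLSW p (ν t) (v t)))) ∧
        (∀ᵐ t ∂(volume.restrict (Icc 0 T)),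
          Tendsto (fun k => dissipationε p (ε (σ k)) (n (σ k) t)) atTop
            (𝓝 (dissipationLSW p (ν t))))) := by
  have h00 : (0 : ℝ) ∈ Icc 0 T := ⟨le_rfl, hT.le⟩
  have hTT : T ∈ Icc 0 T := ⟨hT.le, le_rfl⟩
  obtain ⟨K, h⟩ := exists_boundedSeq hρ₀ hx hT hε hε_lim hcurve hJ htight hν₀_energy.ne hwell
  -- the lower limit is a real number
  obtain ⟨ℓ, hℓ⟩ : ∃ ℓ : ℝ, liminf (fun k => Jε p T (ε k) (n k) (w k)) atTop = (ℓ : EReal) := by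
    obtain ⟨C, hC⟩ := hJ
    have hlow : ∀ k, ((-K : ℝ) : EReal) ≤ Jε p T (ε k) (n k) (w k) := fun k => by
      rw [(hcurve k).Jε_eq hT, EReal.coe_le_coe_iff]
      have h1 : (freeEnergyε p (ε k) (n k 0)).toReal ≤ K :=
        ENNReal.toReal_le_of_le_ofReal h.K_nonneg (h.energy k 0 h00)
      have h2 : 0 ≤ (freeEnergyε p (ε k) (n k T)).toReal := ENNReal.toReal_nonneg
      have h3 : 0 ≤ (∫⁻ t in Icc 0 T, dissipationε p (ε k) (n k t)).toReal := ENNReal.toReal_nonneg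
      have h4 :
        0 ≤ (∫⁻ t in Icc 0 T, actionε p (ε k) (n k t) (w k t)).toReal := ENNReal.toReal_nonneg
      linarith
    refine ⟨_,
      (EReal.coe_toReal (ne_top_of_le_ne_top (EReal.coe_ne_top C) (liminf_le_of_frequently_le'
      (Eventually.of_forall hC).frequently)) (ne_bot_of_le_ne_bot (EReal.coe_ne_bot (-K))
      (le_liminf_of_le (by isBoundedDefault) (Eventually.of_forall hlow)))).symm⟩
  obtain ⟨σ₁, hσ₁, hJ₁⟩ := extraction_forall_of_frequently (P := fun j k => Jε p T (ε k) (n k) (w k)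
    < ((ℓ + 1 / ((j : ℝ) + 1) : ℝ) : EReal)) fun j => frequently_lt_of_liminf_lt
    (by isBoundedDefault) (by
      rw [hℓ, EReal.coe_lt_coe_iff]
      exact lt_add_of_pos_right _ (inv_succ_pos j))
  have h1 := h.comp hσ₁
  obtain ⟨σ₂, f, A, D, hσ₂, hA0, hD0, hf, hA, hD⟩ := h1.exists_subseq_tendsto
  have h2 := h1.comp hσ₂
  obtain ⟨σ₃, ν', hσ₃, hν'⟩ := h2.exists_subseq_vagueTendsto
  have h3 := h2.comp hσ₃
  obtain ⟨σ₄, L, hσ₄, hL⟩ := h3.exists_subseq_flux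
  have h4 := h3.comp hσ₄
  have hσ : StrictMono fun k => σ₁ (σ₂ (σ₃ (σ₄ k))) := hσ₁.comp (hσ₂.comp (hσ₃.comp hσ₄))
  have hσ' : Tendsto (fun k => σ₃ (σ₄ k)) atTop atTop := (hσ₃.comp hσ₄).tendsto_atTop
  set σ : ℕ → ℕ := fun k => σ₁ (σ₂ (σ₃ (σ₄ k))) with hσdef
  set ν : ℝ → Measure ℝ := Function.update ν' 0 ν₀ with hνdef
  have hν0 : ν 0 = ν₀ := Function.update_self _ _ _
  have hν : IsVagueLimit T x (fun k => ε (σ k)) (fun k => n (σ k)) ν := by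
    intro t ht
    rcases eq_or_ne t 0 with rfl | ht0
    · rw [hν0]
      refine ⟨hν₀, LocFin.of_lintegral_rpow p.one_sub_γ_pos.le (ENNReal.lt_top_of_mul_ne_top_right
        hν₀_energy.ne ?_), fun ζ h1 h2 h3 => (hν₀_lim ζ h1 h2 h3).comp hσ.tendsto_atTop⟩
      exact (ENNReal.ofReal_pos.2 (div_pos p.q_pos p.one_sub_γ_pos)).ne'
    · rw [hνdef, Function.update_of_ne ht0]
      obtain ⟨k1, k2, k3⟩ := hν' t ht
      exact ⟨k1, k2, fun ζ h1 h2 h3 => (k3 ζ h1 h2 h3).comp hσ₄.tendsto_atTop⟩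
  obtain ⟨v, U, hfc, hvA, hvD, hmom⟩ :=
    h4.exists_finiteCurve hα hν hL hA0 (((ENNReal.tendsto_ofReal hA).congr fun k =>
      ENNReal.ofReal_toReal (h2.curve k).action_finite.ne).comp hσ')
    (((ENNReal.tendsto_ofReal hD).congr fun k =>
      ENNReal.ofReal_toReal (h2.curve k).dissipation_finite.ne).comp hσ')
  have hF0 :
      Tendsto (fun k => freeEnergyε p (ε (σ k)) (n (σ k) 0)) atTop (𝓝 (energyLSW p (ν 0))) := by
    rw [hν0]; exact hwell.comp hσ.tendsto_atTop
  have hJle : JLSW p T ν v ≤ liminf (fun k => Jε p T (ε k) (n k) (w k)) atTop := by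
    have e1 : f - (energyLSW p ν₀).toReal + D / 2 + A / 2 ≤ ℓ := by
      refine le_of_tendsto_of_tendsto' (((hf.sub (((ENNReal.tendsto_toReal hν₀_energy.ne).comp
        hwell).comp (hσ₁.comp hσ₂).tendsto_atTop)).add (hD.div_const 2)).add (hA.div_const 2))
        (((tendsto_one_div_add_atTop_nhds_zero_nat (𝕜 := ℝ)).comp hσ₂.tendsto_atTop).const_add ℓ
        |>.trans (by rw [add_zero])) fun k => ?_
      have e2 := hJ₁ (σ₂ k)
      rw [(hcurve _).Jε_eq hT, EReal.coe_lt_coe_iff] at e2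
      exact e2.le
    have e3 : (energyLSW p (ν T)).toReal ≤ f := by
      refine ENNReal.toReal_le_of_le_ofReal (ge_of_tendsto' hf fun k => ENNReal.toReal_nonneg)
        ((h4.energyLSW_le_liminf hν hTT).trans_eq (Tendsto.liminf_eq ?_))
      exact ((ENNReal.tendsto_ofReal hf).congr fun k =>
        ENNReal.ofReal_toReal ((h2.curve k).freeEnergyε_lt_top hTT).ne).comp hσ'
    have e4 := ENNReal.toReal_le_of_le_ofReal hA0 hvA
    have e5 := ENNReal.toReal_le_of_le_ofReal hD0 hvD
    rw [hℓ, hfc.JLSW_eq_toReal, EReal.coe_le_coe_iff, hν0]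
    linarith
  -- a further subsequence for the dissipation of curves of maximal slope
  obtain ⟨τ, hτ, hDτ⟩ : ∃ τ : ℕ → ℕ, StrictMono τ ∧ ((∀ k, Jε p T (ε k) (n k) (w k) = 0) →
      JLSW p T ν v ≤ 0 ∧ ∀ᵐ t ∂vol[T], Tendsto
        (fun k => dissipationε p (ε (σ (τ k))) (n (σ (τ k)) t)) atTop (𝓝 (dissipationLSW p (ν t)))) := by
    by_cases hz : ∀ k, Jε p T (ε k) (n k) (w k) = 0
    · have hJ0 : JLSW p T ν v ≤ 0 := hJle.trans_eq (by simp only [hz, liminf_const])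
      obtain ⟨τ, hτ, hτD⟩ :=
        exists_subseq_ae_tendsto (fun k => (h4.curve k).aemeasurable_dissipationε hT)
        hfc.aemeasurable_dissipation hfc.dissipation.ne ((ae_mem_Icc).mono fun t ht =>
          h4.dissipationLSW_le_liminf hν ht)
        (h4.tendsto_of_Jε_le hν hfc hJ0 (fun k => (hz _).le) hF0).2
      exact ⟨τ, hτ, fun _ => ⟨hJ0, hτD⟩⟩
    · exact ⟨id, strictMono_id, fun hz' => absurd hz' hz⟩
  refine ⟨fun k => σ (τ k), ν, v, hσ.comp hτ, hfc.isLSWCurve (hfc.measurable_v.indicator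
    (measurableSet_Icc.prod measurableSet_Ioi)) (ae_of_all _ fun t => EventuallyEq.rfl), hν0, fun t
    ht => (hν.comp hτ t ht).2.2, fun ζ h1 h2 h3 => (hmom ζ (isTestFn_of_hasCompactSupport h1 h2
    h3)).comp hτ.tendsto_atTop, hJle, hfc.JLSW_nonneg, fun hz => ?_⟩
  obtain ⟨hJ0, hDae⟩ := hDτ hz
  refine ⟨le_antisymm hJ0 hfc.JLSW_nonneg, hfc.isLSWSolution hJ0, fun t ht =>
    ((h4.tendsto_of_Jε_le hν hfc hJ0 (fun k => (hz _).le) hF0).1 t ht).comp hτ.tendsto_atTop, ?_,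
    hDae⟩
  filter_upwards [hDae, (hfc.integral_sub_sq_eq_zero hJ0).1, ae_all_iff.2 fun k =>
    (h4.curve k).ae_actionε_eq_of_Jε_le hT (h4.pos k) h4.ρ₀_pos (hz _).le] with t k1 k2 k3
  rw [show actionLSW p (ν t) (v t)
    = dissipationLSW p (ν t) from lintegral_congr_ae (k2.mono fun r hr => by simp only [hr])]
  exact k1.congr fun k => (k3 (τ k)).symm
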